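/- Work in the category of compactly generated spaces (products, including finite powers, carry the compactly generated topology), and fix a field $k$; $H(-)=H_*(-;k)$ denotes singular homology. Let $G$ be a topological group acting on a (symmetric, unital) topological operad $A$, i.e. $G$ acts continuously on each $A(n)$, all structure maps of $A$ (the $\Sigma_n$-actions and the compositions $\gamma_A$) are $G$-equivariant, and the unit $1\in A(1)$ is fixed by $G$. The semidirect product $A\rtimes G$ is the topological operad with $(A\rtimes G)(n)=A(n)\times G^n$, diagonal $\Sigma_n$-action, unit $(1,e)$, and composition $$\gamma\big((a,(g_1,\dots,g_m));(b_1,h^1),\dots,(b_m,h^m)\big)=\big(\gamma_A(a;g_1b_1,\dots,g_mb_m),\,(g_1h^1,\dots,g_mh^m)\big),$$ where $b_i\in A(n_i)$, $h^i\in G^{n_i}$ and $g_ih^i=(g_ih^i_1,\dots,g_ih^i_{n_i})$. For a graded cocommutative Hopf algebra $H$ over $k$ and an operad $P$ of graded $H$-modules, $P\rtimes H$ has $(P\rtimes H)(n)=P(n)\otimes H^{\otimes n}$, diagonal $\Sigma_n$-action and unit $1\otimes 1$; its composition is given by the same formula, with $g_i$ acting on $b_i\otimes h^i\in P(n_i)\otimes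 H^{\otimes n_i}$ through the iterated comultiplication $H\to H^{\otimes(n_i+1)}$ (the first factor acts on $b_i$, the others multiply the $h^i_j$ from the left), and with Koszul signs for all interchanges of factors. **Proposition.** The Künneth map $H(G)\otimes H(G)\to H(G\times G)$ is bijective, and $H(G)$ is a graded cocommutative Hopf algebra (multiplication and antipode induced by the multiplication and the inversion of $G$, unit the class of $e$, counit the augmentation, comultiplication induced by the diagonal). $H(A)$ is an operad of graded $H(G)$-modules, $H(A)\rtimes H(G)$ and $H(A\rtimes G)$ are operads of graded $k$-vector spaces, and there is an isomorphism of operads of graded vector spaces $$\Phi_{G,A}\colon H(A\rtimes G)\;\cong\;H(A)\rtimes H(G),$$ whose inverse is given by the cross product $H(A(n))\otimes H(G)^{\otimes n}\to H(A(n)\times G^n)$. It is natural in $(G,A)$: for every continuous homomorphism $\varphi\colon G\to G'$ and every morphism of topological operads $f\colon A\to A'$ with $f(ga)=\varphi(g)f(a)$, one has $\Phi_{G',A'}\circ H(f\times\varphi^n)=\big(H(f)\otimes H(\varphi)^{\otimes n}\big)\circ\Phi_{G,A}$ for all $n\ge 0$. -/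

import Mathlib

universe u

/-! ### Shuffles and the Eilenberg–Zilber map -/

/-- A `(p, q)`-shuffle, for `p + q = n`, as a lattice path from `(0, 0)` to `(p, q)`. -/
@[ext]
structure Shuffle (p q n : ℕ) where
  fst : Fin (n + 1) →o Fin (p + 1)
  snd : Fin (n + 1) →o Fin (q + 1)
  add_eq : ∀ i, (fst i : ℕ) + (snd i : ℕ) = (i : ℕ)

namespace Shuffle

variable {p q n : ℕ}

noncomputable instance : Fintype (Shuffle p q n) :=
  @Fintype.ofFinite _ (Finite.of_injective
    (fun s : Shuffle p q n => ((s.fst : Fin (n + 1) → Fin (p + 1)),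
      (s.snd : Fin (n + 1) → Fin (q + 1)))) (by
    intro s t h
    simp only [Prod.mk.injEq, DFunLike.coe_fn_eq] at h
    exact Shuffle.ext h.1 h.2))

/-- The number of unit squares between the path `s` and the path which first goes to `(p, 0)`. Its
parity is the one of the corresponding permutation. -/
def area (s : Shuffle p q n) : ℕ := ∑ i : Fin (n + 1), (min (i : ℕ) p - (s.fst i : ℕ))

/-- The reflected path. -/
def swap (s : Shuffle p q n) : Shuffle q p n :=
  ⟨s.snd, s.fst, fun i => by rw [add_comm]; exact s.add_eq i⟩

lemma fst_le (s : Shuffle p q n) {i j : Fin (n + 1)} (h : (i : ℕ) ≤ j) :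
    (s.fst i : ℕ) ≤ s.fst j := s.fst.monotone (show i ≤ j from h)

lemma snd_le (s : Shuffle p q n) {i j : Fin (n + 1)} (h : (i : ℕ) ≤ j) :
    (s.snd i : ℕ) ≤ s.snd j := s.snd.monotone (show i ≤ j from h)

lemma sign_eq (s : Shuffle p q n) : (-1 : ℤ) ^ s.area =
    (-1) ^ (∑ i : Fin (n + 1), min (i : ℕ) p) * (-1) ^ (∑ i, (s.fst i : ℕ)) := by
  have h : s.area + ∑ i, (s.fst i : ℕ) = ∑ i : Fin (n + 1), min (i : ℕ) p := by
    rw [area, ← Finset.sum_add_distrib]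
    refine Finset.sum_congr rfl fun i _ => ?_
    have := s.add_eq i
    have := (s.fst i).2
    omega
  rw [← h, pow_add, mul_assoc, ← pow_add, Even.neg_one_pow ⟨_, rfl⟩, mul_one]

/-- The place where a path crosses the column `a`. -/
lemma exists_cut (s : Shuffle p q n) (h : p + q = n) (a : Fin (p + 2)) :
    ∃ i : Fin (n + 2), (∀ j : Fin (n + 1), ((j : ℕ) < i ↔ (s.fst j : ℕ) < a)) ∧
      (∀ j : Fin (n + 1), (j : ℕ) + 1 = i → (s.fst j : ℕ) + 1 = a) ∧
      (∀ j : Fin (n + 1), (j : ℕ) = i → (s.fst j : ℕ) = a) ∧ (a : ℕ) ≤ i ∧ (i : ℕ) ≤ a + q := by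
  obtain ⟨i, hi⟩ : ∃ i : Fin (n + 2), ∀ j : Fin (n + 1), ((j : ℕ) < i ↔ (s.fst j : ℕ) < a) := by
    by_cases hex : ∃ j : ℕ, ∃ hj : j < n + 1, (a : ℕ) ≤ s.fst ⟨j, hj⟩
    · classical
      obtain ⟨h1, h2⟩ := Nat.find_spec hex
      refine ⟨⟨Nat.find hex, by omega⟩, fun j => ⟨fun hj => ?_, fun hj => ?_⟩⟩
      · have := Nat.find_min hex hj
        push Not at this
        exact this j.2
      · by_contra hcon
        have := s.fst_le (i := ⟨_, h1⟩) (j := j) (by simpa using hcon)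
        omega
    · push Not at hex
      exact ⟨Fin.last _, fun j => ⟨fun _ => hex j j.2, fun _ => j.2⟩⟩
  have hA : ∀ j : Fin (n + 1), (j : ℕ) = i → (s.fst j : ℕ) = a := by
    intro j hj
    have h1 : (a : ℕ) ≤ s.fst j := by
      have := (hi j).not; omega
    rcases Nat.eq_zero_or_pos (j : ℕ) with h0 | h0
    · have := s.add_eq j; omega
    · have hj' := j.2
      let j' : Fin (n + 1) := ⟨j - 1, by omega⟩
      have h2 := (hi j').1 (by simp only [j']; omega)
      have h3 := s.snd_le (i := j') (j := j) (by simp [j'])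
      have h4 := s.add_eq j
      have h5 := s.add_eq j'
      have h6 : (j' : ℕ) = j - 1 := rfl
      omega
  have hB : ∀ j : Fin (n + 1), (j : ℕ) + 1 = i → (s.fst j : ℕ) + 1 = a := by
    intro j hj
    have h1 := (hi j).1 (by omega)
    rcases Nat.lt_or_ge (j : ℕ) n with h0 | h0
    · let j' : Fin (n + 1) := ⟨j + 1, by omega⟩
      have h2 := hA j' (by simp [j', hj])
      have h3 := s.snd_le (i := j) (j := j') (by simp [j'])
      have h4 := s.add_eq j
      have h5 := s.add_eq j'
      have h6 : (j' : ℕ) = j + 1 := rfl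
      omega
    · have h4 := s.add_eq j
      have h5 := (s.snd j).2
      have h6 := a.2
      omega
  refine ⟨i, hi, hB, hA, ?_, ?_⟩
  · rcases Nat.lt_or_ge (i : ℕ) (n + 1) with h0 | h0
    · have h1 := hA ⟨i, h0⟩ rfl
      have h2 := s.add_eq ⟨i, h0⟩
      simp only at h2
      omega
    · have := a.2; omega
  · rcases Nat.lt_or_ge (i : ℕ) (n + 1) with h0 | h0
    · have h1 := hA ⟨i, h0⟩ rfl
      have h2 := s.add_eq ⟨i, h0⟩
      have h3 := (s.snd ⟨i, h0⟩).2
      simp only at h2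
      omega
    · have h1 := hB ⟨n, by omega⟩ (by simp only; have := i.2; omega)
      have h2 := s.add_eq ⟨n, by omega⟩
      have h3 := (s.snd ⟨n, by omega⟩).2
      have := i.2
      simp only at h2
      omega

lemma succAbove_val {n : ℕ} (i : Fin (n + 1)) (j : Fin n) :
    (i.succAbove j : ℕ) = if (j : ℕ) < i then (j : ℕ) else j + 1 := by
  simp only [Fin.succAbove, Fin.lt_def, Fin.val_castSucc]
  split_ifs <;> simp

lemma exists_insert (s : Shuffle p q n) (h : p + q = n) (a : Fin (p + 2)) :
    ∃ x : Fin (n + 2) × Shuffle (p + 1) q (n + 1),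
      x.2.fst x.1 = a ∧ (∀ j, x.2.fst (x.1.succAbove j) = a.succAbove (s.fst j)) ∧
      (∀ j, x.2.snd (x.1.succAbove j) = s.snd j) := by
  obtain ⟨i, hi, hB, hA, h1, h2⟩ := s.exists_cut h a
  have hlo : ∀ j : Fin (n + 1), (j : ℕ) < i → (s.snd j : ℕ) ≤ i - a := by
    intro j hj
    have hi' := i.2
    have e1 := hB ⟨i - 1, by omega⟩ (by simp only; omega)
    have e2 := s.snd_le (i := j) (j := ⟨i - 1, by omega⟩) (by simp only; omega)
    have e3 := s.add_eq ⟨i - 1, by omega⟩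
    simp only at e3
    omega
  have hhi : ∀ j : Fin (n + 1), ¬ (j : ℕ) < i → (i : ℕ) - a ≤ s.snd j := by
    intro j hj
    have hi' := i.2
    have e1 := hA ⟨i, by omega⟩ rfl
    have e2 := s.snd_le (i := ⟨i, by omega⟩) (j := j) (by simp only; omega)
    have e3 := s.add_eq ⟨i, by omega⟩
    simp only at e3
    omega
  let α : Fin (n + 2) → Fin (p + 2) :=
    i.insertNth (α := fun _ => Fin (p + 2)) a (fun j => a.succAbove (s.fst j))
  let β : Fin (n + 2) → Fin (q + 1) :=
    i.insertNth (α := fun _ => Fin (q + 1)) ⟨i - a, by omega⟩ s.snd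
  have hα0 : α i = a := by simp [α]
  have hβ0 : (β i : ℕ) = i - a := by simp [β]
  have hα1 : ∀ j, α (i.succAbove j) = a.succAbove (s.fst j) := by simp [α]
  have hβ1 : ∀ j, β (i.succAbove j) = s.snd j := by simp [β]
  have hαm : Monotone α := by
    intro j k
    revert j k
    simp only [Fin.forall_iff_succAbove (p := i), hα0, hα1, Fin.le_def, le_refl, succAbove_val,
      true_and, imp_self]
    refine ⟨fun k => ?_, fun j => ⟨?_, fun k => ?_⟩⟩
    · have := hi k; split_ifs <;> omega
    · have := hi j; split_ifs <;> omega
    · have := hi k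
      have := hi j
      intro hjk
      have := s.fst_le (i := j) (j := k) (by split_ifs at hjk <;> omega)
      split_ifs at hjk ⊢ <;> omega
  have hβm : Monotone β := by
    intro j k
    revert j k
    simp only [Fin.forall_iff_succAbove (p := i), hβ0, hβ1, Fin.le_def, le_refl, succAbove_val,
      true_and, imp_self]
    refine ⟨fun k => ?_, fun j => ⟨?_, fun k => ?_⟩⟩
    · have := hhi k; split_ifs <;> omega
    · have := hlo j; split_ifs <;> omega
    · intro hjk
      exact s.snd_le (i := j) (j := k) (by split_ifs at hjk <;> omega)
  have hadd : ∀ j, (α j : ℕ) + (β j : ℕ) = (j : ℕ) := by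
    simp only [Fin.forall_iff_succAbove (p := i), hα0, hβ0, hα1, hβ1, succAbove_val]
    refine ⟨by omega, fun j => ?_⟩
    have := hi j
    have := s.add_eq j
    split_ifs <;> omega
  exact ⟨⟨i, ⟨⟨α, hαm⟩, ⟨β, hβm⟩, hadd⟩⟩, hα0, hα1, hβ1⟩

lemma fst_step (s : Shuffle p q n) {i j : Fin (n + 1)} (h : (i : ℕ) ≤ j) :
    (s.fst j : ℕ) ≤ s.fst i + (j - i) := by
  have := s.snd_le h
  have := s.add_eq i
  have := s.add_eq j
  omega

/-- The vertex `x.1` of the path `x.2` is the only one in its column. -/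
def Isol (x : Fin (n + 1) × Shuffle p q n) : Prop :=
  ∀ j, j ≠ x.1 → x.2.fst j ≠ x.2.fst x.1

lemma exists_delete (x : Fin (n + 2) × Shuffle (p + 1) q (n + 1)) (hx : Isol x) :
    ∃ s : Shuffle p q n,
      (∀ j, x.2.fst (x.1.succAbove j) = (x.2.fst x.1).succAbove (s.fst j)) ∧
      (∀ j, x.2.snd (x.1.succAbove j) = s.snd j) := by
  obtain ⟨i, t⟩ := x
  have key : ∀ j, ∃ c : Fin (p + 1), (t.fst i).succAbove c = t.fst (i.succAbove j) := fun j =>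
    Fin.exists_succAbove_eq (hx _ (Fin.succAbove_ne i j))
  choose α hα using key
  have hlt : ∀ j : Fin (n + 1), (j : ℕ) < i ↔ (α j : ℕ) < t.fst i := by
    intro j
    have e1 := congrArg (fun z : Fin _ => (z : ℕ)) (hα j)
    simp only [succAbove_val] at e1
    have e2 := hx _ (Fin.succAbove_ne i j)
    have e2' : (t.fst (i.succAbove j) : ℕ) ≠ t.fst i := fun h => e2 (Fin.ext h)
    constructor
    · intro h
      have e3 := t.fst_le (i := i.succAbove j) (j := i) (by rw [succAbove_val, if_pos h]; omega)
      split_ifs at e1 <;> omega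
    · intro h
      by_contra hcon
      have e3 := t.fst_le (i := i) (j := i.succAbove j) (by rw [succAbove_val, if_neg hcon]; omega)
      split_ifs at e1; omega
  refine ⟨⟨⟨α, ?_⟩, t.snd.comp (Fin.succAboveOrderEmb i).toOrderHom, ?_⟩,
    fun j => (hα j).symm, fun j => rfl⟩
  · intro j k hjk
    have := t.fst.monotone ((Fin.strictMono_succAbove i).monotone hjk)
    rw [← hα, ← hα] at this
    exact (Fin.strictMono_succAbove _).le_iff_le.1 this
  · intro j
    have e1 := congrArg (fun z : Fin _ => (z : ℕ)) (hα j)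
    have e2 := t.add_eq (i.succAbove j)
    have e3 := hlt j
    simp only [succAbove_val] at e1 e2
    change (α j : ℕ) + (t.snd (i.succAbove j) : ℕ) = j
    split_ifs at e1 e2 <;> omega

lemma ext_of_face {x y : Fin (n + 2) × Shuffle p q (n + 1)} (hx : Isol x) (hy : Isol y)
    (h0 : x.2.fst x.1 = y.2.fst y.1)
    (h1 : ∀ j, x.2.fst (x.1.succAbove j) = y.2.fst (y.1.succAbove j))
    (h2 : ∀ j, x.2.snd (x.1.succAbove j) = y.2.snd (y.1.succAbove j)) : x = y := by
  obtain ⟨i, s⟩ := x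
  obtain ⟨i', t⟩ := y
  simp only at h0 h1 h2
  have hi : i = i' := by
    have aux : ∀ (i i' : Fin (n + 2)) (s t : Shuffle p q (n + 1)), Isol (i, s) → Isol (i', t) →
        s.fst i = t.fst i' → (∀ j, s.fst (i.succAbove j) = t.fst (i'.succAbove j)) → ¬ i < i' := by
      intro i i' s t hx hy h0 h1 hlt
      have hlt' : (i : ℕ) < i' := hlt
      have hi' := i'.2
      let j : Fin (n + 1) := ⟨i, by omega⟩
      have e1 : i ≤ i.succAbove j := by
        rw [Fin.le_def, succAbove_val]; simp [j]
      have e2 : i'.succAbove j ≤ i' := by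
        rw [Fin.le_def, succAbove_val]; simp only [j]; rw [if_pos hlt']; omega
      have e3 := s.fst.monotone e1
      have e4 := t.fst.monotone e2
      rw [h1] at e3
      rw [← h0] at e4
      exact hx _ (Fin.succAbove_ne i j) (by rw [h1]; exact le_antisymm e4 e3)
    rcases lt_trichotomy i i' with h | h | h
    · exact absurd h (aux i i' s t hx hy h0 h1)
    · exact h
    · exact absurd h (aux i' i t s hy hx h0.symm (fun j => (h1 j).symm))
  subst hi
  congr 1
  have hf : ∀ j, s.fst j = t.fst j := (Fin.forall_iff_succAbove i).2 ⟨h0, h1⟩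
  ext j
  · exact congrArg _ (hf j)
  · have e1 := s.add_eq j
    have e2 := t.add_eq j
    rw [hf j] at e1
    omega

lemma isol_of_insert (s : Shuffle p q n) (a : Fin (p + 2))
    (x : Fin (n + 2) × Shuffle (p + 1) q (n + 1)) (h0 : x.2.fst x.1 = a)
    (h1 : ∀ j, x.2.fst (x.1.succAbove j) = a.succAbove (s.fst j)) : Isol x := by
  intro j hj
  obtain ⟨k, rfl⟩ := Fin.exists_succAbove_eq hj
  rw [h1, h0]
  exact Fin.succAbove_ne _ _

open Classical in
lemma sum_isol {M : Type*} [AddCommMonoid M] (h : p + q = n)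
    (f : Fin (n + 2) × Shuffle (p + 1) q (n + 1) → M)
    (g : Fin (p + 2) → Shuffle p q n → M)
    (hfg : ∀ x a s, x.2.fst x.1 = a → (∀ j, x.2.fst (x.1.succAbove j) = a.succAbove (s.fst j)) →
      (∀ j, x.2.snd (x.1.succAbove j) = s.snd j) → f x = g a s) :
    ∑ x with Isol x, f x = ∑ a, ∑ s, g a s := by
  rw [← Fintype.sum_prod_type']
  symm
  choose ins h0 h1 h2 using fun (y : Fin (p + 2) × Shuffle p q n) => y.2.exists_insert h y.1
  refine Finset.sum_bij (fun y _ => ins y) ?_ ?_ ?_ ?_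
  · intro y _
    simpa using isol_of_insert y.2 y.1 (ins y) (h0 y) (h1 y)
  · rintro ⟨a, s⟩ _ ⟨b, t⟩ _ e
    have ha : a = b := (h0 (a, s)).symm.trans ((congrArg (fun x => x.2.fst x.1) e).trans (h0 (b, t)))
    subst ha
    congr 1
    ext j
    · have e1 := h1 (a, s) j
      rw [e, h1 (a, t) j] at e1
      exact congrArg _ (Fin.succAbove_right_injective e1).symm
    · have e1 := h2 (a, s) j
      rw [e, h2 (a, t) j] at e1
      exact congrArg _ e1.symm
  · intro x hx
    have hx : Isol x := by simpa using hx
    obtain ⟨s, hs1, hs2⟩ := exists_delete x hx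
    refine ⟨(x.2.fst x.1, s), Finset.mem_univ _, ?_⟩
    refine ext_of_face (isol_of_insert s _ _ (h0 _) (h1 _)) hx (h0 _) (fun j => ?_) (fun j => ?_)
    · rw [h1, hs1]
    · rw [h2, hs2]
  · rintro ⟨a, s⟩ _
    exact (hfg _ a s (h0 _) (h1 _) (h2 _)).symm

/-- The order preserving injection which omits `i`. -/
def coface {n : ℕ} (i : Fin (n + 2)) : Fin (n + 1) →o Fin (n + 2) :=
  (Fin.succAboveOrderEmb i).toOrderHom

@[simp] lemma coface_apply {n : ℕ} (i : Fin (n + 2)) (j : Fin (n + 1)) :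
    coface i j = i.succAbove j := rfl

lemma exists_corner (x : Fin (n + 2) × Shuffle p q (n + 1)) (h1 : ¬ Isol x)
    (h2 : ¬ Isol (x.1, x.2.swap)) :
    ∃ c : ℕ, (∀ t : Shuffle p q (n + 1),
        (∀ j, t.fst (x.1.succAbove j) = x.2.fst (x.1.succAbove j)) →
          ((t.fst x.1 : ℕ) = c ∨ (t.fst x.1 : ℕ) = c + 1) ∧ ¬ Isol (x.1, t) ∧
            ¬ Isol (x.1, t.swap)) ∧
      ∃ t : Shuffle p q (n + 1), t ≠ x.2 ∧
        (∀ j, t.fst (x.1.succAbove j) = x.2.fst (x.1.succAbove j)) := by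
  obtain ⟨i, s⟩ := x
  simp only [Isol, swap, not_forall, not_not, ne_eq] at h1 h2 ⊢
  obtain ⟨j, hj, ej⟩ := h1
  obtain ⟨k, hk, ek⟩ := h2
  have ej' := congrArg (fun z : Fin _ => (z : ℕ)) ej
  have ek' := congrArg (fun z : Fin _ => (z : ℕ)) ek
  have hj' : (j : ℕ) ≠ i := fun h => hj (Fin.ext h)
  have hk' : (k : ℕ) ≠ i := fun h => hk (Fin.ext h)
  have a1 := s.add_eq i
  have a2 := s.add_eq j
  have a3 := s.add_eq k
  have hbet : (1 ≤ (i : ℕ) ∧ (i : ℕ) ≤ n) := by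
    have := i.2; have := j.2; have := k.2
    by_contra hcon
    rcases Nat.lt_or_ge (j : ℕ) k with h | h
    · have := s.fst_le h.le; have := s.snd_le h.le; omega
    · have := s.fst_le h; have := s.snd_le h; omega
  obtain ⟨u, hu⟩ : ∃ u : Fin (n + 2), (u : ℕ) + 1 = i :=
    ⟨⟨i - 1, by omega⟩, by simp only; omega⟩
  obtain ⟨v, hv⟩ : ∃ v : Fin (n + 2), (v : ℕ) = i + 1 := ⟨⟨i + 1, by omega⟩, rfl⟩
  have hui : u ≠ i := fun h => by rw [h] at hu; omega
  have hvi : v ≠ i := fun h => by rw [h] at hv; omega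
  obtain ⟨u', hu'⟩ := Fin.exists_succAbove_eq hui
  obtain ⟨v', hv'⟩ := Fin.exists_succAbove_eq hvi
  have b1 := s.fst_le (i := u) (j := i) (by omega)
  have b2 := s.snd_le (i := u) (j := i) (by omega)
  have b3 := s.fst_le (i := i) (j := v) (by omega)
  have b4 := s.snd_le (i := i) (j := v) (by omega)
  have b5 := s.add_eq u
  have b6 := s.add_eq v
  have huv : (s.fst v : ℕ) = s.fst u + 1 := by
    rcases lt_or_gt_of_ne hj' with hlt | hlt <;> rcases lt_or_gt_of_ne hk' with hlt' | hlt'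
    · rcases Nat.lt_or_ge (j : ℕ) k with h | h
      · have := s.fst_le h.le; have := s.snd_le h.le; omega
      · have := s.fst_le h; have := s.snd_le h; omega
    · have := s.fst_le (i := j) (j := u) (by omega)
      have := s.snd_le (i := v) (j := k) (by omega)
      omega
    · have := s.snd_le (i := k) (j := u) (by omega)
      have := s.fst_le (i := v) (j := j) (by omega)
      omega
    · rcases Nat.lt_or_ge (j : ℕ) k with h | h
      · have := s.fst_le h.le; have := s.snd_le h.le; omega
      · have := s.fst_le h; have := s.snd_le h; omega
  clear ej ek ej' ek' hj' hk' a2 a3 hj hk j k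
  refine ⟨s.fst u, fun t ht => ?_, ?_⟩
  · have c1 := ht u'
    have c2 := ht v'
    rw [hu'] at c1
    rw [hv'] at c2
    have c1' := congrArg (fun z : Fin _ => (z : ℕ)) c1
    have c2' := congrArg (fun z : Fin _ => (z : ℕ)) c2
    have d1 := t.fst_le (i := u) (j := i) (by omega)
    have d3 := t.fst_le (i := i) (j := v) (by omega)
    have d5 := t.add_eq u
    have d6 := t.add_eq v
    have d7 := t.add_eq i
    have hor : (t.fst i : ℕ) = s.fst u ∨ (t.fst i : ℕ) = s.fst u + 1 := by omega
    refine ⟨hor, ?_, ?_⟩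
    · rcases hor with h | h
      · exact ⟨u, hui, Fin.ext (by omega)⟩
      · exact ⟨v, hvi, Fin.ext (by omega)⟩
    · rcases hor with h | h
      · exact ⟨v, hvi, Fin.ext (by omega)⟩
      · exact ⟨u, hui, Fin.ext (by omega)⟩
  · have hval : (s.fst u : ℕ) + s.fst v - s.fst i < p + 1 := by
      have := (s.fst v).2; have := (s.fst u).2; omega
    have hval' : (s.snd u : ℕ) + s.snd v - s.snd i < q + 1 := by
      have := (s.snd v).2; have := (s.snd u).2; omega
    let α : Fin (n + 2) → Fin (p + 1) := i.insertNth (α := fun _ => Fin (p + 1))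
      ⟨s.fst u + s.fst v - s.fst i, hval⟩ (fun j => s.fst (i.succAbove j))
    let β : Fin (n + 2) → Fin (q + 1) := i.insertNth (α := fun _ => Fin (q + 1))
      ⟨s.snd u + s.snd v - s.snd i, hval'⟩ (fun j => s.snd (i.succAbove j))
    have hα0 : (α i : ℕ) = s.fst u + s.fst v - s.fst i := by simp [α]
    have hβ0 : (β i : ℕ) = s.snd u + s.snd v - s.snd i := by simp [β]
    have hα1 : ∀ j, α (i.succAbove j) = s.fst (i.succAbove j) := by simp [α]
    have hβ1 : ∀ j, β (i.succAbove j) = s.snd (i.succAbove j) := by simp [β]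
    have hcmp : ∀ j : Fin (n + 1), (i.succAbove j : ℕ) ≤ u ∨ (v : ℕ) ≤ i.succAbove j := by
      intro j; rw [succAbove_val]; split_ifs <;> omega
    have hαm : Monotone α := by
      intro j k
      revert j k
      simp only [Fin.forall_iff_succAbove (p := i), hα0, hα1, Fin.le_def, le_refl,
        true_and, imp_self]
      refine ⟨fun k hk => ?_, fun j => ⟨fun hk => ?_, fun k hk => s.fst_le hk⟩⟩
      · have := s.fst_le (i := v) (j := i.succAbove k) (by have := hcmp k; omega); omega
      · have := s.fst_le (i := i.succAbove j) (j := u) (by have := hcmp j; omega); omega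
    have hβm : Monotone β := by
      intro j k
      revert j k
      simp only [Fin.forall_iff_succAbove (p := i), hβ0, hβ1, Fin.le_def, le_refl,
        true_and, imp_self]
      refine ⟨fun k hk => ?_, fun j => ⟨fun hk => ?_, fun k hk => s.snd_le hk⟩⟩
      · have := s.snd_le (i := v) (j := i.succAbove k) (by have := hcmp k; omega); omega
      · have := s.snd_le (i := i.succAbove j) (j := u) (by have := hcmp j; omega); omega
    have hadd : ∀ j, (α j : ℕ) + (β j : ℕ) = (j : ℕ) := by
      simp only [Fin.forall_iff_succAbove (p := i), hα0, hβ0, hα1, hβ1]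
      exact ⟨by omega, fun j => s.add_eq _⟩
    refine ⟨⟨⟨α, hαm⟩, ⟨β, hβm⟩, hadd⟩, fun he => ?_, hα1⟩
    have := congrArg (fun t : Shuffle p q (n + 1) => (t.fst i : ℕ)) he
    change (α i : ℕ) = s.fst i at this
    omega

lemma eq_of_fst {s t : Shuffle p q n} (h : ∀ j, s.fst j = t.fst j) : s = t := by
  ext j
  · exact congrArg _ (h j)
  · have e1 := s.add_eq j
    have e2 := t.add_eq j
    rw [h j] at e1
    omega

open Classical in
lemma sum_corner {M : Type*} [AddCommGroup M]
    (F : (Fin (n + 1) →o Fin (p + 1)) → (Fin (n + 1) →o Fin (q + 1)) → M) :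
    ∑ x : Fin (n + 2) × Shuffle p q (n + 1) with ¬ Isol x ∧ ¬ Isol (x.1, x.2.swap),
      ((-1 : ℤ) ^ ((x.1 : ℕ) + x.2.area)) •
        F (x.2.fst.comp (coface x.1)) (x.2.snd.comp (coface x.1)) = 0 := by
  have key : ∀ x : Fin (n + 2) × Shuffle p q (n + 1), ∃ t : Shuffle p q (n + 1),
      (¬ Isol x ∧ ¬ Isol (x.1, x.2.swap)) → t ≠ x.2 ∧
        (∀ j, t.fst (x.1.succAbove j) = x.2.fst (x.1.succAbove j)) := by
    intro x
    by_cases hx : ¬ Isol x ∧ ¬ Isol (x.1, x.2.swap)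
    · obtain ⟨c, -, t, ht⟩ := exists_corner x hx.1 hx.2
      exact ⟨t, fun _ => ht⟩
    · exact ⟨x.2, fun h => absurd h hx⟩
  choose flip hflip using key
  have hne : ∀ {i : Fin (n + 2)} {s t : Shuffle p q (n + 1)}, t ≠ s →
      (∀ j, t.fst (i.succAbove j) = s.fst (i.succAbove j)) → (t.fst i : ℕ) ≠ s.fst i := by
    intro i s t hts h1 h2
    exact hts (eq_of_fst ((Fin.forall_iff_succAbove i).2 ⟨Fin.ext h2, h1⟩))
  have hmem : ∀ x : Fin (n + 2) × Shuffle p q (n + 1),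
      (¬ Isol x ∧ ¬ Isol (x.1, x.2.swap)) →
      ¬ Isol (x.1, flip x) ∧ ¬ Isol (x.1, (flip x).swap) := by
    intro x hx
    obtain ⟨c, hc, -⟩ := exists_corner x hx.1 hx.2
    exact (hc (flip x) (hflip x hx).2).2
  refine Finset.sum_involution (fun x _ => (x.1, flip x)) ?_ ?_ ?_ ?_
  · intro x hx
    have hx : ¬ Isol x ∧ ¬ Isol (x.1, x.2.swap) := by simpa using hx
    obtain ⟨c, hc, -⟩ := exists_corner x hx.1 hx.2
    obtain ⟨h1, h2⟩ := hflip x hx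
    have e1 := (hc (flip x) h2).1
    have e2 := (hc x.2 (fun _ => rfl)).1
    have e3 := hne h1 h2
    have hfst : (flip x).fst.comp (coface x.1) = x.2.fst.comp (coface x.1) := by
      ext j; exact congrArg _ (h2 j)
    have hsnd : (flip x).snd.comp (coface x.1) = x.2.snd.comp (coface x.1) := by
      ext j
      have f1 := (flip x).add_eq (x.1.succAbove j)
      have f2 := x.2.add_eq (x.1.succAbove j)
      rw [h2 j] at f1
      change ((flip x).snd (x.1.succAbove j) : ℕ) = x.2.snd (x.1.succAbove j)
      omega
    simp only [hfst, hsnd]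
    rw [← add_smul, pow_add, pow_add, sign_eq, sign_eq, Fin.sum_univ_succAbove _ x.1,
      Fin.sum_univ_succAbove (fun i => ((flip x).fst i : ℕ)) x.1,
      Fin.sum_univ_succAbove (fun i => (x.2.fst i : ℕ)) x.1]
    simp only [h2]
    have : (-1 : ℤ) ^ (x.2.fst x.1 : ℕ) + (-1) ^ ((flip x).fst x.1 : ℕ) = 0 := by
      rcases e1 with e1 | e1 <;> rcases e2 with e2 | e2 <;> rw [e1, e2]
      · omega
      · ring
      · ring
      · omega
    convert zero_smul ℤ _ using 2
    simp only [pow_add]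
    linear_combination (-1 : ℤ) ^ (x.1 : ℕ) * ((-1) ^ (min (x.1 : ℕ) p) *
      (-1) ^ (∑ i, min (x.1.succAbove i : ℕ) p)) *
        (-1) ^ (∑ i, (x.2.fst (x.1.succAbove i) : ℕ)) * this
  · intro x hx _ he
    have hx : ¬ Isol x ∧ ¬ Isol (x.1, x.2.swap) := by simpa using hx
    exact (hflip x hx).1 (congrArg Prod.snd he)
  · intro x hx
    have hx : ¬ Isol x ∧ ¬ Isol (x.1, x.2.swap) := by simpa using hx
    simpa using hmem x hx
  · intro x hx
    have hx : ¬ Isol x ∧ ¬ Isol (x.1, x.2.swap) := by simpa using hx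
    obtain ⟨c, hc, -⟩ := exists_corner x hx.1 hx.2
    obtain ⟨h1, h2⟩ := hflip x hx
    obtain ⟨h3, h4⟩ := hflip (x.1, flip x) (hmem x hx)
    have e1 := (hc (flip x) h2).1
    have e2 := (hc x.2 (fun _ => rfl)).1
    have e4 := (hc (flip (x.1, flip x)) (fun j => (h4 j).trans (h2 j))).1
    have e3 := hne h1 h2
    have e5 := hne h3 h4
    simp only at e5
    refine Prod.ext rfl (eq_of_fst ((Fin.forall_iff_succAbove x.1).2
      ⟨Fin.ext ?_, fun j => (h4 j).trans (h2 j)⟩))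
    change ((flip (x.1, flip x)).fst x.1 : ℕ) = x.2.fst x.1
    omega

lemma not_isol_both (x : Fin (n + 2) × Shuffle p q (n + 1)) :
    ¬ (Isol x ∧ Isol (x.1, x.2.swap)) := by
  obtain ⟨i, s⟩ := x
  rintro ⟨h1, h2⟩
  have aux : ∀ j : Fin (n + 2), ((j : ℕ) + 1 = i ∨ (i : ℕ) + 1 = j) → False := by
    intro j hj
    have hji : j ≠ i := fun h => by subst h; omega
    have c1 : (s.fst j : ℕ) ≠ s.fst i := fun h => h1 j hji (Fin.ext h)
    have c2 : (s.snd j : ℕ) ≠ s.snd i := fun h => h2 j hji (Fin.ext h)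
    have a1 := s.add_eq i
    have a2 := s.add_eq j
    rcases hj with hj | hj
    · have := s.fst_le (i := j) (j := i) (by omega)
      have := s.snd_le (i := j) (j := i) (by omega)
      omega
    · have := s.fst_le (i := i) (j := j) (by omega)
      have := s.snd_le (i := i) (j := j) (by omega)
      omega
  have := i.2
  rcases Nat.eq_zero_or_pos (i : ℕ) with h | h
  · exact aux ⟨1, by omega⟩ (Or.inr (by simp [h]))
  · exact aux ⟨i - 1, by omega⟩ (Or.inl (by simp only; omega))

/-- The contribution of a face of a shuffle. -/
def term {M : Type*} [AddCommGroup M]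
    (F : (Fin (n + 1) →o Fin (p + 1)) → (Fin (n + 1) →o Fin (q + 1)) → M)
    (x : Fin (n + 2) × Shuffle p q (n + 1)) : M :=
  ((-1 : ℤ) ^ ((x.1 : ℕ) + x.2.area)) • F (x.2.fst.comp (coface x.1)) (x.2.snd.comp (coface x.1))

open Classical in
lemma sum_term {M : Type*} [AddCommGroup M]
    (F : (Fin (n + 1) →o Fin (p + 1)) → (Fin (n + 1) →o Fin (q + 1)) → M) :
    ∑ x, term F x = ∑ x with Isol x, term F x +
      ∑ x : Fin (n + 2) × Shuffle p q (n + 1) with Isol (x.1, x.2.swap), term F x := by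
  have h := sum_corner (p := p) (q := q) F
  rw [Finset.sum_filter] at h
  rw [Finset.sum_filter, Finset.sum_filter, ← Finset.sum_add_distrib, ← sub_eq_zero,
    ← Finset.sum_sub_distrib]
  refine Eq.trans (Finset.sum_congr rfl fun x _ => ?_) h
  have := not_isol_both x
  by_cases h1 : Isol x <;> by_cases h2 : Isol (x.1, x.2.swap)
  · exact absurd ⟨h1, h2⟩ this
  · simp [h1, h2]
  · simp [h1, h2]
  · simp [h1, h2, term]

lemma neg_one_pow_congr {a b : ℕ} (h : Even (a + b)) : (-1 : ℤ) ^ a = (-1) ^ b := by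
  rcases Nat.even_or_odd b with hb | hb
  · rw [hb.neg_one_pow, ((Nat.even_add.1 h).2 hb).neg_one_pow]
  · have : Odd a := by
      rw [← Nat.not_even_iff_odd] at hb ⊢
      exact fun ha => hb ((Nat.even_add.1 h).1 ha)
    rw [hb.neg_one_pow, this.neg_one_pow]

lemma area_add (s : Shuffle p q n) :
    s.area + ∑ i, (s.fst i : ℕ) = ∑ i : Fin (n + 1), min (i : ℕ) p := by
  rw [area, ← Finset.sum_add_distrib]
  refine Finset.sum_congr rfl fun i _ => ?_
  have := s.add_eq i
  have := (s.fst i).2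
  omega

lemma sum_add_sum (s : Shuffle p q n) :
    ∑ i, (s.fst i : ℕ) + ∑ i, (s.snd i : ℕ) = ∑ i : Fin (n + 1), (i : ℕ) := by
  rw [← Finset.sum_add_distrib]
  exact Finset.sum_congr rfl fun i _ => s.add_eq i

lemma sum_min_succ (n p : ℕ) :
    ∑ i : Fin (n + 2), min (i : ℕ) (p + 1) = ∑ i : Fin (n + 1), min (i : ℕ) p + (n + 1) := by
  rw [Fin.sum_univ_succ]
  simp [Finset.sum_add_distrib]

lemma sum_min_castSucc (n p : ℕ) (h : p ≤ n + 1) :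
    ∑ i : Fin (n + 2), min (i : ℕ) p = ∑ i : Fin (n + 1), min (i : ℕ) p + p := by
  rw [Fin.sum_univ_castSucc]
  simp [h]

open Classical in
lemma sum_fst {M : Type*} [AddCommGroup M] (h : p + q = n)
    (F : (Fin (n + 1) →o Fin (p + 2)) → (Fin (n + 1) →o Fin (q + 1)) → M) :
    ∑ x : Fin (n + 2) × Shuffle (p + 1) q (n + 1) with Isol x, term F x =
      ∑ a : Fin (p + 2), ∑ s : Shuffle p q n,
        ((-1 : ℤ) ^ ((a : ℕ) + s.area)) • F ((coface a).comp s.fst) s.snd := by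
  refine sum_isol h _ _ ?_
  rintro ⟨i, t⟩ a s h0 h1 h2
  simp only at h0 h1 h2
  have hf : t.fst.comp (coface i) = (coface a).comp s.fst := by
    ext j; exact congrArg _ (h1 j)
  have hs : t.snd.comp (coface i) = s.snd := by
    ext j; exact congrArg _ (h2 j)
  simp only [term, hf, hs]
  congr 1
  refine neg_one_pow_congr ?_
  have e1 := area_add s
  have e2 := area_add t
  have e3 := sum_add_sum s
  have e4 := sum_add_sum t
  rw [Fin.sum_univ_succAbove (fun j => (t.snd j : ℕ)) i,
    Fin.sum_univ_castSucc (fun j : Fin (n + 1 + 1) => (j : ℕ))] at e4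
  rw [sum_min_succ] at e2
  simp only [h2, Fin.val_last, Fin.val_castSucc] at e4
  have e5 := t.add_eq i
  rw [h0] at e5
  rw [Nat.even_iff]
  omega

open Classical in
lemma sum_fst_zero {M : Type*} [AddCommGroup M]
    (F : (Fin (n + 1) →o Fin 1) → (Fin (n + 1) →o Fin (q + 1)) → M) :
    ∑ x : Fin (n + 2) × Shuffle 0 q (n + 1) with Isol x, term F x = 0 := by
  rw [Finset.sum_filter]
  refine Finset.sum_eq_zero fun x _ => if_neg fun hx => ?_
  obtain ⟨j, hj⟩ := exists_ne x.1
  exact hx j hj (Subsingleton.elim (α := Fin 1) _ _)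

/-- Swapping the two factors. -/
def swapEquiv : Shuffle p q n ≃ Shuffle q p n where
  toFun := swap
  invFun := swap
  left_inv _ := rfl
  right_inv _ := rfl

open Classical in
lemma sum_snd {M : Type*} [AddCommGroup M] (h : p + q = n)
    (F : (Fin (n + 1) →o Fin (p + 1)) → (Fin (n + 1) →o Fin (q + 2)) → M) :
    ∑ x : Fin (n + 2) × Shuffle p (q + 1) (n + 1) with Isol (x.1, x.2.swap), term F x =
      ∑ b : Fin (q + 2), ∑ s : Shuffle p q n,
        ((-1 : ℤ) ^ (p + (b : ℕ) + s.area)) • F s.fst ((coface b).comp s.snd) := by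
  have e1 : ∑ x : Fin (n + 2) × Shuffle p (q + 1) (n + 1) with Isol (x.1, x.2.swap), term F x =
      ∑ x : Fin (n + 2) × Shuffle (q + 1) p (n + 1) with Isol x, term F (x.1, x.2.swap) := by
    rw [Finset.sum_filter, Finset.sum_filter]
    exact Fintype.sum_equiv ((Equiv.refl _).prodCongr swapEquiv) _ _ fun x => rfl
  have e2 : ∀ b : Fin (q + 2), ∑ s : Shuffle p q n,
        ((-1 : ℤ) ^ (p + (b : ℕ) + s.area)) • F s.fst ((coface b).comp s.snd) =
      ∑ s : Shuffle q p n,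
        ((-1 : ℤ) ^ (p + (b : ℕ) + s.swap.area)) • F s.snd ((coface b).comp s.fst) := fun b =>
    Fintype.sum_equiv swapEquiv _ _ fun x => rfl
  simp only [e1, e2]
  refine sum_isol (by omega) _ _ ?_
  rintro ⟨i, t⟩ b s h0 h1 h2
  simp only at h0 h1 h2
  have hf : t.fst.comp (coface i) = (coface b).comp s.fst := by
    ext j; exact congrArg _ (h1 j)
  have hs : t.snd.comp (coface i) = s.snd := by
    ext j; exact congrArg _ (h2 j)
  have hf' : t.swap.snd.comp (coface i) = (coface b).comp s.fst := hf
  have hs' : t.swap.fst.comp (coface i) = s.snd := hs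
  simp only [term, hf', hs']
  congr 1
  refine neg_one_pow_congr ?_
  have e1 := area_add s.swap
  have e2 := area_add t.swap
  change _ + ∑ j, (s.snd j : ℕ) = _ at e1
  change _ + ∑ j, (t.snd j : ℕ) = _ at e2
  rw [Fin.sum_univ_succAbove (fun j => (t.snd j : ℕ)) i, sum_min_castSucc _ _ (by omega)] at e2
  simp only [h2] at e2
  have e5 := t.add_eq i
  rw [h0] at e5
  rw [Nat.even_iff]
  omega

open Classical in
lemma sum_snd_zero {M : Type*} [AddCommGroup M]
    (F : (Fin (n + 1) →o Fin (p + 1)) → (Fin (n + 1) →o Fin 1) → M) :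
    ∑ x : Fin (n + 2) × Shuffle p 0 (n + 1) with Isol (x.1, x.2.swap), term F x = 0 := by
  rw [Finset.sum_filter]
  refine Finset.sum_eq_zero fun x _ => if_neg fun hx => ?_
  obtain ⟨j, hj⟩ := exists_ne x.1
  exact hx j hj (Subsingleton.elim (α := Fin 1) _ _)

end Shuffle

section Chains

open CategoryTheory Limits Simplicial AlgebraicTopology MonoidalCategory

variable (k : Type u) [Field k]

namespace SSetChains

/-- The `k`-module of `n`-chains. -/
noncomputable abbrev C (S : SSet.{u}) (n : ℕ) : ModuleCat.{u} k :=
  (S.chainComplex (ModuleCat.of k k)).X n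

/-- The boundary `C_p → C_{p-1}`, which is zero for `p = 0`. -/
noncomputable def d (S : SSet.{u}) (p : ℕ) : C k S p →ₗ[k] C k S (p - 1) :=
  ((S.chainComplex (ModuleCat.of k k)).d p (p - 1)).hom

variable {k}

/-- The generator given by a simplex. -/
noncomputable def gen {S : SSet.{u}} {n : ℕ} (x : S _⦋n⦌) : C k S n :=
  (S.ιChainComplex (R := ModuleCat.of k k) x).hom (1 : k)

variable (k)

/-- Chains are freely generated by simplices: linear extension of a map. -/
noncomputable def linExt {S : SSet.{u}} {n : ℕ} {M : Type u} [AddCommGroup M] [Module k M]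
    (f : S _⦋n⦌ → M) : C k S n →ₗ[k] M :=
  ((S.isColimitChainComplexXCofan (ModuleCat.of k k) n).desc
    (Cofan.mk (ModuleCat.of k M) (fun x => ModuleCat.ofHom (LinearMap.toSpanSingleton k M (f x))))).hom

variable {k}

lemma linExt_gen {S : SSet.{u}} {n : ℕ} {M : Type u} [AddCommGroup M] [Module k M]
    (f : S _⦋n⦌ → M) (x : S _⦋n⦌) : linExt k f (gen x) = f x := by
  have h := (S.isColimitChainComplexXCofan (ModuleCat.of k k) n).fac
    (Cofan.mk (ModuleCat.of k M)
      (fun x => ModuleCat.ofHom (LinearMap.toSpanSingleton k M (f x)))) ⟨x⟩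
  have h' := congrArg (fun g => g.hom (1 : k)) h
  change _ = (1 : k) • f x at h'
  rw [one_smul] at h'
  exact h'

lemma hom_ext {S : SSet.{u}} {n : ℕ} {M : Type u} [AddCommGroup M] [Module k M]
    {f g : C k S n →ₗ[k] M} (h : ∀ x : S _⦋n⦌, f (gen x) = g (gen x)) : f = g := by
  have : ModuleCat.ofHom f = ModuleCat.ofHom g := by
    refine SSet.chainComplex_hom_ext fun x => ?_
    ext
    exact h x
  exact congrArg (fun z => z.hom) this

lemma d_zero (S : SSet.{u}) : d k S 0 = 0 := by
  have : (S.chainComplex (ModuleCat.of k k)).d 0 (0 - 1) = 0 :=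
    HomologicalComplex.shape _ _ _ (by simp)
  rw [d, this]; rfl

lemma d_gen (S : SSet.{u}) {n : ℕ} (x : S _⦋n + 1⦌) :
    d k S (n + 1) (gen x) = ∑ i : Fin (n + 2), ((-1 : ℤ) ^ (i : ℕ)) • gen (k := k) (S.δ i x) := by
  have h := S.ιChainComplex_d (ModuleCat.of k k) x
  have h' := congrArg (fun g => g.hom (1 : k)) h
  change d k S (n + 1) (gen x) = _ at h'
  rw [h', ModuleCat.hom_sum, LinearMap.sum_apply]
  refine Finset.sum_congr rfl fun i _ => ?_
  rfl

/-- The action of an order preserving map on simplices. -/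
def op (S : SSet.{u}) {n m : ℕ} (f : Fin (n + 1) →o Fin (m + 1)) (x : S _⦋m⦌) : S _⦋n⦌ :=
  S.map (SimplexCategory.mkHom f).op x

lemma op_comp (S : SSet.{u}) {n m l : ℕ} (f : Fin (n + 1) →o Fin (m + 1))
    (g : Fin (m + 1) →o Fin (l + 1)) (x : S _⦋l⦌) : op S f (op S g x) = op S (g.comp f) x := by
  simp only [op, ← Functor.map_comp_apply]
  rfl

lemma op_coface (S : SSet.{u}) {n : ℕ} (i : Fin (n + 2)) (x : S _⦋n + 1⦌) :
    op S (Shuffle.coface i) x = S.δ i x := rfl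

/-- A pair of simplices. -/
def pair {S T : SSet.{u}} {n : ℕ} (x : S _⦋n⦌) (y : T _⦋n⦌) : (S ⊗ T : SSet.{u}) _⦋n⦌ := (x, y)

lemma op_pair {S T : SSet.{u}} {n m : ℕ} (f : Fin (n + 1) →o Fin (m + 1)) (x : S _⦋m⦌)
    (y : T _⦋m⦌) : op (S ⊗ T : SSet.{u}) f (pair x y) = pair (op S f x) (op T f y) := rfl

variable (k)

/-- The Eilenberg–Zilber map `x ⊗ y ↦ ∑ ± (s.fst^* x, s.snd^* y)`, a sum over shuffles `s`. -/
noncomputable def cross (S T : SSet.{u}) (p q n : ℕ) :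
    C k S p →ₗ[k] C k T q →ₗ[k] C k (S ⊗ T : SSet.{u}) n :=
  linExt k fun x => linExt k fun y =>
    ∑ s : Shuffle p q n, ((-1 : ℤ) ^ s.area) • gen (pair (op S s.fst x) (op T s.snd y))

variable {k}

lemma cross_gen {S T : SSet.{u}} {p q n : ℕ} (x : S _⦋p⦌) (y : T _⦋q⦌) :
    cross k S T p q n (gen x) (gen y) =
      ∑ s : Shuffle p q n, ((-1 : ℤ) ^ s.area) • gen (pair (op S s.fst x) (op T s.snd y)) := by
  rw [cross, linExt_gen, linExt_gen]

lemma leibniz (S T : SSet.{u}) {p q n : ℕ} (h : p + q = n) (a : C k S p) (b : C k T q) :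
    d k _ n (cross k S T p q n a b) =
      cross k S T (p - 1) q (n - 1) (d k S p a) b +
        ((-1 : ℤ) ^ p) • cross k S T p (q - 1) (n - 1) a (d k T q b) := by
  suffices H : (cross k S T p q n).compr₂ (d k _ n) =
      (cross k S T (p - 1) q (n - 1)).comp (d k S p) +
        ((-1 : ℤ) ^ p) • (cross k S T p (q - 1) (n - 1)).compl₂ (d k T q) by
    exact congrArg (fun f => f a b) H
  refine hom_ext fun x => hom_ext fun y => ?_
  simp only [LinearMap.compr₂_apply, LinearMap.add_apply, LinearMap.comp_apply,
    LinearMap.smul_apply, LinearMap.compl₂_apply]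
  rcases n with _ | n
  · obtain rfl : p = 0 := by omega
    obtain rfl : q = 0 := by omega
    simp [d_zero]
  let F : (Fin (n + 1) →o Fin (p + 1)) → (Fin (n + 1) →o Fin (q + 1)) →
      C k (S ⊗ T : SSet.{u}) n := fun f g => gen (pair (op S f x) (op T g y))
  have e0 : d k (S ⊗ T : SSet.{u}) (n + 1) (cross k S T p q (n + 1) (gen x) (gen y)) =
      ∑ z, Shuffle.term F z := by
    rw [cross_gen, map_sum, Fintype.sum_prod_type_right]
    refine Finset.sum_congr rfl fun s _ => ?_
    rw [map_zsmul, d_gen, Finset.smul_sum]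
    refine Finset.sum_congr rfl fun i _ => ?_
    rw [smul_smul, ← op_coface, op_pair, op_comp, op_comp, Shuffle.term, pow_add, mul_comm]
  rw [e0, Shuffle.sum_term]
  congr 1
  · rcases p with _ | p
    · rw [Shuffle.sum_fst_zero, d_zero]; simp
    · rw [Shuffle.sum_fst (by omega), d_gen, map_sum, LinearMap.sum_apply]
      refine Finset.sum_congr rfl fun i _ => ?_
      rw [map_zsmul, LinearMap.smul_apply]
      change _ = _ • cross k S T p q n _ _
      rw [cross_gen, Finset.smul_sum]
      refine Finset.sum_congr rfl fun s _ => ?_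
      rw [smul_smul, ← op_coface, op_comp, pow_add]
  · rcases q with _ | q
    · rw [Shuffle.sum_snd_zero, d_zero]; simp
    · rw [Shuffle.sum_snd (by omega), d_gen, map_sum, Finset.smul_sum]
      refine Finset.sum_congr rfl fun i _ => ?_
      rw [map_zsmul]
      change _ = _ • _ • cross k S T p q n _ _
      rw [cross_gen, Finset.smul_sum, Finset.smul_sum]
      refine Finset.sum_congr rfl fun s _ => ?_
      rw [smul_smul, smul_smul, ← op_coface, op_comp, pow_add, pow_add, mul_assoc]

variable (k)

/-- The module of `n`-cycles. -/
noncomputable def Z (S : SSet.{u}) (n : ℕ) : Submodule k (C k S n) := LinearMap.ker (d k S n)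

/-- The `n`-th homology. -/
noncomputable abbrev H (S : SSet.{u}) (n : ℕ) : ModuleCat.{u} k :=
  S.homology (ModuleCat.of k k) n

lemma next_eq (n : ℕ) : (ComplexShape.down ℕ).next n = n - 1 := by
  rcases n with _ | n <;> simp

/-- The homology class of a cycle. -/
noncomputable def cls (S : SSet.{u}) (n : ℕ) : Z k S n →ₗ[k] H k S n :=
  ((S.chainComplex (ModuleCat.of k k)).liftCycles (A := ModuleCat.of k (Z k S n))
    (ModuleCat.ofHom (Z k S n).subtype) (n - 1) (next_eq n) (by ext z; exact z.2) ≫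
      (S.chainComplex (ModuleCat.of k k)).homologyπ n).hom

variable {k}

lemma cls_surjective (S : SSet.{u}) (n : ℕ) : Function.Surjective (cls k S n) := by
  intro y
  let K := S.chainComplex (ModuleCat.of k k)
  obtain ⟨c, rfl⟩ := (ModuleCat.epi_iff_surjective (K.homologyπ n)).1 inferInstance y
  have hc : d k S n ((K.iCycles n).hom c) = 0 := by
    have := congrArg (fun f => f.hom c) (K.iCycles_d n (n - 1))
    exact this
  refine ⟨⟨(K.iCycles n).hom c, hc⟩, ?_⟩
  have h : (K.liftCycles (A := ModuleCat.of k (Z k S n))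
      (ModuleCat.ofHom (Z k S n).subtype) (n - 1) (next_eq n) (by ext z; exact z.2)).hom
        ⟨(K.iCycles n).hom c, hc⟩ = c := by
    apply (ModuleCat.mono_iff_injective (K.iCycles n)).1 inferInstance
    have := congrArg (fun f => f.hom (⟨(K.iCycles n).hom c, hc⟩ : Z k S n))
      (K.liftCycles_i (A := ModuleCat.of k (Z k S n))
      (ModuleCat.ofHom (Z k S n).subtype) (n - 1) (next_eq n) (by ext z; exact z.2))
    exact this
  exact congrArg (K.homologyπ n).hom h

lemma cls_eq_zero_iff (S : SSet.{u}) (n : ℕ) (z : Z k S n) :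
    cls k S n z = 0 ↔ ∃ b : C k S (n + 1), d k S (n + 1) b = z.1 := by
  let K := S.chainComplex (ModuleCat.of k k)
  let l := K.liftCycles (A := ModuleCat.of k (Z k S n))
      (ModuleCat.ofHom (Z k S n).subtype) (n - 1) (next_eq n) (by ext z; exact z.2)
  have hl : (K.iCycles n).hom (l.hom z) = z := by
    have := congrArg (fun f => f.hom z) (K.liftCycles_i (A := ModuleCat.of k (Z k S n))
      (ModuleCat.ofHom (Z k S n).subtype) (n - 1) (next_eq n) (by ext z; exact z.2))
    exact this
  have hex : (ShortComplex.mk _ _ (K.toCycles_comp_homologyπ (n + 1) n)).Exact :=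
    ShortComplex.exact_of_g_is_cokernel _ (K.homologyIsCokernel (n + 1) n (by simp))
  rw [ShortComplex.moduleCat_exact_iff] at hex
  have hi : ∀ b, (K.iCycles n).hom ((K.toCycles (n + 1) n).hom b) = d k S (n + 1) b := fun b =>
    congrArg (fun f => f.hom b) (K.toCycles_i (n + 1) n)
  constructor
  · intro hz
    obtain ⟨b, hb⟩ := hex (l.hom z) hz
    exact ⟨b, by rw [← hi, ← hl]; exact congrArg (K.iCycles n).hom hb⟩
  · rintro ⟨b, hb⟩
    have : l.hom z = (K.toCycles (n + 1) n).hom b := by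
      apply (ModuleCat.mono_iff_injective (K.iCycles n)).1 inferInstance
      exact hl.trans (hb.symm.trans (hi b).symm)
    change (K.homologyπ n).hom (l.hom z) = 0
    rw [this]
    exact congrArg (fun f => f.hom b) (K.toCycles_comp_homologyπ (n + 1) n)

/-- A linear map on cycles which vanishes on boundaries induces a map on homology. -/
noncomputable def desc {S : SSet.{u}} {n : ℕ} {M : Type u} [AddCommGroup M] [Module k M]
    (f : Z k S n →ₗ[k] M)
    (hf : ∀ (z : Z k S n) (b : C k S (n + 1)), d k S (n + 1) b = z.1 → f z = 0) :
    H k S n →ₗ[k] M :=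
  (LinearMap.ker (cls k S n)).liftQ f (fun z hz => by
      obtain ⟨b, hb⟩ := (cls_eq_zero_iff S n z).1 hz
      exact hf z b hb) ∘ₗ
    ((cls k S n).quotKerEquivOfSurjective (cls_surjective S n)).symm.toLinearMap

lemma desc_cls {S : SSet.{u}} {n : ℕ} {M : Type u} [AddCommGroup M] [Module k M]
    (f : Z k S n →ₗ[k] M)
    (hf : ∀ (z : Z k S n) (b : C k S (n + 1)), d k S (n + 1) b = z.1 → f z = 0) (z : Z k S n) :
    desc f hf (cls k S n z) = f z := by
  rw [desc, LinearMap.comp_apply]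
  have : ((cls k S n).quotKerEquivOfSurjective (cls_surjective S n)).symm.toLinearMap
      (cls k S n z) = Submodule.Quotient.mk z := by
    change ((cls k S n).quotKerEquivOfSurjective (cls_surjective S n)).symm _ = _
    rw [LinearEquiv.symm_apply_eq]
    rfl
  rw [this]
  rfl

lemma cross_mem (S T : SSet.{u}) {p q n : ℕ} (h : p + q = n) (z : Z k S p) (w : Z k T q) :
    cross k S T p q n z w ∈ Z k (S ⊗ T : SSet.{u}) n := by
  have hz : d k S p z = 0 := z.2
  have hw : d k T q w = 0 := w.2
  change d k _ n _ = 0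
  rw [leibniz S T h, hz, hw]
  simp

/-- The cross product of cycles. -/
noncomputable def crossZ (S T : SSet.{u}) {p q n : ℕ} (h : p + q = n) :
    Z k S p →ₗ[k] Z k T q →ₗ[k] Z k (S ⊗ T : SSet.{u}) n :=
  LinearMap.mk₂ k (fun z w => ⟨cross k S T p q n z w, cross_mem S T h z w⟩)
    (fun _ _ _ => Subtype.ext (by simp)) (fun _ _ _ => Subtype.ext (by simp))
    (fun _ _ _ => Subtype.ext (by simp)) (fun _ _ _ => Subtype.ext (by simp))

lemma crossZ_boundary (S T : SSet.{u}) {p q n : ℕ} (h : p + q = n) (z : Z k S p) (w : Z k T q)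
    (b : C k T (q + 1)) (hb : d k T (q + 1) b = w.1) :
    (cls k (S ⊗ T : SSet.{u}) n ∘ₗ crossZ S T h z) w = 0 := by
  refine (cls_eq_zero_iff _ _ _).2 ⟨((-1 : ℤ) ^ p) • cross k S T p (q + 1) (n + 1) z b, ?_⟩
  have hz : d k S p z = 0 := z.2
  rw [map_zsmul, leibniz S T (by omega), hz, hb, map_zero, LinearMap.zero_apply, zero_add,
    smul_smul, ← pow_add, Even.neg_one_pow ⟨_, rfl⟩, one_smul]
  rfl

/-- The cross product of a cycle and a homology class. -/
noncomputable def crossAux (S T : SSet.{u}) {p q n : ℕ} (h : p + q = n) :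
    Z k S p →ₗ[k] H k T q →ₗ[k] H k (S ⊗ T : SSet.{u}) n where
  toFun z := desc (cls k (S ⊗ T : SSet.{u}) n ∘ₗ crossZ S T h z) (crossZ_boundary S T h z)
  map_add' z z' := by
    refine LinearMap.ext fun y => ?_
    obtain ⟨w, rfl⟩ := cls_surjective T q y
    simp [desc_cls]
  map_smul' c z := by
    refine LinearMap.ext fun y => ?_
    obtain ⟨w, rfl⟩ := cls_surjective T q y
    simp [desc_cls]

lemma crossAux_cls (S T : SSet.{u}) {p q n : ℕ} (h : p + q = n) (z : Z k S p) (w : Z k T q) :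
    crossAux S T h z (cls k T q w) = cls k (S ⊗ T : SSet.{u}) n (crossZ S T h z w) :=
  desc_cls _ (crossZ_boundary S T h z) w

lemma crossAux_boundary (S T : SSet.{u}) {p q n : ℕ} (h : p + q = n) (z : Z k S p)
    (b : C k S (p + 1)) (hb : d k S (p + 1) b = z.1) : crossAux (k := k) S T h z = 0 := by
  refine LinearMap.ext fun y => ?_
  obtain ⟨w, rfl⟩ := cls_surjective T q y
  rw [crossAux_cls]
  refine (cls_eq_zero_iff _ _ _).2 ⟨cross k S T (p + 1) q (n + 1) b w, ?_⟩
  have hw : d k T q w = 0 := w.2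
  rw [leibniz S T (by omega), hw, hb, map_zero, smul_zero, add_zero]
  rfl

/-- The cross product in homology: `[z] × [w] = [z × w]` for cycles `z` and `w`. -/
noncomputable def crossH (S T : SSet.{u}) {p q n : ℕ} (h : p + q = n) :
    H k S p →ₗ[k] H k T q →ₗ[k] H k (S ⊗ T : SSet.{u}) n :=
  desc (crossAux S T h) (crossAux_boundary S T h)

lemma crossH_cls (S T : SSet.{u}) {p q n : ℕ} (h : p + q = n) (z : Z k S p) (w : Z k T q) :
    crossH S T h (cls k S p z) (cls k T q w) = cls k (S ⊗ T : SSet.{u}) n (crossZ S T h z w) := by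
  rw [crossH, desc_cls, crossAux_cls]

end SSetChains

end Chains

section TopologicalOperads

/-- The `k`-ification of a space: the same set, with the finest topology for which the continuous
maps from compact Hausdorff spaces remain continuous. -/
@[ext]
structure Kify (X : Type u) : Type u where
  out : X

instance {X : Type u} [TopologicalSpace X] : TopologicalSpace (Kify X) :=
  TopologicalSpace.coinduced Kify.mk (TopologicalSpace.compactlyGenerated.{u} X)

/-- The product of two spaces in the category of compactly generated spaces. -/
abbrev KProd (X Y : Type u) : Type u := Kify (X × Y)

/-- The product of a family of spaces in the category of compactly generated spaces. -/
abbrev KPi {ι : Type} (X : ι → Type u) : Type u := Kify (∀ i, X i)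

section Kify

variable {X Y Z : Type u} [TopologicalSpace X] [TopologicalSpace Y] [TopologicalSpace Z]

lemma Kify.continuous_out : Continuous (Kify.out : Kify X → X) :=
  continuous_coinduced_dom.2 (continuous_from_compactlyGenerated _ fun _ g => g.continuous)

lemma Kify.continuous_of_compHaus {K : Type u} [TopologicalSpace K] [CompactSpace K] [T2Space K]
    {f : K → X} (hf : Continuous f) : Continuous (fun x => Kify.mk (f x)) := by
  let F : (Σ (i : (S : CompHaus.{u}) × C(S, X)), i.fst) → X := fun ⟨⟨_, i⟩, s⟩ ↦ i s
  have h1 : TopologicalSpace.coinduced f inferInstance ≤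
      TopologicalSpace.compactlyGenerated.{u} X := by
    have h2 : Continuous (fun x : K => (⟨⟨CompHaus.of K, ⟨f, hf⟩⟩, x⟩ :
        (i : (S : CompHaus.{u}) × C(S, X)) × i.fst)) :=
      continuous_sigmaMk (σ := fun i : (S : CompHaus.{u}) × C(S, X) => (i.fst : Type u))
        (i := ⟨CompHaus.of K, ⟨f, hf⟩⟩)
    have h3 := coinduced_mono (f := F) (continuous_iff_coinduced_le.1 h2)
    rw [coinduced_compose] at h3
    exact h3
  refine continuous_iff_coinduced_le.2 ?_
  have h4 := coinduced_mono (f := Kify.mk (X := X)) h1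
  rw [coinduced_compose] at h4
  exact h4

lemma Kify.continuous_iff [CompactlyGeneratedSpace Z] {f : Z → Kify X} :
    Continuous f ↔ Continuous (fun z => (f z).out) := by
  refine ⟨fun h => Kify.continuous_out.comp h, fun h => ?_⟩
  exact continuous_from_uCompactlyGeneratedSpace _ fun S g =>
    Kify.continuous_of_compHaus (h.comp g.continuous)

instance : CompactlyGeneratedSpace (Kify X) := by
  refine uCompactlyGeneratedSpace_of_continuous_maps fun {Y} _ f hf => ?_
  refine continuous_coinduced_dom.2 (continuous_from_compactlyGenerated _ fun S g => ?_)
  exact hf S ⟨fun x => Kify.mk (g x), Kify.continuous_of_compHaus g.continuous⟩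

lemma KProd.continuous_fst : Continuous (fun x : KProd X Y => x.out.1) :=
  _root_.continuous_fst.comp Kify.continuous_out

lemma KProd.continuous_snd : Continuous (fun x : KProd X Y => x.out.2) :=
  _root_.continuous_snd.comp Kify.continuous_out

lemma KProd.continuous_mk [CompactlyGeneratedSpace Z] {f : Z → X} {g : Z → Y}
    (hf : Continuous f) (hg : Continuous g) :
    Continuous (fun z => (⟨(f z, g z)⟩ : KProd X Y)) :=
  Kify.continuous_iff.2 (hf.prodMk hg)

lemma KPi.continuous_eval {ι : Type} {W : ι → Type u} [∀ i, TopologicalSpace (W i)] (i : ι) :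
    Continuous (fun x : KPi W => x.out i) :=
  (continuous_apply i).comp Kify.continuous_out

lemma KPi.continuous_mk {ι : Type} {W : ι → Type u} [∀ i, TopologicalSpace (W i)]
    [CompactlyGeneratedSpace Z] {f : ∀ i, Z → W i} (hf : ∀ i, Continuous (f i)) :
    Continuous (fun z => (⟨fun i => f i z⟩ : KPi W)) :=
  Kify.continuous_iff.2 (continuous_pi hf)

end Kify

/-! ### Bijections between the inputs of iterated compositions -/

namespace OperadEquiv

/-- The position of the `j`-th input of the `i`-th block. -/
def pos {m : ℕ} {n : Fin m → ℕ} (i : Fin m) (j : Fin (n i)) : Fin (∑ i, n i) :=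
  finSigmaFinEquiv ⟨i, j⟩

lemma exists_pos {m : ℕ} {n : Fin m → ℕ} (p : Fin (∑ i, n i)) :
    ∃ i, ∃ j : Fin (n i), pos i j = p := by
  obtain ⟨⟨i, j⟩, h⟩ := finSigmaFinEquiv.surjective p
  exact ⟨i, j, h⟩

/-- The bijection of inputs which permutes the blocks as prescribed by `σ`. -/
def block {m m' : ℕ} (σ : Fin m ≃ Fin m') (n : Fin m' → ℕ) :
    Fin (∑ i, n (σ i)) ≃ Fin (∑ i, n i) :=
  finSigmaFinEquiv.symm.trans
    ((Equiv.sigmaCongrLeft (β := fun i => Fin (n i)) σ).trans finSigmaFinEquiv)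

lemma block_pos {m m' : ℕ} (σ : Fin m ≃ Fin m') (n : Fin m' → ℕ) (i : Fin m)
    (j : Fin (n (σ i))) : block σ n (pos (n := fun i => n (σ i)) i j) = pos (σ i) j := by
  simp only [block, pos, Equiv.trans_apply, Equiv.symm_apply_apply]
  rfl

/-- The bijection of inputs which acts inside the blocks as prescribed by `τ`. -/
def blocks {m : ℕ} {n n' : Fin m → ℕ} (τ : ∀ i, Fin (n i) ≃ Fin (n' i)) :
    Fin (∑ i, n i) ≃ Fin (∑ i, n' i) :=
  finSigmaFinEquiv.symm.trans ((Equiv.sigmaCongrRight τ).trans finSigmaFinEquiv)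

lemma blocks_pos {m : ℕ} {n n' : Fin m → ℕ} (τ : ∀ i, Fin (n i) ≃ Fin (n' i)) (i : Fin m)
    (j : Fin (n i)) : blocks τ (pos i j) = pos i (τ i j) := by
  simp only [blocks, pos, Equiv.trans_apply, Equiv.symm_apply_apply]
  rfl

/-- The order preserving bijection identifying the inputs of the two ways of forming a twofold
composition. -/
def assoc {m : ℕ} (n : Fin m → ℕ) (l : Fin (∑ i, n i) → ℕ) :
    Fin (∑ p, l p) ≃ Fin (∑ i, ∑ j, l (pos i j)) :=
  finSigmaFinEquiv.symm.trans <|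
    (Equiv.sigmaCongrLeft (β := fun p => Fin (l p)) finSigmaFinEquiv).symm.trans <|
      (Equiv.sigmaAssoc (fun i j => Fin (l (pos i j)))).trans <|
        (Equiv.sigmaCongrRight fun _ => finSigmaFinEquiv).trans finSigmaFinEquiv

lemma assoc_pos {m : ℕ} (n : Fin m → ℕ) (l : Fin (∑ i, n i) → ℕ) (i : Fin m) (j : Fin (n i))
    (r : Fin (l (pos i j))) : assoc n l (pos (pos i j) r) = pos i (pos j r) := by
  have h : (Equiv.sigmaCongrLeft (β := fun p => Fin (l p)) finSigmaFinEquiv).symm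
      ⟨pos i j, r⟩ = ⟨⟨i, j⟩, r⟩ := by
    rw [Equiv.symm_apply_eq]; rfl
  change finSigmaFinEquiv (Equiv.sigmaCongrRight (fun _ => finSigmaFinEquiv)
    (Equiv.sigmaAssoc (fun i j => Fin (l (pos i j)))
      ((Equiv.sigmaCongrLeft (β := fun p => Fin (l p)) finSigmaFinEquiv).symm
        (finSigmaFinEquiv.symm (finSigmaFinEquiv ⟨pos i j, r⟩))))) = _
  rw [Equiv.symm_apply_apply, h]
  rfl

/-- The bijection of inputs of the unit law `γ(1; b) = b`. -/
def oneLeft (n : Fin 1 → ℕ) : Fin (∑ i, n i) ≃ Fin (n 0) :=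
  (finSigmaFinEquiv.symm.trans (Equiv.uniqueSigma (fun i : Fin 1 => Fin (n i))))

lemma oneLeft_pos (n : Fin 1 → ℕ) (j : Fin (n 0)) : oneLeft n (pos 0 j) = j := by
  simp only [oneLeft, pos, Equiv.trans_apply, Equiv.symm_apply_apply]
  rfl

/-- The bijection of inputs of the unit law `γ(a; 1, …, 1) = a`. -/
def oneRight (m : ℕ) : Fin (∑ _i : Fin m, 1) ≃ Fin m :=
  finSigmaFinEquiv.symm.trans (Equiv.sigmaUnique (Fin m) (fun _ => Fin 1))

lemma oneRight_pos {m : ℕ} (i : Fin m) (j : Fin 1) :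
    oneRight m (pos (n := fun _ => 1) i j) = i := by
  simp only [oneRight, pos, Equiv.trans_apply, Equiv.symm_apply_apply]
  rfl

end OperadEquiv

open OperadEquiv

/-- A (symmetric, unital) topological operad, in the category of compactly generated spaces. The
space `obj n` consists of the operations with `n` inputs, and `relabel e` renames the input `i` to
`e i`, so that the right action of a permutation `σ` is `relabel σ⁻¹`. The map `comp n` is
`γ : A(m) × A(n_1) × … × A(n_m) → A(n_1 + … + n_m)`. The last two axioms are the equivariance of
`γ`. -/
structure TopOperad where
  obj : ℕ → Type u
  [top : ∀ n, TopologicalSpace (obj n)]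
  [cg : ∀ n, CompactlyGeneratedSpace (obj n)]
  relabel : ∀ {m n : ℕ}, (Fin m ≃ Fin n) → obj m → obj n
  one : obj 1
  comp : ∀ {m : ℕ} (n : Fin m → ℕ), obj m → (∀ i, obj (n i)) → obj (∑ i, n i)
  continuous_relabel : ∀ {m n : ℕ} (e : Fin m ≃ Fin n), Continuous (relabel e)
  continuous_comp : ∀ {m : ℕ} (n : Fin m → ℕ),
    Continuous (fun x : KProd (obj m) (KPi fun i => obj (n i)) => comp n x.out.1 x.out.2.out)
  relabel_refl : ∀ {n : ℕ} (a : obj n), relabel (Equiv.refl _) a = a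
  relabel_trans : ∀ {l m n : ℕ} (e : Fin l ≃ Fin m) (f : Fin m ≃ Fin n) (a : obj l),
    relabel (e.trans f) a = relabel f (relabel e a)
  one_comp : ∀ (n : Fin 1 → ℕ) (b : ∀ i, obj (n i)), relabel (oneLeft n) (comp n one b) = b 0
  comp_one : ∀ {m : ℕ} (a : obj m), relabel (oneRight m) (comp (fun _ => 1) a fun _ => one) = a
  comp_assoc : ∀ {m : ℕ} (n : Fin m → ℕ) (l : Fin (∑ i, n i) → ℕ) (a : obj m)
    (b : ∀ i, obj (n i)) (c : ∀ p, obj (l p)),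
    relabel (assoc n l) (comp l (comp n a b) c) =
      comp (fun i => ∑ j, l (pos i j)) a
        (fun i => comp (fun j => l (pos i j)) (b i) (fun j => c (pos i j)))
  relabel_comp : ∀ {m m' : ℕ} (σ : Fin m ≃ Fin m') (n : Fin m' → ℕ) (a : obj m)
    (b : ∀ i, obj (n i)),
    comp n (relabel σ a) b = relabel (block σ n) (comp (fun i => n (σ i)) a fun i => b (σ i))
  comp_relabel : ∀ {m : ℕ} {n n' : Fin m → ℕ} (τ : ∀ i, Fin (n i) ≃ Fin (n' i)) (a : obj m)
    (b : ∀ i, obj (n i)),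
    comp n' a (fun i => relabel (τ i) (b i)) = relabel (blocks τ) (comp n a b)

attribute [instance] TopOperad.top TopOperad.cg

/-- A topological group in the category of compactly generated spaces. -/
structure TopGrp where
  carrier : Type u
  [group : Group carrier]
  [top : TopologicalSpace carrier]
  [cg : CompactlyGeneratedSpace carrier]
  continuous_mul : Continuous (fun x : KProd carrier carrier => x.out.1 * x.out.2)
  continuous_inv : Continuous (fun x : carrier => x⁻¹)

attribute [instance] TopGrp.group TopGrp.top TopGrp.cg

/-- A `G`-operad: a topological operad with continuous actions of `G` on the spaces `A(n)`, such
that all structure maps are equivariant. -/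
structure GOperad (G : TopGrp.{u}) extends TopOperad.{u} where
  [action : ∀ n, MulAction G.carrier (obj n)]
  continuous_smul : ∀ n, Continuous (fun x : KProd G.carrier (obj n) => x.out.1 • x.out.2)
  smul_relabel : ∀ {m n : ℕ} (e : Fin m ≃ Fin n) (g : G.carrier) (a : obj m),
    g • relabel e a = relabel e (g • a)
  smul_one : ∀ g : G.carrier, g • one = one
  smul_comp : ∀ {m : ℕ} (n : Fin m → ℕ) (g : G.carrier) (a : obj m) (b : ∀ i, obj (n i)),
    g • comp n a b = comp n (g • a) (fun i => g • b i)

attribute [instance] GOperad.action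

namespace GOperad

variable {G : TopGrp.{u}} (A : GOperad G)

/-- The space `A(n) × Gⁿ`. -/
abbrev SemiObj (n : ℕ) : Type u := KProd (A.obj n) (KPi fun _ : Fin n => G.carrier)

/-- `γ((a, g), (b_1, h^1), …, (b_m, h^m)) =
(γ(a, g_1 b_1, …, g_m b_m), g_1 h^1, …, g_m h^m)`. -/
def semiComp {m : ℕ} (n : Fin m → ℕ) (x : A.SemiObj m) (y : ∀ i, A.SemiObj (n i)) :
    A.SemiObj (∑ i, n i) :=
  ⟨(A.comp n x.out.1 (fun i => x.out.2.out i • (y i).out.1),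
    ⟨fun p => (fun s : (i : Fin m) × Fin (n i) => x.out.2.out s.1 * (y s.1).out.2.out s.2)
      (finSigmaFinEquiv.symm p)⟩)⟩

lemma semiComp_pos {m : ℕ} (n : Fin m → ℕ) (x : A.SemiObj m) (y : ∀ i, A.SemiObj (n i))
    (i : Fin m) (j : Fin (n i)) : (A.semiComp n x y).out.2.out (pos i j) =
      x.out.2.out i * (y i).out.2.out j := by
  change (fun s : (i : Fin m) × Fin (n i) => x.out.2.out s.1 * (y s.1).out.2.out s.2)
    (finSigmaFinEquiv.symm (finSigmaFinEquiv ⟨i, j⟩)) = _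
  rw [Equiv.symm_apply_apply]

/-- Renumbering of the inputs. -/
def semiRelabel {m n : ℕ} (e : Fin m ≃ Fin n) (x : A.SemiObj m) : A.SemiObj n :=
  ⟨(A.relabel e x.out.1, ⟨fun i => x.out.2.out (e.symm i)⟩)⟩

lemma semiRelabel_snd {m n : ℕ} (e : Fin m ≃ Fin n) (x : A.SemiObj m) (i : Fin m) :
    (A.semiRelabel e x).out.2.out (e i) = x.out.2.out i := by
  simp [semiRelabel]

lemma semi_ext {n : ℕ} {x y : A.SemiObj n} (h : x.out.1 = y.out.1)
    (h' : ∀ i, x.out.2.out i = y.out.2.out i) : x = y :=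
  Kify.ext (Prod.ext h (Kify.ext (funext h')))

/-- The semidirect product `A ⋊ G`. -/
def semidirect : TopOperad.{u} where
  obj := A.SemiObj
  relabel e x := A.semiRelabel e x
  one := ⟨(A.one, ⟨fun _ => 1⟩)⟩
  comp n x y := A.semiComp n x y
  continuous_relabel e := KProd.continuous_mk
    ((A.continuous_relabel e).comp KProd.continuous_fst)
    (KPi.continuous_mk fun i => (KPi.continuous_eval _).comp KProd.continuous_snd)
  continuous_comp n := by
    refine KProd.continuous_mk ?_ (KPi.continuous_mk fun p => ?_)
    · refine (A.continuous_comp n).comp (KProd.continuous_mk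
        (KProd.continuous_fst.comp KProd.continuous_fst) (KPi.continuous_mk fun i => ?_))
      exact (A.continuous_smul _).comp (KProd.continuous_mk
        ((KPi.continuous_eval i).comp (KProd.continuous_snd.comp KProd.continuous_fst))
        (KProd.continuous_fst.comp ((KPi.continuous_eval i).comp KProd.continuous_snd)))
    · exact G.continuous_mul.comp (KProd.continuous_mk
        ((KPi.continuous_eval _).comp (KProd.continuous_snd.comp KProd.continuous_fst))
        ((KPi.continuous_eval _).comp (KProd.continuous_snd.comp
          ((KPi.continuous_eval _).comp KProd.continuous_snd))))
  relabel_refl a := A.semi_ext (A.relabel_refl _) fun _ => rfl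
  relabel_trans e f a := A.semi_ext (A.relabel_trans _ _ _) fun _ => rfl
  one_comp n b := by
    refine A.semi_ext ?_ fun i => ?_
    · simp only [semiComp, semiRelabel, one_smul]
      exact A.one_comp n fun i => (b i).out.1
    · have h := A.semiRelabel_snd (oneLeft n)
        (A.semiComp n ⟨(A.one, ⟨fun _ => 1⟩)⟩ b) (pos 0 i)
      rw [oneLeft_pos, semiComp_pos] at h
      simpa using h
  comp_one {m} a := by
    refine A.semi_ext ?_ fun i => ?_
    · simp only [semiComp, semiRelabel, A.smul_one]
      exact A.comp_one a.out.1
    · have h := A.semiRelabel_snd (oneRight m)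
        (A.semiComp (fun _ => 1) a fun _ => ⟨(A.one, ⟨fun _ => 1⟩)⟩) (pos (n := fun _ => 1) i 0)
      rw [oneRight_pos, semiComp_pos] at h
      simpa using h
  comp_assoc n l a b c := by
    refine A.semi_ext ?_ fun p => ?_
    · change A.relabel _ (A.comp _ (A.comp _ _ _) _) = A.comp _ _ _
      rw [A.comp_assoc]
      congr 1
      funext i
      change _ = _ • A.comp _ _ _
      rw [A.smul_comp]
      congr 1
      funext j
      rw [smul_smul, ← semiComp_pos]
    · obtain ⟨i, q, rfl⟩ := exists_pos p
      obtain ⟨j, r, rfl⟩ := exists_pos q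
      rw [← assoc_pos, semiRelabel_snd, semiComp_pos, semiComp_pos, assoc_pos, semiComp_pos,
        semiComp_pos, mul_assoc]
  relabel_comp σ n a b := by
    refine A.semi_ext ?_ fun p => ?_
    · refine (A.relabel_comp σ n _ _).trans ?_
      simp only [semiRelabel, Equiv.symm_apply_apply]
      rfl
    · obtain ⟨i, j, rfl⟩ := exists_pos p
      obtain ⟨i, rfl⟩ := σ.surjective i
      rw [semiComp_pos, ← block_pos, semiRelabel_snd, semiRelabel_snd, semiComp_pos]
  comp_relabel τ a b := by
    refine A.semi_ext ?_ fun p => ?_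
    · refine Eq.trans ?_ (A.comp_relabel τ _ _)
      simp only [semiComp, semiRelabel, A.smul_relabel]
    · obtain ⟨i, j, rfl⟩ := exists_pos p
      obtain ⟨j, rfl⟩ := (τ i).surjective j
      rw [semiComp_pos, ← blocks_pos, semiRelabel_snd, semiRelabel_snd, semiComp_pos]

end GOperad

end TopologicalOperads

section GradedAlgebra

open scoped TensorProduct DirectSum
open OperadEquiv

variable (k : Type u) [Field k]

/-- A graded vector space, concentrated in nonnegative degrees. -/
structure GrMod where
  carrier : Type u
  [addCommGroup : AddCommGroup carrier]
  [module : Module k carrier]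
  deg : ℕ → Submodule k carrier
  internal : DirectSum.IsInternal deg

attribute [instance] GrMod.addCommGroup GrMod.module

instance : CoeSort (GrMod.{u} k) (Type u) := ⟨GrMod.carrier⟩

variable {k}

namespace GrMod

/-- Submodules which admit a family of projections and span everything form a grading. -/
lemma isInternal_of_proj {M : Type u} [AddCommGroup M] [Module k M] {S : ℕ → Submodule k M}
    (p : ℕ → M →ₗ[k] M) (h1 : ∀ d, ∀ x ∈ S d, p d x = x)
    (h2 : ∀ d e, d ≠ e → ∀ x ∈ S e, p d x = 0) (h3 : ⨆ d, S d = ⊤) :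
    DirectSum.IsInternal S := by
  rw [DirectSum.isInternal_submodule_iff_iSupIndep_and_iSup_eq_top]
  refine ⟨fun d => ?_, h3⟩
  rw [Submodule.disjoint_def]
  intro x hx hx'
  have h4 : ⨆ (e) (_ : e ≠ d), S e ≤ LinearMap.ker (p d) :=
    iSup₂_le fun e he y hy => h2 d e he.symm y hy
  rw [← h1 d x hx]
  exact h4 hx'

/-- A graded vector space is the direct sum of its homogeneous components. -/
noncomputable def decomp (V : GrMod.{u} k) : (⨁ n, V.deg n) ≃ₗ[k] V :=
  LinearEquiv.ofBijective (DirectSum.coeLinearMap V.deg) V.internal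

open Classical in
/-- The projection of a graded vector space to the sum of its components with degree in `s`. -/
noncomputable def select (V : GrMod.{u} k) (s : Set ℕ) : V →ₗ[k] V :=
  DirectSum.toModule k ℕ V (fun n => if n ∈ s then (V.deg n).subtype else 0) ∘ₗ
    V.decomp.symm.toLinearMap

open Classical in
lemma select_apply (V : GrMod.{u} k) (s : Set ℕ) {n : ℕ} {x : V} (hx : x ∈ V.deg n) :
    V.select s x = if n ∈ s then x else 0 := by
  have h : V.decomp.symm x = DirectSum.lof k ℕ (fun n => V.deg n) n ⟨x, hx⟩ := by
    rw [LinearEquiv.symm_apply_eq]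
    exact (DirectSum.coeLinearMap_lof V.deg n ⟨x, hx⟩).symm
  simp only [select, LinearMap.comp_apply, LinearEquiv.coe_coe, h, DirectSum.toModule_lof]
  split_ifs <;> rfl

lemma span_homogeneous (V : GrMod.{u} k) :
    Submodule.span k (Set.range (fun x : {x : V // ∃ n, x ∈ V.deg n} => (x : V))) = ⊤ := by
  rw [eq_top_iff, ← V.internal.submodule_iSup_eq_top]
  exact iSup_le fun n x hx => Submodule.subset_span ⟨⟨x, n, hx⟩, rfl⟩

/-- The component of even or odd degree. -/
noncomputable def par (V : GrMod.{u} k) (e : ZMod 2) : V →ₗ[k] V :=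
  V.select {n | (n : ZMod 2) = e}

/-- The tensor product of two graded vector spaces. -/
noncomputable def tensor (V W : GrMod.{u} k) : GrMod.{u} k where
  carrier := V ⊗[k] W
  deg d := Submodule.span k
    {t | ∃ p q, p + q = d ∧ ∃ v ∈ V.deg p, ∃ w ∈ W.deg q, t = v ⊗ₜ[k] w}
  internal := by
    classical
    let π : ℕ → (V ⊗[k] W) →ₗ[k] (V ⊗[k] W) := fun d =>
      ∑ x ∈ Finset.HasAntidiagonal.antidiagonal d,
        TensorProduct.map (V.select {x.1}) (W.select {x.2})
    refine isInternal_of_proj π ?_ ?_ ?_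
    · intro d
      change Submodule.span k _ ≤ LinearMap.eqLocus (π d) LinearMap.id
      rw [Submodule.span_le]
      rintro _ ⟨p, q, h, v, hv, w, hw, rfl⟩
      change π d (v ⊗ₜ[k] w) = v ⊗ₜ[k] w
      simp only [π, LinearMap.sum_apply]
      rw [Finset.sum_eq_single (p, q)]
      · simp [select_apply _ _ hv, select_apply _ _ hw]
      · rintro ⟨p', q'⟩ _ hne
        rw [TensorProduct.map_tmul, select_apply _ _ hv, select_apply _ _ hw]
        by_cases hp : p = p'
        · have hq : q ≠ q' := fun hq => hne (by rw [hp, hq])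
          simp [hq]
        · simp [hp]
      · intro hn
        exact absurd (Finset.HasAntidiagonal.mem_antidiagonal.2 h) hn
    · intro d e hde
      change Submodule.span k _ ≤ LinearMap.ker (π d)
      rw [Submodule.span_le]
      rintro _ ⟨p, q, h, v, hv, w, hw, rfl⟩
      change π d (v ⊗ₜ[k] w) = 0
      simp only [π, LinearMap.sum_apply]
      refine Finset.sum_eq_zero ?_
      rintro ⟨p', q'⟩ hx
      have hx := Finset.HasAntidiagonal.mem_antidiagonal.1 hx
      rw [TensorProduct.map_tmul, select_apply _ _ hv, select_apply _ _ hw]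
      by_cases hp : p = p'
      · have hq : q ≠ q' := fun hq => hde (by simp only at hx; omega)
        simp [hq]
      · simp [hp]
    · rw [eq_top_iff, ← TensorProduct.span_tmul_eq_top, Submodule.span_le]
      rintro _ ⟨v, w, rfl⟩
      have hv : v ∈ ⨆ n, V.deg n := by rw [V.internal.submodule_iSup_eq_top]; trivial
      have hw : w ∈ ⨆ n, W.deg n := by rw [W.internal.submodule_iSup_eq_top]; trivial
      refine Submodule.iSup_induction V.deg (motive := fun v => v ⊗ₜ[k] w ∈ _) hv ?_ ?_ ?_
      · intro p v hv
        refine Submodule.iSup_induction W.deg (motive := fun w => v ⊗ₜ[k] w ∈ _) hw ?_ ?_ ?_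
        · intro q w hw
          exact Submodule.mem_iSup_of_mem (p + q)
            (Submodule.subset_span ⟨p, q, rfl, v, hv, w, hw, rfl⟩)
        · rw [TensorProduct.tmul_zero]; exact Submodule.zero_mem _
        · intro w w' h h'
          rw [TensorProduct.tmul_add]; exact Submodule.add_mem _ h h'
      · rw [TensorProduct.zero_tmul]; exact Submodule.zero_mem _
      · intro v v' h h'
        rw [TensorProduct.add_tmul]; exact Submodule.add_mem _ h h'

/-- The tensor product of a finite family of graded vector spaces. -/
noncomputable def tensorPi {m : ℕ} (V : Fin m → GrMod.{u} k) : GrMod.{u} k where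
  carrier := ⨂[k] i, V i
  deg d := Submodule.span k {t | ∃ p : Fin m → ℕ, ∑ i, p i = d ∧
    ∃ v : ∀ i, V i, (∀ i, v i ∈ (V i).deg (p i)) ∧ t = PiTensorProduct.tprod k v}
  internal := by
    classical
    have key : ∀ (p p' : Fin m → ℕ) (v : ∀ i, V i) (_ : ∀ i, v i ∈ (V i).deg (p i)),
        PiTensorProduct.map (fun i => (V i).select {p' i}) (PiTensorProduct.tprod k v) =
          if p = p' then PiTensorProduct.tprod k v else 0 := by
      intro p p' v hv
      rw [PiTensorProduct.map_tprod]
      split_ifs with h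
      · subst h
        congr 1
        funext i
        rw [select_apply _ _ (hv i)]
        simp
      · obtain ⟨i, hi⟩ := Function.ne_iff.1 h
        refine MultilinearMap.map_coord_zero _ i ?_
        rw [select_apply _ _ (hv i)]
        simp [hi]
    let π : ℕ → (⨂[k] i, V i) →ₗ[k] ⨂[k] i, V i := fun d =>
      ∑ p' ∈ Finset.piAntidiag Finset.univ d,
        PiTensorProduct.map (fun i => (V i).select {p' i})
    refine isInternal_of_proj π ?_ ?_ ?_
    · intro d
      change Submodule.span k _ ≤ LinearMap.eqLocus (π d) LinearMap.id
      rw [Submodule.span_le]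
      rintro _ ⟨p, h, v, hv, rfl⟩
      change π d (PiTensorProduct.tprod k v) =
        PiTensorProduct.tprod k v
      simp only [π, LinearMap.sum_apply]
      simp only [key p _ v hv]
      rw [Finset.sum_ite_eq, if_pos]
      simpa using h
    · intro d e hde
      change Submodule.span k _ ≤ LinearMap.ker (π d)
      rw [Submodule.span_le]
      rintro _ ⟨p, h, v, hv, rfl⟩
      change π d (PiTensorProduct.tprod k v) = 0
      simp only [π, LinearMap.sum_apply]
      simp only [key p _ v hv]
      rw [Finset.sum_ite_eq, if_neg]
      exact fun hm => hde ((Finset.mem_piAntidiag.1 hm).1.symm.trans h)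
    · rw [eq_top_iff, ← PiTensorProduct.submodule_span_eq_top (R := k)
        (g := fun i (x : {x : V i // ∃ n, x ∈ (V i).deg n}) => (x : V i))
        (fun i => (V i).span_homogeneous), Submodule.span_le]
      rintro _ ⟨x, rfl⟩
      choose p hp using fun i => (x i).2
      exact Submodule.mem_iSup_of_mem (∑ i, p i)
        (Submodule.subset_span ⟨p, rfl, _, hp, rfl⟩)

/-! ### Koszul signs -/

/-- The sign of the permutation `v_1, …, v_m, w_1, …, w_m ↦ v_1, w_1, …, v_m, w_m` for elements
`v_i` and `w_i` of parities `δ i` and `η i`. -/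
def shuffleSign {m : ℕ} (δ η : Fin m → ZMod 2) : ℤ :=
  ∏ i, ∏ j ∈ Finset.Ioi i, (-1) ^ (δ j * η i).val

/-- The sign of the permutation of `m` elements of parities `δ i` which moves the `i`-th element
to the position `e i`. -/
def koszulSign {m n : ℕ} (e : Fin m ≃ Fin n) (δ : Fin m → ZMod 2) : ℤ :=
  ∏ i, ∏ j ∈ Finset.Ioi i, if e j < e i then (-1) ^ (δ i * δ j).val else 1

/-- `(a ⊗ b) (v ⊗ w) = (-1) ^ (|b| |v|) • a v ⊗ b w`. -/
noncomputable def signedMap₂ {A B V W : GrMod.{u} k} {X Y : Type u} [AddCommGroup X] [Module k X]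
    [AddCommGroup Y] [Module k Y] (f : A →ₗ[k] V →ₗ[k] X) (g : B →ₗ[k] W →ₗ[k] Y) :
    A ⊗[k] B →ₗ[k] V ⊗[k] W →ₗ[k] X ⊗[k] Y :=
  ∑ δ : ZMod 2, ∑ η : ZMod 2, ((-1 : ℤ) ^ (δ * η).val) •
    (TensorProduct.map₂ f g).compl₁₂ (TensorProduct.map LinearMap.id (B.par δ))
      (TensorProduct.map (V.par η) LinearMap.id)

/-- `v ⊗ w ↦ (-1) ^ (|v| |w|) • w ⊗ v`. -/
noncomputable def signedSwap (V W : GrMod.{u} k) : V ⊗[k] W →ₗ[k] W ⊗[k] V :=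
  ∑ δ : ZMod 2, ∑ η : ZMod 2, ((-1 : ℤ) ^ (δ * η).val) •
    ((TensorProduct.comm k V W).toLinearMap ∘ₗ TensorProduct.map (V.par δ) (W.par η))

/-- `(v_1 ⊗ … ⊗ v_m) (w_1 ⊗ … ⊗ w_m) = ± v_1 w_1 ⊗ … ⊗ v_m w_m`. -/
noncomputable def signedMapPi {m : ℕ} {V W : Fin m → GrMod.{u} k} {X : Fin m → Type u}
    [∀ i, AddCommGroup (X i)] [∀ i, Module k (X i)] (f : ∀ i, V i →ₗ[k] W i →ₗ[k] X i) :
    (⨂[k] i, V i) →ₗ[k] (⨂[k] i, W i) →ₗ[k] ⨂[k] i, X i :=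
  ∑ δ : Fin m → ZMod 2, ∑ η : Fin m → ZMod 2, shuffleSign δ η •
    (PiTensorProduct.map₂ f).compl₁₂ (PiTensorProduct.map fun i => (V i).par (δ i))
      (PiTensorProduct.map fun i => (W i).par (η i))

/-- `v ↦ (v_1 ⊗ … ⊗ v_m ↦ v ⊗ v_1 ⊗ … ⊗ v_m)`. -/
noncomputable def cons {m : ℕ} (V : Fin (m + 1) → Type u) [∀ i, AddCommGroup (V i)]
    [∀ i, Module k (V i)] :
    V 0 →ₗ[k] (⨂[k] i : Fin m, V i.succ) →ₗ[k] ⨂[k] i, V i :=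
  PiTensorProduct.lift.toLinearMap ∘ₗ (PiTensorProduct.tprod k).curryLeft

lemma cons_tprod {m : ℕ} (V : Fin (m + 1) → Type u) [∀ i, AddCommGroup (V i)]
    [∀ i, Module k (V i)] (x : V 0) (v : ∀ i : Fin m, V i.succ) :
    cons V x (PiTensorProduct.tprod k v) = PiTensorProduct.tprod k (Fin.cons x v) := by
  simp [cons]

/-- `v_1 ⊗ w_1, …, v_m ⊗ w_m ↦ (v_1 ⊗ … ⊗ v_m) ⊗ (w_1 ⊗ … ⊗ w_m)`, without signs. -/
noncomputable def split : ∀ {m : ℕ} (V W : Fin m → Type u) [∀ i, AddCommGroup (V i)]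
    [∀ i, Module k (V i)] [∀ i, AddCommGroup (W i)] [∀ i, Module k (W i)],
    MultilinearMap k (fun i => V i ⊗[k] W i) ((⨂[k] i, V i) ⊗[k] (⨂[k] i, W i))
  | 0, _, _, _, _, _, _ => MultilinearMap.constOfIsEmpty k _
      (PiTensorProduct.tprod k isEmptyElim ⊗ₜ[k] PiTensorProduct.tprod k isEmptyElim)
  | _ + 1, V, W, _, _, _, _ => LinearMap.uncurryLeft
      (PiTensorProduct.lift.symm.toLinearMap ∘ₗ
        (TensorProduct.map₂ (cons V) (cons W)).compl₂
          (PiTensorProduct.lift (split (fun i => V i.succ) (fun i => W i.succ))))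

lemma split_tmul {m : ℕ} (V W : Fin m → Type u) [∀ i, AddCommGroup (V i)]
    [∀ i, Module k (V i)] [∀ i, AddCommGroup (W i)] [∀ i, Module k (W i)]
    (v : ∀ i, V i) (w : ∀ i, W i) : split V W (fun i => v i ⊗ₜ[k] w i) =
      PiTensorProduct.tprod k v ⊗ₜ[k] PiTensorProduct.tprod k w := by
  induction m with
  | zero =>
    change PiTensorProduct.tprod k isEmptyElim ⊗ₜ[k] PiTensorProduct.tprod k isEmptyElim = _
    congr 2 <;> exact funext fun i => i.elim0
  | succ m ih =>
    have h := ih (fun i => V i.succ) (fun i => W i.succ) (fun i => v i.succ) (fun i => w i.succ)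
    change TensorProduct.map₂ (cons V) (cons W) (v 0 ⊗ₜ[k] w 0) (PiTensorProduct.lift
      (split (fun i => V i.succ) (fun i => W i.succ)) (PiTensorProduct.tprod k
        (fun i : Fin m => v i.succ ⊗ₜ[k] w i.succ))) = _
    rw [PiTensorProduct.lift.tprod, h, TensorProduct.map₂_apply_tmul, TensorProduct.map_tmul,
      cons_tprod, cons_tprod]
    congr 2 <;> exact Fin.cons_self_tail _

/-- `v_1 ⊗ w_1, …, v_m ⊗ w_m ↦ ± (v_1 ⊗ … ⊗ v_m) ⊗ (w_1 ⊗ … ⊗ w_m)`. -/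
noncomputable def signedSplit {m : ℕ} (V W : Fin m → GrMod.{u} k) :
    (⨂[k] i, V i ⊗[k] W i) →ₗ[k] (⨂[k] i, V i) ⊗[k] (⨂[k] i, W i) :=
  ∑ δ : Fin m → ZMod 2, ∑ η : Fin m → ZMod 2, shuffleSign δ η •
    (TensorProduct.map (PiTensorProduct.map fun i => (V i).par (δ i))
      (PiTensorProduct.map fun i => (W i).par (η i)) ∘ₗ PiTensorProduct.lift (split _ _))

/-- The permutation of tensor factors, with Koszul signs. -/
noncomputable def signedPerm (V : GrMod.{u} k) {m n : ℕ} (e : Fin m ≃ Fin n) :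
    (⨂[k] _i : Fin m, V) →ₗ[k] ⨂[k] _i : Fin n, V :=
  ∑ δ : Fin m → ZMod 2, koszulSign e δ •
    ((PiTensorProduct.reindex k (fun _ => V.carrier) e).toLinearMap ∘ₗ
      PiTensorProduct.map fun i => V.par (δ i))

/-- The positions in a nonempty sequence of blocks. -/
def sigmaSucc {m : ℕ} (n : Fin (m + 1) → ℕ) :
    Fin (n 0) ⊕ ((i : Fin m) × Fin (n i.succ)) ≃ (i : Fin (m + 1)) × Fin (n i) where
  toFun := Sum.elim (fun j => ⟨0, j⟩) (fun s => ⟨s.1.succ, s.2⟩)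
  invFun s := Fin.cases (motive := fun i => Fin (n i) →
    Fin (n 0) ⊕ ((i : Fin m) × Fin (n i.succ))) Sum.inl (fun i j => Sum.inr ⟨i, j⟩) s.1 s.2
  left_inv := by rintro (j | ⟨i, j⟩) <;> rfl
  right_inv := by
    rintro ⟨i, j⟩
    induction i using Fin.cases <;> rfl

/-- The multilinear map `⨂_j h_{1j}, …, ⨂_j h_{mj} ↦ ⨂_{(i,j)} h_{ij}`. -/
noncomputable def flatten (V : Type u) [AddCommGroup V] [Module k V] : ∀ {m : ℕ} (n : Fin m → ℕ),
    MultilinearMap k (fun i => ⨂[k] _j : Fin (n i), V) (⨂[k] _s : (i : Fin m) × Fin (n i), V)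
  | 0, _ => MultilinearMap.constOfIsEmpty k _ (PiTensorProduct.tprod k isEmptyElim)
  | _ + 1, n => LinearMap.uncurryLeft
      (PiTensorProduct.lift.symm.toLinearMap ∘ₗ
        (((TensorProduct.mk k _ _).compr₂ (PiTensorProduct.tmulEquiv k V).toLinearMap).compr₂
          (PiTensorProduct.reindex k (fun _ => V) (sigmaSucc n)).toLinearMap).compl₂
            (PiTensorProduct.lift (flatten V (fun i => n i.succ))))

lemma flatten_tprod (V : Type u) [AddCommGroup V] [Module k V] {m : ℕ} (n : Fin m → ℕ)
    (h : ∀ i, Fin (n i) → V) : flatten V n (fun i => PiTensorProduct.tprod k (h i)) =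
      PiTensorProduct.tprod k (fun s : (i : Fin m) × Fin (n i) => h s.1 s.2) := by
  induction m with
  | zero => exact congrArg (PiTensorProduct.tprod k) (funext fun s => s.1.elim0)
  | succ m ih =>
    change PiTensorProduct.reindex k (fun _ => V) (sigmaSucc n) (PiTensorProduct.tmulEquiv k V
      (PiTensorProduct.tprod k (h 0) ⊗ₜ[k] PiTensorProduct.lift (flatten V fun i => n i.succ)
        (PiTensorProduct.tprod k (fun i : Fin m => PiTensorProduct.tprod k (h i.succ))))) = _
    rw [PiTensorProduct.lift.tprod, ih, PiTensorProduct.tmulEquiv_apply,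
      PiTensorProduct.reindex_tprod]
    congr 1
    funext s
    obtain ⟨s, rfl⟩ := (sigmaSucc n).surjective s
    rw [Equiv.symm_apply_apply]
    rcases s with j | s <;> rfl

/-- Concatenation of tensors. -/
noncomputable def concat (V : Type u) [AddCommGroup V] [Module k V] {m : ℕ} (n : Fin m → ℕ) :
    (⨂[k] i, ⨂[k] _j : Fin (n i), V) →ₗ[k] ⨂[k] _p : Fin (∑ i, n i), V :=
  (PiTensorProduct.reindex k (fun _ => V) finSigmaFinEquiv).toLinearMap ∘ₗ
    PiTensorProduct.lift (flatten V n)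

end GrMod

end GradedAlgebra

section GradedOperads

open scoped TensorProduct DirectSum
open OperadEquiv GrMod

variable (k : Type u) [Field k]

/-- The structure maps of a graded Hopf algebra. -/
structure GrHopf extends GrMod.{u} k where
  mul : carrier →ₗ[k] carrier →ₗ[k] carrier
  one : carrier
  comul : carrier →ₗ[k] carrier ⊗[k] carrier
  counit : carrier →ₗ[k] k
  antipode : carrier →ₗ[k] carrier

/-- The structure maps of an operad of graded vector spaces. -/
structure GrOperad where
  obj : ℕ → GrMod.{u} k
  relabel : ∀ {m n : ℕ}, (Fin m ≃ Fin n) → obj m →ₗ[k] obj n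
  one : obj 1
  comp : ∀ {m : ℕ} (n : Fin m → ℕ),
    obj m →ₗ[k] MultilinearMap k (fun i => (obj (n i)).carrier) (obj (∑ i, n i)).carrier

variable {k}

/-- The axioms of a graded cocommutative Hopf algebra. -/
structure GrHopf.IsCocommHopf (H : GrHopf.{u} k) : Prop where
  mul_mem : ∀ {p q : ℕ} {x y : H.carrier}, x ∈ H.deg p → y ∈ H.deg q → H.mul x y ∈ H.deg (p + q)
  one_mem : H.one ∈ H.deg 0
  comul_mem : ∀ {p : ℕ} {x : H.carrier}, x ∈ H.deg p →
    H.comul x ∈ (H.toGrMod.tensor H.toGrMod).deg p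
  counit_eq_zero : ∀ {p : ℕ} {x : H.carrier}, x ∈ H.deg p → p ≠ 0 → H.counit x = 0
  antipode_mem : ∀ {p : ℕ} {x : H.carrier}, x ∈ H.deg p → H.antipode x ∈ H.deg p
  mul_assoc : ∀ x y z, H.mul (H.mul x y) z = H.mul x (H.mul y z)
  one_mul : ∀ x, H.mul H.one x = x
  mul_one : ∀ x, H.mul x H.one = x
  comul_assoc : ∀ x, TensorProduct.assoc k _ _ _
      (TensorProduct.map H.comul LinearMap.id (H.comul x)) =
    TensorProduct.map LinearMap.id H.comul (H.comul x)
  counit_comul : ∀ x, TensorProduct.map H.counit LinearMap.id (H.comul x) = (1 : k) ⊗ₜ[k] x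
  comul_counit : ∀ x, TensorProduct.map LinearMap.id H.counit (H.comul x) = x ⊗ₜ[k] (1 : k)
  comul_comm : ∀ x, signedSwap H.toGrMod H.toGrMod (H.comul x) = H.comul x
  comul_mul : ∀ x y, H.comul (H.mul x y) =
    signedMap₂ (A := H.toGrMod) (B := H.toGrMod) (V := H.toGrMod) (W := H.toGrMod)
      H.mul H.mul (H.comul x) (H.comul y)
  comul_one : H.comul H.one = H.one ⊗ₜ[k] H.one
  counit_mul : ∀ x y, H.counit (H.mul x y) = H.counit x * H.counit y
  counit_one : H.counit H.one = 1
  antipode_mul : ∀ x, TensorProduct.lift (H.mul ∘ₗ H.antipode) (H.comul x) = H.counit x • H.one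
  mul_antipode : ∀ x, TensorProduct.lift (H.mul.compl₂ H.antipode) (H.comul x) =
    H.counit x • H.one

/-- The axioms of a (symmetric, unital) operad of graded vector spaces. The signs are those of the
permutations of homogeneous elements. -/
structure GrOperad.IsOperad (P : GrOperad.{u} k) : Prop where
  relabel_mem : ∀ {m n : ℕ} (e : Fin m ≃ Fin n) {d : ℕ} {a : P.obj m},
    a ∈ (P.obj m).deg d → P.relabel e a ∈ (P.obj n).deg d
  one_mem : P.one ∈ (P.obj 1).deg 0
  comp_mem : ∀ {m : ℕ} (n : Fin m → ℕ) {d : ℕ} (β : Fin m → ℕ) {a : P.obj m}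
    {b : ∀ i, P.obj (n i)}, a ∈ (P.obj m).deg d → (∀ i, b i ∈ (P.obj (n i)).deg (β i)) →
      P.comp n a b ∈ (P.obj (∑ i, n i)).deg (d + ∑ i, β i)
  relabel_refl : ∀ {n : ℕ} (a : P.obj n), P.relabel (Equiv.refl _) a = a
  relabel_trans : ∀ {l m n : ℕ} (e : Fin l ≃ Fin m) (f : Fin m ≃ Fin n) (a : P.obj l),
    P.relabel (e.trans f) a = P.relabel f (P.relabel e a)
  one_comp : ∀ (n : Fin 1 → ℕ) (b : ∀ i, P.obj (n i)),
    P.relabel (oneLeft n) (P.comp n P.one b) = b 0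
  comp_one : ∀ {m : ℕ} (a : P.obj m),
    P.relabel (oneRight m) (P.comp (fun _ => 1) a fun _ => P.one) = a
  comp_assoc : ∀ {m : ℕ} (n : Fin m → ℕ) (l : Fin (∑ i, n i) → ℕ) (β : Fin m → ℕ)
    (ζ : Fin (∑ i, n i) → ℕ) (a : P.obj m) (b : ∀ i, P.obj (n i)) (c : ∀ p, P.obj (l p)),
    (∀ i, b i ∈ (P.obj (n i)).deg (β i)) → (∀ p, c p ∈ (P.obj (l p)).deg (ζ p)) →
    P.relabel (assoc n l) (P.comp l (P.comp n a b) c) =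
      (∏ i, ∏ i' ∈ Finset.Ioi i, (-1 : ℤ) ^ (β i' * ∑ j, ζ (pos i j))) •
        P.comp (fun i => ∑ j, l (pos i j)) a
          (fun i => P.comp (fun j => l (pos i j)) (b i) (fun j => c (pos i j)))
  relabel_comp : ∀ {m m' : ℕ} (σ : Fin m ≃ Fin m') (n : Fin m' → ℕ) (β : Fin m' → ℕ)
    (a : P.obj m) (b : ∀ i, P.obj (n i)), (∀ i, b i ∈ (P.obj (n i)).deg (β i)) →
    P.comp n (P.relabel σ a) b = koszulSign σ (fun i => (β (σ i) : ZMod 2)) •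
      P.relabel (block σ n) (P.comp (fun i => n (σ i)) a fun i => b (σ i))
  comp_relabel : ∀ {m : ℕ} {n n' : Fin m → ℕ} (τ : ∀ i, Fin (n i) ≃ Fin (n' i)) (a : P.obj m)
    (b : ∀ i, P.obj (n i)),
    P.comp n' a (fun i => P.relabel (τ i) (b i)) = P.relabel (blocks τ) (P.comp n a b)

/-- An isomorphism of operads of graded vector spaces. -/
structure GrOperad.Iso (P Q : GrOperad.{u} k) where
  equiv : ∀ n, P.obj n ≃ₗ[k] Q.obj n
  equiv_mem : ∀ {n d : ℕ} {a : P.obj n}, a ∈ (P.obj n).deg d → equiv n a ∈ (Q.obj n).deg d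
  equiv_relabel : ∀ {m n : ℕ} (e : Fin m ≃ Fin n) (a : P.obj m),
    equiv n (P.relabel e a) = Q.relabel e (equiv m a)
  equiv_one : equiv 1 P.one = Q.one
  equiv_comp : ∀ {m : ℕ} (n : Fin m → ℕ) (a : P.obj m) (b : ∀ i, P.obj (n i)),
    equiv _ (P.comp n a b) = Q.comp n (equiv m a) (fun i => equiv (n i) (b i))

namespace GrHopf

variable (H : GrHopf.{u} k)

/-- The iterated comultiplication `H → H^{⊗n}`. -/
noncomputable def iterComul : ∀ n : ℕ, H.carrier →ₗ[k] ⨂[k] _i : Fin n, H.carrier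
  | 0 => LinearMap.toSpanSingleton k _ (PiTensorProduct.tprod k isEmptyElim) ∘ₗ H.counit
  | n + 1 => TensorProduct.lift (cons fun _ : Fin (n + 1) => H.carrier) ∘ₗ
      TensorProduct.map LinearMap.id (iterComul n) ∘ₗ H.comul

/-- The diagonal action of `H` on `V ⊗ W_1 ⊗ … ⊗ W_n`. -/
noncomputable def diag {V : GrMod.{u} k} {n : ℕ} {W : Fin n → GrMod.{u} k}
    (α : H.carrier →ₗ[k] V →ₗ[k] V) (β : ∀ i, H.carrier →ₗ[k] W i →ₗ[k] W i) :
    H.carrier →ₗ[k] V ⊗[k] (⨂[k] i, W i) →ₗ[k] V ⊗[k] (⨂[k] i, W i) :=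
  signedMap₂ (A := H.toGrMod) (B := H.toGrMod) (W := tensorPi W) α
    (signedMapPi (V := fun _ => H.toGrMod) β ∘ₗ H.iterComul n) ∘ₗ H.comul

end GrHopf

/-- The structure maps of an operad of graded modules over a Hopf algebra. -/
structure GrHOperad (H : GrHopf.{u} k) extends GrOperad.{u} k where
  act : ∀ n, H.carrier →ₗ[k] obj n →ₗ[k] obj n

namespace GrHOperad

variable {H : GrHopf.{u} k} (P : GrHOperad H)

/-- The axioms of an operad of graded modules over a Hopf algebra. -/
structure IsHOperad : Prop where
  isOperad : P.IsOperad
  act_mem : ∀ {n p q : ℕ} {g : H.carrier} {a : P.obj n}, g ∈ H.deg p → a ∈ (P.obj n).deg q →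
    P.act n g a ∈ (P.obj n).deg (p + q)
  one_act : ∀ {n : ℕ} (a : P.obj n), P.act n H.one a = a
  mul_act : ∀ {n : ℕ} (g h : H.carrier) (a : P.obj n),
    P.act n (H.mul g h) a = P.act n g (P.act n h a)
  act_relabel : ∀ {m n : ℕ} (e : Fin m ≃ Fin n) (g : H.carrier) (a : P.obj m),
    P.act n g (P.relabel e a) = P.relabel e (P.act m g a)
  act_one : ∀ g : H.carrier, P.act 1 g P.one = H.counit g • P.one
  act_comp : ∀ {m : ℕ} (n : Fin m → ℕ) (g : H.carrier)
    (t : P.obj m ⊗[k] (⨂[k] i, P.obj (n i))),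
    P.act _ g (TensorProduct.lift (PiTensorProduct.lift.toLinearMap ∘ₗ P.comp n) t) =
      TensorProduct.lift (PiTensorProduct.lift.toLinearMap ∘ₗ P.comp n)
        (H.diag (P.act m) (fun i => P.act (n i)) g t)

/-- The graded vector space `P(n) ⊗ H^{⊗n}`. -/
noncomputable abbrev semiObj (n : ℕ) : GrMod.{u} k :=
  (P.obj n).tensor (tensorPi fun _ : Fin n => H.toGrMod)

/-- The diagonal action of `H` on `P(n) ⊗ H^{⊗n}`. -/
noncomputable def semiAct (n : ℕ) : H.carrier →ₗ[k] P.semiObj n →ₗ[k] P.semiObj n :=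
  H.diag (W := fun _ => H.toGrMod) (P.act n) (fun _ => H.mul)

/-- The map `(b_1 ⊗ h^1) ⊗ … ⊗ (b_m ⊗ h^m) ↦ ± γ(a; b_1, …, b_m) ⊗ h^1 ⊗ … ⊗ h^m`. -/
noncomputable def semiComp₀ {m : ℕ} (n : Fin m → ℕ) :
    P.obj m →ₗ[k] (⨂[k] i, P.semiObj (n i)) →ₗ[k] P.semiObj (∑ i, n i) :=
  LinearMap.lcomp k _
      (signedSplit (fun i => P.obj (n i)) (fun i => tensorPi fun _ : Fin (n i) => H.toGrMod)) ∘ₗ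
    (TensorProduct.mapBilinear (RingHom.id k) _ _ _ _).flip (concat H.carrier n) ∘ₗ
      PiTensorProduct.lift.toLinearMap ∘ₗ P.comp n

/-- The semidirect product `P ⋊ H`. -/
noncomputable def semidirect : GrOperad.{u} k where
  obj := P.semiObj
  relabel e := TensorProduct.map (P.relabel e) (signedPerm H.toGrMod e)
  one := P.one ⊗ₜ[k] PiTensorProduct.tprod k (fun _ => H.one)
  comp n := TensorProduct.lift (((LinearMap.llcomp k _ _ _).compl₁₂ (P.semiComp₀ n)
    (signedMapPi (V := fun _ => H.toGrMod) (W := fun i => P.semiObj (n i))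
      (fun i => P.semiAct (n i)))).compr₂ PiTensorProduct.lift.symm.toLinearMap)

lemma semidirect_comp {m : ℕ} (n : Fin m → ℕ) (a : P.obj m) (g : ⨂[k] _i : Fin m, H.carrier)
    (y : ∀ i, P.semiObj (n i)) : P.semidirect.comp n (a ⊗ₜ[k] g) y =
      TensorProduct.map (PiTensorProduct.lift (P.comp n a)) (concat H.carrier n)
        (signedSplit (fun i => P.obj (n i)) (fun i => tensorPi fun _ : Fin (n i) => H.toGrMod)
          (signedMapPi (V := fun _ => H.toGrMod) (W := fun i => P.semiObj (n i))
            (fun i => P.semiAct (n i)) g (PiTensorProduct.tprod k y))) := rfl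

end GrHOperad

end GradedOperads

section SpaceHomology

open CategoryTheory AlgebraicTopology MonoidalCategory
open scoped TensorProduct DirectSum
open OperadEquiv GrMod

variable (k : Type u) [Field k]

/-- The singular simplicial set of a space. -/
noncomputable abbrev Sing (X : Type u) [TopologicalSpace X] : SSet.{u} :=
  TopCat.toSSet.obj (TopCat.of X)

lemma continuous_pair {X Y : Type u} [TopologicalSpace X] [TopologicalSpace Y]
    {n : SimplexCategory} (f : SimplexCategory.toTop.{u}.obj n ⟶ TopCat.of X)
    (g : SimplexCategory.toTop.{u}.obj n ⟶ TopCat.of Y) :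
    Continuous (fun t => (⟨(f.hom t, g.hom t)⟩ : KProd X Y)) := by
  have h := f.hom.continuous.prodMk g.hom.continuous
  exact Kify.continuous_of_compHaus (K := ULift (stdSimplex ℝ (Fin (n.len + 1)))) h

/-- A pair of singular simplices is a singular simplex of the product (which has the compactly
generated topology). -/
noncomputable def singProd (X Y : Type u) [TopologicalSpace X] [TopologicalSpace Y] :
    (Sing X ⊗ Sing Y : SSet.{u}) ⟶ Sing (KProd X Y) where
  app n := TypeCat.ofHom fun x =>
    ⟨TopCat.ofHom ⟨fun t => ⟨(x.1.down.hom t, x.2.down.hom t)⟩, continuous_pair _ _⟩⟩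

/-- The `n`-th singular homology of a space with coefficients in the field `k`. -/
noncomputable abbrev singH (n : ℕ) (X : Type u) [TopologicalSpace X] : ModuleCat.{u} k :=
  ((singularHomologyFunctor (ModuleCat.{u} k) n).obj (ModuleCat.of k k)).obj (TopCat.of X)

variable {k}

/-- The cross product in the homology of spaces. -/
noncomputable def singCross (X Y : Type u) [TopologicalSpace X] [TopologicalSpace Y] (p q : ℕ) :
    singH k p X →ₗ[k] singH k q Y →ₗ[k] singH k (p + q) (KProd X Y) :=
  (SSetChains.crossH (k := k) (Sing X) (Sing Y) rfl).compr₂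
    (SSet.homologyMap (singProd X Y) (ModuleCat.of k k) (p + q)).hom

variable (k)

/-- The homology of a space as a graded vector space. -/
noncomputable def spaceHomology (X : Type u) [TopologicalSpace X] : GrMod.{u} k where
  carrier := ⨁ n, singH k n X
  deg n := LinearMap.range (DirectSum.lof k ℕ (fun n => singH k n X) n)
  internal := by
    refine isInternal_of_proj (fun n => DirectSum.lof k ℕ (fun n => singH k n X) n ∘ₗ
      DirectSum.component k ℕ (fun n => singH k n X) n) ?_ ?_ ?_
    · rintro d _ ⟨x, rfl⟩
      simp
    · rintro d e h _ ⟨x, rfl⟩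
      simp only [LinearMap.comp_apply]
      rw [DirectSum.component.of, dif_neg h.symm, map_zero]
    · rw [eq_top_iff]
      rintro x -
      induction x using DirectSum.induction_on with
      | zero => exact Submodule.zero_mem _
      | of n x => exact Submodule.mem_iSup_of_mem n ⟨x, rfl⟩
      | add x y hx hy => exact Submodule.add_mem _ hx hy

variable {k}

section Maps

variable {X Y : Type u} [TopologicalSpace X] [TopologicalSpace Y]

/-- The map in homology induced by a continuous map. -/
noncomputable def spaceHomologyMap (f : C(X, Y)) : spaceHomology k X →ₗ[k] spaceHomology k Y :=
  DirectSum.lmap fun n =>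
    (((singularHomologyFunctor (ModuleCat.{u} k) n).obj (ModuleCat.of k k)).map
      (TopCat.ofHom f)).hom

variable (X Y) in
/-- The cross product. -/
noncomputable def homologyCross :
    spaceHomology k X →ₗ[k] spaceHomology k Y →ₗ[k] spaceHomology k (KProd X Y) :=
  DirectSum.toModule k ℕ _ fun p => LinearMap.flip (DirectSum.toModule k ℕ _ fun q =>
    LinearMap.flip ((singCross X Y p q).compr₂
      (DirectSum.lof k ℕ (fun n => singH k n (KProd X Y)) (p + q))))

/-- The class of a point. -/
noncomputable def homologyPoint (x : X) : spaceHomology k X :=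
  DirectSum.lof k ℕ (fun n => singH k n X) 0
    (SSetChains.cls k (Sing X) 0 ⟨SSetChains.gen ⟨TopCat.ofHom (ContinuousMap.const _ x)⟩, by
      change SSetChains.d k (Sing X) 0 _ = 0
      rw [SSetChains.d_zero]; rfl⟩)

variable (X) in
/-- The augmentation `H(X) → k`, which vanishes in positive degrees. -/
noncomputable def homologyAug : spaceHomology k X →ₗ[k] k :=
  (TopCat.singularHomology₀ε (TopCat.of X) (ModuleCat.of k k)).hom ∘ₗ
    DirectSum.component k ℕ (fun n => singH k n X) 0

/-- The homeomorphism `X_0 × (X_1 × … × X_m) → X_0 × … × X_m`. -/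
def kpiCons {m : ℕ} (X : Fin (m + 1) → Type u) [∀ i, TopologicalSpace (X i)] :
    C(KProd (X 0) (KPi fun i : Fin m => X i.succ), KPi X) where
  toFun x := ⟨Fin.cons x.out.1 x.out.2.out⟩
  continuous_toFun := KPi.continuous_mk
    (f := fun i (x : KProd (X 0) (KPi fun i : Fin m => X i.succ)) =>
      Fin.cons (α := X) x.out.1 x.out.2.out i)
    fun i => by
      induction i using Fin.cases with
      | zero => exact KProd.continuous_fst
      | succ i => exact (KPi.continuous_eval i).comp KProd.continuous_snd

/-- The cross product `x_1 × … × x_m` of a finite number of homology classes. -/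
noncomputable def homologyCrossPi : ∀ {m : ℕ} (X : Fin m → Type u) [∀ i, TopologicalSpace (X i)],
    MultilinearMap k (fun i => (spaceHomology k (X i)).carrier) (spaceHomology k (KPi X)).carrier
  | 0, _, _ => MultilinearMap.constOfIsEmpty k _ (homologyPoint ⟨isEmptyElim⟩)
  | _ + 1, X, _ => LinearMap.uncurryLeft
      (PiTensorProduct.lift.symm.toLinearMap ∘ₗ
        ((homologyCross (X 0) (KPi fun i : Fin _ => X i.succ)).compr₂
          (spaceHomologyMap (kpiCons X))).compl₂
            (PiTensorProduct.lift (homologyCrossPi fun i => X i.succ)))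

end Maps

namespace TopGrp

variable (k) (G : TopGrp.{u})

/-- The Künneth map `H(G) ⊗ H(G) → H(G × G)`. -/
noncomputable def kunneth : spaceHomology k G.carrier ⊗[k] spaceHomology k G.carrier →ₗ[k]
    spaceHomology k (KProd G.carrier G.carrier) :=
  TensorProduct.lift (homologyCross G.carrier G.carrier)

/-- The map in homology induced by the diagonal of `G`. -/
noncomputable def diagonal : spaceHomology k G.carrier →ₗ[k] spaceHomology k (KProd G.carrier G.carrier) :=
  spaceHomologyMap ⟨fun g => ⟨(g, g)⟩, KProd.continuous_mk continuous_id continuous_id⟩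

open Classical in
/-- The structure maps of the Hopf algebra `H(G)`. The comultiplication is the composition of the
map induced by the diagonal with the inverse of the Künneth isomorphism. -/
noncomputable def hopf : GrHopf.{u} k where
  toGrMod := spaceHomology k G.carrier
  mul := (homologyCross G.carrier G.carrier).compr₂
    (spaceHomologyMap ⟨fun x => x.out.1 * x.out.2, G.continuous_mul⟩)
  one := homologyPoint 1
  comul := (if h : Function.Bijective (G.kunneth k) then
    (LinearEquiv.ofBijective (G.kunneth k) h).symm.toLinearMap else 0) ∘ₗ G.diagonal k
  counit := homologyAug G.carrier
  antipode := spaceHomologyMap ⟨fun x => x⁻¹, G.continuous_inv⟩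

end TopGrp

namespace TopOperad

variable (k) (A : TopOperad.{u})

/-- The homology of a topological operad. -/
noncomputable def homologyOperad : GrOperad.{u} k where
  obj n := spaceHomology k (A.obj n)
  relabel e := spaceHomologyMap ⟨A.relabel e, A.continuous_relabel e⟩
  one := homologyPoint A.one
  comp {m} n := PiTensorProduct.lift.symm.toLinearMap ∘ₗ
    ((homologyCross (A.obj m) (KPi fun i => A.obj (n i))).compr₂
      (spaceHomologyMap ⟨fun x => A.comp n x.out.1 x.out.2.out, A.continuous_comp n⟩)).compl₂
        (PiTensorProduct.lift (homologyCrossPi fun i => A.obj (n i)))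

end TopOperad

namespace GOperad

variable (k) {G : TopGrp.{u}} (A : GOperad G)

/-- The homology of a `G`-operad, with its action of `H(G)`. -/
noncomputable def homologyHOperad : GrHOperad (G.hopf k) where
  toGrOperad := A.homologyOperad k
  act n := (homologyCross G.carrier (A.obj n)).compr₂
    (spaceHomologyMap ⟨fun x => x.out.1 • x.out.2, A.continuous_smul n⟩)

/-- The Künneth map `H(A(n)) ⊗ H(G)^{⊗n} → H(A(n) × Gⁿ)`. -/
noncomputable def kunneth (n : ℕ) :
    spaceHomology k (A.obj n) ⊗[k] (⨂[k] _i : Fin n, spaceHomology k G.carrier) →ₗ[k]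
      spaceHomology k (A.SemiObj n) :=
  TensorProduct.lift ((homologyCross (A.obj n) (KPi fun _ : Fin n => G.carrier)).compl₂
    (PiTensorProduct.lift (homologyCrossPi fun _ : Fin n => G.carrier)))

/-- A morphism from a `G`-operad to a `G'`-operad which is compatible with a homomorphism
`G → G'`. -/
structure Hom {G G' : TopGrp.{u}} (A : GOperad G) (A' : GOperad G') where
  grp : G.carrier →* G'.carrier
  map : ∀ n, A.obj n → A'.obj n
  continuous_grp : Continuous grp
  continuous_map : ∀ n, Continuous (map n)
  map_relabel : ∀ {m n : ℕ} (e : Fin m ≃ Fin n) (a : A.obj m),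
    map n (A.relabel e a) = A'.relabel e (map m a)
  map_one : map 1 A.one = A'.one
  map_comp : ∀ {m : ℕ} (n : Fin m → ℕ) (a : A.obj m) (b : ∀ i, A.obj (n i)),
    map _ (A.comp n a b) = A'.comp n (map m a) (fun i => map (n i) (b i))
  map_smul : ∀ (n : ℕ) (g : G.carrier) (a : A.obj n), map n (g • a) = grp g • map n a

/-- The induced map `A(n) × Gⁿ → A'(n) × G'ⁿ`. -/
def Hom.semidirect {G G' : TopGrp.{u}} {A : GOperad G} {A' : GOperad G'} (f : Hom A A') (n : ℕ) :
    C(A.SemiObj n, A'.SemiObj n) where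
  toFun x := ⟨(f.map n x.out.1, ⟨fun i => f.grp (x.out.2.out i)⟩)⟩
  continuous_toFun := KProd.continuous_mk ((f.continuous_map n).comp KProd.continuous_fst)
    (KPi.continuous_mk fun i =>
      f.continuous_grp.comp ((KPi.continuous_eval i).comp KProd.continuous_snd))

variable {k} in
/-- The induced map `H(A(n)) ⊗ H(G)^{⊗n} → H(A'(n)) ⊗ H(G')^{⊗n}`. -/
noncomputable def Hom.homologySemidirect {G G' : TopGrp.{u}} {A : GOperad G} {A' : GOperad G'}
    (f : Hom A A') (n : ℕ) :
    spaceHomology k (A.obj n) ⊗[k] (⨂[k] _i : Fin n, spaceHomology k G.carrier) →ₗ[k]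
      spaceHomology k (A'.obj n) ⊗[k] (⨂[k] _i : Fin n, spaceHomology k G'.carrier) :=
  TensorProduct.map (spaceHomologyMap ⟨f.map n, f.continuous_map n⟩)
    (PiTensorProduct.map fun _ => spaceHomologyMap ⟨f.grp, f.continuous_grp⟩)

end GOperad

end SpaceHomology

/-!
The isomorphism is the inverse of the cross product `H(A(n)) ⊗ H(G)^{⊗n} → H(A(n) × Gⁿ)`. The proof
rests on two facts: the cross product is bijective over a field, and it is natural, associative,
unital and graded commutative.

*The Künneth theorem.* For simplicial sets `S` and `T`, choose cycles of `T` whose classes form a basis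
of its homology. The theorem says that the mapping cone of `f ↦ ∑ f_b × W b`, from families of chains
of `S` to chains of `S × T`, is exact (`crossHT_bijective`). As a functor of `S` this cone is free on
simplices, so by the method of acyclic models (`exact_of_models`) it suffices to take `S = Δ[m]`
(`coneD_exact_simplex`), where the chains of `Δ[m]` contract to a vertex and `Δ[m] × T` contracts to
`T`. The singular simplicial set of a compactly generated product is the product of the singular
simplicial sets (`singProd_isIso`), which gives the theorem for spaces (`homologyCross_bijective`), and
by induction for finite products (`homologyCrossPi_bijective`).

*Properties of the cross product.* The Eilenberg–Zilber map is a signed sum over lattice paths. Its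
iterates are sums over lattice paths in three dimensions, whichever way they are bracketed
(`crossT_assoc`), and reflection of paths gives graded commutativity (`crossT_comm`). Therefore
rearranging the factors of a cross product of homogeneous classes introduces exactly the Koszul sign
(`homologyCrossPi_perm`, `homologyCrossPi_unzip`, `homologyCrossPi_blocks`).

*Translation.* Consequently each algebraic operation in question becomes, under the Künneth
isomorphism, the map induced by the corresponding map of spaces: the comultiplications by the
diagonals (`kunneth_comul`, `lift_homologyCrossPi_iterComul`), signed tensor products of pairings by
products of maps (`kunneth_signedMap₂`, `kunneth_signedMapPi`), and diagonal actions by diagonal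
actions (`kunnethPi_diag`). Every identity required of `H(G)` and `H(A)` thus follows from the identity
between maps of spaces, as the Künneth maps are injective. In the same way the cross product respects
renumbering, unit and composition of the two semidirect products (`kunneth_relabel`, `kunneth_one`,
`kunneth_comp`), and is natural (`kunneth_natural`). The operad axioms for `H(A) ⋊ H(G)` are transported
from those of the homology of the topological operad `A ⋊ G` (`GrOperad.Iso.isOperad`).
-/

section TotalChains

open CategoryTheory Limits Simplicial AlgebraicTopology MonoidalCategory
open scoped DirectSum

variable {k : Type u} [Field k]

namespace SSetChains

/-! ### Chains of all degrees -/

variable (k) in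
/-- All chains of a simplicial set: the sum of the modules of `n`-chains. -/
abbrev Tot (S : SSet.{u}) : Type u := ⨁ n, (C k S n : Type u)

variable (k) in
/-- The inclusion of the `n`-chains. -/
noncomputable abbrev inc (S : SSet.{u}) (n : ℕ) : C k S n →ₗ[k] Tot k S :=
  DirectSum.lof k ℕ (fun n => (C k S n : Type u)) n

/-- The generator of `Tot k S` given by a simplex. -/
noncomputable def tgen {S : SSet.{u}} {n : ℕ} (x : S _⦋n⦌) : Tot k S := inc k S n (gen x)

lemma tot_hom_ext {S : SSet.{u}} {M : Type*} [AddCommGroup M] [Module k M] {f g : Tot k S →ₗ[k] M}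
    (h : ∀ n (x : C k S n), f (inc k S n x) = g (inc k S n x)) : f = g :=
  DirectSum.linearMap_ext k fun n => LinearMap.ext fun x => h n x

lemma tot_gen_ext {S : SSet.{u}} {M : Type u} [AddCommGroup M] [Module k M]
    {f g : Tot k S →ₗ[k] M} (h : ∀ n (x : S _⦋n⦌), f (tgen x) = g (tgen x)) : f = g :=
  DirectSum.linearMap_ext k fun n => hom_ext fun x => h n x

variable (k) in
/-- The linear extension of a map which is defined on simplices. -/
noncomputable def totExt {S : SSet.{u}} {M : Type u} [AddCommGroup M] [Module k M]
    (f : ∀ n, S _⦋n⦌ → M) : Tot k S →ₗ[k] M :=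
  DirectSum.toModule k ℕ M fun n => linExt k (f n)

@[simp] lemma totExt_tgen {S : SSet.{u}} {M : Type u} [AddCommGroup M] [Module k M]
    (f : ∀ n, S _⦋n⦌ → M) {n : ℕ} (x : S _⦋n⦌) : totExt k f (tgen x) = f n x := by
  rw [totExt, tgen, DirectSum.toModule_lof, linExt_gen]

variable (k) in
/-- The boundary, on all chains. -/
noncomputable def dT (S : SSet.{u}) : Tot k S →ₗ[k] Tot k S :=
  DirectSum.toModule k ℕ _ fun n => inc k S (n - 1) ∘ₗ d k S n

lemma dT_inc (S : SSet.{u}) (n : ℕ) (x : C k S n) :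
    dT k S (inc k S n x) = inc k S (n - 1) (d k S n x) := by
  rw [dT, DirectSum.toModule_lof]; rfl

lemma dT_tgen_zero (S : SSet.{u}) (x : S _⦋0⦌) : dT k S (tgen x) = 0 := by
  rw [tgen, dT_inc, d_zero]; simp

lemma dT_tgen_succ (S : SSet.{u}) {n : ℕ} (x : S _⦋n + 1⦌) :
    dT k S (tgen x) = ∑ i : Fin (n + 2), ((-1 : ℤ) ^ (i : ℕ)) • tgen (k := k) (S.δ i x) := by
  rw [tgen, dT_inc, d_gen, map_sum]
  exact Finset.sum_congr rfl fun i _ => map_zsmul _ _ _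

lemma d_d (S : SSet.{u}) (n : ℕ) (x : C k S n) : d k S (n - 1) (d k S n x) = 0 :=
  congrArg (fun f => f.hom x) ((S.chainComplex (ModuleCat.of k k)).d_comp_d n (n - 1) (n - 1 - 1))

lemma dT_dT (S : SSet.{u}) (x : Tot k S) : dT k S (dT k S x) = 0 := by
  suffices H : dT k S ∘ₗ dT k S = 0 from congrArg (fun f => f x) H
  refine tot_hom_ext fun n x => ?_
  rw [LinearMap.comp_apply, dT_inc, dT_inc, d_d, map_zero]; rfl

variable (k) in
/-- The map of chains induced by a simplicial map. -/
noncomputable def cmap {S T : SSet.{u}} (f : S ⟶ T) (n : ℕ) : C k S n →ₗ[k] C k T n :=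
  ((SSet.chainComplexMap f (ModuleCat.of k k)).f n).hom

lemma cmap_gen {S T : SSet.{u}} (f : S ⟶ T) {n : ℕ} (x : S _⦋n⦌) :
    cmap k f n (gen x) = gen (f.app _ x) :=
  congrArg (fun g => g.hom (1 : k)) (SSet.ι_chainComplexMap_f S T f (ModuleCat.of k k) x)

lemma d_cmap {S T : SSet.{u}} (f : S ⟶ T) (n : ℕ) (x : C k S n) :
    d k T n (cmap k f n x) = cmap k f (n - 1) (d k S n x) :=
  congrArg (fun g => g.hom x) ((SSet.chainComplexMap f (ModuleCat.of k k)).comm n (n - 1))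

variable (k) in
/-- The map of chains of all degrees induced by a simplicial map. -/
noncomputable def tmap {S T : SSet.{u}} (f : S ⟶ T) : Tot k S →ₗ[k] Tot k T :=
  DirectSum.lmap fun n => cmap k f n

lemma tmap_inc {S T : SSet.{u}} (f : S ⟶ T) (n : ℕ) (x : C k S n) :
    tmap k f (inc k S n x) = inc k T n (cmap k f n x) := by
  simp only [tmap, inc, DirectSum.lmap_lof]

lemma tmap_tgen {S T : SSet.{u}} (f : S ⟶ T) {n : ℕ} (x : S _⦋n⦌) :
    tmap k f (tgen x) = tgen (f.app _ x) := by
  rw [tgen, tmap_inc, cmap_gen]; rfl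

lemma dT_tmap {S T : SSet.{u}} (f : S ⟶ T) (x : Tot k S) :
    dT k T (tmap k f x) = tmap k f (dT k S x) := by
  suffices H : dT k T ∘ₗ tmap k f = tmap k f ∘ₗ dT k S from congrArg (fun g => g x) H
  refine tot_hom_ext fun n x => ?_
  simp only [LinearMap.comp_apply, tmap_inc, dT_inc, d_cmap]

lemma tmap_comp {S T U : SSet.{u}} (f : S ⟶ T) (g : T ⟶ U) (x : Tot k S) :
    tmap k (f ≫ g) x = tmap k g (tmap k f x) := by
  suffices H : tmap k (f ≫ g) = tmap k g ∘ₗ tmap k f from congrArg (fun g => g x) H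
  refine tot_gen_ext fun n x => ?_
  simp only [LinearMap.comp_apply, tmap_tgen]; rfl

lemma tmap_id {S : SSet.{u}} (x : Tot k S) : tmap k (𝟙 S) x = x := by
  suffices H : tmap k (𝟙 S) = LinearMap.id from congrArg (fun g => g x) H
  refine tot_gen_ext fun n x => ?_
  simp only [tmap_tgen]; rfl

variable (k) in
/-- The Eilenberg–Zilber map, on chains of all degrees. -/
noncomputable def crossT (S T : SSet.{u}) :
    Tot k S →ₗ[k] Tot k T →ₗ[k] Tot k (S ⊗ T : SSet.{u}) :=
  DirectSum.toModule k ℕ _ fun p => LinearMap.flip (DirectSum.toModule k ℕ _ fun q =>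
    LinearMap.flip ((cross k S T p q (p + q)).compr₂ (inc k (S ⊗ T : SSet.{u}) (p + q))))

lemma crossT_inc {S T : SSet.{u}} {p q n : ℕ} (h : p + q = n) (x : C k S p) (y : C k T q) :
    crossT k S T (inc k S p x) (inc k T q y) =
      inc k (S ⊗ T : SSet.{u}) n (cross k S T p q n x y) := by
  subst h
  rw [crossT, DirectSum.toModule_lof, LinearMap.flip_apply, DirectSum.toModule_lof]
  rfl

lemma crossT_tgen {S T : SSet.{u}} {p q n : ℕ} (h : p + q = n) (x : S _⦋p⦌) (y : T _⦋q⦌) :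
    crossT k S T (tgen x) (tgen y) =
      ∑ s : Shuffle p q n, ((-1 : ℤ) ^ s.area) • tgen (pair (op S s.fst x) (op T s.snd y)) := by
  rw [tgen, tgen, crossT_inc h, cross_gen, map_sum]
  exact Finset.sum_congr rfl fun i _ => map_zsmul _ _ _

lemma leibniz_inc (S T : SSet.{u}) {p : ℕ} (a : C k S p) (b : Tot k T) :
    dT k _ (crossT k S T (inc k S p a) b) = crossT k S T (dT k S (inc k S p a)) b +
      ((-1 : ℤ) ^ p) • crossT k S T (inc k S p a) (dT k T b) := by
  suffices H : dT k _ ∘ₗ crossT k S T (inc k S p a) = crossT k S T (dT k S (inc k S p a)) +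
      ((-1 : ℤ) ^ p) • crossT k S T (inc k S p a) ∘ₗ dT k T from congrArg (fun g => g b) H
  refine tot_hom_ext fun q b => ?_
  simp only [LinearMap.comp_apply, LinearMap.add_apply, LinearMap.smul_apply, dT_inc]
  rw [crossT_inc rfl, dT_inc, leibniz S T rfl, map_add, map_zsmul]
  congr 1
  · rcases p with _ | p
    · simp [d_zero]
    · rw [crossT_inc (n := p + 1 + q - 1) (by omega)]
  · rcases q with _ | q
    · simp [d_zero]
    · congr 1
      rw [crossT_inc (n := p + (q + 1) - 1) (by omega)]

lemma crossT_map {S T S' T' : SSet.{u}} (f : S ⟶ S') (g : T ⟶ T') (a : Tot k S) (b : Tot k T) :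
    tmap k (f ⊗ₘ g : (S ⊗ T : SSet.{u}) ⟶ S' ⊗ T') (crossT k S T a b) =
      crossT k S' T' (tmap k f a) (tmap k g b) := by
  suffices H : (crossT k S T).compr₂ (tmap k (f ⊗ₘ g : (S ⊗ T : SSet.{u}) ⟶ S' ⊗ T')) =
      (crossT k S' T').compl₁₂ (tmap k f) (tmap k g) from congrArg (fun h => h a b) H
  refine tot_gen_ext fun p x => tot_gen_ext fun q y => ?_
  simp only [LinearMap.compr₂_apply, LinearMap.compl₁₂_apply, tmap_tgen]
  rw [crossT_tgen rfl, crossT_tgen rfl, map_sum]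
  refine Finset.sum_congr rfl fun s _ => ?_
  rw [map_zsmul, tmap_tgen]
  congr 2
  refine Prod.ext ?_ ?_
  · exact (NatTrans.naturality_apply f _ x)
  · exact (NatTrans.naturality_apply g _ y)

/-! ### Homology classes of cycles which need not be homogeneous -/

lemma dT_component (S : SSet.{u}) (z : Tot k S) (n : ℕ) :
    (dT k S z) n = d k S (n + 1) (z (n + 1)) := by
  suffices H : DirectSum.component k ℕ (fun n => (C k S n : Type u)) n ∘ₗ dT k S =
      d k S (n + 1) ∘ₗ DirectSum.component k ℕ (fun n => (C k S n : Type u)) (n + 1) from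
    congrArg (fun g => g z) H
  refine tot_hom_ext fun m x => ?_
  simp only [LinearMap.comp_apply, dT_inc]
  rcases m with _ | m
  · rw [d_zero, LinearMap.zero_apply, map_zero, map_zero, DirectSum.component.of,
      dif_neg (by omega), map_zero]
  · by_cases h : n = m
    · subst h
      rw [DirectSum.component.of, DirectSum.component.of, dif_pos (by omega), dif_pos rfl]
    · rw [DirectSum.component.of, DirectSum.component.of, dif_neg (by omega), dif_neg (by omega),
        map_zero]

lemma component_mem_Z {S : SSet.{u}} {z : Tot k S} (hz : dT k S z = 0) (n : ℕ) :
    z n ∈ Z k S n := by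
  change d k S n (z n) = 0
  rcases n with _ | n
  · rw [d_zero]; rfl
  · rw [← dT_component, hz]; rfl

variable (k) in
/-- The sum of the modules of `n`-cycles. -/
abbrev ZT (S : SSet.{u}) : Type u := ⨁ n, (Z k S n)

variable (k) in
/-- The sum of the homology groups. -/
abbrev HT (S : SSet.{u}) : Type u := ⨁ n, (H k S n : Type u)

variable (k) in
/-- The inclusion of the cycles in the chains. -/
noncomputable def ztot (S : SSet.{u}) : ZT k S →ₗ[k] Tot k S :=
  DirectSum.lmap fun n => (Z k S n).subtype

variable (k) in
/-- The homology classes of cycles. -/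
noncomputable def hcl (S : SSet.{u}) : ZT k S →ₗ[k] HT k S :=
  DirectSum.lmap fun n => cls k S n

lemma ztot_lof (S : SSet.{u}) (n : ℕ) (z : Z k S n) :
    ztot k S (DirectSum.lof k ℕ (fun n => Z k S n) n z) = inc k S n z := by
  simp only [ztot, DirectSum.lmap_lof]; rfl

lemma hcl_lof (S : SSet.{u}) (n : ℕ) (z : Z k S n) :
    hcl k S (DirectSum.lof k ℕ (fun n => Z k S n) n z) =
      DirectSum.lof k ℕ (fun n => (H k S n : Type u)) n (cls k S n z) := by
  simp only [hcl, DirectSum.lmap_lof]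

lemma ztot_apply (S : SSet.{u}) (ζ : ZT k S) (n : ℕ) : ztot k S ζ n = ζ n := by
  rw [ztot, DirectSum.lmap_apply]; rfl

lemma hcl_apply (S : SSet.{u}) (ζ : ZT k S) (n : ℕ) : hcl k S ζ n = cls k S n (ζ n) := by
  rw [hcl, DirectSum.lmap_apply]

lemma dT_ztot (S : SSet.{u}) (ζ : ZT k S) : dT k S (ztot k S ζ) = 0 := by
  induction ζ using DirectSum.induction_on with
  | zero => simp
  | of n z =>
    have hz : d k S n z = 0 := z.2
    have := ztot_lof S n z
    rw [DirectSum.lof_eq_of] at this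
    rw [this, dT_inc, hz, map_zero]
  | add x y hx hy => rw [map_add, map_add, hx, hy, add_zero]

lemma exists_ztot {S : SSet.{u}} {z : Tot k S} (hz : dT k S z = 0) : ∃ ζ, ztot k S ζ = z := by
  classical
  refine ⟨∑ n ∈ DFinsupp.support z, DirectSum.lof k ℕ (fun n => Z k S n) n
    ⟨z n, component_mem_Z hz n⟩, ?_⟩
  rw [map_sum]
  simp only [ztot_lof]
  exact DirectSum.sum_support_of z

lemma hcl_surjective (S : SSet.{u}) : Function.Surjective (hcl k S) :=
  (DirectSum.lmap_surjective _).2 fun n => cls_surjective S n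

lemma hcl_eq_zero_iff (S : SSet.{u}) (ζ : ZT k S) :
    hcl k S ζ = 0 ↔ ∃ u, dT k S u = ztot k S ζ := by
  classical
  constructor
  · intro h
    have h1 : ∀ n, ∃ b : C k S (n + 1), d k S (n + 1) b = (ζ n : C k S n) := fun n => by
      rw [← cls_eq_zero_iff, ← hcl_apply, h]; rfl
    choose b hb using h1
    refine ⟨∑ n ∈ DFinsupp.support (ztot k S ζ), inc k S (n + 1) (b n), ?_⟩
    rw [map_sum]
    refine Eq.trans (Finset.sum_congr rfl fun n _ => ?_) (DirectSum.sum_support_of (ztot k S ζ))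
    rw [dT_inc, ztot_apply, ← hb n]
    rfl
  · rintro ⟨u, hu⟩
    refine DFinsupp.ext fun n => ?_
    rw [hcl_apply]
    refine (cls_eq_zero_iff S n _).2 ⟨u (n + 1), ?_⟩
    rw [← dT_component, hu, ztot_apply]

end SSetChains
end TotalChains

section AcyclicModels

open CategoryTheory Limits Simplicial AlgebraicTopology MonoidalCategory
open scoped DirectSum

variable {k : Type u} [Field k]

namespace SSetChains

/-! ### Cycles and the homology classes they represent -/

/-- The chain `z`, which need not be homogeneous, is a cycle with homology class `h`. -/
def IsRep {S : SSet.{u}} (z : Tot k S) (h : HT k S) : Prop :=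
  ∃ ζ : ZT k S, ztot k S ζ = z ∧ hcl k S ζ = h

namespace IsRep

variable {S T : SSet.{u}} {z z' : Tot k S} {h h' : HT k S}

lemma exists_rep (h : HT k S) : ∃ z, IsRep z h := by
  obtain ⟨ζ, rfl⟩ := hcl_surjective S h
  exact ⟨_, ζ, rfl, rfl⟩

lemma of_cycle (hz : dT k S z = 0) : ∃ h, IsRep z h := by
  obtain ⟨ζ, rfl⟩ := exists_ztot hz
  exact ⟨_, ζ, rfl, rfl⟩

lemma cycle (H : IsRep z h) : dT k S z = 0 := by
  obtain ⟨ζ, rfl, -⟩ := H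
  exact dT_ztot S ζ

lemma eq_zero_iff (H : IsRep z h) : h = 0 ↔ ∃ u, dT k S u = z := by
  obtain ⟨ζ, rfl, rfl⟩ := H
  exact hcl_eq_zero_iff S ζ

lemma add (H : IsRep z h) (H' : IsRep z' h') : IsRep (z + z') (h + h') := by
  obtain ⟨ζ, rfl, rfl⟩ := H
  obtain ⟨ζ', rfl, rfl⟩ := H'
  exact ⟨ζ + ζ', map_add _ _ _, map_add _ _ _⟩

lemma sub (H : IsRep z h) (H' : IsRep z' h') : IsRep (z - z') (h - h') := by
  obtain ⟨ζ, rfl, rfl⟩ := H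
  obtain ⟨ζ', rfl, rfl⟩ := H'
  exact ⟨ζ - ζ', map_sub _ _ _, map_sub _ _ _⟩

lemma smul (c : k) (H : IsRep z h) : IsRep (c • z) (c • h) := by
  obtain ⟨ζ, rfl, rfl⟩ := H
  exact ⟨c • ζ, map_smul _ _ _, map_smul _ _ _⟩

lemma zero : IsRep (0 : Tot k S) 0 := ⟨0, map_zero _, map_zero _⟩

lemma sum {ι : Type*} (s : Finset ι) {z : ι → Tot k S} {h : ι → HT k S}
    (H : ∀ i, IsRep (z i) (h i)) : IsRep (∑ i ∈ s, z i) (∑ i ∈ s, h i) := by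
  classical
  induction s using Finset.induction_on with
  | empty => exact zero
  | insert i s hi ih => rw [Finset.sum_insert hi, Finset.sum_insert hi]; exact (H i).add ih

lemma sub_eq_iff (H : IsRep z h) (H' : IsRep z' h') : h = h' ↔ ∃ u, dT k S u = z - z' := by
  rw [← sub_eq_zero, (H.sub H').eq_zero_iff]

lemma unique (H : IsRep z h) (H' : IsRep z h') : h = h' :=
  (H.sub_eq_iff H').2 ⟨0, by simp⟩

end IsRep

variable (k) in
/-- The map of homology groups induced by a simplicial map. -/
noncomputable def hmap {S T : SSet.{u}} (f : S ⟶ T) : HT k S →ₗ[k] HT k T :=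
  DirectSum.lmap fun n => (SSet.homologyMap f (ModuleCat.of k k) n).hom

/-- The map of homology groups in terms of cycles: `z'` is the image of `z`. -/
lemma homologyMap_cls {S T : SSet.{u}} (f : S ⟶ T) (n : ℕ) (z : Z k S n) (z' : Z k T n)
    (h : (z' : C k T n) = cmap k f n z) :
    (SSet.homologyMap f (ModuleCat.of k k) n).hom (cls k S n z) = cls k T n z' := by
  let φ := SSet.chainComplexMap f (ModuleCat.of k k)
  let K := S.chainComplex (ModuleCat.of k k)
  let L := T.chainComplex (ModuleCat.of k k)
  let l := K.liftCycles (A := ModuleCat.of k (Z k S n))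
      (ModuleCat.ofHom (Z k S n).subtype) (n - 1) (next_eq n) (by ext z; exact z.2)
  let l' := L.liftCycles (A := ModuleCat.of k (Z k T n))
      (ModuleCat.ofHom (Z k T n).subtype) (n - 1) (next_eq n) (by ext z; exact z.2)
  have e1 : (SSet.homologyMap f (ModuleCat.of k k) n).hom (cls k S n z) =
      (L.homologyπ n).hom ((HomologicalComplex.cyclesMap φ n).hom (l.hom z)) :=
    congrArg (fun g => g.hom (l.hom z)) (HomologicalComplex.homologyπ_naturality φ n)
  rw [e1]
  change _ = (L.homologyπ n).hom (l'.hom z')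
  congr 1
  apply (ModuleCat.mono_iff_injective (L.iCycles n)).1 inferInstance
  have e2 : (L.iCycles n).hom ((HomologicalComplex.cyclesMap φ n).hom (l.hom z)) =
      (φ.f n).hom ((K.iCycles n).hom (l.hom z)) :=
    congrArg (fun g => g.hom (l.hom z)) (HomologicalComplex.cyclesMap_i φ n)
  have e3 : (K.iCycles n).hom (l.hom z) = z :=
    congrArg (fun f => f.hom z) (K.liftCycles_i (A := ModuleCat.of k (Z k S n))
      (ModuleCat.ofHom (Z k S n).subtype) (n - 1) (next_eq n) (by ext z; exact z.2))
  have e4 : (L.iCycles n).hom (l'.hom z') = z' :=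
    congrArg (fun f => f.hom z') (L.liftCycles_i (A := ModuleCat.of k (Z k T n))
      (ModuleCat.ofHom (Z k T n).subtype) (n - 1) (next_eq n) (by ext z; exact z.2))
  rw [e2, e3]
  exact h.symm.trans e4.symm

lemma IsRep.map {S T : SSet.{u}} {z : Tot k S} {h : HT k S} (H : IsRep z h) (f : S ⟶ T) :
    IsRep (tmap k f z) (hmap k f h) := by
  obtain ⟨ζ, rfl, rfl⟩ := H
  obtain ⟨ζ', hζ'⟩ := exists_ztot (S := T) (z := tmap k f (ztot k S ζ))
    (by rw [dT_tmap, dT_ztot, map_zero])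
  refine ⟨ζ', hζ', DFinsupp.ext fun n => ?_⟩
  rw [hmap, DirectSum.lmap_apply, hcl_apply, hcl_apply]
  refine (homologyMap_cls f n _ _ ?_).symm
  rw [← ztot_apply, hζ', tmap, DirectSum.lmap_apply, ztot_apply]

lemma isRep_inc {S : SSet.{u}} {n : ℕ} (z : Z k S n) :
    IsRep (inc k S n z) (DirectSum.lof k ℕ (fun n => (H k S n : Type u)) n (cls k S n z)) :=
  ⟨DirectSum.lof k ℕ (fun n => Z k S n) n z, ztot_lof S n z, hcl_lof S n z⟩

/-! ### Natural complexes which are free on models -/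

/-- The simplicial map `Δ[n] ⟶ S` which classifies an `n`-simplex. -/
noncomputable def char {S : SSet.{u}} {n : ℕ} (x : S _⦋n⦌) : Δ[n] ⟶ S := SSet.yonedaEquiv.symm x

/-- The nondegenerate `n`-simplex of `Δ[n]`. -/
noncomputable def top (n : ℕ) : (Δ[n] : SSet.{u}) _⦋n⦌ := SSet.yonedaEquiv (𝟙 _)

lemma char_top {S : SSet.{u}} {n : ℕ} (x : S _⦋n⦌) : (char x).app _ (top n) = x :=
  SSet.yonedaEquiv_symm_app_id x

lemma char_comp {S T : SSet.{u}} {n : ℕ} (x : S _⦋n⦌) (f : S ⟶ T) :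
    char x ≫ f = char (f.app _ x) := SSet.yonedaEquiv_symm_comp _ _

/-- Let `E` be a differential module depending on a simplicial set, which is freely generated by
elements `e i x` where `x` runs through the simplices of dimension `m i`, and let the differential
lower the degree `dg i` of generators. If `E` is exact on the standard simplices, it is exact: on
the generators of bounded degree there is a natural contraction, which is constructed degree by
degree on the universal generators `e i (top (m i))`. -/
theorem exact_of_models (E : SSet.{u} → Type u) [∀ S, AddCommGroup (E S)] [∀ S, Module k (E S)]
    (map : ∀ {S S' : SSet.{u}}, (S ⟶ S') → E S →ₗ[k] E S')
    {I : Type u} (m dg : I → ℕ) (e : ∀ (S : SSet.{u}) (i : I), S _⦋m i⦌ → E S)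
    (hext : ∀ (S : SSet.{u}) (v : ∀ i, S _⦋m i⦌ → E S),
      ∃ L : E S →ₗ[k] E S, ∀ i x, L (e S i x) = v i x)
    (hspan : ∀ S, Submodule.span k (Set.range fun p : Σ i, S _⦋m i⦌ => e S p.1 p.2) = ⊤)
    (D : ∀ S, E S →ₗ[k] E S) (hDD : ∀ S x, D S (D S x) = 0)
    (hmap : ∀ {S S' : SSet.{u}} (f : S ⟶ S') i x, map f (e S i x) = e S' i (f.app _ x))
    (hD : ∀ {S S' : SSet.{u}} (f : S ⟶ S') x, D S' (map f x) = map f (D S x))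
    (hlow : ∀ S i x, D S (e S i x) ∈ Submodule.span k
      {y | ∃ j x', dg j < dg i ∧ y = e S j x'})
    (hex : ∀ (n : ℕ) (x : E Δ[n]), D _ x = 0 → ∃ y, D _ y = x)
    (S : SSet.{u}) (x : E S) (hx : D S x = 0) : ∃ y, D S y = x := by
  classical
  let F : ℕ → ∀ S, Submodule k (E S) := fun N S =>
    Submodule.span k {y | ∃ j x', dg j < N ∧ y = e S j x'}
  have key : ∀ N : ℕ, ∃ h : ∀ S, E S →ₗ[k] E S,
      (∀ {S S' : SSet.{u}} (f : S ⟶ S') x, map f (h S x) = h S' (map f x)) ∧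
      ∀ S, ∀ x ∈ F N S, D S (h S x) + h S (D S x) = x := by
    intro N
    induction N with
    | zero =>
      refine ⟨fun S => 0, by simp, fun S x hx => ?_⟩
      have : F 0 S = ⊥ := by simp [F]
      rw [this, Submodule.mem_bot] at hx
      simp [hx]
    | succ N ih =>
      obtain ⟨h, hnat, hh⟩ := ih
      have hu : ∀ i, ∃ u : E Δ[m i], dg i = N →
          D _ u = e _ i (top (m i)) - h _ (D _ (e _ i (top (m i)))) := by
        intro i
        by_cases hi : dg i = N
        · obtain ⟨u, hu⟩ := hex (m i) (e _ i (top (m i)) - h _ (D _ (e _ i (top (m i))))) (by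
            have := hh _ (D _ (e _ i (top (m i)))) (by
              have := hlow _ i (top (m i)); rwa [hi] at this)
            rw [hDD, map_zero, add_zero] at this
            rw [map_sub, this, sub_self])
          exact ⟨u, fun _ => hu⟩
        · exact ⟨0, fun h => absurd h hi⟩
      choose u hu using hu
      -- On new generators the contraction is forced by naturality, as `x` is the image of
      -- `top (m i)` under `char x`. On all others it remains the old one.
      choose L hL using fun S => hext S fun i x =>
        if dg i = N then map (char x) (u i) else h S (e S i x)
      have hLh : ∀ S, ∀ x ∈ F N S, L S x = h S x := by
        intro S x hx
        refine LinearMap.eqOn_span (s := {y | ∃ j x', dg j < N ∧ y = e S j x'}) ?_ hx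
        rintro _ ⟨j, x', hj, rfl⟩
        rw [hL, if_neg hj.ne]
      refine ⟨L, fun {S S'} f x => ?_, fun S x hx => ?_⟩
      · suffices H : map f ∘ₗ L S = L S' ∘ₗ map f from congrArg (fun g => g x) H
        refine LinearMap.ext_on_range (hspan S) ?_
        rintro ⟨i, x⟩
        simp only [LinearMap.comp_apply, hmap, hL]
        split_ifs with hi
        · have hcomp : ∀ y, map f (map (char x) y) = map (char (f.app _ x)) y := by
            intro y
            suffices H : map f ∘ₗ map (char x) = map (char (f.app _ x)) from
              congrArg (fun g => g y) H
            refine LinearMap.ext_on_range (hspan _) ?_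
            rintro ⟨i, x⟩
            simp only [LinearMap.comp_apply, hmap]
            rw [← char_comp]
            rfl
          exact hcomp _
        · rw [hnat, hmap]
      · refine LinearMap.eqOn_span (f := D S ∘ₗ L S + L S ∘ₗ D S) (g := LinearMap.id)
          (s := {y | ∃ j x', dg j < N + 1 ∧ y = e S j x'}) ?_ hx
        rintro _ ⟨i, x, hi, rfl⟩
        simp only [LinearMap.add_apply, LinearMap.comp_apply, LinearMap.id_apply]
        have hle : D S (e S i x) ∈ F N S := by
          refine Submodule.span_mono ?_ (hlow S i x)
          rintro _ ⟨j, x', hj, rfl⟩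
          exact ⟨j, x', by omega, rfl⟩
        rw [hLh S _ hle, hL]
        split_ifs with hiN
        · rw [hD, hu i hiN, map_sub, hmap, char_top, hnat, ← hD, hmap, char_top, sub_add_cancel]
        · exact hh S _ (Submodule.subset_span ⟨i, x, by omega, rfl⟩)
  have hF : ∀ x, ∃ N, x ∈ F N S := by
    intro x
    have hx : x ∈ Submodule.span k (Set.range fun p : Σ i, S _⦋m i⦌ => e S p.1 p.2) := by
      rw [hspan]; trivial
    have hmono : ∀ {N N'}, N ≤ N' → F N S ≤ F N' S := fun h =>
      Submodule.span_mono fun _ ⟨j, x', hj, e⟩ => ⟨j, x', hj.trans_le h, e⟩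
    induction hx using Submodule.span_induction with
    | mem x hx =>
      obtain ⟨⟨i, x⟩, rfl⟩ := hx
      exact ⟨dg i + 1, Submodule.subset_span ⟨i, x, by omega, rfl⟩⟩
    | zero => exact ⟨0, Submodule.zero_mem _⟩
    | add x y _ _ hx hy =>
      obtain ⟨N, hN⟩ := hx
      obtain ⟨N', hN'⟩ := hy
      exact ⟨max N N', Submodule.add_mem _ (hmono (le_max_left _ _) hN)
        (hmono (le_max_right _ _) hN')⟩
    | smul c x _ hx =>
      obtain ⟨N, hN⟩ := hx
      exact ⟨N, Submodule.smul_mem _ _ hN⟩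
  obtain ⟨N, hN⟩ := hF x
  obtain ⟨h, -, hh⟩ := key N
  refine ⟨h S x, ?_⟩
  have := hh S x hN
  rwa [hx, map_zero, add_zero] at this

end SSetChains
end AcyclicModels

section KunnethSSet

open CategoryTheory Limits Simplicial AlgebraicTopology MonoidalCategory CartesianMonoidalCategory
open scoped DirectSum

variable {k : Type u} [Field k]

namespace SSetChains

/-! ### Chains of the standard simplex -/

/-- The vertex `0` of the standard simplex. -/
noncomputable def vertex (m : ℕ) : (Δ[m] : SSet.{u}) _⦋0⦌ := SSet.stdSimplex.obj₀Equiv.symm 0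

/-- The cone on a simplex of `Δ[m]`, with the vertex `0` as its apex. -/
noncomputable def cone {m n : ℕ} (x : (Δ[m] : SSet.{u}) _⦋n⦌) : (Δ[m] : SSet.{u}) _⦋n + 1⦌ :=
  SSet.stdSimplex.objMk (n := ⦋m⦌) (m := .op ⦋n + 1⦌)
    ⟨Fin.cons (α := fun _ => Fin (m + 1)) 0 fun i => x i, by
      intro i j
      induction i using Fin.cases with
      | zero => intro _; exact Fin.zero_le _
      | succ i =>
        induction j using Fin.cases with
        | zero => intro h; exact absurd h (by simp)
        | succ j =>
          intro h
          exact SSet.stdSimplex.monotone_apply x (Fin.succ_le_succ_iff.1 h)⟩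

lemma cone_zero {m n : ℕ} (x : (Δ[m] : SSet.{u}) _⦋n⦌) : cone x 0 = 0 := rfl

lemma cone_succ {m n : ℕ} (x : (Δ[m] : SSet.{u}) _⦋n⦌) (i : Fin (n + 1)) :
    cone x i.succ = x i := rfl

lemma δ_zero_cone {m n : ℕ} (x : (Δ[m] : SSet.{u}) _⦋n⦌) :
    (Δ[m] : SSet.{u}).δ 0 (cone x) = x := by
  refine SSet.stdSimplex.ext _ _ fun i => ?_
  rw [SSet.stdSimplex.δ_apply, Fin.succAbove_zero, cone_succ]

lemma δ_succ_cone {m n : ℕ} (x : (Δ[m] : SSet.{u}) _⦋n + 1⦌) (i : Fin (n + 2)) :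
    (Δ[m] : SSet.{u}).δ i.succ (cone x) = cone ((Δ[m] : SSet.{u}).δ i x) := by
  refine SSet.stdSimplex.ext _ _ fun j => ?_
  rw [SSet.stdSimplex.δ_apply]
  induction j using Fin.cases with
  | zero => rw [Fin.succ_succAbove_zero, cone_zero, cone_zero]
  | succ j => rw [Fin.succ_succAbove_succ, cone_succ, cone_succ, SSet.stdSimplex.δ_apply]

lemma δ_one_cone {m : ℕ} (x : (Δ[m] : SSet.{u}) _⦋0⦌) :
    (Δ[m] : SSet.{u}).δ 1 (cone x) = vertex m := by
  refine SSet.stdSimplex.ext _ _ fun j => ?_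
  rw [SSet.stdSimplex.δ_apply]
  obtain rfl : j = 0 := Subsingleton.elim (α := Fin 1) _ _
  rfl

variable (k) in
/-- The augmentation of chains. -/
noncomputable def aug (S : SSet.{u}) : Tot k S →ₗ[k] k := totExt k fun n _ => if n = 0 then 1 else 0

/-- The cone operation is a contraction of the chains of `Δ[m]` to the multiples of a vertex. -/
lemma dT_cone {m : ℕ} (a : Tot k (Δ[m] : SSet.{u})) :
    dT k _ (totExt k (fun _ x => tgen (cone x)) a) + totExt k (fun _ x => tgen (cone x)) (dT k _ a) =
      a - aug k _ a • tgen (vertex m) := by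
  let s : Tot k (Δ[m] : SSet.{u}) →ₗ[k] Tot k (Δ[m] : SSet.{u}) := totExt k fun _ x => tgen (cone x)
  suffices H : dT k _ ∘ₗ s + s ∘ₗ dT k _ =
      LinearMap.id - (aug k _).smulRight (tgen (vertex m)) from congrArg (fun g => g a) H
  refine tot_gen_ext fun n x => ?_
  simp only [s, LinearMap.add_apply, LinearMap.comp_apply, LinearMap.sub_apply, LinearMap.id_apply,
    LinearMap.smulRight_apply, totExt_tgen, aug]
  rw [dT_tgen_succ, Fin.sum_univ_succ, δ_zero_cone]
  rcases n with _ | n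
  · rw [dT_tgen_zero]
    simp [δ_one_cone, sub_eq_add_neg]
  · rw [dT_tgen_succ, map_sum]
    simp [δ_succ_cone, pow_succ]

/-! ### Products with a vertex -/

instance (q : ℕ) : Unique (Shuffle 0 q q) where
  default := ⟨⟨fun _ => 0, fun _ _ _ => le_refl _⟩, OrderHom.id, fun i => by simp⟩
  uniq s := by
    refine Shuffle.eq_of_fst fun j => Subsingleton.elim (α := Fin 1) _ _

lemma shuffle_zero_snd {q : ℕ} (s : Shuffle 0 q q) : s.snd = OrderHom.id := by
  rw [Unique.eq_default s]; rfl

lemma shuffle_zero_area {q : ℕ} (s : Shuffle 0 q q) : s.area = 0 := by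
  simp [Shuffle.area]

lemma op_id (S : SSet.{u}) {n : ℕ} (x : S _⦋n⦌) : op S OrderHom.id x = x := by
  have : (SimplexCategory.mkHom (OrderHom.id : Fin (n + 1) →o Fin (n + 1))) = 𝟙 ⦋n⦌ := rfl
  rw [op, this]
  simp

/-- The cross product with a vertex is induced by the inclusion of `T` at that vertex: there is only
one shuffle. -/
lemma crossT_vertex {S T : SSet.{u}} (x : S _⦋0⦌) (b : Tot k T) :
    crossT k S T (tgen x) b =
      tmap k (lift (SSet.const x) (𝟙 T) : T ⟶ (S ⊗ T : SSet.{u})) b := by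
  suffices H : crossT k S T (tgen x) = tmap k (lift (SSet.const x) (𝟙 T)) from
    congrArg (fun g => g b) H
  refine tot_gen_ext fun q y => ?_
  rw [crossT_tgen (n := q) (by omega), Fintype.sum_unique, shuffle_zero_area, shuffle_zero_snd, op_id,
    tmap_tgen, pow_zero, one_smul]
  congr 1

/-- The contraction of the standard simplex to the vertex `0`. -/
noncomputable def contract (m : ℕ) : (Δ[m] ⊗ Δ[1] : SSet.{u}) ⟶ Δ[m] where
  app n := TypeCat.ofHom fun x => SSet.stdSimplex.objMk (n := ⦋m⦌)
    ⟨fun i => if SSet.stdSimplex.asOrderHom x.2 i = 0 then 0 else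
      SSet.stdSimplex.asOrderHom x.1 i, by
      intro i j hij
      have h1 := (SSet.stdSimplex.asOrderHom x.1).monotone hij
      have h2 := (SSet.stdSimplex.asOrderHom x.2).monotone hij
      dsimp only
      split_ifs with hi hj hj
      · exact le_refl _
      · exact Fin.zero_le _
      · rw [hj] at h2; exact absurd (Fin.le_zero_iff.1 h2) hi
      · exact h1⟩
  naturality _ _ _ := rfl

/-- The product of the standard simplex with a simplicial set is homotopy equivalent to it. -/
noncomputable def contractProd (m : ℕ) (T : SSet.{u}) :
    SSet.Homotopy (snd (Δ[m] : SSet.{u}) T ≫ lift (SSet.const (vertex m)) (𝟙 T)) (𝟙 (Δ[m] ⊗ T)) where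
  h := lift (lift (fst _ _ ≫ fst _ _) (snd _ _) ≫ contract m) (fst _ _ ≫ snd _ _)
  h₀ := rfl
  h₁ := by
    refine CartesianMonoidalCategory.hom_ext _ _ ?_ rfl
    ext n x
    refine SSet.stdSimplex.objEquiv.injective ?_
    ext i : 3
    exact if_neg (t := (0 : Fin (m + 1))) (by decide : ¬ (1 : Fin 2) = 0)
  rel := by
    refine NatTrans.ext (funext fun n => ?_)
    ext x
    exact (x.1.2 : False).elim

lemma hmap_id {S : SSet.{u}} (h : HT k S) : hmap k (𝟙 S) h = h := by
  obtain ⟨z, hz⟩ := IsRep.exists_rep h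
  have := hz.map (𝟙 S)
  rw [tmap_id] at this
  exact this.unique hz

/-- A cycle of `Δ[m] × T` is homologous to the product of a vertex with its projection to `T`. -/
lemma exists_contract {m : ℕ} {T : SSet.{u}} {z : Tot k (Δ[m] ⊗ T : SSet.{u})}
    (hz : dT k _ z = 0) : ∃ u, dT k _ u = crossT k _ _ (tgen (vertex m)) (tmap k (snd _ _) z) - z := by
  obtain ⟨h, hh⟩ := IsRep.of_cycle hz
  rw [crossT_vertex, ← tmap_comp]
  refine ((hh.map _).sub_eq_iff hh).1 ?_
  have e : hmap k (snd (Δ[m] : SSet.{u}) T ≫ lift (SSet.const (vertex m)) (𝟙 T)) = hmap k (𝟙 _) := by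
    unfold hmap
    congr 1
    funext n
    rw [(contractProd m T).congr_homologyMap]
  rw [e, hmap_id]

lemma snd_crossT_vertex {S T : SSet.{u}} (x : S _⦋0⦌) (b : Tot k T) :
    tmap k (snd S T) (crossT k S T (tgen x) b) = b := by
  rw [crossT_vertex, ← tmap_comp, lift_snd, tmap_id]

/-! ### The Künneth theorem for simplicial sets -/

section

variable {B : Type u} {T : SSet.{u}} (W : B → Tot k T)

/-- The map `(f_b) ↦ ∑ f_b × W b`. -/
noncomputable def crossFam (S : SSet.{u}) : (B →₀ Tot k S) →ₗ[k] Tot k (S ⊗ T : SSet.{u}) :=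
  Finsupp.lsum k fun b => (crossT k S T).flip (W b)

lemma crossFam_single (S : SSet.{u}) (b : B) (f : Tot k S) :
    crossFam W S (Finsupp.single b f) = crossT k S T f (W b) := by
  simp [crossFam]

lemma dT_crossT_cycle {S T : SSet.{u}} (a : Tot k S) {w : Tot k T} (hw : dT k T w = 0) :
    dT k _ (crossT k S T a w) = crossT k S T (dT k S a) w := by
  suffices H : dT k _ ∘ₗ (crossT k S T).flip w = (crossT k S T).flip w ∘ₗ dT k S from
    congrArg (fun g => g a) H
  refine tot_hom_ext fun n x => ?_
  simp only [LinearMap.comp_apply, LinearMap.flip_apply]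
  rw [leibniz_inc, hw, map_zero, smul_zero, add_zero]

lemma dT_crossFam (hW : ∀ b, dT k T (W b) = 0) (S : SSet.{u}) (f : B →₀ Tot k S) :
    dT k _ (crossFam W S f) = crossFam W S (Finsupp.mapRange.linearMap (dT k S) f) := by
  suffices H : dT k _ ∘ₗ crossFam W S = crossFam W S ∘ₗ Finsupp.mapRange.linearMap (dT k S) from
    congrArg (fun g => g f) H
  refine Finsupp.lhom_ext fun b a => ?_
  simp only [LinearMap.comp_apply, Finsupp.mapRange.linearMap_apply, Finsupp.mapRange_single,
    crossFam_single, dT_crossT_cycle _ (hW b)]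

/-- The mapping cone of `crossFam W S`. -/
abbrev ConeT (B : Type u) (T S : SSet.{u}) : Type u := (B →₀ Tot k S) × Tot k (S ⊗ T : SSet.{u})

/-- The differential of the mapping cone. -/
noncomputable def coneD (S : SSet.{u}) : ConeT (k := k) B T S →ₗ[k] ConeT (k := k) B T S :=
  LinearMap.prod (-(Finsupp.mapRange.linearMap (dT k S) ∘ₗ LinearMap.fst k _ _))
    (crossFam W S ∘ₗ LinearMap.fst k _ _ + dT k _ ∘ₗ LinearMap.snd k _ _)

lemma coneD_apply (S : SSet.{u}) (f : B →₀ Tot k S) (g : Tot k (S ⊗ T : SSet.{u})) :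
    coneD W S (f, g) = (-Finsupp.mapRange.linearMap (dT k S) f, crossFam W S f + dT k _ g) := rfl

lemma mapRange_dT_dT (S : SSet.{u}) (f : B →₀ Tot k S) : Finsupp.mapRange.linearMap (dT k S)
    (Finsupp.mapRange.linearMap (dT k S) f) = 0 := by
  ext b : 1
  simp [dT_dT]

/-- The generators of the mapping cone are indexed by these pairs and the simplices of `S`. -/
abbrev ConeI (B : Type u) (T : SSet.{u}) : Type u := (B × ℕ) ⊕ (Σ n : ℕ, T _⦋n⦌)

/-- The dimension of the simplices of `S` which occur in a generator. -/
def coneDim : ConeI B T → ℕ := Sum.elim Prod.snd Sigma.fst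

variable (k) in
/-- The generators of the mapping cone. -/
noncomputable def coneGen (S : SSet.{u}) : ∀ i : ConeI B T, S _⦋coneDim i⦌ → ConeT (k := k) B T S :=
  Sum.rec (fun i x => (Finsupp.single i.1 (tgen (n := i.2) x), 0))
    (fun i x => (0, tgen (n := i.1) (pair x i.2)))

lemma inc_mem_span {S : SSet.{u}} {n : ℕ} (a : C k S n) :
    inc k S n a ∈ Submodule.span k (Set.range (tgen (k := k) (S := S) (n := n))) := by
  rw [← Submodule.Quotient.mk_eq_zero]
  suffices H : Submodule.mkQ (Submodule.span k (Set.range (tgen (k := k) (S := S) (n := n)))) ∘ₗ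
      inc k S n = 0 from congrArg (fun g => g a) H
  refine hom_ext fun x => ?_
  exact (Submodule.Quotient.mk_eq_zero _).2 (Submodule.subset_span ⟨x, rfl⟩)

lemma span_tgen (S : SSet.{u}) : Submodule.span k
    (Set.range fun p : Σ n, S _⦋n⦌ => tgen (k := k) p.2) = ⊤ := by
  rw [eq_top_iff]
  rintro a -
  induction a using DirectSum.induction_on with
  | zero => exact Submodule.zero_mem _
  | of n a =>
    refine Submodule.span_mono ?_ (inc_mem_span a)
    rintro _ ⟨x, rfl⟩
    exact ⟨⟨n, x⟩, rfl⟩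
  | add x y hx hy => exact Submodule.add_mem _ hx hy

lemma dT_tgen_mem {S : SSet.{u}} {n : ℕ} (x : S _⦋n⦌) : dT k S (tgen x) ∈ Submodule.span k
    {y | ∃ m, ∃ x' : S _⦋m⦌, m < n ∧ y = tgen x'} := by
  rcases n with _ | n
  · rw [dT_tgen_zero]; exact Submodule.zero_mem _
  · rw [dT_tgen_succ]
    refine Submodule.sum_mem _ fun i _ => ?_
    have h : tgen (k := k) (S.δ i x) ∈ Submodule.span k
        {y | ∃ m, ∃ x' : S _⦋m⦌, m < n + 1 ∧ y = tgen x'} :=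
      Submodule.subset_span ⟨n, S.δ i x, by omega, rfl⟩
    exact zsmul_mem h _

/-- The mapping cone of `crossFam W S` is exact for `S = Δ[m]`: up to boundaries, the chains of
`Δ[m]` may be replaced by the multiples of the vertex, and the chains of `Δ[m] ⊗ T` by those
of `T`. -/
lemma coneD_exact_simplex (hW : ∀ b, dT k T (W b) = 0)
    (hW1 : ∀ (c : B →₀ k) u, dT k T u = Finsupp.linearCombination k W c → c = 0)
    (hW2 : ∀ z, dT k T z = 0 → ∃ c u, z = Finsupp.linearCombination k W c + dT k T u)
    (m : ℕ) (x : ConeT (k := k) B T Δ[m]) (hx : coneD W _ x = 0) : ∃ y, coneD W _ y = x := by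
  obtain ⟨f, g⟩ := x
  rw [coneD_apply, Prod.mk_eq_zero, neg_eq_zero] at hx
  obtain ⟨h1, h2⟩ := hx
  let v : Tot k (Δ[m] : SSet.{u}) := tgen (vertex m)
  have hv : dT k _ v = 0 := dT_tgen_zero _ _
  let s : Tot k (Δ[m] : SSet.{u}) →ₗ[k] Tot k (Δ[m] : SSet.{u}) := totExt k fun _ x => tgen (cone x)
  let V : (B →₀ k) →ₗ[k] B →₀ Tot k (Δ[m] : SSet.{u}) :=
    Finsupp.mapRange.linearMap (LinearMap.toSpanSingleton k _ v)
  have hV : ∀ c, Finsupp.mapRange.linearMap (dT k _) (V c) = 0 := by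
    intro c
    ext b : 1
    simp [V, hv]
  have hcV : ∀ c, crossFam W _ (V c) = crossT k _ _ v (Finsupp.linearCombination k W c) := by
    intro c
    suffices H : crossFam W _ ∘ₗ V = crossT k _ _ v ∘ₗ Finsupp.linearCombination k W from
      congrArg (fun g => g c) H
    refine Finsupp.lhom_ext fun b a => ?_
    simp [V, crossFam_single]
  have hvd : ∀ u, crossT k _ T v (dT k _ u) = dT k _ (crossT k _ T v u) := by
    intro u
    rw [crossT_vertex, crossT_vertex, dT_tmap]
  have hf : f = Finsupp.mapRange.linearMap (dT k _) (Finsupp.mapRange.linearMap s f) +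
      V (Finsupp.mapRange.linearMap (aug k _) f) := by
    ext b : 1
    have hb : dT k _ (f b) = 0 := by
      have := congrArg (fun f => f b) h1
      simpa using this
    have := dT_cone (f b)
    rw [hb, map_zero, add_zero] at this
    simp only [Finsupp.coe_add, Pi.add_apply, Finsupp.mapRange.linearMap_apply,
      Finsupp.mapRange_apply, V, s, LinearMap.toSpanSingleton_apply, this, v]
    abel
  set f' := Finsupp.mapRange.linearMap s f
  set c := Finsupp.mapRange.linearMap (aug k _) f
  have h3 : dT k _ (crossFam W _ f' + g) =
      - crossT k _ _ v (Finsupp.linearCombination k W c) := by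
    rw [hf, map_add, hcV, ← dT_crossFam W hW] at h2
    rw [map_add, eq_neg_iff_add_eq_zero, ← h2]
    abel
  have hc : c = 0 := by
    refine hW1 c (-(tmap k (snd _ _) (crossFam W _ f' + g))) ?_
    rw [map_neg, dT_tmap, h3, map_neg, neg_neg, snd_crossT_vertex]
  rw [hc, map_zero, map_zero, neg_zero] at h3
  rw [hc, map_zero, add_zero] at hf
  obtain ⟨u, hu⟩ := exists_contract h3
  obtain ⟨c', u', hu'⟩ := hW2 (tmap k (snd _ _) (crossFam W _ f' + g)) (by
    rw [dT_tmap, h3, map_zero])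
  rw [hu', map_add, hvd, ← hcV] at hu
  refine ⟨(V c' - f', crossT k _ _ v u' - u), ?_⟩
  rw [coneD_apply]
  refine Prod.ext ?_ ?_
  · rw [map_sub, hV, zero_sub, neg_neg]; exact hf.symm
  · simp only [map_sub, hu]; abel

/-- The mapping cone of `crossFam W S` is exact for all `S`, if `W` consists of cycles whose classes
form a basis of the homology of `T`. As a functor of `S` the cone is free on models. In order that the
differential lowers the degree of generators, `(b, x)` with `x` of dimension `n` is given the degree
of a suspension of `x × W b`, namely `n + dg b + 1`. -/
theorem coneD_exact (dg : B → ℕ) (w : ∀ b, C k T (dg b)) (hw : ∀ b, W b = inc k T (dg b) (w b))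
    (hW : ∀ b, dT k T (W b) = 0)
    (hW1 : ∀ (c : B →₀ k) u, dT k T u = Finsupp.linearCombination k W c → c = 0)
    (hW2 : ∀ z, dT k T z = 0 → ∃ c u, z = Finsupp.linearCombination k W c + dT k T u)
    (S : SSet.{u}) (x : ConeT (k := k) B T S) (hx : coneD W S x = 0) : ∃ y, coneD W S y = x := by
  refine exact_of_models (k := k) (fun S => ConeT (k := k) B T S)
    (fun f => LinearMap.prodMap (Finsupp.mapRange.linearMap (tmap k f)) (tmap k (f ⊗ₘ 𝟙 T)))
    (I := ConeI B T) coneDim (Sum.elim (fun i => i.2 + dg i.1 + 1) Sigma.fst) (coneGen k)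
    ?_ ?_ (coneD W) ?_ ?_ ?_ ?_ ?_ S x hx
  · intro S v
    refine ⟨LinearMap.coprod (Finsupp.lsum k fun b => totExt k fun n x => v (.inl (b, n)) x)
      (totExt k fun n x => v (.inr ⟨n, x.2⟩) x.1), ?_⟩
    rintro (⟨b, n⟩ | ⟨n, y⟩) x
    · simp only [coneGen, LinearMap.coprod_apply, map_zero, add_zero, Finsupp.lsum_single]
      exact totExt_tgen _ (n := n) x
    · simp only [coneGen, LinearMap.coprod_apply, map_zero, zero_add]
      exact totExt_tgen _ (n := n) (pair x y)
  · intro S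
    rw [eq_top_iff]
    rintro ⟨f, g⟩ -
    rw [← add_zero f, ← zero_add g, ← Prod.mk_add_mk]
    refine Submodule.add_mem _ ?_ ?_
    · have : (f, (0 : Tot k (S ⊗ T : SSet.{u}))) = ∑ b ∈ f.support, (Finsupp.single b (f b), 0) := by
        conv_lhs => rw [← Finsupp.sum_single f]
        exact Prod.ext (by simp [Prod.fst_sum, Finsupp.sum]) (by simp [Prod.snd_sum])
      rw [this]
      refine Submodule.sum_mem _ fun b _ => ?_
      have h : f b ∈ (⊤ : Submodule k (Tot k S)) := trivial
      rw [← span_tgen] at h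
      have h2 := Submodule.mem_map_of_mem (f := LinearMap.inl k (B →₀ Tot k S)
        (Tot k (S ⊗ T : SSet.{u})) ∘ₗ Finsupp.lsingle b) h
      rw [Submodule.map_span] at h2
      refine Submodule.span_mono ?_ h2
      rintro _ ⟨_, ⟨⟨n, x⟩, rfl⟩, rfl⟩
      exact ⟨⟨.inl (b, n), x⟩, rfl⟩
    · have h : g ∈ (⊤ : Submodule k (Tot k (S ⊗ T : SSet.{u}))) := trivial
      rw [← span_tgen] at h
      have h2 := Submodule.mem_map_of_mem (f := LinearMap.inr k (B →₀ Tot k S)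
        (Tot k (S ⊗ T : SSet.{u}))) h
      rw [Submodule.map_span] at h2
      refine Submodule.span_mono ?_ h2
      rintro _ ⟨_, ⟨⟨n, x⟩, rfl⟩, rfl⟩
      exact ⟨⟨.inr ⟨n, x.2⟩, x.1⟩, rfl⟩
  · rintro S ⟨f, g⟩
    rw [coneD_apply, coneD_apply, map_neg, mapRange_dT_dT, map_neg, map_add, dT_crossFam W hW, dT_dT]
    simp
  · rintro S S' f (⟨b, n⟩ | ⟨n, y⟩) x
    · simp only [coneGen, LinearMap.prodMap_apply, Finsupp.mapRange.linearMap_apply,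
        Finsupp.mapRange_single, map_zero]
      exact Prod.ext (congrArg (Finsupp.single b) (tmap_tgen f (n := n) x)) rfl
    · simp only [coneGen, LinearMap.prodMap_apply, map_zero]
      exact Prod.ext rfl (tmap_tgen (f ⊗ₘ 𝟙 T) (n := n) (pair x y))
  · rintro S S' f ⟨a, g⟩
    simp only [LinearMap.prodMap_apply, coneD_apply, map_neg, map_add, dT_tmap]
    refine Prod.ext ?_ ?_
    · ext b : 1
      simp [dT_tmap]
    · simp only [add_left_inj]
      suffices H : crossFam W S' ∘ₗ Finsupp.mapRange.linearMap (tmap k f) =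
        tmap k (f ⊗ₘ 𝟙 T) ∘ₗ crossFam W S from congrArg (fun g => g a) H
      refine Finsupp.lhom_ext fun b a => ?_
      simp only [LinearMap.comp_apply, Finsupp.mapRange.linearMap_apply, Finsupp.mapRange_single,
        crossFam_single]
      rw [crossT_map, tmap_id]
  · rintro S (⟨b, n⟩ | ⟨n, y⟩) x
    · have h1 := Submodule.mem_map_of_mem (f := LinearMap.inl k (B →₀ Tot k S)
        (Tot k (S ⊗ T : SSet.{u})) ∘ₗ Finsupp.lsingle b) (dT_tgen_mem (k := k) (n := n) x)
      have h2 := Submodule.mem_map_of_mem (f := LinearMap.inr k (B →₀ Tot k S)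
        (Tot k (S ⊗ T : SSet.{u}))) (inc_mem_span (cross k S T n (dg b) (n + dg b)
          (gen (n := n) x) (w b)))
      rw [Submodule.map_span] at h1 h2
      have h3 : coneD W S (coneGen k S (.inl (b, n)) x) =
          -(LinearMap.inl k (B →₀ Tot k S) (Tot k (S ⊗ T : SSet.{u})) ∘ₗ Finsupp.lsingle b)
            (dT k S (tgen (n := n) x)) + LinearMap.inr k (B →₀ Tot k S)
              (Tot k (S ⊗ T : SSet.{u})) (inc k _ (n + dg b) (cross k S T n (dg b) (n + dg b)
          (gen (n := n) x) (w b))) := by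
        rw [← crossT_inc rfl, ← hw b, show coneGen k S (.inl (b, n)) x =
          (Finsupp.single b (tgen (n := n) x), 0) from rfl, coneD_apply]
        refine Prod.ext ?_ ?_
        · simp
        · simp [crossFam_single, tgen]
      rw [h3]
      refine Submodule.add_mem _ (Submodule.neg_mem _ (Submodule.span_mono ?_ h1))
        (Submodule.span_mono ?_ h2)
      · rintro _ ⟨_, ⟨m, x', hm, rfl⟩, rfl⟩
        exact ⟨.inl (b, m), x', by simp only [Sum.elim_inl]; omega, rfl⟩
      · rintro _ ⟨_, ⟨x', rfl⟩, rfl⟩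
        exact ⟨.inr ⟨n + dg b, x'.2⟩, x'.1, by simp, rfl⟩
    · have h1 := Submodule.mem_map_of_mem (f := LinearMap.inr k (B →₀ Tot k S)
        (Tot k (S ⊗ T : SSet.{u}))) (dT_tgen_mem (k := k) (n := n) (pair (n := n) x y))
      rw [Submodule.map_span] at h1
      have h3 : coneD W S (coneGen k S (.inr ⟨n, y⟩) x) = LinearMap.inr k (B →₀ Tot k S)
          (Tot k (S ⊗ T : SSet.{u})) (dT k _ (tgen (n := n) (pair x y))) := by
        rw [show coneGen k S (.inr ⟨n, y⟩) x = (0, tgen (n := n) (pair x y)) from rfl, coneD_apply]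
        simp
      rw [h3]
      refine Submodule.span_mono ?_ h1
      rintro _ ⟨_, ⟨m, x', hm, rfl⟩, rfl⟩
      exact ⟨.inr ⟨m, x'.2⟩, x'.1, hm, rfl⟩
  · exact fun m => coneD_exact_simplex W hW hW1 hW2 m

end

end SSetChains
end KunnethSSet

section KunnethSSet

open CategoryTheory Limits Simplicial AlgebraicTopology MonoidalCategory CartesianMonoidalCategory
open scoped DirectSum TensorProduct

variable {k : Type u} [Field k]

namespace SSetChains

/-! ### The Künneth isomorphism for simplicial sets -/

variable (k) in
/-- The cross product in the homology of simplicial sets, for classes of all degrees. -/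
noncomputable def crossHT (S T : SSet.{u}) :
    HT k S →ₗ[k] HT k T →ₗ[k] HT k (S ⊗ T : SSet.{u}) :=
  DirectSum.toModule k ℕ _ fun p => LinearMap.flip (DirectSum.toModule k ℕ _ fun q =>
    LinearMap.flip ((crossH (k := k) S T (p := p) (q := q) rfl).compr₂
      (DirectSum.lof k ℕ (fun n => (H k (S ⊗ T : SSet.{u}) n : Type u)) (p + q))))

lemma IsRep.cross {S T : SSet.{u}} {z : Tot k S} {w : Tot k T} {h : HT k S} {h' : HT k T}
    (hz : IsRep z h) (hw : IsRep w h') : IsRep (crossT k S T z w) (crossHT k S T h h') := by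
  obtain ⟨ζ, rfl, rfl⟩ := hz
  obtain ⟨ω, rfl, rfl⟩ := hw
  induction ζ using DirectSum.induction_on with
  | zero => simpa using IsRep.zero
  | add x y hx hy => simpa only [map_add, LinearMap.add_apply] using hx.add hy
  | of p z =>
    induction ω using DirectSum.induction_on with
    | zero => simpa using IsRep.zero
    | add x y hx hy => simpa only [map_add] using hx.add hy
    | of q w =>
      have h1 := isRep_inc (crossZ S T rfl z w)
      rw [← crossH_cls] at h1
      rw [← DirectSum.lof_eq_of k, ← DirectSum.lof_eq_of k, ztot_lof, ztot_lof, hcl_lof, hcl_lof,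
        crossT_inc rfl, crossHT, DirectSum.toModule_lof, LinearMap.flip_apply,
        DirectSum.toModule_lof]
      exact h1

lemma crossFam_apply {B : Type u} {T : SSet.{u}} (W : B → Tot k T) (S : SSet.{u})
    (f : B →₀ Tot k S) : crossFam W S f = ∑ b ∈ f.support, crossT k S T (f b) (W b) := by
  simp [crossFam, Finsupp.sum]

/-- The Künneth theorem for simplicial sets. With cycles `W b` representing a basis of the homology
of `T`, an element of the tensor product is a family of homology classes of `S`, and its image is
represented by `crossFam W S` of cycles representing these. Exactness of the mapping cone at
elements `(Z, -u)` is injectivity, and at elements `(0, g)` it is surjectivity. -/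
theorem crossHT_bijective (S T : SSet.{u}) :
    Function.Bijective (TensorProduct.lift (crossHT k S T)) := by
  classical
  let y := DFinsupp.basis (R := k) fun q => Module.Basis.ofVectorSpace k (H k T q)
  have hrep : ∀ b, ∃ w : Z k T b.1, IsRep (inc k T b.1 w) (y b) := by
    rintro ⟨q, j⟩
    obtain ⟨w, hw⟩ := cls_surjective T q (Module.Basis.ofVectorSpace k (H k T q) j)
    refine ⟨w, ?_⟩
    have h := isRep_inc w
    rw [hw] at h
    convert h using 1
    simp [y, DFinsupp.basis]
    rfl
  choose w hw using hrep
  let W : _ → Tot k T := fun b => inc k T b.1 (w b)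
  have hlc : ∀ c, IsRep (Finsupp.linearCombination k W c) (Finsupp.linearCombination k y c) :=
    fun c => by
      rw [Finsupp.linearCombination_apply, Finsupp.linearCombination_apply]
      exact IsRep.sum _ fun b => (hw b).smul _
  have hex := coneD_exact W (fun b => b.1) (fun b => w b) (fun b => rfl) (fun b => (hw b).cycle)
    (fun c u hu => by
      have := (hlc c).eq_zero_iff.2 ⟨u, hu⟩
      exact (linearIndependent_iff.1 y.linearIndependent) c this)
    (fun z hz => by
      obtain ⟨h, hh⟩ := IsRep.of_cycle hz
      have h1 := hlc (y.repr h)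
      rw [y.linearCombination_repr] at h1
      obtain ⟨u, hu⟩ := (hh.sub_eq_iff h1).1 rfl
      exact ⟨_, u, by rw [hu]; abel⟩) S
  let e := TensorProduct.equivFinsuppOfBasisRight (M := HT k S) y
  have he : ∀ f, TensorProduct.lift (crossHT k S T) (e.symm f) =
      ∑ b ∈ f.support, crossHT k S T (f b) (y b) := by
    intro f
    simp only [e, TensorProduct.equivFinsuppOfBasisRight_symm_apply, Finsupp.sum, map_sum,
      TensorProduct.lift.tmul]
  rw [← Function.Bijective.of_comp_iff _ e.symm.bijective]
  constructor
  · rw [← LinearEquiv.coe_toLinearMap, ← LinearMap.coe_comp, injective_iff_map_eq_zero]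
    intro f hf
    rw [LinearMap.comp_apply, LinearEquiv.coe_coe, he] at hf
    choose z hz using fun b => IsRep.exists_rep (f b)
    let Z : _ →₀ Tot k S := Finsupp.onFinset f.support (fun b => if f b = 0 then 0 else z b)
      (fun b hb => by
        by_contra h
        simp at h
        simp [h] at hb)
    have hZ : ∀ b, IsRep (Z b) (f b) := by
      intro b
      simp only [Z, Finsupp.onFinset_apply]
      split_ifs with h
      · rw [h]; exact IsRep.zero
      · exact hz b
    have h1 : IsRep (crossFam W S Z) 0 := by
      rw [← hf]
      have : crossFam W S Z = ∑ b ∈ f.support, crossT k S T (Z b) (W b) := by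
        rw [crossFam_apply]
        refine Finset.sum_subset Finsupp.support_onFinset_subset fun b _ hb => ?_
        rw [Finsupp.notMem_support_iff.1 hb, map_zero, LinearMap.zero_apply]
      rw [this]
      exact IsRep.sum _ fun b => (hZ b).cross (hw b)
    obtain ⟨u, hu⟩ := h1.eq_zero_iff.1 rfl
    obtain ⟨⟨a, a'⟩, ha⟩ := hex (Z, -u) (by
      rw [coneD_apply, map_neg, hu]
      refine Prod.ext ?_ (by simp)
      ext b : 1
      simp [(hZ b).cycle])
    rw [coneD_apply] at ha
    ext b : 1
    refine (hZ b).eq_zero_iff.2 ⟨-(a b), ?_⟩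
    have := congrArg (fun f => f b) (congrArg Prod.fst ha)
    simpa using this
  · intro h
    obtain ⟨g, hg⟩ := IsRep.exists_rep h
    obtain ⟨⟨a, a'⟩, ha⟩ := hex (0, g) (by rw [coneD_apply, hg.cycle]; simp)
    rw [coneD_apply, Prod.mk.injEq] at ha
    have ha1 : ∀ b, ∃ f, IsRep (a b) f := fun b => by
      refine IsRep.of_cycle ?_
      have := congrArg (fun f => f b) ha.1
      simpa using this
    choose f hf using ha1
    let F : _ →₀ HT k S := Finsupp.onFinset a.support f (fun b hb => by
      rw [Finsupp.mem_support_iff]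
      intro h0
      refine hb ((hf b).eq_zero_iff.2 ⟨0, by rw [h0, map_zero]⟩))
    refine ⟨F, ?_⟩
    have h1 : IsRep (crossFam W S a) (TensorProduct.lift (crossHT k S T) (e.symm F)) := by
      have : ∑ b ∈ F.support, crossHT k S T (F b) (y b) =
          ∑ b ∈ a.support, crossHT k S T (F b) (y b) := by
        refine Finset.sum_subset Finsupp.support_onFinset_subset fun b _ hb => ?_
        rw [Finsupp.notMem_support_iff.1 hb, map_zero, LinearMap.zero_apply]
      rw [he, crossFam_apply, this]
      exact IsRep.sum _ fun b => (hf b).cross (hw b)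
    exact (h1.sub_eq_iff hg).2 ⟨-a', by rw [← ha.2, map_neg]; abel⟩

end SSetChains
end KunnethSSet

namespace Shuffle

variable {p q r m n N : ℕ}

/-! ### Commutativity and associativity of shuffles -/

lemma sum_min_add_sum_min (p q : ℕ) : ∑ i : Fin (p + q + 1), min (i : ℕ) p +
    ∑ i : Fin (p + q + 1), min (i : ℕ) q = ∑ i : Fin (p + q + 1), (i : ℕ) + p * q := by
  induction p with
  | zero =>
    rw [zero_mul, add_zero, Finset.sum_eq_zero (fun i _ => by simp), zero_add]
    exact Finset.sum_congr rfl fun i _ => min_eq_left (by omega)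
  | succ p ih =>
    rw [show p + 1 + q = p + q + 1 by omega, sum_min_succ, sum_min_castSucc _ q (by omega),
      Fin.sum_univ_castSucc (fun i : Fin (p + q + 1 + 1) => (i : ℕ)), Nat.succ_mul]
    simp only [Fin.val_castSucc, Fin.val_last]
    omega

/-- A path and its reflection divide the rectangle into two complementary parts. -/
lemma area_add_swap_area (s : Shuffle p q n) (h : p + q = n) : s.area + s.swap.area = p * q := by
  subst h
  have e1 := area_add s
  have e2 := area_add s.swap
  have e3 := sum_add_sum s
  have e4 := sum_min_add_sum_min p q
  change _ + ∑ i, (s.snd i : ℕ) = _ at e2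
  omega

/-- The first coordinate of a path as a function on `ℕ`, constant from `n` on. -/
def x (s : Shuffle p q n) (j : ℕ) : ℕ := s.fst ⟨min j n, by omega⟩

/-- The second coordinate of a path as a function on `ℕ`, constant from `n` on. -/
def y (s : Shuffle p q n) (j : ℕ) : ℕ := s.snd ⟨min j n, by omega⟩

lemma x_add_y (s : Shuffle p q n) {j : ℕ} (hj : j ≤ n) : s.x j + s.y j = j := by
  have := s.add_eq ⟨min j n, by omega⟩
  simpa [x, y, hj] using this

lemma x_mono (s : Shuffle p q n) (j : ℕ) : s.x j ≤ s.x (j + 1) :=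
  s.fst_le (by simp only; omega)

lemma y_mono (s : Shuffle p q n) (j : ℕ) : s.y j ≤ s.y (j + 1) :=
  s.snd_le (by simp only; omega)

lemma x_zero (s : Shuffle p q n) : s.x 0 = 0 := by
  have := s.x_add_y (Nat.zero_le _); omega

lemma x_eq (s : Shuffle p q n) (j : Fin (n + 1)) : (s.fst j : ℕ) = s.x j := by
  simp only [x]; congr 2; ext; simp only; omega

lemma y_eq (s : Shuffle p q n) (j : Fin (n + 1)) : (s.snd j : ℕ) = s.y j := by
  simp only [y]; congr 2; ext; simp only; omega

lemma x_le (s : Shuffle p q n) (j : ℕ) : s.x j ≤ p := Nat.lt_succ_iff.1 (s.fst _).2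

lemma y_le (s : Shuffle p q n) (j : ℕ) : s.y j ≤ q := Nat.lt_succ_iff.1 (s.snd _).2

lemma x_last (s : Shuffle p q n) (h : p + q = n) : s.x n = p := by
  have := s.x_add_y le_rfl
  have := s.x_le n
  have := s.y_le n
  omega

/-- The area as the number of pairs of steps of which the vertical one is the first. -/
lemma area_eq (s : Shuffle p q n) (h : p + q = n) :
    (s.area : ℤ) = ∑ j ∈ Finset.range n, ((s.x (j + 1) : ℤ) - s.x j) * s.y j := by
  have key : ∀ m ≤ n, ∑ j ∈ Finset.range m, ((s.x (j + 1) : ℤ) - s.x j) * s.y j +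
      ∑ i ∈ Finset.range (m + 1), (s.x i : ℤ) = ∑ i : Fin (m + 1), (min (i : ℕ) (s.x m) : ℕ) := by
    intro m
    induction m with
    | zero => intro _; simp [x_zero]
    | succ m ih =>
      intro hm
      have ih := ih (by omega)
      rw [Finset.sum_range_succ, Finset.sum_range_succ _ (m + 1)]
      have h1 := s.x_add_y hm
      have h2 := s.x_add_y (show m ≤ n by omega)
      have h3 := s.x_mono m
      have h4 := s.y_mono m
      rcases (show s.x (m + 1) = s.x m ∨ s.x (m + 1) = s.x m + 1 by omega) with hx | hx
      · rw [hx, sub_self, zero_mul, add_zero, sum_min_castSucc _ _ (by omega)]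
        push_cast at ih ⊢
        linarith
      · rw [hx, sum_min_succ]
        have : (s.y m : ℤ) = m - s.x m := by omega
        push_cast at ih ⊢
        linarith
  have h1 := key n le_rfl
  rw [x_last s h] at h1
  have h2 := area_add s
  have h3 : ∑ i, (s.fst i : ℕ) = ∑ i ∈ Finset.range (n + 1), s.x i := by
    rw [← Fin.sum_univ_eq_sum_range]
    exact Finset.sum_congr rfl fun i _ => s.x_eq i
  rw [h3] at h2
  have h4 : (s.area : ℤ) + ∑ i ∈ Finset.range (n + 1), (s.x i : ℤ) =
    ∑ i : Fin (n + 1), (min (i : ℕ) p : ℕ) := by exact_mod_cast h2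
  linarith

/-- The area may be computed along any path which covers it with steps of length at most one. -/
lemma area_eq_comp (s : Shuffle p q n) (h : p + q = n) (f : ℕ → ℕ) (hf0 : f 0 = 0)
    (hfN : f N = n) (hf : ∀ j < N, f (j + 1) = f j ∨ f (j + 1) = f j + 1) :
    (s.area : ℤ) = ∑ j ∈ Finset.range N, ((s.x (f (j + 1)) : ℤ) - s.x (f j)) * s.y (f j) := by
  rw [area_eq s h, show Finset.range n = Finset.range (f N) by rw [hfN]]
  have key : ∀ J ≤ N, ∑ j ∈ Finset.range (f J), ((s.x (j + 1) : ℤ) - s.x j) * s.y j =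
      ∑ j ∈ Finset.range J, ((s.x (f (j + 1)) : ℤ) - s.x (f j)) * s.y (f j) := by
    intro J
    induction J with
    | zero => intro _; simp [hf0]
    | succ J ih =>
      intro hJ
      rw [Finset.sum_range_succ, ← ih (by omega)]
      rcases hf J hJ with h | h
      · rw [h]; ring
      · rw [h, Finset.sum_range_succ]
  exact key N le_rfl

/-- A lattice path from `(0, 0, 0)` to `(p, q, r)`. -/
@[ext]
structure Tri (p q r N : ℕ) where
  a : Fin (N + 1) →o Fin (p + 1)
  b : Fin (N + 1) →o Fin (q + 1)
  c : Fin (N + 1) →o Fin (r + 1)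
  add_eq : ∀ i, (a i : ℕ) + (b i : ℕ) + (c i : ℕ) = (i : ℕ)

/-- Reversal of the order of the coordinates. -/
def Tri.rev (t : Tri p q r N) : Tri r q p N :=
  ⟨t.c, t.b, t.a, fun i => by have := t.add_eq i; omega⟩

/-- The composition of two paths. -/
def toTri (x : Shuffle p q m × Shuffle m r N) : Tri p q r N :=
  ⟨x.1.fst.comp x.2.fst, x.1.snd.comp x.2.fst, x.2.snd, fun i => by
    have h1 := x.1.add_eq (x.2.fst i)
    have h2 := x.2.add_eq i
    simp only [OrderHom.comp_coe, Function.comp_apply]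
    omega⟩

lemma fst_surjective (s : Shuffle p q n) (h : p + q = n) (i : Fin (p + 1)) : ∃ j, s.fst j = i := by
  obtain ⟨j, -, -, hj, h1, h2⟩ := s.exists_cut h i.castSucc
  simp only [Fin.val_castSucc] at hj h2
  exact ⟨⟨j, by omega⟩, Fin.ext (hj _ rfl)⟩

lemma toTri_bijective (h : p + q = m) (h' : m + r = N) :
    Function.Bijective (toTri : Shuffle p q m × Shuffle m r N → Tri p q r N) := by
  constructor
  · rintro ⟨s, t⟩ ⟨s', t'⟩ e
    have ea : ∀ j, s.fst (t.fst j) = s'.fst (t'.fst j) := fun j =>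
      congrArg (fun x : Tri p q r N => x.a j) e
    have ec : ∀ j, t.snd j = t'.snd j := fun j => congrArg (fun x : Tri p q r N => x.c j) e
    obtain rfl : t = t' := by
      refine eq_of_fst fun j => Fin.ext ?_
      have h1 := t.add_eq j
      have h2 := t'.add_eq j
      rw [ec j] at h1
      omega
    congr 1
    refine eq_of_fst fun i => ?_
    obtain ⟨j, rfl⟩ := t.fst_surjective h' i
    exact ea j
  · rintro ⟨a, b, c, hadd⟩
    have hle : ∀ {i j : Fin (N + 1)}, i ≤ j → (a i : ℕ) ≤ a j ∧ (b i : ℕ) ≤ b j ∧ (c i : ℕ) ≤ c j :=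
      fun h => ⟨a.monotone h, b.monotone h, c.monotone h⟩
    let t : Shuffle m r N := ⟨⟨fun j => ⟨a j + b j, by have := (a j).2; have := (b j).2; omega⟩,
      fun i j hij => by
        have := hle hij
        rw [Fin.le_def]; simp only; omega⟩, c, hadd⟩
    choose j hj using t.fst_surjective h'
    have hj' : ∀ i, (a (j i) : ℕ) + b (j i) = i := fun i => congrArg Fin.val (hj i)
    have hmono : ∀ {i i' : Fin (N + 1)}, (a i : ℕ) + b i ≤ a i' + b i' →
        (a i : ℕ) ≤ a i' ∧ (b i : ℕ) ≤ b i' := by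
      intro i i' hi
      rcases le_total i i' with h | h
      · exact ⟨(hle h).1, (hle h).2.1⟩
      · have := hle h; omega
    let s : Shuffle p q m := ⟨⟨fun i => a (j i), fun i i' hi => (hmono (by
        rw [hj', hj']; exact hi)).1⟩, ⟨fun i => b (j i), fun i i' hi => (hmono (by
        rw [hj', hj']; exact hi)).2⟩, hj'⟩
    have hs : ∀ i, (a (j (t.fst i)) : ℕ) = a i ∧ (b (j (t.fst i)) : ℕ) = b i := by
      intro i
      have h1 : (a (j (t.fst i)) : ℕ) + b (j (t.fst i)) = a i + b i := hj' (t.fst i)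
      have h2 := hmono h1.le
      have h3 := hmono h1.ge
      omega
    refine ⟨(s, t), Tri.ext ?_ ?_ rfl⟩
    · ext i; exact (hs i).1
    · ext i; exact (hs i).2

/-- The composition of two paths, of which the second one refines the second coordinate. -/
def toTri' (x : Shuffle q r m × Shuffle p m N) : Tri p q r N := (toTri (x.1.swap, x.2.swap)).rev

lemma toTri'_bijective (h : q + r = m) (h' : p + m = N) :
    Function.Bijective (toTri' : Shuffle q r m × Shuffle p m N → Tri p q r N) := by
  have h1 := toTri_bijective (p := r) (q := q) (m := m) (r := p) (N := N) (by omega) (by omega)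
  have h2 : Function.Bijective (Tri.rev : Tri r q p N → Tri p q r N) :=
    Function.bijective_iff_has_inverse.2 ⟨Tri.rev, fun _ => rfl, fun _ => rfl⟩
  exact h2.comp (h1.comp ((swapEquiv.prodCongr swapEquiv).bijective))

/-- The number of pairs of steps of a path in which a step in the direction of a later coordinate
precedes one in the direction of an earlier coordinate. Its parity is the sign of the path. -/
noncomputable def Tri.area (t : Tri p q r N) : ℤ :=
  ∑ j : Fin N, (((t.a j.succ : ℕ) : ℤ) - (t.a j.castSucc : ℕ)) *
    ((t.b j.castSucc : ℕ) + (t.c j.castSucc : ℕ)) +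
      ∑ j : Fin N, (((t.b j.succ : ℕ) : ℤ) - (t.b j.castSucc : ℕ)) * (t.c j.castSucc : ℕ)

lemma x_step (s : Shuffle p q n) {j : ℕ} (hj : j < n) : s.x (j + 1) = s.x j ∨
    s.x (j + 1) = s.x j + 1 := by
  have := s.x_add_y (show j ≤ n by omega)
  have := s.x_add_y (show j + 1 ≤ n by omega)
  have := s.x_mono j
  have := s.y_mono j
  omega

/-- The inversions of a composite path are those among its first two coordinates and those between
these and the third. -/
lemma area_toTri (h : p + q = m) (h' : m + r = N) (x : Shuffle p q m × Shuffle m r N) :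
    (toTri x).area = x.1.area + x.2.area := by
  obtain ⟨s, t⟩ := x
  simp only
  rw [area_eq t h', area_eq_comp s h t.x t.x_zero (t.x_last h') (fun j hj => t.x_step hj),
    ← Finset.sum_add_distrib, Tri.area, ← Finset.sum_add_distrib,
    ← Fin.sum_univ_eq_sum_range (fun j => ((s.x (t.x (j + 1)) : ℤ) - s.x (t.x j)) * s.y (t.x j) +
      ((t.x (j + 1) : ℤ) - t.x j) * t.y j)]
  refine Finset.sum_congr rfl fun j _ => ?_
  simp only [toTri, OrderHom.comp_coe, Function.comp_apply, x_eq, y_eq, Fin.val_succ,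
    Fin.val_castSucc]
  have h1 := s.x_add_y (t.x_le (j + 1))
  have h2 := s.x_add_y (t.x_le j)
  have h1' : (s.x (t.x (j + 1)) : ℤ) + s.y (t.x (j + 1)) = t.x (j + 1) := by exact_mod_cast h1
  have h2' : (s.x (t.x j) : ℤ) + s.y (t.x j) = t.x j := by exact_mod_cast h2
  linear_combination (h1' - h2') * (t.y j : ℤ)

lemma area_toTri' (h : q + r = m) (h' : p + m = N) (x : Shuffle q r m × Shuffle p m N) :
    (toTri' x).area = x.1.area + x.2.area := by
  obtain ⟨s, t⟩ := x
  simp only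
  have hx : ∀ j, t.swap.x j = t.y j := fun j => rfl
  rw [area_eq t h', area_eq_comp s h t.swap.x t.swap.x_zero (t.swap.x_last (by omega))
    (fun j hj => t.swap.x_step hj), ← Finset.sum_add_distrib, Tri.area, ← Finset.sum_add_distrib,
    ← Fin.sum_univ_eq_sum_range (fun j => ((s.x (t.swap.x (j + 1)) : ℤ) - s.x (t.swap.x j)) *
      s.y (t.swap.x j) + ((t.x (j + 1) : ℤ) - t.x j) * t.y j)]
  refine Finset.sum_congr rfl fun j _ => ?_
  have h2 := s.x_add_y (t.y_le j)
  have h2' : (s.x (t.y j) : ℤ) + s.y (t.y j) = t.y j := by exact_mod_cast h2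
  simp only [toTri', toTri, Tri.rev, swap, OrderHom.comp_coe, Function.comp_apply, x_eq, y_eq,
    Fin.val_succ, Fin.val_castSucc]
  change _ = ((s.x (t.y (j + 1)) : ℤ) - s.x (t.y j)) * s.y (t.y j) + _
  linear_combination ((t.x (j + 1) : ℤ) - t.x j) * h2'

end Shuffle

section Chains

open CategoryTheory Limits Simplicial AlgebraicTopology MonoidalCategory CartesianMonoidalCategory

variable {k : Type u} [Field k]

namespace SSetChains

/-! ### Commutativity and associativity of the Eilenberg–Zilber map -/

lemma neg_one_pow_eq_of_int {a b a' b' : ℕ} (h : (a : ℤ) + b = a' + b') :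
    (-1 : ℤ) ^ a * (-1) ^ b = (-1) ^ a' * (-1) ^ b' := by
  rw [← pow_add, ← pow_add, show a + b = a' + b' by exact_mod_cast h]

lemma eq_of_tgen {S : SSet.{u}} {M : Type u} [AddCommGroup M] [Module k M]
    (f g : Tot k S →ₗ[k] M) (h : ∀ n (x : S _⦋n⦌), f (tgen x) = g (tgen x)) (a : Tot k S) :
    f a = g a := by
  rw [tot_gen_ext h]

lemma crossT_crossT_tgen {S T U : SSet.{u}} {p q r : ℕ} (x : S _⦋p⦌) (y : T _⦋q⦌) (z : U _⦋r⦌) :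
    tmap k (α_ S T U).hom (crossT k (S ⊗ T) U (crossT k S T (tgen x) (tgen y)) (tgen z)) =
      ∑ w : Shuffle p q (p + q) × Shuffle (p + q) r (p + q + r),
        ((-1 : ℤ) ^ w.1.area * (-1) ^ w.2.area) • tgen (S := S ⊗ (T ⊗ U))
          (pair (op S (Shuffle.toTri w).a x)
            (pair (op T (Shuffle.toTri w).b y) (op U (Shuffle.toTri w).c z))) := by
  rw [crossT_tgen rfl, Fintype.sum_prod_type]
  simp only [map_sum, LinearMap.sum_apply, map_zsmul, LinearMap.smul_apply]
  refine Finset.sum_congr rfl fun s _ => ?_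
  rw [crossT_tgen rfl, map_sum, Finset.smul_sum]
  refine Finset.sum_congr rfl fun t _ => ?_
  rw [map_zsmul, tmap_tgen, smul_smul, op_pair, op_comp, op_comp]
  rfl

lemma crossT_tgen_crossT {S T U : SSet.{u}} {p q r N : ℕ} (h : p + (q + r) = N) (x : S _⦋p⦌)
    (y : T _⦋q⦌) (z : U _⦋r⦌) :
    crossT k S (T ⊗ U) (tgen x) (crossT k T U (tgen y) (tgen z)) =
      ∑ w : Shuffle q r (q + r) × Shuffle p (q + r) N,
        ((-1 : ℤ) ^ w.1.area * (-1) ^ w.2.area) • tgen (S := S ⊗ (T ⊗ U))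
          (pair (op S (Shuffle.toTri' w).a x)
            (pair (op T (Shuffle.toTri' w).b y) (op U (Shuffle.toTri' w).c z))) := by
  rw [crossT_tgen (S := T) rfl, Fintype.sum_prod_type]
  simp only [map_sum, map_zsmul]
  refine Finset.sum_congr rfl fun s _ => ?_
  rw [crossT_tgen h, Finset.smul_sum]
  refine Finset.sum_congr rfl fun t _ => ?_
  rw [smul_smul, op_pair, op_comp, op_comp]
  rfl

/-- The Eilenberg–Zilber map is associative: both sides are sums over lattice paths in three
dimensions, with the same signs. -/
lemma crossT_assoc {S T U : SSet.{u}} (a : Tot k S) (b : Tot k T) (c : Tot k U) :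
    tmap k (α_ S T U).hom (crossT k (S ⊗ T) U (crossT k S T a b) c) =
      crossT k S (T ⊗ U) a (crossT k T U b c) := by
  refine eq_of_tgen (tmap k (α_ S T U).hom ∘ₗ (crossT k (S ⊗ T) U).flip c ∘ₗ (crossT k S T).flip b)
    ((crossT k S (T ⊗ U)).flip (crossT k T U b c)) (fun p x => ?_) a
  refine eq_of_tgen (tmap k (α_ S T U).hom ∘ₗ (crossT k (S ⊗ T) U).flip c ∘ₗ crossT k S T (tgen x))
    (crossT k S (T ⊗ U) (tgen x) ∘ₗ (crossT k T U).flip c) (fun q y => ?_) b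
  refine eq_of_tgen (tmap k (α_ S T U).hom ∘ₗ crossT k (S ⊗ T) U (crossT k S T (tgen x) (tgen y)))
    (crossT k S (T ⊗ U) (tgen x) ∘ₗ crossT k T U (tgen y)) (fun r z => ?_) c
  simp only [LinearMap.comp_apply]
  rw [crossT_crossT_tgen, crossT_tgen_crossT (N := p + q + r) (by omega)]
  let e := (Equiv.ofBijective _ (Shuffle.toTri_bijective (p := p) (q := q) (r := r) rfl rfl)).trans
    (Equiv.ofBijective _ (Shuffle.toTri'_bijective (p := p) (q := q) (r := r) (N := p + q + r)
      rfl (by omega))).symm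
  have he : ∀ w, Shuffle.toTri' (e w) = Shuffle.toTri w := fun w =>
    Equiv.apply_symm_apply (Equiv.ofBijective _ (Shuffle.toTri'_bijective (p := p) (q := q)
      (r := r) (N := p + q + r) rfl (by omega))) _
  refine Fintype.sum_equiv e _ _ fun w => ?_
  have h := Shuffle.area_toTri' rfl (by omega) (e w)
  rw [he, Shuffle.area_toTri rfl rfl] at h
  rw [he, neg_one_pow_eq_of_int h]

/-- The Eilenberg–Zilber map is graded commutative: reflection of paths is a bijection of shuffles
which changes the sign by `(-1) ^ (p * q)`. -/
lemma crossT_comm {S T : SSet.{u}} {p q : ℕ} (a : C k S p) (b : C k T q) :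
    tmap k (lift (snd S T) (fst S T)) (crossT k S T (inc k S p a) (inc k T q b)) =
      ((-1 : ℤ) ^ (p * q)) • crossT k T S (inc k T q b) (inc k S p a) := by
  suffices H : ((crossT k S T).compr₂ (tmap k (lift (snd S T) (fst S T)))).compl₁₂ (inc k S p)
      (inc k T q) = ((-1 : ℤ) ^ (p * q)) • ((crossT k T S).compl₁₂ (inc k T q) (inc k S p)).flip from
    congrArg (fun f => f a b) H
  refine hom_ext fun x => hom_ext fun y => ?_
  change tmap k _ (crossT k S T (tgen x) (tgen y)) =
    ((-1 : ℤ) ^ (p * q)) • crossT k T S (tgen y) (tgen x)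
  rw [crossT_tgen rfl, crossT_tgen (n := p + q) (by omega), map_sum, Finset.smul_sum]
  refine Fintype.sum_equiv Shuffle.swapEquiv _ _ fun s => ?_
  rw [map_zsmul, tmap_tgen, smul_smul]
  change _ = ((-1 : ℤ) ^ (p * q) * (-1) ^ s.swap.area) • _
  rw [← s.area_add_swap_area rfl, pow_add, mul_assoc, ← pow_add, Even.neg_one_pow ⟨_, rfl⟩, mul_one]
  rfl

end SSetChains
end Chains

section HomologyOfSpaces

/-! ### The cross product in the homology of spaces -/

open CategoryTheory Limits Simplicial AlgebraicTopology MonoidalCategory CartesianMonoidalCategory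
open SSetChains
open scoped DirectSum TensorProduct

variable {k : Type u} [Field k]

section

variable {X Y Z X' Y' : Type u} [TopologicalSpace X] [TopologicalSpace Y] [TopologicalSpace Z]
  [TopologicalSpace X'] [TopologicalSpace Y']

/-- The simplicial map induced by a continuous map. -/
noncomputable abbrev singMap (f : C(X, Y)) : Sing X ⟶ Sing Y := TopCat.toSSet.map (TopCat.ofHom f)

/-- The chain `z`, which need not be homogeneous, is a cycle with homology class `x`. -/
def Represents (z : Tot k (Sing X)) (x : spaceHomology k X) : Prop := IsRep (S := Sing X) z x

lemma Represents.unique {z : Tot k (Sing X)} {x x' : spaceHomology k X} (h : Represents z x)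
    (h' : Represents z x') : x = x' := IsRep.unique h h'

lemma Represents.smul {z : Tot k (Sing X)} {x : spaceHomology k X} (c : k) (h : Represents z x) :
    Represents (c • z) (c • x) := IsRep.smul c h

lemma Represents.map {z : Tot k (Sing X)} {x : spaceHomology k X}
    (h : Represents z x) (f : C(X, Y)) :
    Represents (tmap k (singMap f) z) (spaceHomologyMap f x) :=
  IsRep.map h (singMap f)

/-- The inclusion of the homology group in degree `n`. -/
noncomputable def homologyOf (n : ℕ) : singH k n X →ₗ[k] spaceHomology k X :=
  DirectSum.lof k ℕ (fun n => singH k n X) n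

lemma homologyCross_of {p q : ℕ} (a : singH k p X) (b : singH k q Y) :
    homologyCross X Y (homologyOf p a) (homologyOf q b) =
      homologyOf (p + q) (singCross X Y p q a b) := by
  have h1 := DirectSum.toModule_lof k (φ := fun p => LinearMap.flip (DirectSum.toModule k ℕ _ fun q =>
    LinearMap.flip ((singCross (k := k) X Y p q).compr₂
      (DirectSum.lof k ℕ (fun n => singH k n (KProd X Y)) (p + q))))) p a
  have h2 := DirectSum.toModule_lof k (φ := fun q => LinearMap.flip
    ((singCross (k := k) X Y p q).compr₂
      (DirectSum.lof k ℕ (fun n => singH k n (KProd X Y)) (p + q)))) q b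
  exact (DFunLike.congr_fun h1 _).trans (DFunLike.congr_fun h2 a)

lemma spaceHomologyMap_of (f : C(X, Y)) {n : ℕ} (a : singH k n X) :
    spaceHomologyMap f (homologyOf n a) =
      homologyOf n ((((singularHomologyFunctor (ModuleCat.{u} k) n).obj (ModuleCat.of k k)).map
      (TopCat.ofHom f)).hom a) :=
  DirectSum.lmap_lof (R := k) (fun n => (((singularHomologyFunctor (ModuleCat.{u} k) n).obj
    (ModuleCat.of k k)).map (TopCat.ofHom f)).hom) n a

lemma mem_deg_iff {n : ℕ} {x : spaceHomology k X} :
    x ∈ (spaceHomology k X).deg n ↔ ∃ a, homologyOf n a = x := Iff.rfl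

lemma homologyAug_of (n : ℕ) (a : singH k n X) : homologyAug X (homologyOf n a) =
    (TopCat.singularHomology₀ε (TopCat.of X) (ModuleCat.of k k)).hom
      (DirectSum.component k ℕ (fun n => singH k n X) 0
        (DirectSum.lof k ℕ (fun n => singH k n X) n a)) := rfl

lemma crossHT_lof {S T : SSet.{u}} {p q : ℕ} (a : H k S p) (b : H k T q) :
    crossHT k S T (DirectSum.lof k ℕ (fun n => (H k S n : Type u)) p a)
      (DirectSum.lof k ℕ (fun n => (H k T n : Type u)) q b) =
    DirectSum.lof k ℕ (fun n => (H k (S ⊗ T : SSet.{u}) n : Type u)) (p + q) (crossH S T rfl a b) := by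
  rw [crossHT, DirectSum.toModule_lof, LinearMap.flip_apply, DirectSum.toModule_lof]
  rfl

lemma homologyCross_eq_hmap (x : spaceHomology k X) (y : spaceHomology k Y) :
    homologyCross X Y x y = hmap k (singProd X Y) (crossHT k (Sing X) (Sing Y) x y) := by
  suffices H : homologyCross X Y = (crossHT k (Sing X) (Sing Y)).compr₂ (hmap k (singProd X Y)) from
    congrArg (fun f => f x y) H
  refine DirectSum.linearMap_ext k fun p => LinearMap.ext fun a => ?_
  refine DirectSum.linearMap_ext k fun q => LinearMap.ext fun b => ?_
  change homologyCross X Y (DirectSum.lof k ℕ (fun n => singH k n X) p a)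
      (DirectSum.lof k ℕ (fun n => singH k n Y) q b) = hmap k (singProd X Y)
    (crossHT k (Sing X) (Sing Y) (DirectSum.lof k ℕ (fun n => (H k (Sing X) n : Type u)) p a)
      (DirectSum.lof k ℕ (fun n => (H k (Sing Y) n : Type u)) q b))
  refine (homologyCross_of a b).trans (Eq.trans ?_ (congrArg _ (crossHT_lof a b).symm))
  exact (DirectSum.lmap_lof (R := k) (fun n => (SSet.homologyMap (singProd X Y)
    (ModuleCat.of k k) n).hom) _ _).symm

lemma Represents.cross {z : Tot k (Sing X)} {x : spaceHomology k X} {w : Tot k (Sing Y)}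
    {y : spaceHomology k Y} (h : Represents z x) (h' : Represents w y) :
    Represents (tmap k (singProd X Y) (crossT k _ _ z w))
      (homologyCross X Y x y) := by
  rw [homologyCross_eq_hmap]
  exact IsRep.map (IsRep.cross h h') _

lemma exists_represents (x : spaceHomology k X) : ∃ z, IsRep (S := Sing X) z x := IsRep.exists_rep x

lemma singMap_comp (f : C(X, Y)) (g : C(Y, Z)) : singMap (g.comp f) = singMap f ≫ singMap g := rfl

lemma spaceHomologyMap_comp (f : C(X, Y)) (g : C(Y, Z)) (x : spaceHomology k X) :
    spaceHomologyMap (g.comp f) x = spaceHomologyMap g (spaceHomologyMap f x) := by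
  obtain ⟨z, hz⟩ := exists_represents x
  have h1 := Represents.map hz (g.comp f)
  rw [singMap_comp, tmap_comp] at h1
  exact h1.unique (Represents.map (Represents.map hz f) g)

lemma spaceHomologyMap_id (x : spaceHomology k X) : spaceHomologyMap (ContinuousMap.id X) x = x :=
  hmap_id (S := Sing X) x

/-- The simplices of a singular simplicial set are determined by their underlying maps. -/
lemma sing_ext {n : SimplexCategoryᵒᵖ} {a b : (Sing X).obj n}
    (h : ∀ t, a.down.hom t = b.down.hom t) : a = b :=
  ULift.ext _ _ (TopCat.hom_ext (ContinuousMap.ext h))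

/-- Naturality of the cross product. Here and below a map between products enters as any continuous
map with the prescribed values, so that the lemma applies to every construction of that map. -/
lemma homologyCross_map {f : C(X, X')} {g : C(Y, Y')} (F : C(KProd X Y, KProd X' Y'))
    (hF : ∀ z, F z = ⟨(f z.out.1, g z.out.2)⟩) (x : spaceHomology k X) (y : spaceHomology k Y) :
    spaceHomologyMap F (homologyCross X Y x y) =
      homologyCross X' Y' (spaceHomologyMap f x) (spaceHomologyMap g y) := by
  obtain ⟨z, hz⟩ := exists_represents x
  obtain ⟨w, hw⟩ := exists_represents y
  have h1 := Represents.map (Represents.cross hz hw) F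
  have h2 := Represents.cross (Represents.map hz f) (Represents.map hw g)
  have e : singProd X Y ≫ singMap F = (singMap f ⊗ₘ singMap g) ≫ singProd X' Y' := by
    ext n a
    exact sing_ext fun t => hF _
  rw [← tmap_comp, e, tmap_comp, crossT_map] at h1
  exact h1.unique h2

lemma homologyCross_assoc (F : C(KProd (KProd X Y) Z, KProd X (KProd Y Z)))
    (hF : ∀ w, F w = ⟨(w.out.1.out.1, ⟨(w.out.1.out.2, w.out.2)⟩)⟩)
    (x : spaceHomology k X) (y : spaceHomology k Y) (z : spaceHomology k Z) :
    spaceHomologyMap F (homologyCross (KProd X Y) Z (homologyCross X Y x y) z) =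
      homologyCross X (KProd Y Z) x (homologyCross Y Z y z) := by
  obtain ⟨a, ha⟩ := exists_represents x
  obtain ⟨b, hb⟩ := exists_represents y
  obtain ⟨c, hc⟩ := exists_represents z
  have h1 := Represents.map (Represents.cross (Represents.cross ha hb) hc) F
  have h2 := Represents.cross ha (Represents.cross hb hc)
  have e : (singProd X Y ⊗ₘ 𝟙 (Sing Z)) ≫ singProd (KProd X Y) Z ≫ singMap F =
      (α_ (Sing X) (Sing Y) (Sing Z)).hom ≫ (𝟙 (Sing X) ⊗ₘ singProd Y Z) ≫
        singProd X (KProd Y Z) := by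
    ext n a
    exact sing_ext fun t => hF _
  have e1 := crossT_map (singProd X Y) (𝟙 (Sing Z)) (crossT k _ _ a b) c
  have e2 := crossT_map (𝟙 (Sing X)) (singProd Y Z) a (crossT k _ _ b c)
  rw [tmap_id] at e1 e2
  rw [← e1, ← tmap_comp, ← tmap_comp, e, tmap_comp, tmap_comp, crossT_assoc, e2] at h1
  exact h1.unique h2

lemma exists_represents_of_mem {p : ℕ} {x : spaceHomology k X} (hx : x ∈ (spaceHomology k X).deg p) :
    ∃ z : SSetChains.Z k (Sing X) p, Represents (inc k _ p z) x := by
  obtain ⟨h, rfl⟩ := hx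
  obtain ⟨z, rfl⟩ := cls_surjective (Sing X) p h
  exact ⟨z, isRep_inc z⟩

/-- Graded commutativity of the cross product. -/
lemma homologyCross_comm (F : C(KProd X Y, KProd Y X)) (hF : ∀ z, F z = ⟨(z.out.2, z.out.1)⟩)
    {p q : ℕ} {x : spaceHomology k X} {y : spaceHomology k Y}
    (hx : x ∈ (spaceHomology k X).deg p) (hy : y ∈ (spaceHomology k Y).deg q) :
    spaceHomologyMap F (homologyCross X Y x y) = ((-1 : ℤ) ^ (p * q)) • homologyCross Y X y x := by
  obtain ⟨z, hz⟩ := exists_represents_of_mem hx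
  obtain ⟨w, hw⟩ := exists_represents_of_mem hy
  have h1 := Represents.map (Represents.cross hz hw) F
  have h2 := (Represents.cross hw hz).smul ((-1 : k) ^ (p * q))
  have e : singProd X Y ≫ singMap F = lift (snd _ _) (fst _ _) ≫ singProd Y X := by
    ext n a
    exact sing_ext fun t => hF _
  rw [← tmap_comp, e, tmap_comp, crossT_comm, map_zsmul, ← Int.cast_smul_eq_zsmul k] at h1
  rw [← Int.cast_smul_eq_zsmul k]
  push_cast at h1 ⊢
  exact h1.unique h2

lemma exists_represents_point (x : X) : ∃ v : (Sing X) _⦋0⦌, (∀ t, v.down.hom t = x) ∧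
    Represents (tgen v) (homologyPoint (k := k) x) :=
  ⟨⟨TopCat.ofHom (ContinuousMap.const _ x)⟩, fun _ => rfl, isRep_inc (S := Sing X) ⟨_, _⟩⟩

/-- The cross product with a point, followed by the second projection, is the identity. -/
lemma point_homologyCross (F : C(KProd X Y, Y)) (hF : ∀ z, F z = z.out.2) (x : X)
    (y : spaceHomology k Y) :
    spaceHomologyMap F (homologyCross X Y (homologyPoint x) y) = y := by
  obtain ⟨v, -, hv⟩ := exists_represents_point (k := k) x
  obtain ⟨w, hw⟩ := exists_represents y
  have h1 := Represents.map (Represents.cross hv hw) F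
  have e : singProd X Y ≫ singMap F = snd _ _ := by
    ext n a
    exact sing_ext fun t => hF _
  rw [← tmap_comp, e, snd_crossT_vertex] at h1
  exact h1.unique hw

lemma spaceHomologyMap_point (f : C(X, Y)) (x : X) :
    spaceHomologyMap f (homologyPoint (k := k) x) = homologyPoint (f x) := by
  obtain ⟨v, hv', hv⟩ := exists_represents_point (k := k) x
  obtain ⟨w, hw', hw⟩ := exists_represents_point (k := k) (f x)
  have h1 := Represents.map hv f
  rw [tmap_tgen] at h1
  have e : (singMap f).app _ v = w := sing_ext fun t => by
    rw [hw']
    exact congrArg f (hv' t)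
  rw [e] at h1
  exact h1.unique hw

lemma homologyPoint_mem (x : X) : homologyPoint x ∈ (spaceHomology k X).deg 0 := ⟨_, rfl⟩

lemma spaceHomologyMap_mem (f : C(X, Y)) {p : ℕ} {x : spaceHomology k X}
    (hx : x ∈ (spaceHomology k X).deg p) : spaceHomologyMap f x ∈ (spaceHomology k Y).deg p := by
  obtain ⟨h, rfl⟩ := mem_deg_iff.1 hx
  exact mem_deg_iff.2 ⟨_, (spaceHomologyMap_of f h).symm⟩

lemma homologyCross_mem {p q : ℕ} {x : spaceHomology k X} {y : spaceHomology k Y}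
    (hx : x ∈ (spaceHomology k X).deg p) (hy : y ∈ (spaceHomology k Y).deg q) :
    homologyCross X Y x y ∈ (spaceHomology k (KProd X Y)).deg (p + q) := by
  obtain ⟨h, rfl⟩ := mem_deg_iff.1 hx
  obtain ⟨h', rfl⟩ := mem_deg_iff.1 hy
  exact mem_deg_iff.2 ⟨_, (homologyCross_of h h').symm⟩

/-- Homology in degree zero is generated by points. -/
lemma mem_span_homologyPoint {x : spaceHomology k X} (hx : x ∈ (spaceHomology k X).deg 0) :
    x ∈ Submodule.span k (Set.range (homologyPoint (k := k) (X := X))) := by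
  obtain ⟨h, rfl⟩ := hx
  obtain ⟨z, rfl⟩ := cls_surjective (Sing X) 0 h
  let _ : Unique (SimplexCategory.toTop.{u}.obj ⦋0⦌ : Type u) :=
    inferInstanceAs (Unique (ULift (stdSimplex ℝ (Fin 1))))
  let o : (SimplexCategory.toTop.{u}.obj ⦋0⦌ : Type u) := default
  have key : ∀ c : C k (Sing X) 0, DirectSum.lof k ℕ (fun n => singH k n X) 0
      (cls k (Sing X) 0 ⟨c, by change d k (Sing X) 0 c = 0; rw [d_zero]; rfl⟩) ∈
      Submodule.span k (Set.range (homologyPoint (k := k) (X := X))) := by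
    intro c
    let L : C k (Sing X) 0 →ₗ[k] SSetChains.Z k (Sing X) 0 :=
      LinearMap.codRestrict _ LinearMap.id fun c => by
        change d k (Sing X) 0 c = 0; rw [d_zero]; rfl
    have hc : c ∈ Submodule.span k (Set.range (gen (k := k) (S := Sing X) (n := 0))) := by
      have : Submodule.span k (Set.range (gen (k := k) (S := Sing X) (n := 0))) = ⊤ := by
        rw [← Submodule.ker_mkQ (Submodule.span k _), LinearMap.ker_eq_top]
        exact hom_ext fun x => (Submodule.Quotient.mk_eq_zero _).2 (Submodule.subset_span ⟨x, rfl⟩)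
      rw [this]; trivial
    change (DirectSum.lof k ℕ (fun n => singH k n X) 0 ∘ₗ cls k (Sing X) 0 ∘ₗ L) c ∈ _
    induction hc using Submodule.span_induction with
    | mem c hc =>
      obtain ⟨v, rfl⟩ := hc
      refine Submodule.subset_span ⟨v.down.hom o, ?_⟩
      obtain ⟨w, hw', hw⟩ := exists_represents_point (k := k) (v.down.hom o)
      have e : v = w := sing_ext fun t => by
        rw [hw']
        congr 1
        exact Subsingleton.elim (α := (SimplexCategory.toTop.{u}.obj ⦋0⦌ : Type u)) _ _
      subst e
      exact hw.unique (isRep_inc (L (gen v)))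
    | zero => rw [map_zero]; exact Submodule.zero_mem _
    | add x y _ _ hx hy => rw [map_add]; exact Submodule.add_mem _ hx hy
    | smul c x _ hx => rw [map_smul]; exact Submodule.smul_mem _ _ hx
  exact key z

lemma homologyAug_eq_zero {p : ℕ} {x : spaceHomology k X} (hx : x ∈ (spaceHomology k X).deg p)
    (hp : p ≠ 0) : homologyAug X x = 0 := by
  obtain ⟨h, rfl⟩ := mem_deg_iff.1 hx
  rw [homologyAug_of, DirectSum.component.of, dif_neg hp, map_zero]

/-- The augmentation is one on the class of a vertex. -/
lemma homology₀ε_cls_gen {S : SSet.{u}} (v : S _⦋0⦌) (z : SSetChains.Z k S 0)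
    (hz : (z : C k S 0) = gen v) :
    (S.homology₀ε (ModuleCat.of k k)).hom (cls k S 0 z) = 1 := by
  have h := congrArg (fun f => f.hom (1 : k))
    (SSet.liftCycles_ιChainComplex_homologyπ_homology₀ε (X := S) (ModuleCat.of k k) v)
  refine Eq.trans ?_ h
  let K := S.chainComplex (ModuleCat.of k k)
  change (S.homology₀ε (ModuleCat.of k k)).hom ((K.homologyπ 0).hom _) =
    (S.homology₀ε (ModuleCat.of k k)).hom ((K.homologyπ 0).hom _)
  congr 2
  apply (ModuleCat.mono_iff_injective (K.iCycles 0)).1 inferInstance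
  have h2 := congrArg (fun f => f.hom (1 : k)) ((S.chainComplex (ModuleCat.of k k)).liftCycles_i
    (S.ιChainComplex (R := ModuleCat.of k k) v) 0 (by simp) (by simp))
  have h3 := congrArg (fun f => f.hom z)
    (K.liftCycles_i (A := ModuleCat.of k (SSetChains.Z k S 0))
      (ModuleCat.ofHom (SSetChains.Z k S 0).subtype) (0 - 1) (next_eq 0) (by ext z; exact z.2))
  exact Eq.trans h3 (hz.trans h2.symm)

lemma homologyAug_point (x : X) : homologyAug X (homologyPoint (k := k) x) = 1 :=
  (homologyAug_of 0 _).trans ((congrArg _ (DirectSum.component.lof_self k _ _)).trans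
    (homology₀ε_cls_gen (S := Sing X) _ _ rfl))

/-- A constant map annihilates homology in positive degrees, and is the augmentation in degree
zero. -/
lemma spaceHomologyMap_const (f : C(X, Y)) (y : Y) (hf : ∀ x, f x = y) (x : spaceHomology k X) :
    spaceHomologyMap f x = homologyAug X x • homologyPoint y := by
  have hx : x ∈ ⨆ n, (spaceHomology k X).deg n := by
    rw [(spaceHomology k X).internal.submodule_iSup_eq_top]; trivial
  induction hx using Submodule.iSup_induction' with
  | zero => simp
  | add x x' _ _ h h' => rw [map_add, map_add, add_smul, h, h']
  | mem n x hx =>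
    rcases eq_or_ne n 0 with rfl | hn
    · refine LinearMap.eqOn_span (f := spaceHomologyMap f)
        (g := (LinearMap.toSpanSingleton k _ (homologyPoint y)) ∘ₗ homologyAug X) ?_
        (mem_span_homologyPoint hx)
      rintro _ ⟨x, rfl⟩
      rw [spaceHomologyMap_point, hf, LinearMap.comp_apply, homologyAug_point,
        LinearMap.toSpanSingleton_apply, one_smul]
    · rw [homologyAug_eq_zero hx hn, zero_smul]
      -- The map factors through a point, the homology of which is concentrated in degree zero.
      let i : C(X, PUnit.{u + 1}) := ContinuousMap.const _ PUnit.unit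
      let j : C(PUnit.{u + 1}, Y) := ContinuousMap.const _ y
      have e : f = j.comp i := ContinuousMap.ext hf
      rw [e, spaceHomologyMap_comp]
      obtain ⟨h, hh⟩ := mem_deg_iff.1 (spaceHomologyMap_mem i hx)
      have : Subsingleton (singH k n PUnit.{u + 1}) :=
        ModuleCat.subsingleton_of_isZero (isZero_singularHomologyFunctor_of_totallyDisconnectedSpace
          (ModuleCat.{u} k) n (ModuleCat.of k k) (TopCat.of PUnit.{u + 1}) hn)
      rw [← hh, Subsingleton.elim h 0, map_zero, map_zero]

/-- The product of singular simplicial sets is that of the compactly generated product: a simplex is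
a compactly generated space, so maps from it to the product are pairs of maps to the factors. -/
instance singProd_isIso : IsIso (singProd X Y) := by
  let inv : Sing (KProd X Y) ⟶ (Sing X ⊗ Sing Y : SSet.{u}) :=
    lift (singMap (X := KProd X Y) ⟨_, KProd.continuous_fst⟩)
      (singMap (X := KProd X Y) ⟨_, KProd.continuous_snd⟩)
  refine ⟨inv, ?_, ?_⟩
  · ext n a
    · exact sing_ext (X := X) fun t => rfl
    · exact sing_ext (X := Y) fun t => rfl
  · ext n a
    exact sing_ext (X := KProd X Y) fun t => rfl

variable (X Y) in
/-- The Künneth theorem for spaces. -/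
theorem homologyCross_bijective : Function.Bijective
    (TensorProduct.lift (homologyCross (k := k) X Y)) := by
  have e : TensorProduct.lift (homologyCross (k := k) X Y) =
      hmap k (singProd X Y) ∘ₗ TensorProduct.lift (crossHT k (Sing X) (Sing Y)) :=
    TensorProduct.ext' fun x y => homologyCross_eq_hmap x y
  rw [e]
  refine Function.Bijective.comp (g := hmap k (singProd X Y)) ?_
    (crossHT_bijective (Sing X) (Sing Y))
  have hc : ∀ {S T : SSet.{u}} (f : S ⟶ T) (g : T ⟶ S), f ≫ g = 𝟙 _ → ∀ x,
      hmap k g (hmap k f x) = x := by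
    intro S T f g h x
    obtain ⟨z, hz⟩ := IsRep.exists_rep x
    have h1 := (hz.map f).map g
    rw [← tmap_comp, h, tmap_id] at h1
    exact h1.unique hz
  exact Function.bijective_iff_has_inverse.2 ⟨hmap k (CategoryTheory.inv (singProd X Y)),
    hc _ _ (IsIso.hom_inv_id _), hc _ _ (IsIso.inv_hom_id _)⟩

end

end HomologyOfSpaces

section ProductMaps

/-! ### Maps between finite products -/

open scoped DirectSum TensorProduct

variable {k : Type u} [Field k]
variable {X Y Z W X' Y' : Type u} [TopologicalSpace X] [TopologicalSpace Y] [TopologicalSpace Z]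
  [TopologicalSpace W] [TopologicalSpace X'] [TopologicalSpace Y']

namespace KProd

/-- The first projection. -/
def fst : C(KProd X Y, X) := ⟨_, KProd.continuous_fst⟩

/-- The second projection. -/
def snd : C(KProd X Y, Y) := ⟨_, KProd.continuous_snd⟩

/-- The map to a product with given components. -/
def pair [CompactlyGeneratedSpace Z] (f : C(Z, X)) (g : C(Z, Y)) : C(Z, KProd X Y) :=
  ⟨_, KProd.continuous_mk f.continuous g.continuous⟩

/-- The product of two maps. -/
def map (f : C(X, X')) (g : C(Y, Y')) : C(KProd X Y, KProd X' Y') :=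
  pair (f.comp fst) (g.comp snd)

/-- `((x, y), z) ↦ (x, (y, z))`. -/
def assoc : C(KProd (KProd X Y) Z, KProd X (KProd Y Z)) :=
  pair (fst.comp fst) (pair (snd.comp fst) snd)

/-- `(x, (y, z)) ↦ ((x, y), z)`. -/
def assocInv : C(KProd X (KProd Y Z), KProd (KProd X Y) Z) :=
  pair (pair fst (fst.comp snd)) (snd.comp snd)

/-- `(x, y) ↦ (y, x)`. -/
def swap : C(KProd X Y, KProd Y X) := pair snd fst

/-- `(x, (y, z)) ↦ (y, (x, z))`. -/
def leftComm : C(KProd X (KProd Y Z), KProd Y (KProd X Z)) :=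
  pair (fst.comp snd) (pair fst (snd.comp snd))

/-- `((x, y), (z, w)) ↦ ((x, z), (y, w))`. -/
def interchange : C(KProd (KProd X Y) (KProd Z W), KProd (KProd X Z) (KProd Y W)) :=
  pair (pair (fst.comp fst) (fst.comp snd)) (pair (snd.comp fst) (snd.comp snd))

end KProd

namespace KPi

variable {ι : Type} {V : ι → Type u} [∀ i, TopologicalSpace (V i)]

/-- The projection to a factor. -/
def eval (i : ι) : C(KPi V, V i) := ⟨_, KPi.continuous_eval i⟩

/-- The map to a product with given components. -/
def lift [CompactlyGeneratedSpace Z] (f : ∀ i, C(Z, V i)) : C(Z, KPi V) :=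
  ⟨_, KPi.continuous_mk fun i => (f i).continuous⟩

instance {V : Fin 0 → Type u} : Subsingleton (KPi V) :=
  ⟨fun _ _ => Kify.ext (funext fun i => i.elim0)⟩

end KPi

namespace GrMod

/-- Two linear maps on a graded vector space are equal if they agree on homogeneous elements. -/
lemma linearMap_ext {V : GrMod.{u} k} {M : Type*} [AddCommGroup M] [Module k M] {f g : V →ₗ[k] M}
    (h : ∀ n, ∀ x ∈ V.deg n, f x = g x) : f = g :=
  LinearMap.ext_on_range (v := fun x : {x : V // ∃ n, x ∈ V.deg n} => (x : V)) V.span_homogeneous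
    fun ⟨x, n, hx⟩ => h n x hx

end GrMod

/-! ### Consequences of the unit law -/

/-- The inclusion of `X` in `Y × X` at a point of `Y` is the cross product with that point. -/
lemma spaceHomologyMap_mk_point {F : C(X, KProd Y X)} {y : Y} (hF : ∀ x, F x = ⟨(y, x)⟩)
    (x : spaceHomology k X) :
    spaceHomologyMap F x = homologyCross Y X (homologyPoint y) x := by
  let j : C(PUnit.{u + 1}, Y) := ContinuousMap.const _ y
  have h1 : homologyCross Y X (homologyPoint y) x =
      spaceHomologyMap (KProd.map j (ContinuousMap.id X))
        (homologyCross PUnit.{u + 1} X (homologyPoint PUnit.unit) x) := by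
    rw [homologyCross_map (f := j) (g := ContinuousMap.id X) _ (fun _ => rfl),
      spaceHomologyMap_point, spaceHomologyMap_id]
    rfl
  have h2 : KProd.map j (ContinuousMap.id X) = F.comp KProd.snd :=
    ContinuousMap.ext fun z => (hF _).symm
  rw [h1, h2, spaceHomologyMap_comp, point_homologyCross _ fun _ => rfl]

lemma homologyCross_point (F : C(KProd X Y, X)) (hF : ∀ z, F z = z.out.1) (y : Y)
    (x : spaceHomology k X) :
    spaceHomologyMap F (homologyCross X Y x (homologyPoint y)) = x := by
  suffices H : spaceHomologyMap F ∘ₗ (homologyCross X Y).flip (homologyPoint y) =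
    LinearMap.id (R := k) from congrArg (fun f => f x) H
  refine GrMod.linearMap_ext fun n x hx => ?_
  have e : F = KProd.snd.comp KProd.swap := ContinuousMap.ext hF
  rw [e, LinearMap.comp_apply, LinearMap.flip_apply, spaceHomologyMap_comp,
    homologyCross_comm _ (fun _ => rfl) hx (homologyPoint_mem y), map_zsmul,
    point_homologyCross _ fun _ => rfl]
  simp

/-- The projection to the second factor applies the augmentation to the first one. -/
lemma snd_homologyCross (F : C(KProd X Y, Y)) (hF : ∀ z, F z = z.out.2) (x : spaceHomology k X)
    (y : spaceHomology k Y) :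
    spaceHomologyMap F (homologyCross X Y x y) = homologyAug X x • y := by
  let c : C(X, PUnit.{u + 1}) := ContinuousMap.const _ PUnit.unit
  have e : F = KProd.snd.comp (KProd.map c (ContinuousMap.id Y)) := ContinuousMap.ext hF
  rw [e, spaceHomologyMap_comp, homologyCross_map (f := c) (g := ContinuousMap.id Y) _
    (fun _ => rfl), spaceHomologyMap_id, spaceHomologyMap_const c PUnit.unit (fun _ => rfl),
    map_smul, LinearMap.smul_apply, map_smul, point_homologyCross _ fun _ => rfl]

/-- The projection to the first factor applies the augmentation to the second one. -/
lemma fst_homologyCross (F : C(KProd X Y, X)) (hF : ∀ z, F z = z.out.1) (x : spaceHomology k X)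
    (y : spaceHomology k Y) :
    spaceHomologyMap F (homologyCross X Y x y) = homologyAug Y y • x := by
  let c : C(Y, PUnit.{u + 1}) := ContinuousMap.const _ PUnit.unit
  have e : F = KProd.fst.comp (KProd.map (ContinuousMap.id X) c) := ContinuousMap.ext hF
  rw [e, spaceHomologyMap_comp, homologyCross_map (f := ContinuousMap.id X) (g := c) _
    (fun _ => rfl), spaceHomologyMap_id, spaceHomologyMap_const c PUnit.unit (fun _ => rfl),
    map_smul, map_smul, homologyCross_point _ fun _ => rfl]

lemma homologyAug_map (f : C(X, Y)) (x : spaceHomology k X) :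
    homologyAug Y (spaceHomologyMap f x) = homologyAug X x := by
  let c : C(X, PUnit.{u + 1}) := ContinuousMap.const _ PUnit.unit
  let c' : C(Y, PUnit.{u + 1}) := ContinuousMap.const _ PUnit.unit
  have h : spaceHomologyMap (c'.comp f) x = spaceHomologyMap c x := rfl
  rw [spaceHomologyMap_comp, spaceHomologyMap_const c' PUnit.unit (fun _ => rfl),
    spaceHomologyMap_const c PUnit.unit (fun _ => rfl)] at h
  simpa [homologyAug_point] using congrArg (homologyAug PUnit.{u + 1}) h

lemma homologyAug_cross (x : spaceHomology k X) (y : spaceHomology k Y) :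
    homologyAug _ (homologyCross X Y x y) = homologyAug X x * homologyAug Y y := by
  rw [← homologyAug_map KProd.snd, snd_homologyCross _ fun _ => rfl, map_smul, smul_eq_mul]

lemma homologyCross_point_point (x : X) (y : Y) :
    homologyCross X Y (homologyPoint x) (homologyPoint (k := k) y) = homologyPoint ⟨(x, y)⟩ := by
  let c : C(PUnit.{u + 1}, Y) := ContinuousMap.const _ y
  let G : C(PUnit.{u + 1}, KProd X PUnit.{u + 1}) := ContinuousMap.const _ ⟨(x, PUnit.unit)⟩
  have h := spaceHomologyMap_mk_point (k := k) (F := G) (y := x) (fun _ => rfl)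
    (homologyPoint PUnit.unit)
  have h2 := homologyCross_map (k := k) (f := ContinuousMap.id X) (g := c)
    (KProd.map (ContinuousMap.id X) c) (fun _ => rfl) (homologyPoint x) (homologyPoint PUnit.unit)
  rw [← h, spaceHomologyMap_id, spaceHomologyMap_point, spaceHomologyMap_point,
    spaceHomologyMap_point] at h2
  exact h2.symm

/-! ### Interchanging factors -/

lemma homologyCross_assocInv (x : spaceHomology k X) (y : spaceHomology k Y)
    (z : spaceHomology k Z) :
    spaceHomologyMap KProd.assocInv (homologyCross X (KProd Y Z) x (homologyCross Y Z y z)) =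
      homologyCross (KProd X Y) Z (homologyCross X Y x y) z := by
  rw [← homologyCross_assoc KProd.assoc fun _ => rfl, ← spaceHomologyMap_comp]
  exact spaceHomologyMap_id _

lemma homologyCross_leftComm {p q : ℕ} {x : spaceHomology k X} {y : spaceHomology k Y}
    (hx : x ∈ (spaceHomology k X).deg p) (hy : y ∈ (spaceHomology k Y).deg q)
    (z : spaceHomology k Z) :
    spaceHomologyMap KProd.leftComm (homologyCross X (KProd Y Z) x (homologyCross Y Z y z)) =
      ((-1 : ℤ) ^ (p * q)) • homologyCross Y (KProd X Z) y (homologyCross X Z x z) := by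
  have e : (KProd.leftComm : C(KProd X (KProd Y Z), _)) =
    (KProd.assoc.comp (KProd.map KProd.swap (ContinuousMap.id Z))).comp KProd.assocInv := rfl
  rw [e, spaceHomologyMap_comp, homologyCross_assocInv, spaceHomologyMap_comp,
    homologyCross_map (f := KProd.swap) (g := ContinuousMap.id Z) _ (fun _ => rfl),
    homologyCross_comm _ (fun _ => rfl) hx hy, map_zsmul, LinearMap.smul_apply, map_zsmul,
    homologyCross_assoc _ fun _ => rfl, spaceHomologyMap_id]

lemma homologyCross_interchange {p q : ℕ} (x : spaceHomology k X) {y : spaceHomology k Y}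
    {z : spaceHomology k Z} (w : spaceHomology k W)
    (hy : y ∈ (spaceHomology k Y).deg p) (hz : z ∈ (spaceHomology k Z).deg q) :
    spaceHomologyMap KProd.interchange (homologyCross (KProd X Y) (KProd Z W)
      (homologyCross X Y x y) (homologyCross Z W z w)) =
      ((-1 : ℤ) ^ (p * q)) • homologyCross (KProd X Z) (KProd Y W)
        (homologyCross X Z x z) (homologyCross Y W y w) := by
  have e : (KProd.interchange : C(KProd (KProd X Y) (KProd Z W), _)) =
    (KProd.assocInv.comp (KProd.map (ContinuousMap.id X) KProd.leftComm)).comp KProd.assoc := rfl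
  rw [e, spaceHomologyMap_comp, homologyCross_assoc _ fun _ => rfl, spaceHomologyMap_comp,
    homologyCross_map (f := ContinuousMap.id X) (g := KProd.leftComm) _ (fun _ => rfl),
    homologyCross_leftComm hy hz, map_zsmul, map_zsmul, spaceHomologyMap_id,
    homologyCross_assocInv]

end ProductMaps

section CrossPi

/-! ### Cross products of finite families -/

open scoped DirectSum TensorProduct
open OperadEquiv GrMod

variable {k : Type u} [Field k]

section Basic

variable {m : ℕ} {X Y : Fin m → Type u} [∀ i, TopologicalSpace (X i)] [∀ i, TopologicalSpace (Y i)]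

lemma homologyCrossPi_zero {X : Fin 0 → Type u} [∀ i, TopologicalSpace (X i)]
    (x : ∀ i, spaceHomology k (X i)) (a : KPi X) :
    homologyCrossPi X x = homologyPoint a := by
  rw [Subsingleton.elim a ⟨isEmptyElim⟩]
  rfl

lemma homologyCrossPi_succ {X : Fin (m + 1) → Type u} [∀ i, TopologicalSpace (X i)]
    (x : ∀ i, spaceHomology k (X i)) :
    homologyCrossPi X x = spaceHomologyMap (kpiCons X) (homologyCross (X 0) _ (x 0)
      (homologyCrossPi (fun i => X i.succ) fun i => x i.succ)) := by
  rw [homologyCrossPi, LinearMap.uncurryLeft_apply, LinearMap.comp_apply, LinearEquiv.coe_coe,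
    PiTensorProduct.lift_symm, LinearMap.compMultilinearMap_apply, LinearMap.compl₂_apply,
    PiTensorProduct.lift.tprod, LinearMap.compr₂_apply]
  rfl

lemma homologyCrossPi_map (f : ∀ i, C(X i, Y i)) (F : C(KPi X, KPi Y))
    (hF : ∀ z i, (F z).out i = f i (z.out i)) (x : ∀ i, spaceHomology k (X i)) :
    spaceHomologyMap F (homologyCrossPi X x) =
      homologyCrossPi Y fun i => spaceHomologyMap (f i) (x i) := by
  induction m with
  | zero =>
    rw [homologyCrossPi_zero _ ⟨isEmptyElim⟩, spaceHomologyMap_point, ← homologyCrossPi_zero]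
  | succ m ih =>
    let F' : C(KPi fun i : Fin m => X i.succ, KPi fun i : Fin m => Y i.succ) :=
      KPi.lift fun i => (f i.succ).comp (KPi.eval i)
    have e : F.comp (kpiCons X) = (kpiCons Y).comp (KProd.map (f 0) F') :=
      ContinuousMap.ext fun z => Kify.ext (funext fun i => (hF _ i).trans (by
        induction i using Fin.cases <;> rfl))
    rw [homologyCrossPi_succ, ← spaceHomologyMap_comp, e, spaceHomologyMap_comp,
      homologyCross_map (f := f 0) (g := F') _ (fun _ => rfl),
      ih (fun i => f i.succ) F' fun _ _ => rfl, homologyCrossPi_succ]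

lemma homologyCrossPi_mem {p : Fin m → ℕ} {x : ∀ i, spaceHomology k (X i)}
    (hx : ∀ i, x i ∈ (spaceHomology k (X i)).deg (p i)) :
    homologyCrossPi X x ∈ (spaceHomology k (KPi X)).deg (∑ i, p i) := by
  induction m with
  | zero => exact homologyPoint_mem _
  | succ m ih =>
    rw [homologyCrossPi_succ, Fin.sum_univ_succ]
    exact spaceHomologyMap_mem _ (homologyCross_mem (hx 0) (ih fun i => hx i.succ))

lemma homologyCrossPi_point (a : ∀ i, X i) :
    homologyCrossPi X (fun i => homologyPoint (k := k) (a i)) = homologyPoint ⟨a⟩ := by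
  induction m with
  | zero => exact homologyCrossPi_zero _ _
  | succ m ih =>
    rw [homologyCrossPi_succ, ih, homologyCross_point_point, spaceHomologyMap_point]
    congr 1
    exact Kify.ext (Fin.cons_self_tail a)

lemma kpiCons_bijective (X : Fin (m + 1) → Type u) [∀ i, TopologicalSpace (X i)] :
    Function.Bijective (spaceHomologyMap (k := k) (kpiCons X)) := by
  let g : C(KPi X, KProd (X 0) (KPi fun i : Fin m => X i.succ)) :=
    KProd.pair (KPi.eval 0) (KPi.lift fun i => KPi.eval i.succ)
  refine Function.bijective_iff_has_inverse.2 ⟨spaceHomologyMap g, fun x => ?_, fun x => ?_⟩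
  · rw [← spaceHomologyMap_comp]
    exact spaceHomologyMap_id x
  · rw [← spaceHomologyMap_comp]
    have e : (kpiCons X).comp g = ContinuousMap.id _ :=
      ContinuousMap.ext fun z => Kify.ext (Fin.cons_self_tail z.out)
    rw [e, spaceHomologyMap_id]

/-- The isomorphism `V 0 ⊗ (V 1 ⊗ … ⊗ V m) ≃ V 0 ⊗ V 1 ⊗ … ⊗ V m`. -/
lemma lift_cons_bijective (V : Fin (m + 1) → Type u) [∀ i, AddCommGroup (V i)]
    [∀ i, Module k (V i)] : Function.Bijective (TensorProduct.lift (GrMod.cons (k := k) V)) := by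
  let g : (⨂[k] i, V i) →ₗ[k] V 0 ⊗[k] (⨂[k] i : Fin m, V i.succ) :=
    PiTensorProduct.lift (LinearMap.uncurryLeft
      (PiTensorProduct.lift.symm.toLinearMap ∘ₗ TensorProduct.mk k _ _))
  have hg : ∀ v, g (PiTensorProduct.tprod k v) =
      v 0 ⊗ₜ PiTensorProduct.tprod k (fun i : Fin m => v i.succ) := fun v => by
    simp only [g, PiTensorProduct.lift.tprod]
    rfl
  have h1 : g ∘ₗ TensorProduct.lift (GrMod.cons (k := k) V) = LinearMap.id := by
    refine TensorProduct.ext (LinearMap.ext fun x => PiTensorProduct.ext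
      (MultilinearMap.ext fun v => ?_))
    change g (TensorProduct.lift (GrMod.cons V) (x ⊗ₜ PiTensorProduct.tprod k v)) =
      x ⊗ₜ PiTensorProduct.tprod k v
    rw [TensorProduct.lift.tmul, GrMod.cons_tprod, hg]
    rfl
  have h2 : TensorProduct.lift (GrMod.cons (k := k) V) ∘ₗ g = LinearMap.id := by
    refine PiTensorProduct.ext (MultilinearMap.ext fun v => ?_)
    simp only [LinearMap.compMultilinearMap_apply, LinearMap.comp_apply, hg,
      TensorProduct.lift.tmul, GrMod.cons_tprod, LinearMap.id_apply]
    congr 1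
    exact Fin.cons_self_tail v
  exact Function.bijective_iff_has_inverse.2
    ⟨g, fun x => congrArg (fun f => f x) h1, fun x => congrArg (fun f => f x) h2⟩

/-- The Künneth theorem for finite products. -/
theorem homologyCrossPi_bijective (X : Fin m → Type u) [∀ i, TopologicalSpace (X i)] :
    Function.Bijective (PiTensorProduct.lift (homologyCrossPi (k := k) X)) := by
  induction m with
  | zero =>
    let ε := homologyAug (k := k) (KPi X)
    let a : KPi X := ⟨isEmptyElim⟩
    refine Function.bijective_iff_has_inverse.2
      ⟨fun x => ε x • PiTensorProduct.tprod k isEmptyElim, fun t => ?_, fun x => ?_⟩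
    · suffices H : LinearMap.toSpanSingleton k _ (PiTensorProduct.tprod k isEmptyElim) ∘ₗ ε ∘ₗ
          PiTensorProduct.lift (homologyCrossPi (k := k) X) = LinearMap.id from
        congrArg (fun f => f t) H
      refine PiTensorProduct.ext (MultilinearMap.ext fun v => ?_)
      simp only [LinearMap.compMultilinearMap_apply, LinearMap.comp_apply,
        PiTensorProduct.lift.tprod, LinearMap.id_apply, LinearMap.toSpanSingleton_apply, ε]
      rw [homologyCrossPi_zero _ a, homologyAug_point, one_smul]
      congr 1
      exact funext fun i => i.elim0
    · simp only [map_smul, PiTensorProduct.lift.tprod]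
      rw [homologyCrossPi_zero _ a, ← spaceHomologyMap_const (ContinuousMap.id _) a
        fun _ => Subsingleton.elim _ _, spaceHomologyMap_id]
  | succ m ih =>
    have e : PiTensorProduct.lift (homologyCrossPi (k := k) X) ∘ₗ
        TensorProduct.lift (GrMod.cons _) = spaceHomologyMap (kpiCons X) ∘ₗ
      TensorProduct.lift (homologyCross (X 0) _) ∘ₗ TensorProduct.map LinearMap.id
        (PiTensorProduct.lift (homologyCrossPi (k := k) fun i => X i.succ)) := by
      refine TensorProduct.ext (LinearMap.ext fun x => PiTensorProduct.ext
        (MultilinearMap.ext fun v => ?_))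
      change PiTensorProduct.lift (homologyCrossPi (k := k) X) (TensorProduct.lift (GrMod.cons _)
          (x ⊗ₜ PiTensorProduct.tprod k v)) =
        spaceHomologyMap (kpiCons X) (TensorProduct.lift (homologyCross (X 0) _)
          (TensorProduct.map LinearMap.id
            (PiTensorProduct.lift (homologyCrossPi (k := k) fun i => X i.succ))
            (x ⊗ₜ PiTensorProduct.tprod k v)))
      rw [TensorProduct.map_tmul, TensorProduct.lift.tmul, TensorProduct.lift.tmul,
        GrMod.cons_tprod, PiTensorProduct.lift.tprod, PiTensorProduct.lift.tprod,
        homologyCrossPi_succ]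
      rfl
    have h1 : Function.Bijective (TensorProduct.map (LinearMap.id (R := k)
        (M := spaceHomology k (X 0)))
        (PiTensorProduct.lift (homologyCrossPi (k := k) fun i => X i.succ))) := by
      exact (TensorProduct.congr (LinearEquiv.refl k _)
        (LinearEquiv.ofBijective _ (ih fun i => X i.succ))).bijective
    have h2 := (kpiCons_bijective (k := k) X).comp
      ((homologyCross_bijective (X 0) (KPi fun i : Fin m => X i.succ)).comp h1)
    rw [← Function.Bijective.of_comp_iff _ (lift_cons_bijective _)]
    convert h2 using 1
    exact congrArg DFunLike.coe e

end Basic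

end CrossPi

section CrossPiRearrange

/-! ### Rearranging the factors of a cross product -/

open scoped DirectSum TensorProduct
open OperadEquiv GrMod

variable {k : Type u} [Field k]

/-- Cross products of pairs: the shuffle of the factors contributes a sign. -/
lemma homologyCrossPi_unzip {m : ℕ} {X Y : Fin m → Type u} [∀ i, TopologicalSpace (X i)]
    [∀ i, TopologicalSpace (Y i)]
    (F : C(KPi fun i => KProd (X i) (Y i), KProd (KPi X) (KPi Y)))
    (hF : ∀ z, F z = ⟨(⟨fun i => (z.out i).out.1⟩, ⟨fun i => (z.out i).out.2⟩)⟩)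
    {p q : Fin m → ℕ} {x : ∀ i, spaceHomology k (X i)} {y : ∀ i, spaceHomology k (Y i)}
    (hx : ∀ i, x i ∈ (spaceHomology k (X i)).deg (p i))
    (hy : ∀ i, y i ∈ (spaceHomology k (Y i)).deg (q i)) :
    spaceHomologyMap F (homologyCrossPi _ fun i => homologyCross (X i) (Y i) (x i) (y i)) =
      (∏ i, ∏ j ∈ Finset.Ioi i, (-1 : ℤ) ^ (p j * q i)) •
        homologyCross _ _ (homologyCrossPi X x) (homologyCrossPi Y y) := by
  induction m with
  | zero =>
    rw [homologyCrossPi_zero _ ⟨isEmptyElim⟩, homologyCrossPi_zero x ⟨isEmptyElim⟩,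
      homologyCrossPi_zero y ⟨isEmptyElim⟩, spaceHomologyMap_point, homologyCross_point_point]
    simp only [Finset.univ_eq_empty, Finset.prod_empty, one_smul]
    congr 1
    exact Kify.ext (Prod.ext (Subsingleton.elim _ _) (Subsingleton.elim _ _))
  | succ m ih =>
    let F' : C(KPi fun i : Fin m => KProd (X i.succ) (Y i.succ),
        KProd (KPi fun i : Fin m => X i.succ) (KPi fun i : Fin m => Y i.succ)) :=
      KProd.pair (KPi.lift fun i => KProd.fst.comp (KPi.eval i))
        (KPi.lift fun i => KProd.snd.comp (KPi.eval i))
    have e : F.comp (kpiCons fun i => KProd (X i) (Y i)) =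
        ((KProd.map (kpiCons X) (kpiCons Y)).comp KProd.interchange).comp
          (KProd.map (ContinuousMap.id _) F') := by
      refine ContinuousMap.ext fun z => (hF _).trans (Kify.ext (Prod.ext ?_ ?_))
      all_goals exact Kify.ext (funext fun i => by induction i using Fin.cases <;> rfl)
    rw [homologyCrossPi_succ, ← spaceHomologyMap_comp, e, spaceHomologyMap_comp,
      homologyCross_map (f := ContinuousMap.id _) (g := F') _ (fun _ => rfl),
      ih F' (fun _ => rfl) (fun i => hx i.succ) (fun i => hy i.succ), map_zsmul, map_zsmul,
      spaceHomologyMap_id, spaceHomologyMap_comp,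
      homologyCross_interchange _ _ (hy 0) (homologyCrossPi_mem fun i => hx i.succ), map_zsmul,
      homologyCross_map (f := kpiCons X) (g := kpiCons Y) _ (fun _ => rfl), ← homologyCrossPi_succ,
      ← homologyCrossPi_succ, smul_smul]
    congr 1
    rw [Fin.prod_univ_succ, mul_comm]
    congr 1
    · rw [Finset.mul_sum, ← Finset.prod_pow_eq_pow_sum, Fin.prod_Ioi_zero]
      exact Finset.prod_congr rfl fun i _ => by rw [mul_comm]
    · exact Finset.prod_congr rfl fun i _ => by rw [Fin.prod_Ioi_succ]

section

variable {A B B' C D E P : Type u} [TopologicalSpace A] [TopologicalSpace B] [TopologicalSpace B']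
  [TopologicalSpace C] [TopologicalSpace D] [TopologicalSpace E] [TopologicalSpace P]

/-- If `F` splits `D` into `B` and `C`, then `A × D` splits into `A × B` and `C`, without a sign. The
maps `g` and `c` identify `A × D` and `A × B` with products `P` and `E` of families. This is the
inductive step for splitting off consecutive factors. -/
lemma homologyCross_cons_left (f : C(P, KProd E C)) (g : C(KProd A D, P)) (c : C(KProd A B, E))
    (F : C(D, KProd B C))
    (hf : ∀ z, f (g z) = ⟨(c ⟨(z.out.1, (F z.out.2).out.1)⟩, (F z.out.2).out.2)⟩)
    (a : spaceHomology k A) {d : spaceHomology k D} {b : spaceHomology k B} {e : spaceHomology k C}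
    (hF : spaceHomologyMap F d = homologyCross B C b e) :
    spaceHomologyMap f (spaceHomologyMap g (homologyCross A D a d)) =
      homologyCross E C (spaceHomologyMap c (homologyCross A B a b)) e := by
  have h : f.comp g = ((KProd.map c (ContinuousMap.id C)).comp KProd.assocInv).comp
    (KProd.map (ContinuousMap.id A) F) := ContinuousMap.ext hf
  rw [← spaceHomologyMap_comp, h, spaceHomologyMap_comp,
    homologyCross_map (f := ContinuousMap.id A) (g := F) _ (fun _ => rfl), hF,
    spaceHomologyMap_comp, spaceHomologyMap_id, homologyCross_assocInv,
    homologyCross_map (f := c) (g := ContinuousMap.id C) _ (fun _ => rfl), spaceHomologyMap_id]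

/-- If `g` takes a factor `A` out of `P`, leaving `B`, and `F` rearranges `B`, the signs multiply. This
is the inductive step for permutations and for blocks. -/
lemma homologyCross_map_tail (f : C(P, E)) (g : C(P, KProd A B)) (c : C(KProd A B', E))
    (F : C(B, B')) (hf : ∀ z, f z = c ⟨((g z).out.1, F (g z).out.2)⟩) {p : spaceHomology k P}
    {a : spaceHomology k A} {b : spaceHomology k B} {b' : spaceHomology k B'} {s s' : ℤ}
    (hg : spaceHomologyMap g p = s • homologyCross A B a b)
    (hF : spaceHomologyMap F b = s' • b') :
    spaceHomologyMap f p = (s * s') • spaceHomologyMap c (homologyCross A B' a b') := by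
  have h : f = (c.comp (KProd.map (ContinuousMap.id A) F)).comp g := ContinuousMap.ext hf
  rw [h, spaceHomologyMap_comp, hg, spaceHomologyMap_comp, map_zsmul,
    homologyCross_map (f := ContinuousMap.id A) (g := F) _ (fun _ => rfl), hF,
    spaceHomologyMap_id, map_zsmul, map_zsmul, map_zsmul, smul_smul]

/-- If `F` moves a factor `C` to the front of `D`, then `C` is moved to the front of `A × D` at the cost
of interchanging it with `A`. -/
lemma homologyCross_cons_right (f : C(P, KProd C E)) (g : C(KProd A D, P)) (c : C(KProd A B, E))
    (F : C(D, KProd C B))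
    (hf : ∀ z, f (g z) = ⟨((F z.out.2).out.1, c ⟨(z.out.1, (F z.out.2).out.2)⟩)⟩) {p q : ℕ}
    {a : spaceHomology k A} {d : spaceHomology k D} {b : spaceHomology k B} {e : spaceHomology k C}
    {s : ℤ} (ha : a ∈ (spaceHomology k A).deg p) (he : e ∈ (spaceHomology k C).deg q)
    (hF : spaceHomologyMap F d = s • homologyCross C B e b) :
    spaceHomologyMap f (spaceHomologyMap g (homologyCross A D a d)) =
      (s * (-1) ^ (p * q)) • homologyCross C E e (spaceHomologyMap c (homologyCross A B a b)) := by
  have h : f.comp g = ((KProd.map (ContinuousMap.id C) c).comp KProd.leftComm).comp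
    (KProd.map (ContinuousMap.id A) F) := ContinuousMap.ext hf
  rw [← spaceHomologyMap_comp, h, spaceHomologyMap_comp,
    homologyCross_map (f := ContinuousMap.id A) (g := F) _ (fun _ => rfl), hF,
    spaceHomologyMap_comp, spaceHomologyMap_id, map_zsmul, map_zsmul,
    homologyCross_leftComm ha he, map_zsmul, map_zsmul,
    homologyCross_map (f := ContinuousMap.id C) (g := c) _ (fun _ => rfl), spaceHomologyMap_id,
    smul_smul]

end

/-- A product over consecutive positions is the product of two products. -/
lemma homologyCrossPi_append {r s N : ℕ} (hN : r + s = N) {X : Fin N → Type u}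
    [∀ i, TopologicalSpace (X i)] (h : Fin r → Fin N) (t : Fin s → Fin N)
    (hh : ∀ j, (h j : ℕ) = j) (ht : ∀ j, (t j : ℕ) = r + j)
    (F : C(KPi X, KProd (KPi fun j => X (h j)) (KPi fun j => X (t j))))
    (hF : ∀ z, F z = ⟨(⟨fun j => z.out (h j)⟩, ⟨fun j => z.out (t j)⟩)⟩)
    (x : ∀ i, spaceHomology k (X i)) :
    spaceHomologyMap F (homologyCrossPi X x) = homologyCross _ _
      (homologyCrossPi (fun j => X (h j)) fun j => x (h j))
      (homologyCrossPi (fun j => X (t j)) fun j => x (t j)) := by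
  induction r generalizing N with
  | zero =>
    obtain rfl : s = N := by omega
    obtain rfl : t = id := funext fun j => Fin.ext (by simp [ht])
    rw [homologyCrossPi_zero (X := fun j => X (h j)) _ ⟨isEmptyElim⟩]
    refine spaceHomologyMap_mk_point (fun z => (hF z).trans ?_) _
    exact Kify.ext (Prod.ext (Subsingleton.elim _ _) rfl)
  | succ r ih =>
    obtain ⟨N, rfl⟩ : ∃ N', N = N' + 1 := ⟨r + s, by omega⟩
    let h' : Fin r → Fin N := fun j => ⟨j, by omega⟩
    let t' : Fin s → Fin N := fun j => ⟨r + j, by omega⟩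
    obtain rfl : h = Fin.cons 0 fun j => (h' j).succ := funext fun j => Fin.ext (by
      rw [hh]
      induction j using Fin.cases <;> simp [h'])
    obtain rfl : t = fun j => (t' j).succ := funext fun j => Fin.ext (by
      rw [ht]
      simp only [t', Fin.val_succ]
      omega)
    let F' : C(KPi fun i : Fin N => X i.succ,
        KProd (KPi fun j => X (h' j).succ) (KPi fun j => X (t' j).succ)) :=
      KProd.pair (KPi.lift fun j => KPi.eval _) (KPi.lift fun j => KPi.eval _)
    rw [homologyCrossPi_succ x]
    refine (homologyCross_cons_left F (kpiCons X) (kpiCons fun j => X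
      ((Fin.cons 0 fun j => (h' j).succ : Fin (r + 1) → Fin (N + 1)) j)) F' (fun z => ?_) (x 0)
      (ih (by omega) h' t' (fun _ => rfl) (fun _ => rfl) F' (fun _ => rfl) _)).trans
      (congrArg (fun y => homologyCross _ _ y _) (homologyCrossPi_succ (X := fun j => X
        ((Fin.cons 0 fun j => (h' j).succ : Fin (r + 1) → Fin (N + 1)) j)) fun j => x _).symm)
    refine (hF _).trans (Kify.ext (Prod.ext ?_ rfl))
    exact Kify.ext (funext fun i => by induction i using Fin.cases <;> rfl)

/-- A product over blocks of consecutive positions is the product of the products over the blocks.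
By hypothesis `e i j` is the position of the `j`-th entry of the `i`-th block. -/
lemma homologyCrossPi_blocks {m N : ℕ} {n : Fin m → ℕ} (hN : ∑ i, n i = N) {X : Fin N → Type u}
    [∀ i, TopologicalSpace (X i)] (e : ∀ i, Fin (n i) → Fin N)
    (he : ∀ i j, (e i j : ℕ) = (∑ i', if i' < i then n i' else 0) + j)
    (F : C(KPi X, KPi fun i => KPi fun j => X (e i j)))
    (hF : ∀ z, F z = ⟨fun i => ⟨fun j => z.out (e i j)⟩⟩) (x : ∀ i, spaceHomology k (X i)) :
    spaceHomologyMap F (homologyCrossPi X x) =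
      homologyCrossPi _ fun i => homologyCrossPi (fun j => X (e i j)) fun j => x (e i j) := by
  induction m generalizing N with
  | zero =>
    obtain rfl : N = 0 := by simpa using hN.symm
    rw [homologyCrossPi_zero _ ⟨isEmptyElim⟩, spaceHomologyMap_point, ← homologyCrossPi_zero]
  | succ m ih =>
    rw [Fin.sum_univ_succ] at hN
    let t : Fin (∑ i : Fin m, n i.succ) → Fin N := fun j => ⟨n 0 + j, by omega⟩
    have hlt : ∀ (i : Fin m) (j : Fin (n i.succ)),
        (∑ i' : Fin m, if i' < i then n i'.succ else 0) + j < ∑ i : Fin m, n i.succ := by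
      intro i j
      have h1 : ∑ i' : Fin m, (if i' < i then n i'.succ else 0) + n i.succ =
          ∑ i' : Fin m, if i' ≤ i then n i'.succ else 0 := by
        have : n i.succ = ∑ i' : Fin m, if i' = i then n i'.succ else 0 := by simp
        rw [this, ← Finset.sum_add_distrib]
        refine Finset.sum_congr rfl fun i' _ => ?_
        rcases lt_trichotomy i' i with h | h | h
        · simp [h, h.le, h.ne]
        · simp [h]
        · simp [h.not_gt, h.not_ge, h.ne']
      have h2 : ∑ i' : Fin m, (if i' ≤ i then n i'.succ else 0) ≤ ∑ i : Fin m, n i.succ :=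
        Finset.sum_le_sum fun i' _ => by split_ifs <;> omega
      have := j.2
      omega
    let e' : ∀ i : Fin m, Fin (n i.succ) → Fin (∑ i : Fin m, n i.succ) := fun i j => ⟨_, hlt i j⟩
    obtain ⟨e₀, e₁, rfl⟩ : ∃ (e₀ : Fin (n 0) → Fin N) (e₁ : ∀ i : Fin m, Fin (n i.succ) → Fin N),
      e = Fin.cons e₀ e₁ := ⟨e 0, fun i => e i.succ, (Fin.cons_self_tail e).symm⟩
    obtain rfl : e₁ = fun i j => t (e' i j) := funext fun i => funext fun j => Fin.ext (by
      have h1 := he i.succ j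
      rw [Fin.sum_univ_succ] at h1
      simp only [Fin.cons_succ, Fin.succ_pos, if_true, Fin.succ_lt_succ_iff] at h1
      simp only [t, e']
      omega)
    let G : C(KPi X, KProd (KPi fun j => X (e₀ j)) (KPi fun j => X (t j))) :=
      KProd.pair (KPi.lift fun j => KPi.eval _) (KPi.lift fun j => KPi.eval _)
    let F' : C(KPi fun j => X (t j), KPi fun i => KPi fun j => X (t (e' i j))) :=
      KPi.lift fun i => KPi.lift fun j => KPi.eval _
    refine (homologyCross_map_tail F G (kpiCons fun i => KPi fun j => X ((Fin.cons e₀ fun i j =>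
      t (e' i j) : ∀ i, Fin (n i) → Fin N) i j)) F' (fun z => ?_) (s := 1) (s' := 1)
      ((homologyCrossPi_append hN e₀ t (fun j => by simpa using he 0 j) (fun j => rfl) G
        (fun _ => rfl) x).trans (one_smul _ _).symm)
      ((ih rfl e' (fun _ _ => rfl) F' (fun _ => rfl) _).trans (one_smul _ _).symm)).trans ?_
    · refine (hF _).trans (Kify.ext (funext fun i => ?_))
      induction i using Fin.cases <;> rfl
    · rw [mul_one, one_smul]
      exact (homologyCrossPi_succ (X := fun i => KPi fun j => X ((Fin.cons e₀ fun i j =>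
        t (e' i j) : ∀ i, Fin (n i) → Fin N) i j)) fun i => homologyCrossPi
          (fun j => X ((Fin.cons e₀ fun i j => t (e' i j) : ∀ i, Fin (n i) → Fin N) i j))
            fun j => x _).symm

/-- Moving a factor to the front contributes the signs of interchanging it with its
predecessors. -/
lemma homologyCrossPi_pull {N : ℕ} {X : Fin (N + 1) → Type u} [∀ i, TopologicalSpace (X i)]
    (r : Fin (N + 1)) (s : Fin N → Fin (N + 1)) (hs : s = r.succAbove)
    (F : C(KPi X, KProd (X r) (KPi fun j => X (s j))))
    (hF : ∀ z, F z = ⟨(z.out r, ⟨fun j => z.out (s j)⟩)⟩) {p : Fin (N + 1) → ℕ}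
    {x : ∀ i, spaceHomology k (X i)} (hx : ∀ i, x i ∈ (spaceHomology k (X i)).deg (p i)) :
    spaceHomologyMap F (homologyCrossPi X x) =
      (∏ j, if s j < r then (-1 : ℤ) ^ (p r * p (s j)) else 1) •
        homologyCross _ _ (x r) (homologyCrossPi (fun j => X (s j)) fun j => x (s j)) := by
  induction N with
  | zero =>
    obtain rfl : r = 0 := Fin.ext (by omega)
    obtain rfl : s = Fin.succ := funext fun j => j.elim0
    rw [homologyCrossPi_succ, ← spaceHomologyMap_comp]
    have e : F.comp (kpiCons X) = ContinuousMap.id _ := ContinuousMap.ext fun z => hF _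
    rw [e, spaceHomologyMap_id]
    simp
  | succ N ih =>
    induction r using Fin.cases with
    | zero =>
      obtain rfl : s = Fin.succ := hs.trans (funext fun j => by simp)
      rw [homologyCrossPi_succ, ← spaceHomologyMap_comp]
      have e : F.comp (kpiCons X) = ContinuousMap.id _ := ContinuousMap.ext fun z => hF _
      rw [e, spaceHomologyMap_id]
      simp
    | succ r =>
      obtain ⟨s', hs'⟩ : ∃ s', s' = r.succAbove := ⟨_, rfl⟩
      obtain rfl : s = Fin.cons 0 fun j => (s' j).succ := by
        rw [hs, hs']
        funext j
        induction j using Fin.cases with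
        | zero => simp
        | succ j => simp
      let F' : C(KPi fun i : Fin (N + 1) => X i.succ, KProd (X r.succ) (KPi fun j => X (s' j).succ)) :=
        KProd.pair (KPi.eval _) (KPi.lift fun j => KPi.eval _)
      rw [homologyCrossPi_succ x]
      have hF' := ih (X := fun i => X i.succ) r s' hs' F' (fun _ => rfl) (p := fun i => p i.succ)
        (x := fun i => x i.succ) (fun i => hx i.succ)
      refine (homologyCross_cons_right (a := x 0) (e := x r.succ) (p := p 0) (q := p r.succ) F
        (kpiCons X) (kpiCons fun j => X
          ((Fin.cons 0 fun j => (s' j).succ : Fin (N + 1) → Fin (N + 2)) j)) F' (fun z => ?_)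
        (hx 0) (hx r.succ) hF').trans ?_
      · refine (hF _).trans (Kify.ext (Prod.ext rfl ?_))
        exact Kify.ext (funext fun i => by induction i using Fin.cases <;> rfl)
      · refine congrArg₂ (fun (a : ℤ) b => a • homologyCross _ _ (x r.succ) b) ?_
          (homologyCrossPi_succ (X := fun j => X ((Fin.cons 0 fun j => (s' j).succ :
            Fin (N + 1) → Fin (N + 2)) j)) fun j => x _).symm
        rw [Fin.prod_univ_succ, mul_comm]
        simp [mul_comm]

/-- A permutation of the factors contributes a Koszul sign: move the factor which is to be the first
one to the front, and permute the others. -/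
lemma homologyCrossPi_perm {m n : ℕ} {X : Fin n → Type u} [∀ i, TopologicalSpace (X i)]
    (e : Fin m → Fin n) (he : Function.Bijective e) (F : C(KPi X, KPi fun j => X (e j)))
    (hF : ∀ z, F z = ⟨fun j => z.out (e j)⟩) {p : Fin n → ℕ}
    {x : ∀ i, spaceHomology k (X i)} (hx : ∀ i, x i ∈ (spaceHomology k (X i)).deg (p i)) :
    spaceHomologyMap F (homologyCrossPi X x) =
      (∏ i, ∏ j ∈ Finset.Ioi i, if e j < e i then (-1 : ℤ) ^ (p (e i) * p (e j)) else 1) •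
        homologyCrossPi (fun j => X (e j)) fun j => x (e j) := by
  induction m generalizing n with
  | zero =>
    obtain rfl : n = 0 := by simpa using (Fintype.card_of_bijective he).symm
    rw [homologyCrossPi_zero _ ⟨isEmptyElim⟩, spaceHomologyMap_point,
      ← homologyCrossPi_zero fun j => x (e j)]
    simp
  | succ m ih =>
    obtain rfl : m + 1 = n := by simpa using Fintype.card_of_bijective he
    obtain ⟨r, e', rfl⟩ : ∃ (r : Fin (m + 1)) (e' : Fin m → Fin m),
        e = Fin.cons r fun j => r.succAbove (e' j) := by
      have : ∀ j : Fin m, ∃ c, (e 0).succAbove c = e j.succ := fun j =>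
        Fin.exists_succAbove_eq fun h => Fin.succ_ne_zero j (he.1 h)
      choose c hc using this
      exact ⟨e 0, c, funext fun j => by induction j using Fin.cases <;> simp [hc]⟩
    have he' : Function.Bijective e' := by
      rw [← Finite.injective_iff_bijective]
      intro i j hij
      have := @he.1 i.succ j.succ (by simp [hij])
      exact Fin.succ_injective _ this
    let G : C(KPi X, KProd (X r) (KPi fun j => X (r.succAbove j))) :=
      KProd.pair (KPi.eval _) (KPi.lift fun j => KPi.eval _)
    let F' : C(KPi fun j => X (r.succAbove j), KPi fun j => X (r.succAbove (e' j))) :=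
      KPi.lift fun j => KPi.eval _
    refine (homologyCross_map_tail F G (kpiCons fun j => X ((Fin.cons r fun j =>
      r.succAbove (e' j) : Fin (m + 1) → Fin (m + 1)) j)) F' (fun z => ?_)
      (homologyCrossPi_pull r _ rfl G (fun _ => rfl) hx)
      (ih e' he' F' (fun _ => rfl) (fun i => hx (r.succAbove i)))).trans ?_
    · refine (hF _).trans (Kify.ext (funext fun i => ?_))
      induction i using Fin.cases <;> rfl
    refine congrArg₂ (fun (a : ℤ) b => a • b) ?_ (homologyCrossPi_succ (X := fun j => X
      ((Fin.cons r fun j => r.succAbove (e' j) : Fin (m + 1) → Fin (m + 1)) j)) fun j => x _).symm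
    rw [Fin.prod_univ_succ]
    congr 1
    · rw [Fin.prod_Ioi_zero, ← (Equiv.ofBijective e' he').prod_comp]
      rfl
    · refine Finset.prod_congr rfl fun i _ => ?_
      rw [Fin.prod_Ioi_succ]
      simp [Fin.succAbove_lt_succAbove_iff]

end CrossPiRearrange

section GradedSigns

/-! ### Signed maps on homogeneous elements -/

open scoped DirectSum TensorProduct

variable {k : Type u} [Field k]

namespace GrMod

lemma neg_one_pow_val_mul (p q : ℕ) : (-1 : ℤ) ^ ((p : ZMod 2) * (q : ZMod 2)).val =
    (-1) ^ (p * q) := by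
  rw [← Nat.cast_mul, ZMod.val_natCast, ← Nat.div_add_mod (p * q) 2, pow_add, pow_mul]
  simp

lemma shuffleSign_cast {m : ℕ} (p q : Fin m → ℕ) :
    shuffleSign (fun i => (p i : ZMod 2)) (fun i => (q i : ZMod 2)) =
      ∏ i, ∏ j ∈ Finset.Ioi i, (-1 : ℤ) ^ (p j * q i) := by
  simp only [shuffleSign, neg_one_pow_val_mul]

lemma shuffleSign_mul_self {m : ℕ} (δ η : Fin m → ZMod 2) :
    shuffleSign δ η * shuffleSign δ η = 1 := by
  rw [shuffleSign, ← Finset.prod_mul_distrib]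
  refine Finset.prod_eq_one fun i _ => ?_
  rw [← Finset.prod_mul_distrib]
  exact Finset.prod_eq_one fun j _ => by rw [← pow_add, Even.neg_one_pow ⟨_, rfl⟩]

lemma koszulSign_cast {m n : ℕ} (e : Fin m ≃ Fin n) (p : Fin m → ℕ) :
    koszulSign e (fun i => (p i : ZMod 2)) =
      ∏ i, ∏ j ∈ Finset.Ioi i, if e j < e i then (-1 : ℤ) ^ (p i * p j) else 1 := by
  simp only [koszulSign, neg_one_pow_val_mul]

lemma par_apply (V : GrMod.{u} k) {p : ℕ} {x : V} (hx : x ∈ V.deg p) (δ : ZMod 2) :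
    V.par δ x = if (p : ZMod 2) = δ then x else 0 := by
  rw [par, select_apply _ _ hx]
  by_cases h : (p : ZMod 2) = δ
  · rw [if_pos h, if_pos (Set.mem_ofPred_eq ▸ h)]
  · rw [if_neg h, if_neg (Set.mem_ofPred_eq ▸ h)]

lemma select_mem (V : GrMod.{u} k) (n : ℕ) (x : V) : V.select {n} x ∈ V.deg n := by
  have h : (V.deg n).mkQ ∘ₗ V.select {n} = 0 := linearMap_ext fun p x hx => by
    rw [LinearMap.comp_apply, select_apply _ _ hx, LinearMap.zero_apply]
    split_ifs with hp
    · obtain rfl : p = n := hp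
      exact (Submodule.Quotient.mk_eq_zero _).2 hx
    · exact map_zero _
  exact (Submodule.Quotient.mk_eq_zero _).1 (congrArg (fun f => f x) h)

/-- An injective graded map reflects degrees. -/
lemma mem_of_injective {V W : GrMod.{u} k} {f : V →ₗ[k] W} (hf : Function.Injective f)
    (hfd : ∀ n, ∀ x ∈ V.deg n, f x ∈ W.deg n) {n : ℕ} {x : V} (hx : f x ∈ W.deg n) :
    x ∈ V.deg n := by
  have h : W.select {n} ∘ₗ f = f ∘ₗ V.select {n} := linearMap_ext fun p x hx => by
    rw [LinearMap.comp_apply, LinearMap.comp_apply, select_apply _ _ hx,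
      select_apply _ _ (hfd p x hx)]
    split_ifs <;> simp
  have h' : W.select {n} (f x) = f (V.select {n} x) := congrArg (fun f => f x) h
  rw [select_apply _ _ hx, if_pos (Set.mem_singleton n)] at h'
  rw [hf h']
  exact select_mem V n x

lemma tensor_hom_ext {V W : GrMod.{u} k} {M : Type*} [AddCommGroup M] [Module k M]
    {f g : V ⊗[k] W →ₗ[k] M}
    (h : ∀ p q, ∀ v ∈ V.deg p, ∀ w ∈ W.deg q, f (v ⊗ₜ w) = g (v ⊗ₜ w)) : f = g := by
  refine TensorProduct.ext (linearMap_ext fun p v hv => linearMap_ext fun q w hw => ?_)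
  exact h p q v hv w hw

lemma pi_hom_ext {m : ℕ} {V : Fin m → GrMod.{u} k} {M : Type*} [AddCommGroup M] [Module k M]
    {f g : (⨂[k] i, V i) →ₗ[k] M} (h : ∀ (p : Fin m → ℕ) (v : ∀ i, V i),
      (∀ i, v i ∈ (V i).deg (p i)) → f (PiTensorProduct.tprod k v) = g (PiTensorProduct.tprod k v)) :
    f = g := by
  refine LinearMap.ext_on_range (PiTensorProduct.submodule_span_eq_top (R := k)
    (g := fun i (x : {x : V i // ∃ n, x ∈ (V i).deg n}) => (x : V i))
    (fun i => (V i).span_homogeneous)) fun x => ?_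
  choose p hp using fun i => (x i).2
  exact h p _ hp

lemma signedMap₂_tmul {A B V W : GrMod.{u} k} {X Y : Type u} [AddCommGroup X] [Module k X]
    [AddCommGroup Y] [Module k Y] (f : A →ₗ[k] V →ₗ[k] X) (g : B →ₗ[k] W →ₗ[k] Y) (a : A) {b : B}
    {v : V} (w : W) {p q : ℕ} (hb : b ∈ B.deg p) (hv : v ∈ V.deg q) :
    signedMap₂ f g (a ⊗ₜ b) (v ⊗ₜ w) = ((-1 : ℤ) ^ (p * q)) • f a v ⊗ₜ[k] g b w := by
  simp only [signedMap₂, LinearMap.sum_apply, LinearMap.smul_apply, LinearMap.compl₁₂_apply,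
    TensorProduct.map_tmul, LinearMap.id_apply, par_apply _ hb, par_apply _ hv]
  rw [Finset.sum_eq_single (p : ZMod 2) (fun δ _ hδ => by simp [hδ.symm]) (by simp),
    Finset.sum_eq_single (q : ZMod 2) (fun δ _ hδ => by simp [hδ.symm]) (by simp),
    if_pos rfl, if_pos rfl, neg_one_pow_val_mul]
  rfl

lemma signedSwap_tmul {V W : GrMod.{u} k} {v : V} {w : W} {p q : ℕ} (hv : v ∈ V.deg p)
    (hw : w ∈ W.deg q) : signedSwap V W (v ⊗ₜ w) = ((-1 : ℤ) ^ (p * q)) • w ⊗ₜ[k] v := by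
  simp only [signedSwap, LinearMap.sum_apply, LinearMap.smul_apply, LinearMap.comp_apply,
    TensorProduct.map_tmul, par_apply _ hv, par_apply _ hw]
  rw [Finset.sum_eq_single (p : ZMod 2) (fun δ _ hδ => by simp [hδ.symm]) (by simp),
    Finset.sum_eq_single (q : ZMod 2) (fun δ _ hδ => by simp [hδ.symm]) (by simp),
    if_pos rfl, if_pos rfl, neg_one_pow_val_mul]
  rfl

/-- A homogeneous tensor survives only that projection to parities which is given by its degrees, so
that one summand remains in a sum over all parities. -/
lemma map_par_tprod {m : ℕ} {V : Fin m → GrMod.{u} k} {p : Fin m → ℕ} {v : ∀ i, V i}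
    (hv : ∀ i, v i ∈ (V i).deg (p i)) (δ : Fin m → ZMod 2) :
    PiTensorProduct.map (fun i => (V i).par (δ i)) (PiTensorProduct.tprod k v) =
      if (fun i => (p i : ZMod 2)) = δ then PiTensorProduct.tprod k v else 0 := by
  rw [PiTensorProduct.map_tprod]
  split_ifs with h
  · subst h
    congr 1
    funext i
    rw [par_apply _ (hv i), if_pos rfl]
  · obtain ⟨i, hi⟩ := Function.ne_iff.1 h
    refine MultilinearMap.map_coord_zero _ i ?_
    rw [par_apply _ (hv i), if_neg hi]

/-- A signed sum of linear maps, all but one of which vanish at `x`. -/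
lemma sum_zsmul_apply {ι M N : Type*} [Fintype ι] [DecidableEq ι] [AddCommGroup M] [Module k M]
    [AddCommGroup N] [Module k N] (c : ι → ℤ) (f : ι → M →ₗ[k] N) (x : M) (i₀ : ι)
    (h : ∀ i, i ≠ i₀ → f i x = 0) : (∑ i, c i • f i) x = c i₀ • f i₀ x := by
  rw [LinearMap.sum_apply, Finset.sum_eq_single i₀ (fun i _ hi => by
    rw [LinearMap.smul_apply, h i hi, smul_zero]) (by simp), LinearMap.smul_apply]

lemma sum_sum_zsmul_apply {ι M N : Type*} [Fintype ι] [DecidableEq ι] [AddCommGroup M]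
    [Module k M] [AddCommGroup N] [Module k N] (c : ι → ι → ℤ) (f : ι → ι → M →ₗ[k] N) (x : M)
    (i₀ j₀ : ι) (h : ∀ i j, ¬ (i = i₀ ∧ j = j₀) → f i j x = 0) :
    (∑ i, ∑ j, c i j • f i j) x = c i₀ j₀ • f i₀ j₀ x := by
  have := sum_zsmul_apply (fun _ => 1) (fun i => ∑ j, c i j • f i j) x i₀ fun i hi => by
    rw [sum_zsmul_apply (c i) (f i) x j₀ fun j _ => h i j fun h => hi h.1,
      h i j₀ fun h => hi h.1, smul_zero]
  simp only [one_smul] at this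
  rw [this, sum_zsmul_apply (c i₀) (f i₀) x j₀ fun j hj => h i₀ j fun h => hj h.2]

lemma sum_sum_zsmul_apply₂ {ι L M N : Type*} [Fintype ι] [DecidableEq ι] [AddCommGroup L]
    [Module k L] [AddCommGroup M] [Module k M] [AddCommGroup N] [Module k N] (c : ι → ι → ℤ)
    (f : ι → ι → L →ₗ[k] M →ₗ[k] N) (x : L) (y : M) (i₀ j₀ : ι)
    (h : ∀ i j, ¬ (i = i₀ ∧ j = j₀) → f i j x y = 0) :
    (∑ i, ∑ j, c i j • f i j) x y = c i₀ j₀ • f i₀ j₀ x y := by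
  refine Eq.trans ?_ (sum_sum_zsmul_apply c (fun i j => (f i j).flip y) x i₀ j₀ h)
  simp only [LinearMap.sum_apply, LinearMap.smul_apply, LinearMap.flip_apply]

lemma signedMapPi_tprod {m : ℕ} {V W : Fin m → GrMod.{u} k} {X : Fin m → Type u}
    [∀ i, AddCommGroup (X i)] [∀ i, Module k (X i)] (f : ∀ i, V i →ₗ[k] W i →ₗ[k] X i)
    {p q : Fin m → ℕ} {v : ∀ i, V i} {w : ∀ i, W i} (hv : ∀ i, v i ∈ (V i).deg (p i))
    (hw : ∀ i, w i ∈ (W i).deg (q i)) :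
    signedMapPi f (PiTensorProduct.tprod k v) (PiTensorProduct.tprod k w) =
      (∏ i, ∏ j ∈ Finset.Ioi i, (-1 : ℤ) ^ (p j * q i)) •
        PiTensorProduct.tprod k (fun i => f i (v i) (w i)) := by
  refine (sum_sum_zsmul_apply₂ (fun δ η => shuffleSign δ η) (fun δ η =>
    (PiTensorProduct.map₂ f).compl₁₂ (PiTensorProduct.map fun i => (V i).par (δ i))
      (PiTensorProduct.map fun i => (W i).par (η i))) _ _ (fun i => (p i : ZMod 2))
        (fun i => (q i : ZMod 2)) ?_).trans ?_
  · intro δ η h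
    rw [LinearMap.compl₁₂_apply, map_par_tprod hv, map_par_tprod hw]
    split_ifs with h1 h2
    · exact (h ⟨h1.symm, h2.symm⟩).elim
    · exact map_zero _
    · exact LinearMap.map_zero₂ _ _
    · exact LinearMap.map_zero₂ _ _
  · rw [LinearMap.compl₁₂_apply, map_par_tprod hv, map_par_tprod hw, if_pos rfl, if_pos rfl,
      shuffleSign_cast, PiTensorProduct.map₂_tprod_tprod]

lemma signedSplit_tprod {m : ℕ} {V W : Fin m → GrMod.{u} k} {p q : Fin m → ℕ} {v : ∀ i, V i}
    {w : ∀ i, W i} (hv : ∀ i, v i ∈ (V i).deg (p i)) (hw : ∀ i, w i ∈ (W i).deg (q i)) :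
    signedSplit V W (PiTensorProduct.tprod k fun i => v i ⊗ₜ w i) =
      (∏ i, ∏ j ∈ Finset.Ioi i, (-1 : ℤ) ^ (p j * q i)) •
        (PiTensorProduct.tprod k v ⊗ₜ[k] PiTensorProduct.tprod k w) := by
  have hs : PiTensorProduct.lift (split (fun i => (V i).carrier) (fun i => (W i).carrier))
      (PiTensorProduct.tprod k fun i => v i ⊗ₜ w i) =
      PiTensorProduct.tprod k v ⊗ₜ[k] PiTensorProduct.tprod k w := by
    rw [PiTensorProduct.lift.tprod, split_tmul]
  refine (sum_sum_zsmul_apply (fun δ η => shuffleSign δ η) (fun δ η =>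
    TensorProduct.map (PiTensorProduct.map fun i => (V i).par (δ i))
      (PiTensorProduct.map fun i => (W i).par (η i)) ∘ₗ
        PiTensorProduct.lift (split (fun i => (V i).carrier) (fun i => (W i).carrier))) _
          (fun i => (p i : ZMod 2)) (fun i => (q i : ZMod 2)) ?_).trans ?_
  · intro δ η h
    rw [LinearMap.comp_apply, hs, TensorProduct.map_tmul, map_par_tprod hv, map_par_tprod hw]
    split_ifs with h1 h2
    · exact (h ⟨h1.symm, h2.symm⟩).elim
    · exact TensorProduct.tmul_zero _ _
    · exact TensorProduct.zero_tmul _ _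
    · exact TensorProduct.zero_tmul _ _
  · rw [LinearMap.comp_apply, hs, TensorProduct.map_tmul, map_par_tprod hv, map_par_tprod hw,
      if_pos rfl, if_pos rfl, shuffleSign_cast]

lemma signedPerm_tprod {V : GrMod.{u} k} {m n : ℕ} (e : Fin m ≃ Fin n) {p : Fin m → ℕ}
    {v : Fin m → V} (hv : ∀ i, v i ∈ V.deg (p i)) :
    signedPerm V e (PiTensorProduct.tprod k v) =
      (∏ i, ∏ j ∈ Finset.Ioi i, if e j < e i then (-1 : ℤ) ^ (p i * p j) else 1) •
        PiTensorProduct.tprod k (fun i => v (e.symm i)) := by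
  refine (sum_zsmul_apply (fun δ => koszulSign e δ)
    (fun δ => (PiTensorProduct.reindex k (fun _ => V.carrier) e).toLinearMap ∘ₗ
      PiTensorProduct.map fun i => V.par (δ i)) _ (fun i => (p i : ZMod 2)) ?_).trans ?_
  · intro δ hδ
    rw [LinearMap.comp_apply, map_par_tprod (V := fun _ => V) hv, if_neg hδ.symm, map_zero]
  · rw [LinearMap.comp_apply, map_par_tprod (V := fun _ => V) hv, if_pos rfl, koszulSign_cast,
      LinearEquiv.coe_coe, PiTensorProduct.reindex_tprod]

end GrMod

end GradedSigns

section KunnethMaps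

open scoped DirectSum TensorProduct
open OperadEquiv GrMod

variable {k : Type u} [Field k]

/-! ### Signed maps and the Künneth isomorphism -/

/-- The Künneth isomorphism turns signed tensor products of pairings into products of maps. The
modules `W` and `Y`, which need not be the homology of a space, are compared with homology by maps
`jW` and `jY`; for iterated tensor products these are themselves Künneth maps. -/
lemma kunneth_signedMap₂ {𝔸 𝔹 𝕍 𝕎 𝕏 𝕐 : Type u} [TopologicalSpace 𝔸] [TopologicalSpace 𝔹]
    [TopologicalSpace 𝕍] [TopologicalSpace 𝕎] [TopologicalSpace 𝕏] [TopologicalSpace 𝕐]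
    {W : GrMod.{u} k} {Y : Type u} [AddCommGroup Y] [Module k Y]
    (f : spaceHomology k 𝔸 →ₗ[k] spaceHomology k 𝕍 →ₗ[k] spaceHomology k 𝕏)
    (g : spaceHomology k 𝔹 →ₗ[k] W →ₗ[k] Y) (jW : W →ₗ[k] spaceHomology k 𝕎)
    (jY : Y →ₗ[k] spaceHomology k 𝕐) (φ : C(KProd 𝔸 𝕍, 𝕏)) (ψ : C(KProd 𝔹 𝕎, 𝕐))
    (hf : ∀ a v, f a v = spaceHomologyMap φ (homologyCross 𝔸 𝕍 a v))
    (hg : ∀ b w, jY (g b w) = spaceHomologyMap ψ (homologyCross 𝔹 𝕎 b (jW w)))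
    (s : spaceHomology k 𝔸 ⊗[k] spaceHomology k 𝔹) (t : spaceHomology k 𝕍 ⊗[k] W) :
    TensorProduct.lift ((homologyCross 𝕏 𝕐).compl₂ jY) (signedMap₂ f g s t) =
      spaceHomologyMap ((KProd.map φ ψ).comp KProd.interchange)
        (homologyCross _ _ (TensorProduct.lift (homologyCross 𝔸 𝔹) s)
          (TensorProduct.lift ((homologyCross 𝕍 𝕎).compl₂ jW) t)) := by
  suffices H : (signedMap₂ f g).compr₂ (TensorProduct.lift ((homologyCross 𝕏 𝕐).compl₂ jY)) =
      ((homologyCross (k := k) (KProd 𝔸 𝔹) (KProd 𝕍 𝕎)).compr₂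
        (spaceHomologyMap ((KProd.map φ ψ).comp KProd.interchange))).compl₁₂
        (TensorProduct.lift (homologyCross 𝔸 𝔹))
          (TensorProduct.lift ((homologyCross 𝕍 𝕎).compl₂ jW)) from
    congrArg (fun f => f s t) H
  refine tensor_hom_ext fun p q a ha b hb => tensor_hom_ext fun p' q' v hv w hw => ?_
  rw [LinearMap.compr₂_apply, signedMap₂_tmul _ _ _ _ hb hv, map_zsmul, TensorProduct.lift.tmul,
    LinearMap.compl₁₂_apply, TensorProduct.lift.tmul, TensorProduct.lift.tmul,
    LinearMap.compl₂_apply, LinearMap.compl₂_apply, LinearMap.compr₂_apply, hf, hg,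
    spaceHomologyMap_comp, homologyCross_interchange _ _ hb hv, map_zsmul,
    homologyCross_map (f := φ) (g := ψ) _ fun _ => rfl]

/-- The map which pairs the components of two families. -/
def KPi.zip {ι : Type} {X Y : ι → Type u} [∀ i, TopologicalSpace (X i)]
    [∀ i, TopologicalSpace (Y i)] : C(KProd (KPi X) (KPi Y), KPi fun i => KProd (X i) (Y i)) :=
  KPi.lift fun i => KProd.pair ((KPi.eval i).comp KProd.fst) ((KPi.eval i).comp KProd.snd)

/-- The map which separates the components of a family of pairs. -/
def KPi.unzip {ι : Type} {X Y : ι → Type u} [∀ i, TopologicalSpace (X i)]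
    [∀ i, TopologicalSpace (Y i)] : C(KPi fun i => KProd (X i) (Y i), KProd (KPi X) (KPi Y)) :=
  KProd.pair (KPi.lift fun i => KProd.fst.comp (KPi.eval i))
    (KPi.lift fun i => KProd.snd.comp (KPi.eval i))

lemma shuffleProd_mul_self {m : ℕ} (p q : Fin m → ℕ) :
    (∏ i, ∏ j ∈ Finset.Ioi i, (-1 : ℤ) ^ (p j * q i)) *
      (∏ i, ∏ j ∈ Finset.Ioi i, (-1 : ℤ) ^ (p j * q i)) = 1 := by
  rw [← shuffleSign_cast, shuffleSign_mul_self]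

/-- The inverse of `homologyCrossPi_unzip`. -/
lemma homologyCrossPi_zip {m : ℕ} {X Y : Fin m → Type u} [∀ i, TopologicalSpace (X i)]
    [∀ i, TopologicalSpace (Y i)] {p q : Fin m → ℕ} {x : ∀ i, spaceHomology k (X i)}
    {y : ∀ i, spaceHomology k (Y i)} (hx : ∀ i, x i ∈ (spaceHomology k (X i)).deg (p i))
    (hy : ∀ i, y i ∈ (spaceHomology k (Y i)).deg (q i)) :
    spaceHomologyMap KPi.zip (homologyCross _ _ (homologyCrossPi X x) (homologyCrossPi Y y)) =
      (∏ i, ∏ j ∈ Finset.Ioi i, (-1 : ℤ) ^ (p j * q i)) •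
        homologyCrossPi _ fun i => homologyCross (X i) (Y i) (x i) (y i) := by
  have h := congrArg (spaceHomologyMap KPi.zip)
    (homologyCrossPi_unzip KPi.unzip (fun _ => rfl) hx hy)
  rw [← spaceHomologyMap_comp, map_zsmul] at h
  have h1 : spaceHomologyMap (KPi.zip.comp KPi.unzip)
      (homologyCrossPi _ fun i => homologyCross (X i) (Y i) (x i) (y i)) = _ :=
    spaceHomologyMap_id _
  rw [h1] at h
  rw [h, smul_smul, shuffleProd_mul_self, one_smul]

/-- The Künneth isomorphism turns signed tensor products of families of pairings into products of
maps. As in `kunneth_signedMap₂`, the modules `W i` and `X i` are compared with homology by maps. -/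
lemma kunneth_signedMapPi {m : ℕ} {𝕍 𝕎 𝕏 : Fin m → Type u} [∀ i, TopologicalSpace (𝕍 i)]
    [∀ i, TopologicalSpace (𝕎 i)] [∀ i, TopologicalSpace (𝕏 i)] {W : Fin m → GrMod.{u} k}
    {X : Fin m → Type u} [∀ i, AddCommGroup (X i)] [∀ i, Module k (X i)]
    (f : ∀ i, spaceHomology k (𝕍 i) →ₗ[k] W i →ₗ[k] X i)
    (jW : ∀ i, W i →ₗ[k] spaceHomology k (𝕎 i))
    (hjW : ∀ i d, ∀ w ∈ (W i).deg d, jW i w ∈ (spaceHomology k (𝕎 i)).deg d)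
    (jX : ∀ i, X i →ₗ[k] spaceHomology k (𝕏 i)) (φ : ∀ i, C(KProd (𝕍 i) (𝕎 i), 𝕏 i))
    (hf : ∀ i v w, jX i (f i v w) = spaceHomologyMap (φ i) (homologyCross _ _ v (jW i w)))
    (F : C(KProd (KPi 𝕍) (KPi 𝕎), KPi 𝕏))
    (hF : ∀ z i, (F z).out i = φ i ⟨(z.out.1.out i, z.out.2.out i)⟩)
    (s : ⨂[k] i, spaceHomology k (𝕍 i)) (t : ⨂[k] i, W i) :
    PiTensorProduct.lift ((homologyCrossPi 𝕏).compLinearMap jX)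
        (signedMapPi (V := fun i => spaceHomology k (𝕍 i)) f s t) =
      spaceHomologyMap F (homologyCross _ _ (PiTensorProduct.lift (homologyCrossPi 𝕍) s)
        (PiTensorProduct.lift ((homologyCrossPi 𝕎).compLinearMap jW) t)) := by
  suffices H : (signedMapPi (V := fun i => spaceHomology k (𝕍 i)) f).compr₂
        (PiTensorProduct.lift ((homologyCrossPi 𝕏).compLinearMap jX)) =
      ((homologyCross (k := k) (KPi 𝕍) (KPi 𝕎)).compr₂ (spaceHomologyMap F)).compl₁₂
        (PiTensorProduct.lift (homologyCrossPi 𝕍))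
          (PiTensorProduct.lift ((homologyCrossPi 𝕎).compLinearMap jW)) from
    congrArg (fun f => f s t) H
  refine pi_hom_ext (V := fun i => spaceHomology k (𝕍 i)) fun p v hv => pi_hom_ext fun q w hw => ?_
  let Φ : C(KPi fun i => KProd (𝕍 i) (𝕎 i), KPi 𝕏) := KPi.lift fun i => (φ i).comp (KPi.eval i)
  have hFΦ : F = Φ.comp KPi.zip := ContinuousMap.ext fun z => Kify.ext (funext fun i => hF z i)
  rw [LinearMap.compr₂_apply, signedMapPi_tprod (V := fun i => spaceHomology k (𝕍 i)) _ hv hw,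
    map_zsmul, PiTensorProduct.lift.tprod, LinearMap.compl₁₂_apply, LinearMap.compr₂_apply,
    PiTensorProduct.lift.tprod, PiTensorProduct.lift.tprod, MultilinearMap.compLinearMap_apply,
    MultilinearMap.compLinearMap_apply, hFΦ, spaceHomologyMap_comp,
    homologyCrossPi_zip hv fun i => hjW i _ _ (hw i), map_zsmul,
    homologyCrossPi_map φ Φ fun _ _ => rfl]
  simp only [hf]

end KunnethMaps

section HopfAlgebra

open scoped DirectSum TensorProduct
open OperadEquiv GrMod

variable {k : Type u} [Field k]

/-! ### The Hopf algebra of a topological group -/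

lemma lift_homologyCross_mem {X Y : Type u} [TopologicalSpace X] [TopologicalSpace Y] {n : ℕ}
    {t : spaceHomology k X ⊗[k] spaceHomology k Y}
    (ht : t ∈ ((spaceHomology k X).tensor (spaceHomology k Y)).deg n) :
    TensorProduct.lift (homologyCross X Y) t ∈ (spaceHomology k (KProd X Y)).deg n := by
  refine (Submodule.span_le (p := ((spaceHomology k (KProd X Y)).deg n).comap
    (TensorProduct.lift (homologyCross X Y)))).2 ?_ ht
  rintro _ ⟨p, q, rfl, x, hx, y, hy, rfl⟩
  exact homologyCross_mem hx hy

namespace TopGrp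

variable (G : TopGrp.{u})

/-- The multiplication of a topological group. -/
def mulMap : C(KProd G.carrier G.carrier, G.carrier) :=
  ⟨fun x => x.out.1 * x.out.2, G.continuous_mul⟩

/-- The inversion of a topological group. -/
def invMap : C(G.carrier, G.carrier) := ⟨fun x => x⁻¹, G.continuous_inv⟩

/-- The diagonal of a topological group. -/
def diagMap : C(G.carrier, KProd G.carrier G.carrier) :=
  ⟨fun g => ⟨(g, g)⟩, KProd.continuous_mk continuous_id continuous_id⟩

/-- The Künneth map for three factors. -/
noncomputable def kunneth₃ : spaceHomology k G.carrier ⊗[k]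
    (spaceHomology k G.carrier ⊗[k] spaceHomology k G.carrier) →ₗ[k]
      spaceHomology k (KProd G.carrier (KProd G.carrier G.carrier)) :=
  TensorProduct.lift ((homologyCross _ _).compl₂ (G.kunneth k))

lemma kunneth_bijective : Function.Bijective (G.kunneth k) := homologyCross_bijective _ _

lemma kunneth₃_injective : Function.Injective (G.kunneth₃ (k := k)) := by
  have h : G.kunneth₃ (k := k) = TensorProduct.lift (homologyCross _ _) ∘ₗ
      (G.kunneth k).lTensor (spaceHomology k G.carrier) := TensorProduct.ext' fun x t => rfl
  rw [h]
  exact (homologyCross_bijective _ _).1.comp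
    (Module.Flat.lTensor_preserves_injective_linearMap _ G.kunneth_bijective.1)

variable (k) in
/-- The multiplication of `H(G)`. This is the multiplication of `G.hopf k`, with a type in which the
underlying module is visibly the homology of `G`. -/
noncomputable def homologyMul : spaceHomology k G.carrier →ₗ[k] spaceHomology k G.carrier →ₗ[k]
    spaceHomology k G.carrier :=
  (homologyCross G.carrier G.carrier).compr₂ (spaceHomologyMap G.mulMap)

variable (k) in
/-- The comultiplication of `H(G)`, again in terms of the homology of `G`. -/
noncomputable def homologyComul : spaceHomology k G.carrier →ₗ[k]
    spaceHomology k G.carrier ⊗[k] spaceHomology k G.carrier := (G.hopf k).comul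

/-- The comultiplication becomes the map induced by the diagonal, under the Künneth
isomorphism. -/
lemma kunneth_comul (x : spaceHomology k G.carrier) :
    G.kunneth k (G.homologyComul k x) = spaceHomologyMap G.diagMap x := by
  classical
  have h : G.homologyComul k = (if h : Function.Bijective (G.kunneth k) then
      (LinearEquiv.ofBijective (G.kunneth k) h).symm.toLinearMap else 0) ∘ₗ G.diagonal k := by
    unfold homologyComul hopf
    congr!
  rw [h, dif_pos G.kunneth_bijective]
  exact LinearEquiv.apply_symm_apply (LinearEquiv.ofBijective (G.kunneth k) G.kunneth_bijective) _

/-- The Künneth isomorphism turns `S(x) y` into the map `(g, h) ↦ g⁻¹ h`. -/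
lemma lift_mul_antipode (t : spaceHomology k G.carrier ⊗[k] spaceHomology k G.carrier) :
    TensorProduct.lift ((G.homologyMul k) ∘ₗ (spaceHomologyMap G.invMap)) t =
      spaceHomologyMap (G.mulMap.comp (KProd.map G.invMap (ContinuousMap.id _)))
        (G.kunneth k t) := by
  refine congrArg (fun f => f t) (TensorProduct.ext' (g := TensorProduct.lift
    ((G.homologyMul k) ∘ₗ (spaceHomologyMap G.invMap))) (h := spaceHomologyMap _ ∘ₗ G.kunneth k)
      fun x y => ?_)
  refine Eq.trans ?_ (spaceHomologyMap_comp _ _ (homologyCross _ _ x y)).symm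
  rw [homologyCross_map (f := G.invMap) (g := ContinuousMap.id _) _ (fun _ => rfl),
    spaceHomologyMap_id]
  rfl

lemma lift_mul_antipode_right (t : spaceHomology k G.carrier ⊗[k] spaceHomology k G.carrier) :
    TensorProduct.lift ((G.homologyMul k).compl₂ (spaceHomologyMap G.invMap)) t =
      spaceHomologyMap (G.mulMap.comp (KProd.map (ContinuousMap.id _) G.invMap))
        (G.kunneth k t) := by
  refine congrArg (fun f => f t) (TensorProduct.ext' (g := TensorProduct.lift
    ((G.homologyMul k).compl₂ (spaceHomologyMap G.invMap))) (h := spaceHomologyMap _ ∘ₗ G.kunneth k)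
      fun x y => ?_)
  refine Eq.trans ?_ (spaceHomologyMap_comp _ _ (homologyCross _ _ x y)).symm
  rw [homologyCross_map (g := G.invMap) (f := ContinuousMap.id _) _ (fun _ => rfl),
    spaceHomologyMap_id]
  rfl

/-- The Künneth isomorphism turns the signed interchange into the interchange of factors. -/
lemma kunneth_signedSwap (t : spaceHomology k G.carrier ⊗[k] spaceHomology k G.carrier) :
    G.kunneth k (signedSwap _ _ t) = spaceHomologyMap KProd.swap (G.kunneth k t) := by
  refine congrArg (fun f => f t) (tensor_hom_ext
    (f := G.kunneth k ∘ₗ signedSwap _ _) (g := spaceHomologyMap KProd.swap ∘ₗ G.kunneth k)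
      fun p q x hx y hy => ?_)
  rw [LinearMap.comp_apply, signedSwap_tmul hx hy, map_zsmul]
  exact (homologyCross_comm KProd.swap (fun _ => rfl) hx hy).symm

lemma kunneth₃_assoc (s : spaceHomology k G.carrier ⊗[k] spaceHomology k G.carrier)
    (y : spaceHomology k G.carrier) :
    G.kunneth₃ (TensorProduct.assoc k _ _ _ (s ⊗ₜ y)) =
      spaceHomologyMap KProd.assoc (homologyCross _ _ (G.kunneth k s) y) := by
  refine congrArg (fun f => f s) (TensorProduct.ext' (g := (G.kunneth₃ ∘ₗ
    (TensorProduct.assoc k _ _ _).toLinearMap) ∘ₗ (TensorProduct.mk k _ _).flip y)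
      (h := spaceHomologyMap KProd.assoc ∘ₗ (homologyCross _ _).flip y ∘ₗ G.kunneth k)
        fun a b => ?_)
  exact (homologyCross_assoc KProd.assoc (fun _ => rfl) a b y).symm

/-- Both sides are `x ↦ (x, x, x)` under the Künneth isomorphism for three factors. -/
lemma hopf_comul_assoc (x : spaceHomology k G.carrier) :
    TensorProduct.assoc k _ _ _ (TensorProduct.map (G.homologyComul k) LinearMap.id
      ((G.homologyComul k) x)) =
    TensorProduct.map LinearMap.id (G.homologyComul k) ((G.homologyComul k) x) := by
  have h1 : ∀ t : spaceHomology k G.carrier ⊗[k] spaceHomology k G.carrier,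
      G.kunneth₃ (TensorProduct.assoc k _ _ _ (TensorProduct.map (G.homologyComul k) LinearMap.id t)) =
        spaceHomologyMap (KProd.assoc.comp (KProd.map G.diagMap (ContinuousMap.id _)))
          (G.kunneth k t) := fun t => by
    refine congrArg (fun f => f t) (TensorProduct.ext' (g := (G.kunneth₃ ∘ₗ
      (TensorProduct.assoc k _ _ _).toLinearMap) ∘ₗ
        TensorProduct.map (G.homologyComul k) LinearMap.id)
      (h := spaceHomologyMap _ ∘ₗ G.kunneth k) fun a b => ?_)
    refine (G.kunneth₃_assoc ((G.homologyComul k) a) b).trans ?_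
    refine Eq.trans ?_ (spaceHomologyMap_comp _ _ (homologyCross _ _ a b)).symm
    rw [homologyCross_map (f := G.diagMap) (g := ContinuousMap.id _) _ (fun _ => rfl),
      spaceHomologyMap_id, kunneth_comul]
  have h2 : ∀ t : spaceHomology k G.carrier ⊗[k] spaceHomology k G.carrier,
      G.kunneth₃ (TensorProduct.map LinearMap.id (G.homologyComul k) t) =
        spaceHomologyMap (KProd.map (ContinuousMap.id _) G.diagMap) (G.kunneth k t) := fun t => by
    refine congrArg (fun f => f t) (TensorProduct.ext' (g := G.kunneth₃ ∘ₗ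
        TensorProduct.map LinearMap.id (G.homologyComul k))
      (h := spaceHomologyMap _ ∘ₗ G.kunneth k) fun a b => ?_)
    refine Eq.trans ?_ (homologyCross_map (g := G.diagMap) (f := ContinuousMap.id _) _
      (fun _ => rfl) a b).symm
    rw [spaceHomologyMap_id, ← kunneth_comul]
    rfl
  refine G.kunneth₃_injective ((h1 _).trans (Eq.trans ?_ (h2 _).symm))
  rw [kunneth_comul, ← spaceHomologyMap_comp, ← spaceHomologyMap_comp]
  rfl

lemma hopf_counit_comul (x : spaceHomology k G.carrier) :
    TensorProduct.map (homologyAug G.carrier) LinearMap.id ((G.homologyComul k) x) = (1 : k) ⊗ₜ[k] x := by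
  have h : ∀ t : spaceHomology k G.carrier ⊗[k] spaceHomology k G.carrier,
      TensorProduct.lid k _ (TensorProduct.map (homologyAug G.carrier) LinearMap.id t) =
        spaceHomologyMap KProd.snd (G.kunneth k t) := fun t =>
    congrArg (fun f => f t) (TensorProduct.ext' (g := (TensorProduct.lid k _).toLinearMap ∘ₗ
      TensorProduct.map (homologyAug G.carrier) LinearMap.id)
      (h := spaceHomologyMap KProd.snd ∘ₗ G.kunneth k) fun a b =>
        (snd_homologyCross KProd.snd (fun _ => rfl) a b).symm)
  refine (TensorProduct.lid k (spaceHomology k G.carrier)).injective ((h _).trans ?_)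
  rw [kunneth_comul, ← spaceHomologyMap_comp, TensorProduct.lid_tmul, one_smul]
  exact spaceHomologyMap_id x

lemma hopf_comul_counit (x : spaceHomology k G.carrier) :
    TensorProduct.map LinearMap.id (homologyAug G.carrier) ((G.homologyComul k) x) = x ⊗ₜ[k] (1 : k) := by
  have h : ∀ t : spaceHomology k G.carrier ⊗[k] spaceHomology k G.carrier,
      TensorProduct.rid k _ (TensorProduct.map LinearMap.id (homologyAug G.carrier) t) =
        spaceHomologyMap KProd.fst (G.kunneth k t) := fun t =>
    congrArg (fun f => f t) (TensorProduct.ext' (g := (TensorProduct.rid k _).toLinearMap ∘ₗ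
      TensorProduct.map LinearMap.id (homologyAug G.carrier))
      (h := spaceHomologyMap KProd.fst ∘ₗ G.kunneth k) fun a b =>
        (fst_homologyCross KProd.fst (fun _ => rfl) a b).symm)
  refine (TensorProduct.rid k (spaceHomology k G.carrier)).injective ((h _).trans ?_)
  rw [kunneth_comul, ← spaceHomologyMap_comp, TensorProduct.rid_tmul, one_smul]
  exact spaceHomologyMap_id x

lemma hopf_mul_assoc (x y z : spaceHomology k G.carrier) :
    (G.homologyMul k) ((G.homologyMul k) x y) z = (G.homologyMul k) x ((G.homologyMul k) y z) := by
  have h1 := homologyCross_map (f := G.mulMap) (g := ContinuousMap.id _)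
    (KProd.map G.mulMap (ContinuousMap.id _)) (fun _ => rfl) (homologyCross _ _ x y) z
  have h2 := homologyCross_map (f := ContinuousMap.id _) (g := G.mulMap)
    (KProd.map (ContinuousMap.id _) G.mulMap) (fun _ => rfl) x (homologyCross _ _ y z)
  rw [spaceHomologyMap_id] at h1 h2
  refine (congrArg (spaceHomologyMap G.mulMap) h1.symm).trans
    (Eq.trans ?_ (congrArg (spaceHomologyMap G.mulMap) h2))
  rw [← homologyCross_assoc KProd.assoc (fun _ => rfl), ← spaceHomologyMap_comp,
    ← spaceHomologyMap_comp, ← spaceHomologyMap_comp]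
  congr 2
  exact ContinuousMap.ext fun w => mul_assoc _ _ _

/-- The comultiplication is multiplicative, as `(gh, gh) = (g, g)(h, h)`. -/
lemma hopf_comul_mul (x y : spaceHomology k G.carrier) : (G.homologyComul k) ((G.homologyMul k) x y) =
    signedMap₂ (A := spaceHomology k G.carrier) (B := spaceHomology k G.carrier)
      (V := spaceHomology k G.carrier) (W := spaceHomology k G.carrier)
      (G.homologyMul k) (G.homologyMul k) ((G.homologyComul k) x) ((G.homologyComul k) y) := by
  refine G.kunneth_bijective.1 ?_
  refine (G.kunneth_comul _).trans (Eq.trans ?_ (kunneth_signedMap₂ (W := spaceHomology k G.carrier)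
    (G.homologyMul k) (G.homologyMul k) LinearMap.id LinearMap.id G.mulMap G.mulMap (fun _ _ => rfl)
      (fun _ _ => rfl) ((G.homologyComul k) x) ((G.homologyComul k) y)).symm)
  have h := homologyCross_map (f := G.diagMap) (g := G.diagMap)
    (KProd.map G.diagMap G.diagMap) (fun _ => rfl) x y
  rw [← kunneth_comul, ← kunneth_comul] at h
  refine Eq.trans ?_ (congrArg (spaceHomologyMap ((KProd.map G.mulMap G.mulMap).comp
    KProd.interchange)) h)
  change spaceHomologyMap G.diagMap (spaceHomologyMap G.mulMap (homologyCross _ _ x y)) = _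
  rw [← spaceHomologyMap_comp, ← spaceHomologyMap_comp]
  rfl

lemma homologyComul_mem {p : ℕ} {x : spaceHomology k G.carrier}
    (hx : x ∈ (spaceHomology k G.carrier).deg p) : G.homologyComul k x ∈
      ((spaceHomology k G.carrier).tensor (spaceHomology k G.carrier)).deg p := by
  refine mem_of_injective (V := (spaceHomology k G.carrier).tensor
    (spaceHomology k G.carrier)) (W := spaceHomology k (KProd G.carrier G.carrier))
    (f := G.kunneth k) G.kunneth_bijective.1 (fun _ _ => lift_homologyCross_mem) ?_
  have h := spaceHomologyMap_mem G.diagMap hx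
  rwa [← kunneth_comul] at h

lemma hopf_one_mul (x : spaceHomology k G.carrier) :
    (G.homologyMul k) (homologyPoint 1) x = x := by
  have h := homologyCross_map (k := k) (f := ContinuousMap.const _ 1)
    (g := ContinuousMap.id G.carrier) (KProd.map (ContinuousMap.const G.carrier (1 : G.carrier))
      (ContinuousMap.id _)) (fun _ => rfl) (homologyPoint (1 : G.carrier)) x
  rw [spaceHomologyMap_id, spaceHomologyMap_point, ContinuousMap.const_apply] at h
  refine (congrArg (spaceHomologyMap G.mulMap) h.symm).trans ?_
  rw [← spaceHomologyMap_comp]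
  exact point_homologyCross _ (fun z => one_mul z.out.2) _ _

lemma hopf_mul_one (x : spaceHomology k G.carrier) :
    (G.homologyMul k) x (homologyPoint 1) = x := by
  have h := homologyCross_map (k := k) (g := ContinuousMap.const _ 1)
    (f := ContinuousMap.id G.carrier) (KProd.map (ContinuousMap.id _)
      (ContinuousMap.const G.carrier (1 : G.carrier))) (fun _ => rfl) x
        (homologyPoint (1 : G.carrier))
  rw [spaceHomologyMap_id, spaceHomologyMap_point, ContinuousMap.const_apply] at h
  refine (congrArg (spaceHomologyMap G.mulMap) h.symm).trans ?_
  rw [← spaceHomologyMap_comp]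
  exact homologyCross_point _ (fun z => mul_one z.out.1) _ _

lemma hopf_comul_comm (x : spaceHomology k G.carrier) :
    signedSwap (spaceHomology k G.carrier) (spaceHomology k G.carrier) (G.homologyComul k x) =
      G.homologyComul k x := by
  refine G.kunneth_bijective.1 ((G.kunneth_signedSwap _).trans ?_)
  rw [kunneth_comul, ← spaceHomologyMap_comp]
  rfl

lemma hopf_comul_one : G.homologyComul k (homologyPoint 1) =
    homologyPoint 1 ⊗ₜ[k] homologyPoint (1 : G.carrier) := by
  refine G.kunneth_bijective.1 ((G.kunneth_comul _).trans ((spaceHomologyMap_point _ _).trans ?_))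
  exact (homologyCross_point_point _ _).symm

lemma hopf_antipode_mul (x : spaceHomology k G.carrier) :
    TensorProduct.lift ((G.homologyMul k) ∘ₗ (spaceHomologyMap G.invMap)) (G.homologyComul k x) =
      homologyAug G.carrier x • homologyPoint 1 := by
  refine (G.lift_mul_antipode _).trans ?_
  rw [kunneth_comul, ← spaceHomologyMap_comp]
  exact spaceHomologyMap_const _ 1 (fun g => inv_mul_cancel g) x

lemma hopf_mul_antipode (x : spaceHomology k G.carrier) :
    TensorProduct.lift ((G.homologyMul k).compl₂ (spaceHomologyMap G.invMap))
      (G.homologyComul k x) = homologyAug G.carrier x • homologyPoint 1 := by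
  refine (G.lift_mul_antipode_right _).trans ?_
  rw [kunneth_comul, ← spaceHomologyMap_comp]
  exact spaceHomologyMap_const _ 1 (fun g => mul_inv_cancel g) x

/-- The homology of a topological group is a graded cocommutative Hopf algebra. -/
theorem isCocommHopf : (G.hopf k).IsCocommHopf where
  mul_mem hx hy := spaceHomologyMap_mem G.mulMap (homologyCross_mem hx hy)
  one_mem := homologyPoint_mem 1
  comul_mem hx := G.homologyComul_mem hx
  counit_eq_zero hx hp := homologyAug_eq_zero hx hp
  antipode_mem hx := spaceHomologyMap_mem G.invMap hx
  mul_assoc := G.hopf_mul_assoc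
  one_mul := G.hopf_one_mul
  mul_one := G.hopf_mul_one
  comul_assoc := G.hopf_comul_assoc
  counit_comul := G.hopf_counit_comul
  comul_counit := G.hopf_comul_counit
  comul_comm := G.hopf_comul_comm
  comul_mul := G.hopf_comul_mul
  comul_one := G.hopf_comul_one
  counit_mul x y := (homologyAug_map G.mulMap (homologyCross _ _ x y)).trans (homologyAug_cross x y)
  counit_one := homologyAug_point 1
  antipode_mul := G.hopf_antipode_mul
  mul_antipode := G.hopf_mul_antipode

end TopGrp

end HopfAlgebra

section HomologyOperads

open scoped DirectSum TensorProduct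
open OperadEquiv GrMod

variable {k : Type u} [Field k]

/-! ### The homology of a topological operad -/

section

variable {X Y Z : Type u} [TopologicalSpace X] [TopologicalSpace Y] [TopologicalSpace Z]

lemma spaceHomologyMap_point_cross (f : C(KProd X Y, Z)) (x : X) (g : C(Y, Z))
    (h : ∀ y, f ⟨(x, y)⟩ = g y) (y : spaceHomology k Y) :
    spaceHomologyMap f (homologyCross X Y (homologyPoint x) y) = spaceHomologyMap g y := by
  have h1 := homologyCross_map (k := k) (f := ContinuousMap.const X x) (g := ContinuousMap.id Y)
    (KProd.map (ContinuousMap.const X x) (ContinuousMap.id Y)) (fun _ => rfl) (homologyPoint x) y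
  rw [spaceHomologyMap_id, spaceHomologyMap_point, ContinuousMap.const_apply] at h1
  have h2 : f.comp (KProd.map (ContinuousMap.const X x) (ContinuousMap.id Y)) =
      g.comp KProd.snd := ContinuousMap.ext fun z => h z.out.2
  rw [← h1, ← spaceHomologyMap_comp, h2, spaceHomologyMap_comp,
    point_homologyCross _ fun _ => rfl]

lemma spaceHomologyMap_cross_point (f : C(KProd X Y, Z)) (y : Y) (g : C(X, Z))
    (h : ∀ x, f ⟨(x, y)⟩ = g x) (x : spaceHomology k X) :
    spaceHomologyMap f (homologyCross X Y x (homologyPoint y)) = spaceHomologyMap g x := by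
  have h1 := homologyCross_map (k := k) (g := ContinuousMap.const Y y) (f := ContinuousMap.id X)
    (KProd.map (ContinuousMap.id X) (ContinuousMap.const Y y)) (fun _ => rfl) x (homologyPoint y)
  rw [spaceHomologyMap_id, spaceHomologyMap_point, ContinuousMap.const_apply] at h1
  have h2 : f.comp (KProd.map (ContinuousMap.id X) (ContinuousMap.const Y y)) =
      g.comp KProd.fst := ContinuousMap.ext fun z => h z.out.1
  rw [← h1, ← spaceHomologyMap_comp, h2, spaceHomologyMap_comp,
    homologyCross_point _ fun _ => rfl]

end

lemma homologyCrossPi_one {X : Fin 1 → Type u} [∀ i, TopologicalSpace (X i)]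
    (x : ∀ i, spaceHomology k (X i)) :
    spaceHomologyMap (KPi.eval 0) (homologyCrossPi X x) = x 0 := by
  rw [homologyCrossPi_succ, ← spaceHomologyMap_comp,
    homologyCrossPi_zero _ (⟨fun i => i.elim0⟩ : KPi fun i : Fin 0 => X i.succ)]
  exact homologyCross_point _ (fun _ => rfl) _ _

namespace TopOperad

variable (A : TopOperad.{u})

/-- The renumbering of inputs as a continuous map. -/
def relabelMap {m n : ℕ} (e : Fin m ≃ Fin n) : C(A.obj m, A.obj n) :=
  ⟨A.relabel e, A.continuous_relabel e⟩

/-- The operad composition as a continuous map. -/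
def compMap {m : ℕ} (n : Fin m → ℕ) :
    C(KProd (A.obj m) (KPi fun i => A.obj (n i)), A.obj (∑ i, n i)) :=
  ⟨fun x => A.comp n x.out.1 x.out.2.out, A.continuous_comp n⟩

lemma homologyOperad_comp {m : ℕ} (n : Fin m → ℕ) (a : spaceHomology k (A.obj m))
    (b : ∀ i, spaceHomology k (A.obj (n i))) : (A.homologyOperad k).comp n a b =
      spaceHomologyMap (A.compMap n) (homologyCross _ _ a (homologyCrossPi _ b)) := by
  have h := PiTensorProduct.lift.tprod (φ := homologyCrossPi (k := k) fun i => A.obj (n i)) b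
  exact congrArg (fun t => spaceHomologyMap (A.compMap n) (homologyCross _ _ a t)) h

/-- Equivariance in the outer operation: the Koszul sign is that of permuting the factors of the cross
product of the inner operations. -/
lemma homologyOperad_relabel_comp {m m' : ℕ} (σ : Fin m ≃ Fin m') (n : Fin m' → ℕ)
    (β : Fin m' → ℕ) (a : spaceHomology k (A.obj m)) (b : ∀ i, spaceHomology k (A.obj (n i)))
    (hb : ∀ i, b i ∈ (spaceHomology k (A.obj (n i))).deg (β i)) :
    (A.homologyOperad k).comp n (spaceHomologyMap (A.relabelMap σ) a) b =
      koszulSign σ (fun i => (β (σ i) : ZMod 2)) • spaceHomologyMap (A.relabelMap (block σ n))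
        ((A.homologyOperad k).comp (fun i => n (σ i)) a fun i => b (σ i)) := by
  let P : C(KPi fun i => A.obj (n i), KPi fun i => A.obj (n (σ i))) :=
    KPi.lift fun i => KPi.eval (σ i)
  have h1 := homologyCross_map (f := A.relabelMap σ) (g := ContinuousMap.id _)
    (KProd.map (A.relabelMap σ) (ContinuousMap.id _)) (fun _ => rfl) a
      (homologyCrossPi (fun i => A.obj (n i)) b)
  have h2 := homologyCross_map (f := ContinuousMap.id _) (g := P)
    (KProd.map (ContinuousMap.id _) P) (fun _ => rfl) a
      (homologyCrossPi (fun i => A.obj (n i)) b)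
  rw [spaceHomologyMap_id] at h1 h2
  rw [homologyCrossPi_perm σ σ.bijective P (fun _ => rfl) hb, map_zsmul] at h2
  rw [koszulSign_cast σ fun i => β (σ i)]
  refine (A.homologyOperad_comp n _ b).trans ?_
  refine Eq.trans ?_ (congrArg (fun t => _ • spaceHomologyMap (A.relabelMap (block σ n)) t)
    (A.homologyOperad_comp (fun i => n (σ i)) a fun i => b (σ i)).symm)
  rw [← h1, ← spaceHomologyMap_comp, ← spaceHomologyMap_comp]
  rw [← map_zsmul]
  refine Eq.trans ?_ (congrArg (spaceHomologyMap ((A.relabelMap (block σ n)).comp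
    (A.compMap fun i => n (σ i)))) h2)
  rw [← spaceHomologyMap_comp]
  congr 2
  exact ContinuousMap.ext fun z => A.relabel_comp σ n z.out.1 z.out.2.out

lemma homologyOperad_comp_relabel {m : ℕ} {n n' : Fin m → ℕ} (τ : ∀ i, Fin (n i) ≃ Fin (n' i))
    (a : spaceHomology k (A.obj m)) (b : ∀ i, spaceHomology k (A.obj (n i))) :
    (A.homologyOperad k).comp n' a (fun i => spaceHomologyMap (A.relabelMap (τ i)) (b i)) =
      spaceHomologyMap (A.relabelMap (blocks τ)) ((A.homologyOperad k).comp n a b) := by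
  let T : C(KPi fun i => A.obj (n i), KPi fun i => A.obj (n' i)) :=
    KPi.lift fun i => (A.relabelMap (τ i)).comp (KPi.eval i)
  have h := homologyCross_map (f := ContinuousMap.id _) (g := T)
    (KProd.map (ContinuousMap.id _) T) (fun _ => rfl) a
      (homologyCrossPi (fun i => A.obj (n i)) b)
  rw [spaceHomologyMap_id, homologyCrossPi_map (fun i => A.relabelMap (τ i)) T
    fun _ _ => rfl] at h
  refine (A.homologyOperad_comp n' a _).trans ?_
  refine Eq.trans ?_ (congrArg (spaceHomologyMap (A.relabelMap (blocks τ)))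
    (A.homologyOperad_comp n a b).symm)
  rw [← h, ← spaceHomologyMap_comp, ← spaceHomologyMap_comp]
  congr 2
  exact ContinuousMap.ext fun z => A.comp_relabel τ z.out.1 z.out.2.out

/-- The position of an entry of a block, as a number. -/
lemma pos_val {m : ℕ} {n : Fin m → ℕ} (i : Fin m) (j : Fin (n i)) :
    (pos i j : ℕ) = (∑ i', if i' < i then n i' else 0) + j := by
  rw [pos, finSigmaFinEquiv_apply, ← Finset.sum_filter]
  congr 1
  exact Finset.sum_bij (fun i' _ => Fin.castLE i.2.le i')
    (fun i' _ => Finset.mem_filter.2 ⟨Finset.mem_univ _, i'.2⟩)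
    (fun _ _ _ _ h => Fin.castLE_injective _ h)
    (fun i' h => ⟨⟨i', (Finset.mem_filter.1 h).2⟩, Finset.mem_univ _, rfl⟩) fun _ _ => rfl

/-- Associativity: the sign is that of pairing each `b i` with the block of the inputs `c` which it
receives. -/
lemma homologyOperad_comp_assoc {m : ℕ} (n : Fin m → ℕ) (l : Fin (∑ i, n i) → ℕ) (β : Fin m → ℕ)
    (ζ : Fin (∑ i, n i) → ℕ) (a : spaceHomology k (A.obj m))
    (b : ∀ i, spaceHomology k (A.obj (n i))) (c : ∀ p, spaceHomology k (A.obj (l p)))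
    (hb : ∀ i, b i ∈ (spaceHomology k (A.obj (n i))).deg (β i))
    (hc : ∀ p, c p ∈ (spaceHomology k (A.obj (l p))).deg (ζ p)) :
    spaceHomologyMap (A.relabelMap (assoc n l))
        ((A.homologyOperad k).comp l ((A.homologyOperad k).comp n a b) c) =
      (∏ i, ∏ i' ∈ Finset.Ioi i, (-1 : ℤ) ^ (β i' * ∑ j, ζ (pos i j))) •
        (A.homologyOperad k).comp (fun i => ∑ j, l (pos i j)) a
          (fun i => (A.homologyOperad k).comp (fun j => l (pos i j)) (b i)
            (fun j => c (pos i j))) := by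
  let C : ∀ i, spaceHomology k (KPi fun j : Fin (n i) => A.obj (l (pos i j))) := fun i =>
    homologyCrossPi _ fun j => c (pos i j)
  let K : C(KPi fun p => A.obj (l p), KPi fun i => KPi fun j : Fin (n i) => A.obj (l (pos i j))) :=
    KPi.lift fun i => KPi.lift fun j => KPi.eval (pos i j)
  let M : C(KPi fun i => KProd (A.obj (n i)) (KPi fun j : Fin (n i) => A.obj (l (pos i j))),
      KPi fun i => A.obj (∑ j, l (pos i j))) :=
    KPi.lift fun i => (A.compMap fun j => l (pos i j)).comp (KPi.eval i)
  have hK : spaceHomologyMap K (homologyCrossPi _ c) = homologyCrossPi _ C :=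
    homologyCrossPi_blocks rfl (fun i j => pos i j) (fun i j => pos_val i j) K (fun _ => rfl) c
  have hC : ∀ i, C i ∈ (spaceHomology k _).deg (∑ j, ζ (pos i j)) := fun i =>
    homologyCrossPi_mem fun j => hc (pos i j)
  have hM : spaceHomologyMap M (homologyCrossPi _ fun i => homologyCross _ _ (b i) (C i)) =
      homologyCrossPi _ fun i => spaceHomologyMap (A.compMap fun j => l (pos i j))
        (homologyCross _ _ (b i) (C i)) :=
    homologyCrossPi_map (fun i => A.compMap fun j => l (pos i j)) M (fun _ _ => rfl) _
  have hz := homologyCrossPi_zip hb hC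
  let F : C(KProd (KPi fun i => A.obj (n i)) (KPi fun p => A.obj (l p)),
      KPi fun i => A.obj (∑ j, l (pos i j))) :=
    M.comp (KPi.zip.comp (KProd.map (ContinuousMap.id _) K))
  have hF : spaceHomologyMap F (homologyCross _ _ (homologyCrossPi _ b) (homologyCrossPi _ c)) =
      (∏ i, ∏ i' ∈ Finset.Ioi i, (-1 : ℤ) ^ (β i' * ∑ j, ζ (pos i j))) •
        homologyCrossPi _ fun i => spaceHomologyMap (A.compMap fun j => l (pos i j))
          (homologyCross _ _ (b i) (C i)) := by
    rw [← hM, ← map_zsmul, ← hz, spaceHomologyMap_comp, spaceHomologyMap_comp,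
      homologyCross_map (f := ContinuousMap.id _) (g := K) _ (fun _ => rfl),
      spaceHomologyMap_id, hK]
  have h1 := homologyCross_map (f := A.compMap n) (g := ContinuousMap.id _)
    (KProd.map (A.compMap n) (ContinuousMap.id _)) (fun _ => rfl)
      (homologyCross _ _ a (homologyCrossPi _ b)) (homologyCrossPi (fun p => A.obj (l p)) c)
  have h2 := homologyCross_map (f := ContinuousMap.id _) (g := F)
    (KProd.map (ContinuousMap.id _) F) (fun _ => rfl) a
      (homologyCross _ _ (homologyCrossPi _ b) (homologyCrossPi _ c))
  rw [spaceHomologyMap_id] at h1 h2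
  rw [hF, map_zsmul, ← homologyCross_assoc KProd.assoc (fun _ => rfl),
    ← spaceHomologyMap_comp] at h2
  have e1 : (A.homologyOperad k).comp l ((A.homologyOperad k).comp n a b) c =
      spaceHomologyMap (A.compMap l) (homologyCross _ _ (spaceHomologyMap (A.compMap n)
        (homologyCross _ _ a (homologyCrossPi _ b))) (homologyCrossPi _ c)) :=
    (A.homologyOperad_comp l _ c).trans (by rw [← A.homologyOperad_comp n a b])
  have e2 : (A.homologyOperad k).comp (fun i => ∑ j, l (pos i j)) a
          (fun i => (A.homologyOperad k).comp (fun j => l (pos i j)) (b i)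
            (fun j => c (pos i j))) =
      spaceHomologyMap (A.compMap fun i => ∑ j, l (pos i j)) (homologyCross _ _ a
        (homologyCrossPi _ fun i => spaceHomologyMap (A.compMap fun j => l (pos i j))
          (homologyCross _ _ (b i) (C i)))) := by
    refine (A.homologyOperad_comp _ a _).trans ?_
    congr 3
    funext i
    exact A.homologyOperad_comp _ (b i) _
  refine (congrArg (spaceHomologyMap (A.relabelMap (assoc n l))) e1).trans (Eq.trans ?_
    (congrArg (fun t : spaceHomology k (A.obj (∑ i, ∑ j, l (pos i j))) =>
      (∏ i, ∏ i' ∈ Finset.Ioi i, (-1 : ℤ) ^ (β i' * ∑ j, ζ (pos i j))) • t) e2).symm)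
  rw [← h1, ← spaceHomologyMap_comp, ← spaceHomologyMap_comp, ← map_zsmul]
  refine Eq.trans ?_ (congrArg (spaceHomologyMap (A.compMap fun i => ∑ j, l (pos i j))) h2)
  rw [← spaceHomologyMap_comp]
  congr 2
  exact ContinuousMap.ext fun z =>
    A.comp_assoc n l z.out.1.out.1 z.out.1.out.2.out z.out.2.out

/-- The homology of a topological operad is an operad of graded vector spaces. -/
theorem homologyOperad_isOperad : (A.homologyOperad k).IsOperad where
  relabel_mem e _ _ ha := spaceHomologyMap_mem (A.relabelMap e) ha
  one_mem := homologyPoint_mem A.one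
  comp_mem n d β a b ha hb := by
    have h := spaceHomologyMap_mem (A.compMap n) (homologyCross_mem ha (homologyCrossPi_mem hb))
    rwa [← A.homologyOperad_comp n a b] at h
  relabel_refl a := by
    refine Eq.trans ?_ (spaceHomologyMap_id a)
    exact congrArg (fun f => spaceHomologyMap f a) (ContinuousMap.ext fun x => A.relabel_refl x)
  relabel_trans e f a := by
    refine Eq.trans ?_ (spaceHomologyMap_comp (A.relabelMap e) (A.relabelMap f) a)
    exact congrArg (fun f => spaceHomologyMap f a)
      (ContinuousMap.ext fun x => A.relabel_trans e f x)
  one_comp n b := by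
    refine (congrArg (spaceHomologyMap (A.relabelMap (oneLeft n)))
      (A.homologyOperad_comp n (homologyPoint A.one) b)).trans ?_
    rw [← spaceHomologyMap_comp]
    refine (spaceHomologyMap_point_cross _ A.one (KPi.eval 0) (fun z => ?_) _).trans
      (homologyCrossPi_one b)
    exact A.one_comp n z.out
  comp_one {m} a := by
    refine (congrArg (spaceHomologyMap (A.relabelMap (oneRight m)))
      (A.homologyOperad_comp (fun _ => 1) a fun _ => homologyPoint A.one)).trans ?_
    rw [← spaceHomologyMap_comp, homologyCrossPi_point]
    refine (spaceHomologyMap_cross_point _ _ (ContinuousMap.id _) (fun z => ?_) _).trans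
      (spaceHomologyMap_id a)
    exact A.comp_one z
  comp_assoc n l β ζ a b c hb hc := A.homologyOperad_comp_assoc n l β ζ a b c hb hc
  relabel_comp σ n β a b hb := A.homologyOperad_relabel_comp σ n β a b hb
  comp_relabel τ a b := A.homologyOperad_comp_relabel τ a b

end TopOperad

end HomologyOperads

section DiagonalActions

open scoped DirectSum TensorProduct
open OperadEquiv GrMod

variable {k : Type u} [Field k]

/-! ### Diagonal actions -/

section

variable (V : Type u) [TopologicalSpace V] {m : ℕ} (W : Fin m → Type u)
  [∀ i, TopologicalSpace (W i)]

/-- The Künneth map `H(V) ⊗ (H(W_1) ⊗ … ⊗ H(W_m)) → H(V × (W_1 × … × W_m))`. -/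
noncomputable def kunnethPi : spaceHomology k V ⊗[k] (⨂[k] i, spaceHomology k (W i)) →ₗ[k]
    spaceHomology k (KProd V (KPi W)) :=
  TensorProduct.lift ((homologyCross V (KPi W)).compl₂ (PiTensorProduct.lift (homologyCrossPi W)))

variable {V W}

lemma kunnethPi_bijective : Function.Bijective (kunnethPi (k := k) V W) := by
  let e : (⨂[k] i, spaceHomology k (W i)) ≃ₗ[k] spaceHomology k (KPi W) :=
    LinearEquiv.ofBijective _ (homologyCrossPi_bijective W)
  have h : kunnethPi (k := k) V W = TensorProduct.lift (homologyCross V (KPi W)) ∘ₗ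
      (TensorProduct.congr (LinearEquiv.refl k _) e).toLinearMap :=
    TensorProduct.ext' fun x t => rfl
  rw [h]
  exact (homologyCross_bijective V (KPi W)).comp
    (TensorProduct.congr (LinearEquiv.refl k (spaceHomology k V)) e).bijective

lemma lift_homologyCrossPi_mem {d : ℕ} {t : ⨂[k] i, spaceHomology k (W i)}
    (ht : t ∈ (tensorPi fun i => spaceHomology k (W i)).deg d) :
    PiTensorProduct.lift (homologyCrossPi W) t ∈ (spaceHomology k (KPi W)).deg d := by
  refine (Submodule.span_le (p := ((spaceHomology k (KPi W)).deg d).comap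
    (PiTensorProduct.lift (homologyCrossPi W)))).2 ?_ ht
  rintro _ ⟨p, rfl, x, hx, rfl⟩
  change PiTensorProduct.lift (homologyCrossPi W) (PiTensorProduct.tprod k x) ∈
    (spaceHomology k (KPi W)).deg (∑ i, p i)
  rw [PiTensorProduct.lift.tprod]
  exact homologyCrossPi_mem hx

lemma kunnethPi_mem {d : ℕ} {t : spaceHomology k V ⊗[k] (⨂[k] i, spaceHomology k (W i))}
    (ht : t ∈ ((spaceHomology k V).tensor (tensorPi fun i => spaceHomology k (W i))).deg d) :
    kunnethPi V W t ∈ (spaceHomology k (KProd V (KPi W))).deg d := by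
  refine (Submodule.span_le (p := ((spaceHomology k (KProd V (KPi W))).deg d).comap
    (kunnethPi V W))).2 ?_ ht
  rintro _ ⟨p, q, rfl, x, hx, y, hy, rfl⟩
  exact homologyCross_mem hx (lift_homologyCrossPi_mem hy)

lemma lift_homologyCrossPi_cons {W : Fin (m + 1) → Type u} [∀ i, TopologicalSpace (W i)]
    (x : spaceHomology k (W 0)) (s : ⨂[k] i : Fin m, spaceHomology k (W i.succ)) :
    PiTensorProduct.lift (homologyCrossPi W)
        (GrMod.cons (fun i => (spaceHomology k (W i)).carrier) x s) =
      spaceHomologyMap (kpiCons W) (homologyCross _ _ x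
        (PiTensorProduct.lift (homologyCrossPi fun i : Fin m => W i.succ) s)) := by
  suffices H : PiTensorProduct.lift (homologyCrossPi W) ∘ₗ
      GrMod.cons (fun i => (spaceHomology k (W i)).carrier) x =
      spaceHomologyMap (kpiCons W) ∘ₗ homologyCross _ _ x ∘ₗ
        PiTensorProduct.lift (homologyCrossPi fun i : Fin m => W i.succ) from
    congrArg (fun f => f s) H
  refine PiTensorProduct.ext (MultilinearMap.ext fun y => ?_)
  change PiTensorProduct.lift (homologyCrossPi W) (GrMod.cons
    (fun i => (spaceHomology k (W i)).carrier) x (PiTensorProduct.tprod k y)) =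
      spaceHomologyMap (kpiCons W) (homologyCross _ _ x (PiTensorProduct.lift
        (homologyCrossPi fun i : Fin m => W i.succ) (PiTensorProduct.tprod k y)))
  rw [cons_tprod, PiTensorProduct.lift.tprod, PiTensorProduct.lift.tprod]
  exact homologyCrossPi_succ (X := W)
    (Fin.cons (α := fun i => (spaceHomology k (W i)).carrier) x y)

end

namespace TopGrp

variable (G : TopGrp.{u})

/-- The diagonal `G → Gⁿ`. -/
def diagPiMap (n : ℕ) : C(G.carrier, KPi fun _ : Fin n => G.carrier) :=
  KPi.lift fun _ => ContinuousMap.id _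

variable (k) in
/-- The iterated comultiplication of `H(G)`, in terms of the homology of `G`. -/
noncomputable def homologyIterComul (n : ℕ) : spaceHomology k G.carrier →ₗ[k]
    ⨂[k] _i : Fin n, spaceHomology k G.carrier := (G.hopf k).iterComul n

/-- The iterated comultiplication becomes the map induced by the diagonal, under the Künneth
isomorphism. -/
lemma lift_homologyCrossPi_iterComul (n : ℕ) (g : spaceHomology k G.carrier) :
    PiTensorProduct.lift (homologyCrossPi fun _ : Fin n => G.carrier) (G.homologyIterComul k n g) =
      spaceHomologyMap (G.diagPiMap n) g := by
  induction n generalizing g with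
  | zero =>
    change PiTensorProduct.lift (homologyCrossPi fun _ : Fin 0 => G.carrier)
      (homologyAug G.carrier g • PiTensorProduct.tprod k isEmptyElim) = _
    rw [map_smul, PiTensorProduct.lift.tprod,
      homologyCrossPi_zero _ (⟨isEmptyElim⟩ : KPi fun _ : Fin 0 => G.carrier)]
    exact (spaceHomologyMap_const _ _ (fun _ => Subsingleton.elim _ _) g).symm
  | succ n ih =>
    have h : ∀ t : spaceHomology k G.carrier ⊗[k] spaceHomology k G.carrier,
        PiTensorProduct.lift (homologyCrossPi fun _ : Fin (n + 1) => G.carrier)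
          (TensorProduct.lift (GrMod.cons fun _ : Fin (n + 1) => (spaceHomology k G.carrier).carrier)
            (TensorProduct.map LinearMap.id (G.homologyIterComul k n) t)) =
        spaceHomologyMap ((kpiCons fun _ : Fin (n + 1) => G.carrier).comp
          (KProd.map (ContinuousMap.id _) (G.diagPiMap n))) (G.kunneth k t) := fun t => by
      refine congrArg (fun f => f t) (TensorProduct.ext' (g := PiTensorProduct.lift
        (homologyCrossPi fun _ : Fin (n + 1) => G.carrier) ∘ₗ TensorProduct.lift
          (GrMod.cons fun _ : Fin (n + 1) => (spaceHomology k G.carrier).carrier) ∘ₗ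
            TensorProduct.map LinearMap.id (G.homologyIterComul k n))
        (h := spaceHomologyMap _ ∘ₗ G.kunneth k) fun x y => ?_)
      refine (lift_homologyCrossPi_cons (W := fun _ : Fin (n + 1) => G.carrier) x
        (G.homologyIterComul k n y)).trans ?_
      refine Eq.trans ?_ (spaceHomologyMap_comp _ _ (homologyCross _ _ x y)).symm
      rw [homologyCross_map (f := ContinuousMap.id _) (g := G.diagPiMap n) _ (fun _ => rfl),
        spaceHomologyMap_id, ih]
    refine (h (G.homologyComul k g)).trans ?_
    rw [kunneth_comul, ← spaceHomologyMap_comp]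
    congr 2
    refine ContinuousMap.ext fun x => Kify.ext (funext fun i => ?_)
    induction i using Fin.cases <;> rfl

/-- The diagonal action of `H(G)` is induced by the diagonal action of `G`. -/
lemma kunnethPi_diag {n : ℕ} {V : Type u} [TopologicalSpace V] {W : Fin n → Type u}
    [∀ i, TopologicalSpace (W i)]
    (α : spaceHomology k G.carrier →ₗ[k] spaceHomology k V →ₗ[k] spaceHomology k V)
    (β : ∀ i, spaceHomology k G.carrier →ₗ[k] spaceHomology k (W i) →ₗ[k] spaceHomology k (W i))
    (φ : C(KProd G.carrier V, V)) (ψ : ∀ i, C(KProd G.carrier (W i), W i))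
    (hα : ∀ g v, α g v = spaceHomologyMap φ (homologyCross _ _ g v))
    (hβ : ∀ i g w, β i g w = spaceHomologyMap (ψ i) (homologyCross _ _ g w))
    (F : C(KProd G.carrier (KProd V (KPi W)), KProd V (KPi W)))
    (hF : ∀ z, F z = ⟨(φ ⟨(z.out.1, z.out.2.out.1)⟩,
      ⟨fun i => ψ i ⟨(z.out.1, z.out.2.out.2.out i)⟩⟩)⟩)
    (g : spaceHomology k G.carrier) (t : spaceHomology k V ⊗[k] (⨂[k] i, spaceHomology k (W i))) :
    kunnethPi V W ((G.hopf k).diag (V := spaceHomology k V) (W := fun i => spaceHomology k (W i))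
      α β g t) = spaceHomologyMap F (homologyCross _ _ g (kunnethPi V W t)) := by
  let ψ' : C(KProd G.carrier (KPi W), KPi W) :=
    KPi.lift fun i => (ψ i).comp (KProd.pair KProd.fst ((KPi.eval i).comp KProd.snd))
  let Ψ : C(KProd (KPi fun _ : Fin n => G.carrier) (KPi W), KPi W) :=
    KPi.lift fun i => (ψ i).comp
      (KProd.pair ((KPi.eval i).comp KProd.fst) ((KPi.eval i).comp KProd.snd))
  have h1 : ∀ (s : ⨂[k] _i : Fin n, spaceHomology k G.carrier)
      (w : ⨂[k] i, spaceHomology k (W i)),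
      PiTensorProduct.lift (homologyCrossPi W) (signedMapPi (V := fun _ => spaceHomology k G.carrier)
        (W := fun i => spaceHomology k (W i)) β s w) = spaceHomologyMap Ψ (homologyCross _ _
          (PiTensorProduct.lift (homologyCrossPi fun _ : Fin n => G.carrier) s)
            (PiTensorProduct.lift (homologyCrossPi W) w)) := fun s w =>
    kunneth_signedMapPi (𝕍 := fun _ => G.carrier) (𝕎 := W) (𝕏 := W)
      (W := fun i => spaceHomology k (W i)) β (fun _ => LinearMap.id) (fun _ _ _ h => h)
        (fun _ => LinearMap.id) ψ hβ Ψ (fun _ _ => rfl) s w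
  let γ : spaceHomology k G.carrier →ₗ[k] (⨂[k] i, spaceHomology k (W i)) →ₗ[k]
      (⨂[k] i, spaceHomology k (W i)) := signedMapPi (V := fun _ => spaceHomology k G.carrier)
        (W := fun i => spaceHomology k (W i)) β ∘ₗ G.homologyIterComul k n
  have h2 : ∀ b w, PiTensorProduct.lift (homologyCrossPi W) (γ b w) =
      spaceHomologyMap ψ' (homologyCross _ _ b (PiTensorProduct.lift (homologyCrossPi W) w)) := by
    intro b w
    refine (h1 (G.homologyIterComul k n b) w).trans ?_
    have h := homologyCross_map (f := G.diagPiMap n) (g := ContinuousMap.id _)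
      (KProd.map (G.diagPiMap n) (ContinuousMap.id _)) (fun _ => rfl) b
        (PiTensorProduct.lift (homologyCrossPi W) w)
    rw [lift_homologyCrossPi_iterComul]
    rw [spaceHomologyMap_id] at h
    rw [← h, ← spaceHomologyMap_comp]
    rfl
  have h3 := kunneth_signedMap₂ (W := tensorPi fun i => spaceHomology k (W i)) α γ
    (PiTensorProduct.lift (homologyCrossPi W)) (PiTensorProduct.lift (homologyCrossPi W)) φ ψ'
      hα h2 (G.homologyComul k g) t
  refine h3.trans ?_
  have h := homologyCross_map (f := G.diagMap) (g := ContinuousMap.id _)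
    (KProd.map G.diagMap (ContinuousMap.id _)) (fun _ => rfl) g (kunnethPi V W t)
  rw [spaceHomologyMap_id, ← kunneth_comul] at h
  refine (congrArg (spaceHomologyMap ((KProd.map φ ψ').comp KProd.interchange)) h.symm).trans ?_
  rw [← spaceHomologyMap_comp]
  congr 2
  exact ContinuousMap.ext fun z => (hF z).symm

end TopGrp

end DiagonalActions

section HomologyOfGOperads

open scoped DirectSum TensorProduct
open OperadEquiv GrMod

variable {k : Type u} [Field k]

/-! ### The homology of a `G`-operad -/

namespace GOperad

variable {G : TopGrp.{u}} (A : GOperad G)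

/-- The action of `G` as a continuous map. -/
def actMap (n : ℕ) : C(KProd G.carrier (A.obj n), A.obj n) :=
  ⟨fun x => x.out.1 • x.out.2, A.continuous_smul n⟩

variable (k) in
/-- The action of `H(G)` on `H(A(n))`. This is the action of `A.homologyHOperad k`, in terms of the
homology of spaces. -/
noncomputable def homologyAct (n : ℕ) : spaceHomology k G.carrier →ₗ[k]
    spaceHomology k (A.obj n) →ₗ[k] spaceHomology k (A.obj n) :=
  (homologyCross G.carrier (A.obj n)).compr₂ (spaceHomologyMap (A.actMap n))

lemma homologyAct_apply {n : ℕ} (g : spaceHomology k G.carrier) (a : spaceHomology k (A.obj n)) :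
    A.homologyAct k n g a = spaceHomologyMap (A.actMap n) (homologyCross _ _ g a) := rfl

/-- The total composition of the homology operad, by way of the Künneth isomorphism. -/
lemma lift_comp {m : ℕ} (n : Fin m → ℕ)
    (t : spaceHomology k (A.obj m) ⊗[k] (⨂[k] i, spaceHomology k (A.obj (n i)))) :
    TensorProduct.lift (PiTensorProduct.lift.toLinearMap ∘ₗ (A.homologyOperad k).comp n) t =
      spaceHomologyMap (A.compMap n) (kunnethPi (A.obj m) (fun i => A.obj (n i)) t) := by
  refine congrArg (fun f => f t) (TensorProduct.ext' (g := TensorProduct.lift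
    (PiTensorProduct.lift.toLinearMap ∘ₗ (A.homologyOperad k).comp n))
    (h := spaceHomologyMap (A.compMap n) ∘ₗ kunnethPi (A.obj m) fun i => A.obj (n i))
      fun a s => ?_)
  refine congrArg (fun f => f s) (PiTensorProduct.ext (MultilinearMap.ext fun b => ?_) :
    PiTensorProduct.lift ((A.homologyOperad k).comp n a) = spaceHomologyMap (A.compMap n) ∘ₗ
      homologyCross _ _ a ∘ₗ PiTensorProduct.lift (homologyCrossPi fun i => A.obj (n i)))
  exact (PiTensorProduct.lift.tprod _).trans rfl

lemma homologyAct_mul {n : ℕ} (g h : spaceHomology k G.carrier) (a : spaceHomology k (A.obj n)) :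
    A.homologyAct k n (G.homologyMul k g h) a =
      A.homologyAct k n g (A.homologyAct k n h a) := by
  have h1 := homologyCross_map (f := G.mulMap) (g := ContinuousMap.id (A.obj n))
    (KProd.map G.mulMap (ContinuousMap.id _)) (fun _ => rfl) (homologyCross _ _ g h) a
  have h2 := homologyCross_map (f := ContinuousMap.id G.carrier) (g := A.actMap n)
    (KProd.map (ContinuousMap.id _) (A.actMap n)) (fun _ => rfl) g (homologyCross _ _ h a)
  rw [spaceHomologyMap_id] at h1 h2
  refine (congrArg (spaceHomologyMap (A.actMap n)) h1.symm).trans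
    (Eq.trans ?_ (congrArg (spaceHomologyMap (A.actMap n)) h2))
  rw [← homologyCross_assoc KProd.assoc (fun _ => rfl), ← spaceHomologyMap_comp,
    ← spaceHomologyMap_comp, ← spaceHomologyMap_comp]
  congr 2
  exact ContinuousMap.ext fun w => mul_smul _ _ _

lemma homologyAct_relabel {m n : ℕ} (e : Fin m ≃ Fin n) (g : spaceHomology k G.carrier)
    (a : spaceHomology k (A.obj m)) :
    A.homologyAct k n g (spaceHomologyMap (A.relabelMap e) a) =
      spaceHomologyMap (A.relabelMap e) (A.homologyAct k m g a) := by
  have h := homologyCross_map (f := ContinuousMap.id G.carrier) (g := A.relabelMap e)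
    (KProd.map (ContinuousMap.id _) (A.relabelMap e)) (fun _ => rfl) g a
  rw [spaceHomologyMap_id] at h
  rw [homologyAct_apply, ← h, homologyAct_apply, ← spaceHomologyMap_comp,
    ← spaceHomologyMap_comp]
  congr 2
  exact ContinuousMap.ext fun z => A.smul_relabel e z.out.1 z.out.2

lemma homologyAct_comp {m : ℕ} (n : Fin m → ℕ) (g : spaceHomology k G.carrier)
    (t : spaceHomology k (A.obj m) ⊗[k] (⨂[k] i, spaceHomology k (A.obj (n i)))) :
    A.homologyAct k _ g (TensorProduct.lift
        (PiTensorProduct.lift.toLinearMap ∘ₗ (A.homologyOperad k).comp n) t) =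
      TensorProduct.lift (PiTensorProduct.lift.toLinearMap ∘ₗ (A.homologyOperad k).comp n)
        ((G.hopf k).diag (V := spaceHomology k (A.obj m))
          (W := fun i => spaceHomology k (A.obj (n i))) (A.homologyAct k m)
            (fun i => A.homologyAct k (n i)) g t) := by
  let F : C(KProd G.carrier (KProd (A.obj m) (KPi fun i => A.obj (n i))),
      KProd (A.obj m) (KPi fun i => A.obj (n i))) :=
    KProd.pair ((A.actMap m).comp (KProd.pair KProd.fst (KProd.fst.comp KProd.snd)))
      (KPi.lift fun i => (A.actMap (n i)).comp
        (KProd.pair KProd.fst ((KPi.eval i).comp (KProd.snd.comp KProd.snd))))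
  have h1 := G.kunnethPi_diag (W := fun i => A.obj (n i)) (A.homologyAct k m)
    (fun i => A.homologyAct k (n i)) (A.actMap m) (fun i => A.actMap (n i)) (fun _ _ => rfl)
      (fun _ _ _ => rfl) F (fun _ => rfl) g t
  have h2 := homologyCross_map (f := ContinuousMap.id G.carrier) (g := A.compMap n)
    (KProd.map (ContinuousMap.id _) (A.compMap n)) (fun _ => rfl) g
      (kunnethPi (A.obj m) (fun i => A.obj (n i)) t)
  rw [spaceHomologyMap_id] at h2
  refine (congrArg (A.homologyAct k _ g) (A.lift_comp n t)).trans
    (Eq.trans ?_ (A.lift_comp n _).symm)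
  refine Eq.trans ?_ (congrArg (spaceHomologyMap (A.compMap n)) h1.symm)
  rw [homologyAct_apply, ← h2, ← spaceHomologyMap_comp, ← spaceHomologyMap_comp]
  congr 2
  exact ContinuousMap.ext fun z => A.smul_comp n z.out.1 z.out.2.out.1 z.out.2.out.2.out

/-- The homology of a `G`-operad is an operad of graded `H(G)`-modules. -/
theorem homologyHOperad_isHOperad : (A.homologyHOperad k).IsHOperad where
  isOperad := A.homologyOperad_isOperad
  act_mem {n} _ _ _ _ hg ha := spaceHomologyMap_mem (A.actMap n) (homologyCross_mem hg ha)
  one_act {n} a := (spaceHomologyMap_point_cross (A.actMap n) 1 (ContinuousMap.id _)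
    (fun x => one_smul _ x) a).trans (spaceHomologyMap_id a)
  mul_act g h a := A.homologyAct_mul g h a
  act_relabel e g a := A.homologyAct_relabel e g a
  act_one g := (spaceHomologyMap_cross_point (A.actMap 1) A.one (ContinuousMap.const _ A.one)
    (fun x => A.smul_one x) g).trans (spaceHomologyMap_const _ _ (fun _ => rfl) g)
  act_comp n g t := A.homologyAct_comp n g t

end GOperad

end HomologyOfGOperads

section Transport

variable {k : Type u} [Field k]

open GrMod OperadEquiv

/-! ### Transport of operad structures -/

/-- An operad isomorphic to an operad is an operad. The converse of `equiv_mem`, which an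
isomorphism is not required to satisfy by definition, holds by injectivity. -/
lemma GrOperad.Iso.isOperad {P Q : GrOperad.{u} k} (e : P.Iso Q) (h : P.IsOperad) : Q.IsOperad := by
  have hs : ∀ {n d : ℕ} {a : Q.obj n}, a ∈ (Q.obj n).deg d →
      (e.equiv n).symm a ∈ (P.obj n).deg d := fun {n d a} ha =>
    mem_of_injective (f := (e.equiv n).toLinearMap) (e.equiv n).injective
      (fun _ _ h => e.equiv_mem h) (by simpa using ha)
  have hr : ∀ {m n : ℕ} (f : Fin m ≃ Fin n) (a : Q.obj m),
      Q.relabel f a = e.equiv n (P.relabel f ((e.equiv m).symm a)) := fun f a => by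
    rw [e.equiv_relabel, LinearEquiv.apply_symm_apply]
  have hc : ∀ {m : ℕ} (n : Fin m → ℕ) (a : Q.obj m) (b : ∀ i, Q.obj (n i)),
      Q.comp n a b = e.equiv _ (P.comp n ((e.equiv m).symm a)
        fun i => (e.equiv (n i)).symm (b i)) := fun n a b => by
    rw [e.equiv_comp]
    simp only [LinearEquiv.apply_symm_apply]
  exact
    { relabel_mem := fun f _ _ ha => by rw [hr]; exact e.equiv_mem (h.relabel_mem f (hs ha))
      one_mem := by rw [← e.equiv_one]; exact e.equiv_mem h.one_mem
      comp_mem := fun n _ β _ _ ha hb => by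
        rw [hc]; exact e.equiv_mem (h.comp_mem n β (hs ha) fun i => hs (hb i))
      relabel_refl := fun a => by rw [hr, h.relabel_refl, LinearEquiv.apply_symm_apply]
      relabel_trans := fun f g a => by
        rw [hr, h.relabel_trans, hr g, hr f, LinearEquiv.symm_apply_apply]
      one_comp := fun n b => by
        rw [hr, hc, LinearEquiv.symm_apply_apply, ← e.equiv_one, LinearEquiv.symm_apply_apply,
          h.one_comp, LinearEquiv.apply_symm_apply]
      comp_one := fun {m} a => by
        rw [hr, hc, LinearEquiv.symm_apply_apply, ← e.equiv_one]
        simp only [LinearEquiv.symm_apply_apply]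
        rw [h.comp_one, LinearEquiv.apply_symm_apply]
      comp_assoc := fun n l β ζ a b c hb hc' => by
        rw [hr, hc, hc n, LinearEquiv.symm_apply_apply, LinearEquiv.symm_apply_apply,
          h.comp_assoc n l β ζ _ _ _ (fun i => hs (hb i)) (fun p => hs (hc' p)), map_zsmul, hc]
        simp only [hc, LinearEquiv.symm_apply_apply]
      relabel_comp := fun σ n β a b hb => by
        rw [hc, hr σ, LinearEquiv.symm_apply_apply,
          h.relabel_comp σ n β _ _ (fun i => hs (hb i)), map_zsmul, hr, hc,
          LinearEquiv.symm_apply_apply]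
      comp_relabel := fun τ a b => by
        rw [hc, hr (blocks τ), hc, LinearEquiv.symm_apply_apply, ← h.comp_relabel]
        simp only [hr, LinearEquiv.symm_apply_apply] }

end Transport

section HomologyOfSemidirectProducts

open scoped DirectSum TensorProduct
open OperadEquiv GrMod

variable {k : Type u} [Field k]

/-! ### The homology of a semidirect product -/

section

variable (X : Type u) [TopologicalSpace X]

/-- Renumbering of the factors of a power. -/
def KPi.perm {m n : ℕ} (e : Fin m ≃ Fin n) : C(KPi fun _ : Fin m => X, KPi fun _ : Fin n => X) :=
  KPi.lift fun i => KPi.eval (e.symm i)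

/-- Concatenation of tuples. -/
def KPi.concat {m : ℕ} (n : Fin m → ℕ) :
    C(KPi fun i => KPi fun _ : Fin (n i) => X, KPi fun _ : Fin (∑ i, n i) => X) :=
  KPi.lift fun p =>
    (KPi.eval (V := fun _ : Fin (n (finSigmaFinEquiv.symm p).1) => X)
      (finSigmaFinEquiv.symm p).2).comp
        (KPi.eval (V := fun i => KPi fun _ : Fin (n i) => X) (finSigmaFinEquiv.symm p).1)

variable {X}

lemma GrMod.koszulSign_mul_self {m n : ℕ} (e : Fin m ≃ Fin n) (δ : Fin m → ZMod 2) :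
    koszulSign e δ * koszulSign e δ = 1 := by
  rw [koszulSign, ← Finset.prod_mul_distrib]
  refine Finset.prod_eq_one fun i _ => ?_
  rw [← Finset.prod_mul_distrib]
  refine Finset.prod_eq_one fun j _ => ?_
  split_ifs
  · rw [← pow_add, Even.neg_one_pow ⟨_, rfl⟩]
  · rw [one_mul]

/-- The Künneth isomorphism turns signed permutations into permutations of the factors of a power. -/
lemma lift_homologyCrossPi_signedPerm {m n : ℕ} (e : Fin m ≃ Fin n)
    (t : ⨂[k] _i : Fin m, spaceHomology k X) :
    PiTensorProduct.lift (homologyCrossPi fun _ : Fin n => X) (signedPerm (spaceHomology k X) e t) =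
      spaceHomologyMap (KPi.perm X e)
        (PiTensorProduct.lift (homologyCrossPi fun _ : Fin m => X) t) := by
  refine congrArg (fun f => f t) (pi_hom_ext (V := fun _ => spaceHomology k X)
    (f := PiTensorProduct.lift (homologyCrossPi fun _ : Fin n => X) ∘ₗ signedPerm _ e)
    (g := spaceHomologyMap (KPi.perm X e) ∘ₗ
      PiTensorProduct.lift (homologyCrossPi fun _ : Fin m => X)) fun p x hx => ?_)
  let Q : C(KPi fun _ : Fin n => X, KPi fun _ : Fin m => X) := KPi.lift fun i => KPi.eval (e i)
  have h := homologyCrossPi_perm (X := fun _ : Fin n => X) e e.bijective Q (fun _ => rfl)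
    (p := fun i => p (e.symm i)) (x := fun i => x (e.symm i)) fun i => hx _
  simp only [Equiv.symm_apply_apply] at h
  have h2 := congrArg (spaceHomologyMap (KPi.perm X e)) h
  rw [← spaceHomologyMap_comp, map_zsmul] at h2
  have h3 : (KPi.perm X e).comp Q = ContinuousMap.id _ :=
    ContinuousMap.ext fun z => Kify.ext (funext fun i => congrArg z.out (e.apply_symm_apply i))
  rw [h3, spaceHomologyMap_id] at h2
  rw [LinearMap.comp_apply, LinearMap.comp_apply, signedPerm_tprod e hx, map_zsmul,
    PiTensorProduct.lift.tprod, PiTensorProduct.lift.tprod, h2, smul_smul, ← koszulSign_cast,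
    koszulSign_mul_self, one_smul]

/-- The Künneth isomorphism turns concatenation of tensors into concatenation of tuples. -/
lemma homologyCrossPi_concat {m : ℕ} (n : Fin m → ℕ)
    (t : ∀ i, ⨂[k] _j : Fin (n i), spaceHomology k X) :
    PiTensorProduct.lift (homologyCrossPi fun _ : Fin (∑ i, n i) => X)
      (GrMod.concat (spaceHomology k X) n (PiTensorProduct.tprod k t)) =
    spaceHomologyMap (KPi.concat X n) (homologyCrossPi _ fun i =>
      PiTensorProduct.lift (homologyCrossPi fun _ : Fin (n i) => X) (t i)) := by
  let f : MultilinearMap k (fun i => ⨂[k] _j : Fin (n i), spaceHomology k X)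
      (spaceHomology k (KPi fun _ : Fin (∑ i, n i) => X)) :=
    (PiTensorProduct.lift (homologyCrossPi fun _ : Fin (∑ i, n i) => X) ∘ₗ
      GrMod.concat (spaceHomology k X) n).compMultilinearMap (PiTensorProduct.tprod k)
  let g : MultilinearMap k (fun i => ⨂[k] _j : Fin (n i), spaceHomology k X)
      (spaceHomology k (KPi fun _ : Fin (∑ i, n i) => X)) :=
    (spaceHomologyMap (KPi.concat X n)).compMultilinearMap
      ((homologyCrossPi fun i => KPi fun _ : Fin (n i) => X).compLinearMap fun i =>
        PiTensorProduct.lift (homologyCrossPi fun _ : Fin (n i) => X))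
  suffices H : PiTensorProduct.lift f = PiTensorProduct.lift g by
    have h : f = g := PiTensorProduct.lift.injective H
    exact congrArg (fun f => f t) h
  refine LinearMap.ext_on_range (PiTensorProduct.submodule_span_eq_top (R := k)
    (g := fun i => PiTensorProduct.tprod k (s := fun _ : Fin (n i) => (spaceHomology k X).carrier))
    (fun i => PiTensorProduct.span_tprod_eq_top)) fun x => ?_
  rw [PiTensorProduct.lift.tprod, PiTensorProduct.lift.tprod]
  change PiTensorProduct.lift (homologyCrossPi fun _ : Fin (∑ i, n i) => X)
      (PiTensorProduct.reindex k (fun _ => (spaceHomology k X).carrier) finSigmaFinEquiv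
        (PiTensorProduct.lift (flatten (spaceHomology k X) n) (PiTensorProduct.tprod k fun i =>
          PiTensorProduct.tprod k (x i)))) = spaceHomologyMap (KPi.concat X n)
    (homologyCrossPi _ fun i => PiTensorProduct.lift (homologyCrossPi fun _ : Fin (n i) => X)
      (PiTensorProduct.tprod k (x i)))
  rw [PiTensorProduct.lift.tprod, flatten_tprod, PiTensorProduct.reindex_tprod,
    PiTensorProduct.lift.tprod]
  let B : C(KPi fun _ : Fin (∑ i, n i) => X, KPi fun i => KPi fun _ : Fin (n i) => X) :=
    KPi.lift fun i => KPi.lift fun j => KPi.eval (pos i j)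
  have h := homologyCrossPi_blocks (X := fun _ : Fin (∑ i, n i) => X) rfl (fun i j => pos i j)
    (fun i j => TopOperad.pos_val i j) B (fun _ => rfl)
      (fun p => x (finSigmaFinEquiv.symm p).1 (finSigmaFinEquiv.symm p).2)
  have h2 := congrArg (spaceHomologyMap (KPi.concat X n)) h
  have h3 : (KPi.concat X n).comp B = ContinuousMap.id _ :=
    ContinuousMap.ext fun z => Kify.ext (funext fun p =>
      congrArg z.out (finSigmaFinEquiv.apply_symm_apply p))
  rw [← spaceHomologyMap_comp, h3, spaceHomologyMap_id] at h2
  rw [h2]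
  congr 2
  funext i
  rw [PiTensorProduct.lift.tprod]
  congr 1
  funext j
  change (fun s : (i : Fin m) × Fin (n i) => x s.1 s.2)
    (finSigmaFinEquiv.symm (finSigmaFinEquiv ⟨i, j⟩)) = _
  rw [Equiv.symm_apply_apply]

end

/-- Linear maps on a tensor product of tensor products are equal if they agree on tensors of pairs of
homogeneous elements. -/
lemma GrMod.pi_tensor_hom_ext {m : ℕ} {V W : Fin m → GrMod.{u} k} {M : Type*} [AddCommGroup M]
    [Module k M] {f g : (⨂[k] i, V i ⊗[k] W i) →ₗ[k] M}
    (h : ∀ (p q : Fin m → ℕ) (v : ∀ i, V i) (w : ∀ i, W i), (∀ i, v i ∈ (V i).deg (p i)) →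
      (∀ i, w i ∈ (W i).deg (q i)) → f (PiTensorProduct.tprod k fun i => v i ⊗ₜ w i) =
        g (PiTensorProduct.tprod k fun i => v i ⊗ₜ w i)) : f = g := by
  refine LinearMap.ext_on_range (PiTensorProduct.submodule_span_eq_top (R := k)
    (g := fun i (x : {x : V i // ∃ n, x ∈ (V i).deg n} × {x : W i // ∃ n, x ∈ (W i).deg n}) =>
      (x.1 : V i) ⊗ₜ[k] (x.2 : W i)) (fun i => ?_)) fun x => ?_
  · rw [← TensorProduct.map₂_mk_top_top_eq_top, ← (V i).span_homogeneous,
      ← (W i).span_homogeneous, Submodule.map₂_span_span, Set.image2_range]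
    rfl
  · choose p hp using fun i => (x i).1.2
    choose q hq using fun i => (x i).2.2
    exact h p q _ _ hp hq

namespace GOperad

variable {G : TopGrp.{u}} (A : GOperad G)

lemma kunneth_bijective (n : ℕ) : Function.Bijective (A.kunneth k n) :=
  kunnethPi_bijective (V := A.obj n) (W := fun _ : Fin n => G.carrier)

lemma kunneth_mem {n d : ℕ}
    {t : spaceHomology k (A.obj n) ⊗[k] (⨂[k] _i : Fin n, spaceHomology k G.carrier)}
    (ht : t ∈ ((A.homologyHOperad k).semiObj n).deg d) :
    A.kunneth k n t ∈ (spaceHomology k (A.SemiObj n)).deg d :=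
  kunnethPi_mem (V := A.obj n) (W := fun _ : Fin n => G.carrier) ht

lemma kunneth_tmul {n : ℕ} (a : spaceHomology k (A.obj n))
    (h : ⨂[k] _i : Fin n, spaceHomology k G.carrier) : A.kunneth k n (a ⊗ₜ h) =
      homologyCross _ _ a (PiTensorProduct.lift (homologyCrossPi fun _ => G.carrier) h) := rfl

lemma kunneth_relabel {m n : ℕ} (e : Fin m ≃ Fin n)
    (t : spaceHomology k (A.obj m) ⊗[k] (⨂[k] _i : Fin m, spaceHomology k G.carrier)) :
    A.kunneth k n ((A.homologyHOperad k).semidirect.relabel e t) =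
      spaceHomologyMap (A.semidirect.relabelMap e) (A.kunneth k m t) := by
  refine congrArg (fun f => f t) (TensorProduct.ext' (g := A.kunneth k n ∘ₗ
    TensorProduct.map (spaceHomologyMap (A.relabelMap e)) (signedPerm (spaceHomology k G.carrier) e))
      (h := spaceHomologyMap (A.semidirect.relabelMap e) ∘ₗ A.kunneth k m) fun a h => ?_)
  refine Eq.trans ?_ (homologyCross_map (f := A.relabelMap e) (g := KPi.perm G.carrier e)
    (A.semidirect.relabelMap e) (fun _ => rfl) a _).symm
  rw [← lift_homologyCrossPi_signedPerm]
  rfl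

lemma kunneth_one : A.kunneth k 1 (A.homologyHOperad k).semidirect.one =
    homologyPoint A.semidirect.one := by
  refine Eq.trans ?_ (homologyCross_point_point A.one _)
  refine congrArg (homologyCross _ _ (homologyPoint A.one)) ?_
  exact (PiTensorProduct.lift.tprod _).trans (homologyCrossPi_point (fun _ => (1 : G.carrier)))

/-- The action of `G` on `A(n) × Gⁿ`. -/
def semiActMap (n : ℕ) : C(KProd G.carrier (A.SemiObj n), A.SemiObj n) :=
  KProd.pair ((A.actMap n).comp (KProd.pair KProd.fst (KProd.fst.comp KProd.snd)))
    (KPi.lift fun i => G.mulMap.comp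
      (KProd.pair KProd.fst ((KPi.eval i).comp (KProd.snd.comp KProd.snd))))

variable (k) in
/-- The action of `H(G)` on `H(A(n)) ⊗ H(G)^{⊗n}`, in terms of the homology of `G`. -/
noncomputable def homologySemiAct (n : ℕ) : spaceHomology k G.carrier →ₗ[k]
    (A.homologyHOperad k).semiObj n →ₗ[k] (A.homologyHOperad k).semiObj n :=
  (A.homologyHOperad k).semiAct n

/-- The action of `H(G)` on `H(A(n)) ⊗ H(G)^{⊗n}` corresponds to the action of `G` on `A(n) × Gⁿ`. -/
lemma kunneth_semiAct {n : ℕ} (g : spaceHomology k G.carrier)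
    (t : (A.homologyHOperad k).semiObj n) : A.kunneth k n (A.homologySemiAct k n g t) =
      spaceHomologyMap (A.semiActMap n) (homologyCross _ _ g (A.kunneth k n t)) :=
  G.kunnethPi_diag (W := fun _ : Fin n => G.carrier) (A.homologyAct k n)
    (fun _ => G.homologyMul k) (A.actMap n) (fun _ => G.mulMap) (fun _ _ => rfl)
      (fun _ _ _ => rfl) (A.semiActMap n) (fun _ => rfl) g t

/-- The map `A(m) × ∏ (A(n_i) × G^{n_i}) → A(∑ n_i) × G^{∑ n_i}` which composes the operations and
concatenates the tuples of elements of `G`. -/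
def semiCompMap₀ {m : ℕ} (n : Fin m → ℕ) :
    C(KProd (A.obj m) (KPi fun i => A.SemiObj (n i)), A.SemiObj (∑ i, n i)) :=
  ((KProd.map (A.compMap n) (KPi.concat G.carrier n)).comp KProd.assocInv).comp
    (KProd.map (ContinuousMap.id _) KPi.unzip)

/-- The part of the composition of `H(A) ⋊ H(G)` which follows the action of `H(G)` corresponds to the
same part of the composition of `A ⋊ G`. -/
lemma kunneth_semiComp₀ {m : ℕ} (n : Fin m → ℕ) (a : spaceHomology k (A.obj m))
    (T : ⨂[k] i, (A.homologyHOperad k).semiObj (n i)) :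
    A.kunneth k _ ((A.homologyHOperad k).semiComp₀ n a T) =
      spaceHomologyMap (A.semiCompMap₀ n) (homologyCross _ _ a (PiTensorProduct.lift
        ((homologyCrossPi fun i => A.SemiObj (n i)).compLinearMap fun i => A.kunneth k (n i))
          T)) := by
  refine congrArg (fun f => f T) (pi_tensor_hom_ext (V := fun i => spaceHomology k (A.obj (n i)))
    (W := fun i => tensorPi fun _ : Fin (n i) => spaceHomology k G.carrier)
    (f := A.kunneth k _ ∘ₗ (A.homologyHOperad k).semiComp₀ n a)
    (g := spaceHomologyMap (A.semiCompMap₀ n) ∘ₗ homologyCross _ _ a ∘ₗ PiTensorProduct.lift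
      ((homologyCrossPi fun i => A.SemiObj (n i)).compLinearMap fun i => A.kunneth k (n i)))
    fun p q v w hv hw => ?_)
  let C : ∀ i, spaceHomology k (KPi fun _ : Fin (n i) => G.carrier) := fun i =>
    PiTensorProduct.lift (homologyCrossPi fun _ : Fin (n i) => G.carrier) (w i)
  have hC : ∀ i, C i ∈ (spaceHomology k (KPi fun _ : Fin (n i) => G.carrier)).deg (q i) :=
    fun i => lift_homologyCrossPi_mem (W := fun _ : Fin (n i) => G.carrier) (hw i)
  -- The signs of separating the factors, in algebra and in topology, are the same.
  have e1 : A.kunneth k _ ((A.homologyHOperad k).semiComp₀ n a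
      (PiTensorProduct.tprod k fun i => v i ⊗ₜ w i)) =
        (∏ i, ∏ j ∈ Finset.Ioi i, (-1 : ℤ) ^ (p j * q i)) •
          homologyCross _ _ (spaceHomologyMap (A.compMap n)
            (homologyCross _ _ a (homologyCrossPi _ v)))
              (spaceHomologyMap (KPi.concat G.carrier n) (homologyCrossPi _ C)) := by
    have hs := signedSplit_tprod (V := fun i => spaceHomology k (A.obj (n i)))
      (W := fun i => tensorPi fun _ : Fin (n i) => spaceHomology k G.carrier) hv hw
    let N : (⨂[k] i, spaceHomology k (A.obj (n i))) ⊗[k]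
        (⨂[k] i, ⨂[k] _j : Fin (n i), spaceHomology k G.carrier) →ₗ[k]
          spaceHomology k (A.SemiObj (∑ i, n i)) := A.kunneth k _ ∘ₗ TensorProduct.map
      (PiTensorProduct.lift ((A.homologyOperad k).comp n a))
        (GrMod.concat (spaceHomology k G.carrier) n)
    refine (congrArg N hs).trans ((map_zsmul N _ _).trans (congrArg _ ?_))
    have h1 : PiTensorProduct.lift ((A.homologyOperad k).comp n a) (PiTensorProduct.tprod k v) =
        spaceHomologyMap (A.compMap n) (homologyCross _ _ a (homologyCrossPi _ v)) :=
      (PiTensorProduct.lift.tprod _).trans (A.homologyOperad_comp n a v)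
    exact congrArg₂ (fun x y => homologyCross (A.obj (∑ i, n i)) (KPi fun _ => G.carrier) x y) h1
      (homologyCrossPi_concat n w)
  have e2 : PiTensorProduct.lift ((homologyCrossPi fun i => A.SemiObj (n i)).compLinearMap
      fun i => A.kunneth k (n i)) (PiTensorProduct.tprod k fun i => v i ⊗ₜ w i) =
        homologyCrossPi (fun i => A.SemiObj (n i)) fun i => homologyCross _ _ (v i) (C i) :=
    (PiTensorProduct.lift.tprod _).trans rfl
  have h1 := homologyCross_map (f := ContinuousMap.id (A.obj m)) (g := KPi.unzip)
    (KProd.map (ContinuousMap.id _) KPi.unzip) (fun _ => rfl) a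
      (homologyCrossPi (fun i => A.SemiObj (n i)) fun i => homologyCross _ _ (v i) (C i))
  rw [spaceHomologyMap_id, homologyCrossPi_unzip KPi.unzip (fun _ => rfl) hv hC, map_zsmul] at h1
  refine e1.trans (Eq.trans ?_ (congrArg (fun t => spaceHomologyMap (A.semiCompMap₀ n)
    (homologyCross _ _ a t)) e2).symm)
  rw [semiCompMap₀, spaceHomologyMap_comp, h1, map_zsmul, spaceHomologyMap_comp,
    homologyCross_assocInv,
    homologyCross_map (f := A.compMap n) (g := KPi.concat G.carrier n) _ (fun _ => rfl)]

/-- The Künneth isomorphism is compatible with the compositions. Both are the action on the inner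
operations, followed by the map of `kunneth_semiComp₀`. -/
lemma kunneth_comp {m : ℕ} (n : Fin m → ℕ)
    (t : spaceHomology k (A.obj m) ⊗[k] (⨂[k] _i : Fin m, spaceHomology k G.carrier))
    (y : ∀ i, (A.homologyHOperad k).semiObj (n i)) :
    A.kunneth k _ ((A.homologyHOperad k).semidirect.comp n t y) =
      (A.semidirect.homologyOperad k).comp n (A.kunneth k m t)
        fun i => A.kunneth k (n i) (y i) := by
  refine Eq.trans ?_ (A.semidirect.homologyOperad_comp n (A.kunneth k m t)
    fun i => A.kunneth k (n i) (y i)).symm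
  let z : spaceHomology k (KPi fun i => A.SemiObj (n i)) :=
    homologyCrossPi (fun i => A.SemiObj (n i)) fun i => A.kunneth k (n i) (y i)
  let f : ∀ i, spaceHomology k G.carrier →ₗ[k] (A.homologyHOperad k).semiObj (n i) →ₗ[k]
      (A.homologyHOperad k).semiObj (n i) := fun i => A.homologySemiAct k (n i)
  let L : spaceHomology k (A.obj m) ⊗[k] (⨂[k] _i : Fin m, spaceHomology k G.carrier) →ₗ[k]
      spaceHomology k (A.SemiObj (∑ i, n i)) := A.kunneth k _ ∘ₗ
    (PiTensorProduct.lift.toLinearMap ∘ₗ (A.homologyHOperad k).semidirect.comp n).flip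
      (PiTensorProduct.tprod k y)
  have hL : ∀ t, L t = A.kunneth k _ ((A.homologyHOperad k).semidirect.comp n t y) := fun t =>
    congrArg (A.kunneth k _) (PiTensorProduct.lift.tprod
      (φ := (A.homologyHOperad k).semidirect.comp n t) y)
  refine (hL t).symm.trans ?_
  refine congrArg (fun f => f t) (TensorProduct.ext' (g := L) (h := spaceHomologyMap
    (A.semidirect.compMap n) ∘ₗ (homologyCross _ _).flip z ∘ₗ A.kunneth k m) fun a g => ?_)
  refine (hL _).trans ((A.kunneth_semiComp₀ n a (signedMapPi
    (V := fun _ => spaceHomology k G.carrier) (W := fun i => (A.homologyHOperad k).semiObj (n i))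
      f g (PiTensorProduct.tprod k y))).trans ?_)
  let F : C(KProd (KPi fun _ : Fin m => G.carrier) (KPi fun i => A.SemiObj (n i)),
      KPi fun i => A.SemiObj (n i)) := KPi.lift fun i => (A.semiActMap (n i)).comp
    (KProd.pair ((KPi.eval i).comp KProd.fst) ((KPi.eval i).comp KProd.snd))
  have h1 := kunneth_signedMapPi (𝕍 := fun _ : Fin m => G.carrier)
    (𝕎 := fun i => A.SemiObj (n i)) (𝕏 := fun i => A.SemiObj (n i))
    (W := fun i => (A.homologyHOperad k).semiObj (n i)) f (fun i => A.kunneth k (n i))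
    (fun i d w hw => A.kunneth_mem hw) (fun i => A.kunneth k (n i))
    (fun i => A.semiActMap (n i)) (fun i v w => A.kunneth_semiAct v w) F (fun _ _ => rfl) g
    (PiTensorProduct.tprod k y)
  have h2 : PiTensorProduct.lift ((homologyCrossPi fun i => A.SemiObj (n i)).compLinearMap
      fun i => A.kunneth k (n i)) (PiTensorProduct.tprod k y) = z :=
    (PiTensorProduct.lift.tprod _).trans rfl
  refine (congrArg (fun t => spaceHomologyMap (A.semiCompMap₀ n) (homologyCross _ _ a t))
    (h1.trans (congrArg (fun t => spaceHomologyMap F (homologyCross _ _ (PiTensorProduct.lift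
      (homologyCrossPi fun _ : Fin m => G.carrier) g) t)) h2))).trans ?_
  have h3 := homologyCross_map (f := ContinuousMap.id (A.obj m)) (g := F)
    (KProd.map (ContinuousMap.id _) F) (fun _ => rfl) a (homologyCross _ _
      (PiTensorProduct.lift (homologyCrossPi fun _ : Fin m => G.carrier) g) z)
  rw [spaceHomologyMap_id, ← homologyCross_assoc KProd.assoc (fun _ => rfl)] at h3
  refine (congrArg (spaceHomologyMap (A.semiCompMap₀ n)) h3.symm).trans ?_
  rw [← spaceHomologyMap_comp, ← spaceHomologyMap_comp]
  rfl

variable (k) in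
/-- The Künneth isomorphism `H(A(n)) ⊗ H(G)^{⊗n} ≃ H(A(n) × Gⁿ)`. -/
noncomputable def kunnethEquiv (n : ℕ) : (A.homologyHOperad k).semidirect.obj n ≃ₗ[k]
    (A.semidirect.homologyOperad k).obj n :=
  LinearEquiv.ofBijective (A.kunneth k n) (A.kunneth_bijective n)

variable (k) in
/-- The isomorphism `H(A ⋊ G) ≅ H(A) ⋊ H(G)`. -/
noncomputable def homologySemidirectIso :
    GrOperad.Iso (A.semidirect.homologyOperad k) (A.homologyHOperad k).semidirect where
  equiv n := (A.kunnethEquiv k n).symm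
  equiv_mem {n d x} hx := mem_of_injective (f := (A.kunnethEquiv k n).toLinearMap)
    (A.kunnethEquiv k n).injective (fun _ _ h => A.kunneth_mem h) (by
      rw [LinearEquiv.coe_coe, LinearEquiv.apply_symm_apply]; exact hx)
  equiv_relabel {m n} e x := by
    rw [LinearEquiv.symm_apply_eq]
    refine Eq.trans ?_ (A.kunneth_relabel e ((A.kunnethEquiv k m).symm x)).symm
    exact congrArg ((A.semidirect.homologyOperad k).relabel e)
      ((A.kunnethEquiv k m).apply_symm_apply x).symm
  equiv_one := by
    rw [LinearEquiv.symm_apply_eq]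
    exact A.kunneth_one.symm
  equiv_comp {m} n a b := by
    rw [LinearEquiv.symm_apply_eq]
    refine Eq.trans ?_ (A.kunneth_comp n ((A.kunnethEquiv k m).symm a)
      fun i => (A.kunnethEquiv k (n i)).symm (b i)).symm
    exact congrArg₂ (fun a b => (A.semidirect.homologyOperad k).comp n a b)
      ((A.kunnethEquiv k m).apply_symm_apply a).symm
      (funext fun i => ((A.kunnethEquiv k (n i)).apply_symm_apply (b i)).symm)

/-- The Künneth isomorphism is natural in the group and the operad. -/
lemma kunneth_natural {G' : TopGrp.{u}} {A : GOperad G} {A' : GOperad G'} (f : Hom A A') (n : ℕ)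
    (t : spaceHomology k (A.obj n) ⊗[k] (⨂[k] _i : Fin n, spaceHomology k G.carrier)) :
    A'.kunneth k n (f.homologySemidirect n t) =
      spaceHomologyMap (f.semidirect n) (A.kunneth k n t) := by
  let φ : C(G.carrier, G'.carrier) := ⟨f.grp, f.continuous_grp⟩
  let φn : C(KPi fun _ : Fin n => G.carrier, KPi fun _ : Fin n => G'.carrier) :=
    KPi.lift fun i => φ.comp (KPi.eval i)
  have h : PiTensorProduct.lift (homologyCrossPi (k := k) fun _ : Fin n => G'.carrier) ∘ₗ
      PiTensorProduct.map (fun _ => spaceHomologyMap φ) = spaceHomologyMap φn ∘ₗ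
        PiTensorProduct.lift (homologyCrossPi fun _ : Fin n => G.carrier) := by
    refine PiTensorProduct.ext (MultilinearMap.ext fun x => ?_)
    change PiTensorProduct.lift (homologyCrossPi (k := k) fun _ : Fin n => G'.carrier)
      (PiTensorProduct.map (fun _ => spaceHomologyMap φ) (PiTensorProduct.tprod k x)) =
        spaceHomologyMap φn (PiTensorProduct.lift (homologyCrossPi fun _ : Fin n => G.carrier)
          (PiTensorProduct.tprod k x))
    rw [PiTensorProduct.map_tprod, PiTensorProduct.lift.tprod, PiTensorProduct.lift.tprod,
      homologyCrossPi_map (fun _ => φ) φn fun _ _ => rfl]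
  refine congrArg (fun f => f t) (TensorProduct.ext' (g := A'.kunneth k n ∘ₗ
    f.homologySemidirect n) (h := spaceHomologyMap (f.semidirect n) ∘ₗ A.kunneth k n)
      fun a s => ?_)
  refine Eq.trans ?_ (homologyCross_map (f := ⟨f.map n, f.continuous_map n⟩) (g := φn)
    (f.semidirect n) (fun _ => rfl) a _).symm
  exact congrArg (homologyCross _ _ _) (congrArg (fun f => f s) h)

end GOperad

end HomologyOfSemidirectProducts
theorem mainTheorem10 (k : Type u) [Field k] :
    (∀ G : TopGrp.{u}, Function.Bijective (G.kunneth k) ∧ (G.hopf k).IsCocommHopf) ∧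
    (∀ (G : TopGrp.{u}) (A : GOperad G), (A.homologyHOperad k).IsHOperad ∧
      (A.homologyHOperad k).semidirect.IsOperad ∧ (A.semidirect.homologyOperad k).IsOperad) ∧
    ∃ Φ : ∀ (G : TopGrp.{u}) (A : GOperad G),
        GrOperad.Iso (A.semidirect.homologyOperad k) (A.homologyHOperad k).semidirect,
      (∀ (G : TopGrp.{u}) (A : GOperad G) (n : ℕ)
        (t : ((A.homologyHOperad k).semidirect.obj n).carrier),
        ((Φ G A).equiv n).symm t = A.kunneth k n t) ∧
      ∀ (G G' : TopGrp.{u}) (A : GOperad G) (A' : GOperad G') (f : GOperad.Hom A A') (n : ℕ)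
        (x : (spaceHomology k (A.SemiObj n)).carrier),
        (Φ G' A').equiv n (spaceHomologyMap (f.semidirect n) x) =
          f.homologySemidirect n ((Φ G A).equiv n x) := by
  refine ⟨fun G => ⟨G.kunneth_bijective, G.isCocommHopf⟩, fun G A =>
    ⟨A.homologyHOperad_isHOperad,
      (A.homologySemidirectIso k).isOperad A.semidirect.homologyOperad_isOperad,
      A.semidirect.homologyOperad_isOperad⟩,
    fun _ A => A.homologySemidirectIso k, fun _ _ _ _ => rfl, fun G G' A A' f n x => ?_⟩
  refine (LinearEquiv.symm_apply_eq (A'.kunnethEquiv k n)).2 ?_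
  refine Eq.trans ?_ (A.kunneth_natural f n ((A.kunnethEquiv k n).symm x)).symm
  exact congrArg (spaceHomologyMap (f.semidirect n))
    ((A.kunnethEquiv k n).apply_symm_apply x).symm
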